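/- Consider the system (HBS) on $\mathbb{R}^3$, $$\partial_t u+u\cdot\nabla u-\Delta_h u+\nabla \Pi=\rho e_3,\qquad \partial_t\rho+u\cdot\nabla\rho=0,\qquad \operatorname{div}u=0,\qquad (u,\rho)|_{t=0}=(u_0,\rho_0),$$ where $\Delta_h=\partial_1^2+\partial_2^2$ and $\nabla_h=(\partial_1,\partial_2)$. Write $r=(x_1^2+x_2^2)^{1/2}$, let $(e_r,e_\theta,e_z)$ be the cylindrical frame, and let $\omega=\operatorname{curl}u$, $\omega_0=\operatorname{curl}u_0$, $\omega_\theta=\omega\cdot e_\theta$. A smooth solution on $[0,T)$, $0<T\le\infty$, is a pair $(u,\rho)$ of $C^\infty$ functions on $[0,T)\times\mathbb{R}^3$ which belongs to $L^\infty_{\rm loc}([0,T);H^k(\mathbb{R}^3))$ for every $k\in\mathbb{N}$ and which satisfies the equations pointwise with a pressure $\Pi(t,\cdot)\in C^\infty(\mathbb{R}^3)$. Proposition. Let $u_0\in H^1(\mathbb{R}^3)$ be an axisymmetric vector field without swirl, i.e. $u_0=u_{0,r}(r,z)e_r+u_{0,z}(r,z)e_z$, with zero divergence and $\omega_0/r\in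 L^2$. Let $\rho_0\in L^2\cap L^\infty$ depend only on $(r,z)$, and be such that $\operatorname{Supp}\rho_0$ does not intersect the axis $(Oz)$ and its orthogonal projection $\Pi_z(\operatorname{Supp}\rho_0)$ onto $(Oz)$ is compact. Then there is a constant $C>0$, depending only on the initial data, such that every smooth solution of (HBS) on $[0,T)$ with these data, for any $0<T\le\infty$, satisfies for every $t\in[0,T)$ $$\|\omega_\theta(t)\|_{L^2}^2+\int_0^t\Big(\|\nabla_h\omega_\theta(\tau)\|_{L^2}^2+\Big\|\frac{\omega_\theta}{r}(\tau)\Big\|_{L^2}^2\Big)d\tau+\Big\|\frac{\omega_\theta}{r}(t)\Big\|_{L^2}^2+\int_0^t\Big\|\nabla_h\Big(\frac{\omega_\theta}{r}\Big)(\tau)\Big\|_{L^2}^2d\tau\le Ce^{\exp(Ct^{17})},$$ and also $\|u(t)\|_{H^1}^2\le Ce^{\exp(Ct^{17})}$. The dependence of $C$ on the data is only through an upper bound for $\|u_0\|_{H^1}$, $\|\omega_0/r\|_{L^2}$, $\|\rho_0\|_{L^2}$, $\|\rho_0\|_{L^\infty}$ and $\operatorname{diam}\Pi_z(\operatorname{Supp}\rho_0)$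 and a positive lower bound for the distance of $\operatorname{Supp}\rho_0$ to $(Oz)$. -/

import Mathlib

open MeasureTheory Set
open scoped ENNReal NNReal ContDiff

noncomputable section

namespace HBS

/-- The space `ℝ³` with its Euclidean norm; the coordinates `0, 1` are horizontal and the
coordinate `2` is the vertical variable `z`. -/
abbrev E3 : Type := EuclideanSpace ℝ (Fin 3)

/-- The vertical unit vector. -/
def e₃ : E3 := EuclideanSpace.single 2 1

/-- The (classical) partial derivative in the direction of the `i`-th coordinate. -/
def pd {F : Type*} [NormedAddCommGroup F] [NormedSpace ℝ F] (i : Fin 3) (f : E3 → F) (x : E3) : F :=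
  fderiv ℝ f x (EuclideanSpace.single i 1)

/-- The horizontal Laplacian `∂₁² + ∂₂²`. -/
def lapH {F : Type*} [NormedAddCommGroup F] [NormedSpace ℝ F] (f : E3 → F) (x : E3) : F :=
  pd 0 (pd 0 f) x + pd 1 (pd 1 f) x

/-- The divergence of a vector field whose partial derivatives are `D 0, D 1, D 2`. -/
def divOf (D : Fin 3 → E3 → E3) (x : E3) : ℝ := ∑ i, D i x i

/-- The curl of a vector field whose partial derivatives are `D 0, D 1, D 2`. -/
def curlOf (D : Fin 3 → E3 → E3) (x : E3) : E3 :=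
  !₂[D 1 x 2 - D 2 x 1, D 2 x 0 - D 0 x 2, D 0 x 1 - D 1 x 0]

/-- The divergence of a differentiable vector field. -/
def div (v : E3 → E3) : E3 → ℝ := divOf (fun i => pd i v)

/-- The vorticity of a differentiable vector field. -/
def curl (v : E3 → E3) : E3 → E3 := curlOf (fun i => pd i v)

/-- The distance `r = (x₁² + x₂²)^{1/2}` to the vertical axis. -/
def rad (x : E3) : ℝ := Real.sqrt (x 0 ^ 2 + x 1 ^ 2)

/-- The vertical axis `(Oz)`. -/
def axis : Set E3 := {x | x 0 = 0 ∧ x 1 = 0}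

/-- The orthogonal projector onto the vertical axis. -/
def projZ (x : E3) : E3 := !₂[0, 0, x 2]

/-- The radial unit vector `e_r` (zero on the axis, where it is not defined). -/
def er (x : E3) : E3 := !₂[x 0 / rad x, x 1 / rad x, 0]

/-- The angular unit vector `e_θ` (zero on the axis, where it is not defined). -/
def eθ (x : E3) : E3 := !₂[-(x 1) / rad x, x 0 / rad x, 0]

/-- A vector field is axisymmetric without swirl: `v = v_r(r,z) e_r + v_z(r,z) e_z`. -/
def IsAxisymVector (v : E3 → E3) : Prop :=
  ∃ vr vz : ℝ → ℝ → ℝ, ∀ x, v x = vr (rad x) (x 2) • er x + vz (rad x) (x 2) • e₃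

/-- A scalar function depends only on `(r,z)`. -/
def IsAxisymScalar (f : E3 → ℝ) : Prop :=
  ∃ g : ℝ → ℝ → ℝ, ∀ x, f x = g (rad x) (x 2)

/-- The angular component of the vorticity of `v`. -/
def ωθ (v : E3 → E3) (x : E3) : ℝ := inner ℝ (curl v x) (eθ x)

/-- `ω_θ / r`. (The axis, where the quotient is not defined, is a null set.) -/
def ωθr (v : E3 → E3) (x : E3) : ℝ := ωθ v x / rad x

/-- The squared `L²(ℝ³)` norm, as an extended nonnegative real. -/
def l2sq {F : Type*} [NormedAddCommGroup F] (f : E3 → F) : ℝ≥0∞ := eLpNorm f 2 volume ^ 2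

/-- `‖∇_h f‖²` in `L²(ℝ³)`, where `∇_h = (∂₁, ∂₂)`. -/
def gradHsq (f : E3 → ℝ) : ℝ≥0∞ := l2sq (pd 0 f) + l2sq (pd 1 f)

/-- The squared `H¹(ℝ³)` norm of a vector field `v` whose partial derivatives are
`D 0, D 1, D 2`. -/
def h1sq (v : E3 → E3) (D : Fin 3 → E3 → E3) : ℝ≥0∞ := l2sq v + ∑ i, l2sq (D i)

/-- `g` is the weak `i`-th partial derivative of `f` on `ℝ³`. -/
def IsWeakPartial (i : Fin 3) (f g : E3 → E3) : Prop :=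
  LocallyIntegrable f ∧ LocallyIntegrable g ∧
    ∀ φ : E3 → ℝ, ContDiff ℝ ∞ φ → HasCompactSupport φ →
      ∫ x, pd i φ x • f x = -∫ x, φ x • g x

/-- The hypotheses on the initial velocity `u₀`, with weak partial derivatives `D i`, and on the
initial density `ρ₀`. -/
structure IsAdmissibleData (u₀ : E3 → E3) (D : Fin 3 → E3 → E3) (ρ₀ : E3 → ℝ) : Prop where
  u_memLp : MemLp u₀ 2 volume
  u_weak : ∀ i, IsWeakPartial i u₀ (D i)
  Du_memLp : ∀ i, MemLp (D i) 2 volume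
  u_axisym : IsAxisymVector u₀
  u_div : ∀ᵐ x, divOf D x = 0
  vorticity : MemLp (fun x => (rad x)⁻¹ • curlOf D x) 2 volume
  ρ_memLp_two : MemLp ρ₀ 2 volume
  ρ_memLp_top : MemLp ρ₀ ∞ volume
  ρ_axisym : IsAxisymScalar ρ₀
  ρ_support : Disjoint (tsupport ρ₀) axis
  ρ_compact : IsCompact (projZ '' tsupport ρ₀)

/-- The size of the initial data is controlled by `M`, and the distance of the support of the
density to the axis is at least `δ`. -/
structure DataBound (M : ℝ≥0) (δ : ℝ) (u₀ : E3 → E3) (D : Fin 3 → E3 → E3) (ρ₀ : E3 → ℝ) :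
    Prop where
  u_h1 : h1sq u₀ D ≤ (M : ℝ≥0∞) ^ 2
  vorticity : eLpNorm (fun x => (rad x)⁻¹ • curlOf D x) 2 volume ≤ M
  ρ_two : eLpNorm ρ₀ 2 volume ≤ M
  ρ_top : eLpNorm ρ₀ ∞ volume ≤ M
  ρ_dist : ∀ x ∈ tsupport ρ₀, ∀ y ∈ axis, δ ≤ dist x y
  ρ_diam : Metric.diam (projZ '' tsupport ρ₀) ≤ M

/-- The time interval `[0,T)`, where `T = ∞` is allowed. -/
def timeInterval (T : EReal) : Set ℝ := {t | 0 ≤ t ∧ (t : EReal) < T}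

/-- `(u, ρ)`, with pressure `P`, is a smooth solution on `[0,T) × ℝ³`, with initial data
`(u₀, ρ₀)`, of
`∂ₜu + u·∇u - Δ_h u + ∇P = ρ e₃`, `∂ₜρ + u·∇ρ = 0`, `div u = 0`:
`u` and `ρ` are `C^∞` on `[0,T) × ℝ³` and belong to `L^∞_loc([0,T); H^k(ℝ³))` for every `k`. -/
structure IsSmoothSolution (T : EReal) (u₀ : E3 → E3) (ρ₀ : E3 → ℝ)
    (u : ℝ → E3 → E3) (ρ P : ℝ → E3 → ℝ) : Prop where
  u_smooth : ContDiffOn ℝ ∞ (fun q : ℝ × E3 => u q.1 q.2) (timeInterval T ×ˢ univ)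
  ρ_smooth : ContDiffOn ℝ ∞ (fun q : ℝ × E3 => ρ q.1 q.2) (timeInterval T ×ˢ univ)
  P_smooth : ∀ t ∈ timeInterval T, ContDiff ℝ ∞ (P t)
  u_sobolev : ∀ k : ℕ, ∀ t ∈ timeInterval T, ∃ B : ℝ≥0, ∀ s ∈ Icc 0 t,
    eLpNorm (iteratedFDeriv ℝ k (u s)) 2 volume ≤ B
  ρ_sobolev : ∀ k : ℕ, ∀ t ∈ timeInterval T, ∃ B : ℝ≥0, ∀ s ∈ Icc 0 t,
    eLpNorm (iteratedFDeriv ℝ k (ρ s)) 2 volume ≤ B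
  momentum : ∀ t ∈ timeInterval T, ∀ x,
    derivWithin (fun s => u s x) (timeInterval T) t + fderiv ℝ (u t) x (u t x) - lapH (u t) x
      + gradient (P t) x = ρ t x • e₃
  transport : ∀ t ∈ timeInterval T, ∀ x,
    derivWithin (fun s => ρ s x) (timeInterval T) t + fderiv ℝ (ρ t) x (u t x) = 0
  incompressible : ∀ t ∈ timeInterval T, ∀ x, div (u t) x = 0
  u_init : u 0 = u₀
  ρ_init : ρ 0 = ρ₀

end HBS

end

/-! Write `f = v_r / r` and `Γ = ω_θ / r`. Without swirl, `Γ` solves `∂_t Γ + u·∇Γ - (Δ_h + (2/r)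
∂_r) Γ = -∂_r ρ / r`, an equation without stretching. The singular operator has the good sign
(`integral_mul_rq_nonpos`). Since `ρ` vanishes near the axis, `∂_r ρ / r = div_h (x_h ρ / r²)` can
be integrated by parts. Hence `‖Γ‖² + ∫ ‖∇_h Γ‖²` grows at most like the time integral of `‖ρ / r‖²`
(`AxiSol.gam_energy`).

The density is transported. Let `W` be the time integral of `speed`, a common bound for `|v_r / r|`
and `|v_z|`. The support of `ρ` approaches the axis at most like `exp (-W)` and spreads vertically
by at most `W`. In cylindrical coordinates the integral of `1 / r²` diverges only logarithmically at
the axis, so `‖ρ / r‖²` is at most a constant times `1 + W²` (`AxiSol.radInv_le`).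

Conversely, `speed²` is a multiple of `ctrl`, which contains only the squared norms of `Γ`, `∇_h Γ`,
`v` and `∇_h v`. This uses the elliptic equation `(∂_z² + Δ_h + (2/r) ∂_r) f = ∂_z Γ` and an
embedding for axisymmetric functions (`AxiFlow.vr_sq_le`, `AxiFlow.v_two_sq_le`), and asks for no
vertical smoothing. By Cauchy-Schwarz in time, `W²` is then controlled linearly by the quantity
under estimation, and Grönwall's inequality closes with one exponential of a multiple of `(1 + T)³`
(`AxiSol.gam_le`). The vorticity is stretched at a rate at most `speed`, which produces the second
exponential (`AxiSol.vort_le`). For divergence-free fields the gradient has the norm of the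
vorticity, whence the `H¹` bound.

Three points need care. The pressure has no assumed decay or time regularity; it is eliminated by
`integral_curlFree_mul_divFree` and `exists_nsq_dt_le`. Symmetry is not part of the definition of a
solution; it follows from `CompSol.unique` applied to reflections through vertical planes, which
also exclude swirl. Finally, division by `r` must preserve Sobolev bounds; it is realised as
division by `x₀` through the averages `quot`. -/

namespace HBS

/-! ### Partial derivatives of scalar functions -/

/-- The `i`-th basis vector. -/
noncomputable abbrev bv (i : Fin 3) : E3 := EuclideanSpace.single i 1

lemma pd_eq_of_hasFDerivAt {f : E3 → ℝ} {f' : E3 →L[ℝ] ℝ} {x : E3} (h : HasFDerivAt f f' x)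
    (i : Fin 3) : pd i f x = f' (bv i) := by
  rw [pd, h.fderiv]

lemma pd_congr_nhds {F : Type*} [NormedAddCommGroup F] [NormedSpace ℝ F] {f g : E3 → F} {x : E3}
    (h : f =ᶠ[nhds x] g) (i : Fin 3) : pd i f x = pd i g x := by
  rw [pd, pd, h.fderiv_eq]

section rules
variable {f g : E3 → ℝ} {x : E3} (i : Fin 3)

lemma pd_add (hf : DifferentiableAt ℝ f x) (hg : DifferentiableAt ℝ g x) :
    pd i (fun y => f y + g y) x = pd i f x + pd i g x := by
  rw [pd_eq_of_hasFDerivAt (hf.hasFDerivAt.fun_add hg.hasFDerivAt)]; rfl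

lemma pd_sub (hf : DifferentiableAt ℝ f x) (hg : DifferentiableAt ℝ g x) :
    pd i (fun y => f y - g y) x = pd i f x - pd i g x := by
  rw [pd_eq_of_hasFDerivAt (hf.hasFDerivAt.fun_sub hg.hasFDerivAt)]; rfl

lemma pd_neg (hf : DifferentiableAt ℝ f x) : pd i (fun y => - f y) x = - pd i f x := by
  rw [pd_eq_of_hasFDerivAt hf.hasFDerivAt.fun_neg]; rfl

lemma pd_mul (hf : DifferentiableAt ℝ f x) (hg : DifferentiableAt ℝ g x) :
    pd i (fun y => f y * g y) x = pd i f x * g x + f x * pd i g x := by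
  rw [pd_eq_of_hasFDerivAt (hf.hasFDerivAt.fun_mul hg.hasFDerivAt)]
  simp [pd]; ring

lemma pd_const (c : ℝ) : pd i (fun _ : E3 => c) x = 0 := by
  rw [pd_eq_of_hasFDerivAt (hasFDerivAt_const c x)]; rfl

lemma pd_const_mul (c : ℝ) (hf : DifferentiableAt ℝ f x) :
    pd i (fun y => c * f y) x = c * pd i f x := by
  rw [pd_mul i (differentiableAt_const c) hf, pd_const]; ring

lemma hasFDerivAt_coord (j : Fin 3) : HasFDerivAt (fun y : E3 => y j)
    (EuclideanSpace.proj j : E3 →L[ℝ] ℝ) x :=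
  (EuclideanSpace.proj j : E3 →L[ℝ] ℝ).hasFDerivAt

lemma differentiable_coord (j : Fin 3) : Differentiable ℝ (fun y : E3 => y j) :=
  fun _ => (hasFDerivAt_coord j).differentiableAt

lemma contDiff_coord {n : WithTop ℕ∞} (j : Fin 3) : ContDiff ℝ n (fun y : E3 => y j) :=
  (EuclideanSpace.proj j : E3 →L[ℝ] ℝ).contDiff

lemma pd_coord (j : Fin 3) : pd i (fun y : E3 => y j) x = if j = i then 1 else 0 := by
  rw [pd_eq_of_hasFDerivAt (hasFDerivAt_coord j)]
  simp

lemma pd_coord_mul (j : Fin 3) (hf : DifferentiableAt ℝ f x) :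
    pd i (fun y => y j * f y) x = (if j = i then f x else 0) + x j * pd i f x := by
  rw [pd_mul i (differentiable_coord j x) hf, pd_coord]
  split_ifs <;> ring

lemma pd_sum {ι : Type*} (s : Finset ι) (F : ι → E3 → ℝ)
    (h : ∀ j ∈ s, DifferentiableAt ℝ (F j) x) :
    pd i (fun y => ∑ j ∈ s, F j y) x = ∑ j ∈ s, pd i (F j) x := by
  rw [pd_eq_of_hasFDerivAt (HasFDerivAt.fun_sum fun j hj => (h j hj).hasFDerivAt)]
  simp [pd]

lemma pd_comp_real {φ : ℝ → ℝ} {φ' : ℝ} (hφ : HasDerivAt φ φ' (f x)) (hf : DifferentiableAt ℝ f x) :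
    pd i (fun y => φ (f y)) x = φ' * pd i f x := by
  exact (pd_eq_of_hasFDerivAt (hφ.comp_hasFDerivAt x hf.hasFDerivAt) i).trans (by simp [pd])

end rules

lemma contDiff_pd {F : Type*} [NormedAddCommGroup F] [NormedSpace ℝ F] {f : E3 → F}
    (hf : ContDiff ℝ ∞ f) (i : Fin 3) : ContDiff ℝ ∞ (pd i f) :=
  (hf.fderiv_right (m := ∞) (by simp)).clm_apply contDiff_const

lemma pd_comm {f : E3 → ℝ} (hf : ContDiff ℝ ∞ f) (i j : Fin 3) (x : E3) :
    pd i (pd j f) x = pd j (pd i f) x := by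
  have h1 : ∀ k l : Fin 3, pd k (pd l f) x = fderiv ℝ (fderiv ℝ f) x (bv k) (bv l) := by
    intro k l
    have hd : DifferentiableAt ℝ (fderiv ℝ f) x :=
      ((hf.fderiv_right (m := ∞) (by simp)).differentiable (by simp)) x
    have := (hd.hasFDerivAt.clm_apply (hasFDerivAt_const (bv l) x))
    rw [show pd l f = fun y => fderiv ℝ f y (bv l) from rfl, pd_eq_of_hasFDerivAt this]
    simp
  have hs : IsSymmSndFDerivAt ℝ f x :=
    (hf.of_le (m := 2) ENat.LEInfty.out).contDiffAt.isSymmSndFDerivAt (by simp)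
  rw [h1, h1, hs.eq]

lemma fderiv_apply_eq_sum {F : Type*} [NormedAddCommGroup F] [NormedSpace ℝ F] (f : E3 → F)
    (x v : E3) : fderiv ℝ f x v = ∑ i, v i • pd i f x := by
  have hv : v = ∑ i, v i • bv i := by
    ext k
    fin_cases k <;> simp [Fin.sum_univ_three]
  conv_lhs => rw [hv]
  simp [map_sum, pd]

/-! ### Iterated partial derivatives -/

/-- The iterated partial derivative along a word of directions. -/
noncomputable def pdl : List (Fin 3) → (E3 → ℝ) → E3 → ℝ
  | [], f => f
  | i :: l, f => pdl l (pd i f)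

lemma contDiff_pdl {f : E3 → ℝ} (hf : ContDiff ℝ ∞ f) (l : List (Fin 3)) :
    ContDiff ℝ ∞ (pdl l f) := by
  induction l generalizing f with
  | nil => exact hf
  | cons i l ih => exact ih (contDiff_pd hf i)

lemma pdl_append (l₁ l₂ : List (Fin 3)) (f : E3 → ℝ) : pdl (l₁ ++ l₂) f = pdl l₂ (pdl l₁ f) := by
  induction l₁ generalizing f with
  | nil => rfl
  | cons i l ih => exact ih _

lemma pd_add_fun {f g : E3 → ℝ} (hf : ContDiff ℝ ∞ f) (hg : ContDiff ℝ ∞ g) (i : Fin 3) :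
    pd i (fun y => f y + g y) = fun y => pd i f y + pd i g y :=
  funext fun x => pd_add i (hf.differentiable (by simp) x) (hg.differentiable (by simp) x)

lemma pd_mul_fun {f g : E3 → ℝ} (hf : ContDiff ℝ ∞ f) (hg : ContDiff ℝ ∞ g) (i : Fin 3) :
    pd i (fun y => f y * g y) = fun y => pd i f y * g y + f y * pd i g y :=
  funext fun x => pd_mul i (hf.differentiable (by simp) x) (hg.differentiable (by simp) x)

lemma pd_const_mul_fun {f : E3 → ℝ} (c : ℝ) (hf : ContDiff ℝ ∞ f) (i : Fin 3) :
    pd i (fun y => c * f y) = fun y => c * pd i f y :=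
  funext fun x => pd_const_mul i c (hf.differentiable (by simp) x)

lemma pdl_add {f g : E3 → ℝ} (hf : ContDiff ℝ ∞ f) (hg : ContDiff ℝ ∞ g) (l : List (Fin 3)) :
    pdl l (fun y => f y + g y) = fun y => pdl l f y + pdl l g y := by
  induction l generalizing f g with
  | nil => rfl
  | cons i l ih =>
    simp only [pdl]
    rw [pd_add_fun hf hg]
    exact ih (contDiff_pd hf i) (contDiff_pd hg i)

lemma pdl_const_mul {f : E3 → ℝ} (c : ℝ) (hf : ContDiff ℝ ∞ f) (l : List (Fin 3)) :
    pdl l (fun y => c * f y) = fun y => c * pdl l f y := by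
  induction l generalizing f with
  | nil => rfl
  | cons i l ih =>
    simp only [pdl]
    rw [pd_const_mul_fun c hf]
    exact ih (contDiff_pd hf i)

/-- Iterated partial derivatives are values of the iterated Fréchet derivative. -/
lemma pdl_eq_iteratedFDeriv {F : Type*} [NormedAddCommGroup F] [NormedSpace ℝ F] (l : List (Fin 3))
    (f : E3 → F) (L : F →L[ℝ] ℝ) (hf : ContDiff ℝ ∞ f) :
    ∃ m : Fin l.length → E3, (∀ k, ‖m k‖ ≤ 1) ∧
      ∀ x, pdl l (fun y => L (f y)) x = L (iteratedFDeriv ℝ l.length f x m) := by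
  suffices H : ∀ n, ∀ l : List (Fin 3), l.length = n → ∃ m : Fin n → E3, (∀ k, ‖m k‖ ≤ 1) ∧
      ∀ x, pdl l (fun y => L (f y)) x = L (iteratedFDeriv ℝ n f x m) from H _ l rfl
  intro n
  induction n with
  | zero =>
    intro l hl
    rw [List.length_eq_zero_iff] at hl
    subst hl
    exact ⟨Fin.elim0, fun k => k.elim0, fun x => by simp [pdl]⟩
  | succ n ih =>
    intro l hl
    have hne : l ≠ [] := by rintro rfl; simp at hl
    obtain ⟨m, hm1, hm⟩ := ih l.dropLast (by simp [hl])
    -- The head of a word acts first, so its last letter is the outermost derivative. That is the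
    -- direction which `iteratedFDeriv_succ_apply_left` reads in slot 0.
    have hl2 := List.dropLast_append_getLast hne
    refine ⟨Fin.cons (bv (l.getLast hne)) m, ?_, fun x => ?_⟩
    · intro k
      refine Fin.cases ?_ (fun k => ?_) k
      · simp
      · simpa using hm1 k
    · have h0 : pdl l (fun y => L (f y)) x =
          pd (l.getLast hne) (pdl l.dropLast (fun y => L (f y))) x := by
        conv_lhs => rw [← hl2, pdl_append]
        rfl
      rw [h0]
      have h1 : pdl l.dropLast (fun y => L (f y)) = fun x => L (iteratedFDeriv ℝ n f x m) :=
        funext hm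
      rw [h1]
      have hd : DifferentiableAt ℝ (iteratedFDeriv ℝ n f) x :=
        (hf.differentiable_iteratedFDeriv (by exact_mod_cast WithTop.coe_lt_top _)) x
      have hd2 : HasFDerivAt (fun x => iteratedFDeriv ℝ n f x m)
          ((fderiv ℝ (iteratedFDeriv ℝ n f) x).flipMultilinear m) x :=
        ((ContinuousMultilinearMap.apply ℝ (fun _ : Fin n => E3) F m).hasFDerivAt).comp x
          hd.hasFDerivAt
      refine (pd_eq_of_hasFDerivAt (L.hasFDerivAt.comp x hd2) _).trans ?_
      rw [iteratedFDeriv_succ_apply_left]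
      simp

end HBS

namespace HBS

/-! ### Slicing integrals -/

/-- The vertical variable is kept outside so that polar coordinates can later be used in the inner,
horizontal integral. -/
lemma lintegral_slice {g : E3 → ℝ≥0∞} (hg : Measurable g) :
    ∫⁻ x, g x = ∫⁻ z : ℝ, ∫⁻ p : ℝ × ℝ, g !₂[p.1, p.2, z] := by
  have h1 := (PiLp.volume_preserving_toLp (Fin 3)).lintegral_comp hg
  have h2 := ((volume_preserving_piFinSuccAbove (fun _ : Fin 3 => ℝ) 2).symm).lintegral_comp
    (hg.comp (PiLp.volume_preserving_toLp (Fin 3)).measurable)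
  refine h1.symm.trans (h2.symm.trans ?_)
  rw [Measure.volume_eq_prod]
  refine (lintegral_prod _ ((hg.comp (PiLp.volume_preserving_toLp (Fin 3)).measurable).comp
      (MeasurableEquiv.measurable _)).aemeasurable).trans ?_
  congr 1
  funext z
  have hm : Measurable fun y : Fin 2 → ℝ => g (WithLp.toLp 2
      ((MeasurableEquiv.piFinSuccAbove (fun _ : Fin 3 => ℝ) 2).symm (z, y))) :=
    hg.comp ((PiLp.volume_preserving_toLp (Fin 3)).measurable.comp
      ((MeasurableEquiv.measurable _).comp measurable_prodMk_left))
  have h3 := ((volume_preserving_finTwoArrow ℝ).symm).lintegral_comp hm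
  simp only [Function.comp_apply]
  rw [← h3]
  congr 1
  funext p
  congr 1
  ext k
  fin_cases k <;> rfl

lemma lintegral_slice₃ {g : E3 → ℝ≥0∞} (hg : Measurable g) :
    ∫⁻ x, g x = ∫⁻ z : ℝ, ∫⁻ a : ℝ, ∫⁻ b : ℝ, g !₂[a, b, z] := by
  rw [lintegral_slice hg]
  congr 1
  funext z
  have : Measurable fun p : ℝ × ℝ => g !₂[p.1, p.2, z] := by
    refine hg.comp ((PiLp.volume_preserving_toLp (Fin 3)).measurable.comp ?_)
    refine measurable_pi_lambda _ fun k => ?_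
    fin_cases k
    · exact measurable_fst
    · exact measurable_snd
    · exact measurable_const
  rw [Measure.volume_eq_prod, lintegral_prod _ this.aemeasurable]

/-! ### Pointwise bounds by square integrals of derivatives -/

/-- Average `ψ s ≤ ψ y + ∫ |ψ'|` over `y` in an interval of length one; no decay at infinity is
needed. -/
lemma le_integral_add_abs_deriv {ψ ψ' : ℝ → ℝ} (s : ℝ) (h : ∀ y, HasDerivAt ψ (ψ' y) y)
    (hc : Continuous ψ') : ψ s ≤ ∫ y in s..s + 1, (ψ y + |ψ' y|) := by
  have hψ : Continuous ψ := continuous_iff_continuousAt.2 fun y => (h y).continuousAt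
  have key : ∀ y ∈ Icc s (s + 1), ψ s ≤ ψ y + ∫ τ in s..s + 1, |ψ' τ| := by
    intro y hy
    have h1 : ∫ τ in s..y, ψ' τ = ψ y - ψ s :=
      intervalIntegral.integral_eq_sub_of_hasDerivAt (fun x _ => h x) (hc.intervalIntegrable _ _)
    have h2 : |∫ τ in s..y, ψ' τ| ≤ ∫ τ in s..y, |ψ' τ| :=
      intervalIntegral.abs_integral_le_integral_abs hy.1
    have h3 : ∫ τ in s..y, |ψ' τ| ≤ ∫ τ in s..s + 1, |ψ' τ| :=
      intervalIntegral.integral_mono_interval le_rfl hy.1 hy.2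
        (Filter.Eventually.of_forall fun _ => abs_nonneg _) (hc.abs.intervalIntegrable _ _)
    have := abs_le.1 h2
    linarith [this.1]
  have h4 : ∫ _y in s..s + 1, ψ s ≤ ∫ y in s..s + 1, (ψ y + ∫ τ in s..s + 1, |ψ' τ|) :=
    intervalIntegral.integral_mono_on (by linarith) (by simp)
      ((hψ.add continuous_const).intervalIntegrable _ _) key
  rw [intervalIntegral.integral_add (hψ.intervalIntegrable _ _) (by simp)] at h4
  rw [intervalIntegral.integral_add (hψ.intervalIntegrable _ _) (hc.abs.intervalIntegrable _ _)]
  simpa using h4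

lemma ofReal_le_lintegral_add_abs_deriv {ψ ψ' : ℝ → ℝ} (s : ℝ) (h : ∀ y, HasDerivAt ψ (ψ' y) y)
    (hc : Continuous ψ') (h0 : ∀ y, 0 ≤ ψ y) :
    ENNReal.ofReal (ψ s) ≤ ∫⁻ y in Ioc s (s + 1), ENNReal.ofReal (ψ y + |ψ' y|) := by
  have hψ : Continuous ψ := continuous_iff_continuousAt.2 fun y => (h y).continuousAt
  have h1 := le_integral_add_abs_deriv s h hc
  rw [intervalIntegral.integral_of_le (by linarith)] at h1
  refine (ENNReal.ofReal_le_ofReal h1).trans (le_of_eq ?_)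
  refine ofReal_integral_eq_lintegral_ofReal ?_
    (Filter.Eventually.of_forall fun y => add_nonneg (h0 y) (abs_nonneg _))
  exact ((hψ.add hc.abs).intervalIntegrable s (s + 1)).1

/-- One-dimensional Sobolev inequality: the preceding bound for `φ ^ 2`, with `2 |φ φ'| ≤ φ ^ 2 + φ'
^ 2`. -/
lemma sq_enorm_le_lintegral {φ φ' : ℝ → ℝ} (s : ℝ) (h : ∀ y, HasDerivAt φ (φ' y) y)
    (hc : Continuous φ') :
    ‖φ s‖ₑ ^ 2 ≤ 2 * ∫⁻ y, (‖φ y‖ₑ ^ 2 + ‖φ' y‖ₑ ^ 2) := by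
  have e : ∀ y : ℝ, ‖y‖ₑ ^ 2 = ENNReal.ofReal (y ^ 2) := fun y => by
    rw [Real.enorm_eq_ofReal_abs, ← ENNReal.ofReal_pow (abs_nonneg _), sq_abs]
  have hφ : Continuous φ := continuous_iff_continuousAt.2 fun y => (h y).continuousAt
  have h1 := ofReal_le_lintegral_add_abs_deriv (ψ := fun y => φ y ^ 2)
    (ψ' := fun y => 2 * φ y * φ' y) s (fun y => by simpa using (h y).fun_pow 2)
    (by fun_prop) (fun y => sq_nonneg _)
  rw [e, ← lintegral_const_mul' _ _ (by simp)]
  refine h1.trans ((setLIntegral_le_lintegral _ _).trans (lintegral_mono fun y => ?_))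
  simp only [e]
  rw [← ENNReal.ofReal_add (sq_nonneg _) (sq_nonneg _),
    show (2 : ℝ≥0∞) = ENNReal.ofReal 2 by simp, ← ENNReal.ofReal_mul (by norm_num)]
  refine ENNReal.ofReal_le_ofReal ?_
  have h3 : |2 * φ y * φ' y| ≤ φ y ^ 2 + φ' y ^ 2 := by
    rw [abs_le]; constructor <;> nlinarith [sq_nonneg (φ y + φ' y), sq_nonneg (φ y - φ' y)]
  nlinarith [sq_nonneg (φ' y)]

lemma hasDerivAt_line {f : E3 → ℝ} (hf : Differentiable ℝ f) (i : Fin 3) (x : E3) (y : ℝ) :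
    HasDerivAt (fun y : ℝ => f (x + y • bv i)) (pd i f (x + y • bv i)) y := by
  have h1 : HasDerivAt (fun y : ℝ => x + y • bv i) (bv i) y := by
    simpa using ((hasDerivAt_id y).smul_const (bv i)).const_add x
  exact (hf (x + y • bv i)).hasFDerivAt.comp_hasDerivAt y h1

lemma vec_add_smul_bv (a b c y : ℝ) :
    (!₂[a, b, c] : E3) + y • bv 0 = !₂[a + y, b, c] ∧
    (!₂[a, b, c] : E3) + y • bv 1 = !₂[a, b + y, c] ∧
    (!₂[a, b, c] : E3) + y • bv 2 = !₂[a, b, c + y] := by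
  refine ⟨?_, ?_, ?_⟩ <;> ext k <;> fin_cases k <;> simp

lemma sq_enorm_le_lintegral_line {f : E3 → ℝ} (hf : ContDiff ℝ ∞ f) (a b c : ℝ) :
    ‖f !₂[a, b, c]‖ₑ ^ 2 ≤ 2 * ∫⁻ y, (‖f !₂[y, b, c]‖ₑ ^ 2 + ‖pd 0 f !₂[y, b, c]‖ₑ ^ 2) ∧
    ‖f !₂[a, b, c]‖ₑ ^ 2 ≤ 2 * ∫⁻ y, (‖f !₂[a, y, c]‖ₑ ^ 2 + ‖pd 1 f !₂[a, y, c]‖ₑ ^ 2) ∧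
    ‖f !₂[a, b, c]‖ₑ ^ 2 ≤ 2 * ∫⁻ y, (‖f !₂[a, b, y]‖ₑ ^ 2 + ‖pd 2 f !₂[a, b, y]‖ₑ ^ 2) := by
  have hd := hf.differentiable (by simp)
  have key : ∀ (i : Fin 3) (x : E3) (s : ℝ), ‖f (x + s • bv i)‖ₑ ^ 2 ≤
      2 * ∫⁻ y : ℝ, (‖f (x + y • bv i)‖ₑ ^ 2 + ‖pd i f (x + y • bv i)‖ₑ ^ 2) := fun i x s =>
    sq_enorm_le_lintegral s (hasDerivAt_line hd i x)
      ((contDiff_pd hf i).continuous.comp (by fun_prop))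
  have k0 := key 0 !₂[0, b, c] a
  have k1 := key 1 !₂[a, 0, c] b
  have k2 := key 2 !₂[a, b, 0] c
  simp only [(vec_add_smul_bv _ _ _ _).1, zero_add] at k0
  simp only [(vec_add_smul_bv _ _ _ _).2.1, zero_add] at k1
  simp only [(vec_add_smul_bv _ _ _ _).2.2, zero_add] at k2
  exact ⟨k0, k1, k2⟩

lemma lintegral_sq_enorm (f : E3 → ℝ) : ∫⁻ x, ‖f x‖ₑ ^ 2 = eLpNorm f 2 volume ^ 2 := by
  rw [eLpNorm_eq_lintegral_rpow_enorm_toReal (by norm_num) (by norm_num), ← ENNReal.rpow_natCast, ← ENNReal.rpow_mul]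
  simp

lemma continuous_vec : Continuous fun p : ℝ × ℝ × ℝ => (!₂[p.1, p.2.1, p.2.2] : E3) := by
  refine (PiLp.continuous_toLp 2 _).comp (continuous_pi fun k => ?_)
  fin_cases k
  · exact continuous_fst
  · exact continuous_snd.fst
  · exact continuous_snd.snd

/-- The words of mixed partial derivatives in which each direction occurs at most once. -/
def cubeWords : List (List (Fin 3)) := [[], [0], [1], [1, 0], [2], [2, 0], [2, 1], [2, 1, 0]]

/-- The one-dimensional inequality is iterated over the three coordinates. Each direction costs a
factor 2 and at most one derivative, which explains the constant 8 and the eight words. -/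
lemma sq_enorm_le_sum {f : E3 → ℝ} (hf : ContDiff ℝ ∞ f) (x : E3) :
    ‖f x‖ₑ ^ 2 ≤ 8 * (cubeWords.map fun l => eLpNorm (pdl l f) 2 volume ^ 2).sum := by
  have hx : x = !₂[x 0, x 1, x 2] := by ext k; fin_cases k <;> rfl
  have hc : ∀ {g : E3 → ℝ}, ContDiff ℝ ∞ g → Continuous g := fun h => h.continuous
  have cv := continuous_vec
  -- one variable at a time
  have s0 : ∀ {g : E3 → ℝ}, ContDiff ℝ ∞ g → ∀ a b c, ‖g !₂[a, b, c]‖ₑ ^ 2 ≤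
      2 * ((∫⁻ y, ‖g !₂[a, y, c]‖ₑ ^ 2) + ∫⁻ y, ‖pd 1 g !₂[a, y, c]‖ₑ ^ 2) := by
    intro g hg a b c
    refine ((sq_enorm_le_lintegral_line hg a b c).2.1).trans (le_of_eq ?_)
    rw [lintegral_add_left]
    have : Continuous fun y : ℝ => g !₂[a, y, c] :=
      (hc hg).comp (cv.comp (f := fun y : ℝ => ((a, y, c) : ℝ × ℝ × ℝ)) (by fun_prop))
    exact (this.measurable.enorm).pow_const 2
  have s1 : ∀ {g : E3 → ℝ}, ContDiff ℝ ∞ g → ∀ a b c, ‖g !₂[a, b, c]‖ₑ ^ 2 ≤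
      4 * ((∫⁻ w, ∫⁻ y, ‖g !₂[w, y, c]‖ₑ ^ 2) + (∫⁻ w, ∫⁻ y, ‖pd 1 g !₂[w, y, c]‖ₑ ^ 2) +
        (∫⁻ w, ∫⁻ y, ‖pd 0 g !₂[w, y, c]‖ₑ ^ 2) +
          ∫⁻ w, ∫⁻ y, ‖pd 1 (pd 0 g) !₂[w, y, c]‖ₑ ^ 2) := by
    intro g hg a b c
    have hm : ∀ {h : E3 → ℝ}, ContDiff ℝ ∞ h → Measurable fun w : ℝ =>
        ∫⁻ y : ℝ, ‖h !₂[w, y, c]‖ₑ ^ 2 := by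
      intro h hh
      refine Measurable.lintegral_prod_right' (f := fun p : ℝ × ℝ => ‖h !₂[p.1, p.2, c]‖ₑ ^ 2) ?_
      have : Continuous fun p : ℝ × ℝ => h !₂[p.1, p.2, c] :=
        (hc hh).comp (cv.comp (f := fun p : ℝ × ℝ => ((p.1, p.2, c) : ℝ × ℝ × ℝ)) (by fun_prop))
      exact (this.measurable.enorm).pow_const 2
    have hm1 := hm hg
    have hm2 := hm (contDiff_pd hg 1)
    have hm3 := hm (contDiff_pd hg 0)
    refine ((sq_enorm_le_lintegral_line hg a b c).1).trans ?_
    refine (mul_le_mul_right (lintegral_mono fun w =>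
      add_le_add (s0 hg w b c) (s0 (contDiff_pd hg 0) w b c)) 2).trans (le_of_eq ?_)
    simp only [← mul_add]
    rw [lintegral_const_mul' _ _ (by simp), lintegral_add_left (by fun_prop),
      lintegral_add_left (by fun_prop), lintegral_add_left (by fun_prop)]
    ring
  have s2 : ∀ {g : E3 → ℝ}, ContDiff ℝ ∞ g →
      Measurable fun c : ℝ => ∫⁻ w : ℝ, ∫⁻ y : ℝ, ‖g !₂[w, y, c]‖ₑ ^ 2 := by
    intro h hh
    refine Measurable.lintegral_prod_right'
      (f := fun p : ℝ × ℝ => ∫⁻ y : ℝ, ‖h !₂[p.2, y, p.1]‖ₑ ^ 2) ?_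
    refine Measurable.lintegral_prod_right'
      (f := fun p : (ℝ × ℝ) × ℝ => ‖h !₂[p.1.2, p.2, p.1.1]‖ₑ ^ 2) ?_
    have : Continuous fun p : (ℝ × ℝ) × ℝ => h !₂[p.1.2, p.2, p.1.1] :=
      (hc hh).comp (cv.comp (f := fun p : (ℝ × ℝ) × ℝ => ((p.1.2, p.2, p.1.1) : ℝ × ℝ × ℝ))
        (by fun_prop))
    exact (this.measurable.enorm).pow_const 2
  have s3 : ∀ {g : E3 → ℝ}, ContDiff ℝ ∞ g →
      ∫⁻ c : ℝ, ∫⁻ w : ℝ, ∫⁻ y : ℝ, ‖g !₂[w, y, c]‖ₑ ^ 2 = eLpNorm g 2 volume ^ 2 := by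
    intro g hg
    rw [← lintegral_sq_enorm, lintegral_slice₃ (((hc hg).measurable.enorm).pow_const 2)]
  have m0 := s2 hf
  have m1 := s2 (contDiff_pd hf 1)
  have m2 := s2 (contDiff_pd hf 0)
  have m3 := s2 (contDiff_pd (contDiff_pd hf 0) 1)
  have hf2 := contDiff_pd hf 2
  have m4 := s2 hf2
  have m5 := s2 (contDiff_pd hf2 1)
  have m6 := s2 (contDiff_pd hf2 0)
  have m7 := s2 (contDiff_pd (contDiff_pd hf2 0) 1)
  rw [hx]
  refine ((sq_enorm_le_lintegral_line hf _ _ _).2.2).trans ?_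
  refine (mul_le_mul_right (lintegral_mono fun z =>
      add_le_add (s1 hf (x 0) (x 1) z) (s1 hf2 (x 0) (x 1) z)) 2).trans (le_of_eq ?_)
  simp only [← mul_add]
  rw [lintegral_const_mul' _ _ (by simp)]
  repeat rw [lintegral_add_left (by fun_prop)]
  rw [s3 hf, s3 hf2, s3 (contDiff_pd hf 1), s3 (contDiff_pd hf 0), s3 (contDiff_pd hf2 1),
    s3 (contDiff_pd hf2 0), s3 (contDiff_pd (contDiff_pd hf 0) 1),
    s3 (contDiff_pd (contDiff_pd hf2 0) 1)]
  have e1 : pdl [1, 0] f = pd 1 (pd 0 f) := funext fun x => pd_comm hf 0 1 x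
  have e2 : pdl [2, 1, 0] f = pd 1 (pd 0 (pd 2 f)) := funext fun x => pd_comm hf2 0 1 x
  simp only [cubeWords, List.map, List.sum_cons, List.sum_nil, e1, e2]
  simp only [pdl]
  ring

end HBS

namespace HBS

/-! ### Families of smooth functions bounded in every Sobolev space -/

/-- A family of smooth functions all of whose partial derivatives are bounded in `L²(ℝ³)`,
uniformly for times in `J`. -/
structure SobFam (J : Set ℝ) (a : ℝ → E3 → ℝ) : Prop where
  smooth : ∀ t ∈ J, ContDiff ℝ ∞ (a t)
  bound : ∀ l, ∃ B : ℝ≥0, ∀ t ∈ J, eLpNorm (pdl l (a t)) 2 volume ≤ B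

/-- A smooth function all of whose partial derivatives are in `L²(ℝ³)`. -/
abbrev Sob (f : E3 → ℝ) : Prop := SobFam univ fun _ => f

namespace SobFam
variable {J : Set ℝ} {a b : ℝ → E3 → ℝ}

lemma sob (h : SobFam J a) {t : ℝ} (ht : t ∈ J) : Sob (a t) where
  smooth _ _ := h.smooth t ht
  bound l := (h.bound l).imp fun _ hB _ _ => hB t ht

lemma congr (h : SobFam J a) (hab : ∀ t ∈ J, b t = a t) : SobFam J b where
  smooth t ht := by rw [hab t ht]; exact h.smooth t ht
  bound l := (h.bound l).imp fun _ hB t ht => by rw [hab t ht]; exact hB t ht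

lemma pd (h : SobFam J a) (i : Fin 3) : SobFam J (fun t => HBS.pd i (a t)) where
  smooth t ht := contDiff_pd (h.smooth t ht) i
  bound l := h.bound (i :: l)

lemma add (ha : SobFam J a) (hb : SobFam J b) : SobFam J (fun t x => a t x + b t x) where
  smooth t ht := (ha.smooth t ht).add (hb.smooth t ht)
  bound l := by
    obtain ⟨A, hA⟩ := ha.bound l
    obtain ⟨B, hB⟩ := hb.bound l
    refine ⟨A + B, fun t ht => ?_⟩
    rw [pdl_add (ha.smooth t ht) (hb.smooth t ht)]
    refine (eLpNorm_add_le (contDiff_pdl (ha.smooth t ht) l).continuous.aestronglyMeasurable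
      (contDiff_pdl (hb.smooth t ht) l).continuous.aestronglyMeasurable (by norm_num)).trans ?_
    exact_mod_cast add_le_add (hA t ht) (hB t ht)

lemma const_mul (ha : SobFam J a) (c : ℝ) : SobFam J (fun t x => c * a t x) where
  smooth t ht := contDiff_const.mul (ha.smooth t ht)
  bound l := by
    obtain ⟨A, hA⟩ := ha.bound l
    refine ⟨‖c‖₊ * A, fun t ht => ?_⟩
    rw [pdl_const_mul c (ha.smooth t ht)]
    refine (eLpNorm_const_smul_le (c := c)).trans ?_
    push_cast
    exact mul_le_mul_right (hA t ht) _

lemma neg (ha : SobFam J a) : SobFam J (fun t x => - a t x) := by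
  simpa using ha.const_mul (-1)

lemma sub (ha : SobFam J a) (hb : SobFam J b) : SobFam J (fun t x => a t x - b t x) := by
  simpa [sub_eq_add_neg] using ha.add hb.neg

lemma zero : SobFam J (fun _ _ => 0) where
  smooth _ _ := contDiff_const
  bound l := by
    refine ⟨0, fun t _ => ?_⟩
    have : pdl l (fun _ : E3 => (0 : ℝ)) = fun _ => 0 := by
      have := pdl_const_mul (f := fun _ : E3 => (0 : ℝ)) 0 contDiff_const l
      simpa using this
    rw [this]
    simp

lemma sum {ι : Type*} (s : Finset ι) {F : ι → ℝ → E3 → ℝ} (h : ∀ i ∈ s, SobFam J (F i)) :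
    SobFam J (fun t x => ∑ i ∈ s, F i t x) := by
  classical
  induction s using Finset.induction_on with
  | empty => simpa using zero
  | insert i s hi ih =>
    simp only [Finset.sum_insert hi]
    exact (h i (by simp)).add (ih fun j hj => h j (by simp [hj]))

lemma memLp (h : SobFam J a) {t : ℝ} (ht : t ∈ J) : MemLp (a t) 2 volume := by
  obtain ⟨B, hB⟩ := h.bound []
  exact ⟨(h.smooth t ht).continuous.aestronglyMeasurable, (hB t ht).trans_lt (by simp)⟩

/-- Sobolev families are uniformly bounded. -/
lemma exists_abs_le (h : SobFam J a) : ∃ B : ℝ≥0, ∀ t ∈ J, ∀ x, |a t x| ≤ B := by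
  choose B hB using h.bound
  refine ⟨8 * (cubeWords.map B).sum, fun t ht x => ?_⟩
  have h1 := sq_enorm_le_sum (h.smooth t ht) x
  -- A sum of squares is at most the square of the sum, and 8 is enlarged to `64 = 8 ^ 2` so that a
  -- square root can be taken.
  have h2 : ‖a t x‖ₑ ^ 2 ≤ (8 * ((cubeWords.map B).sum : ℝ≥0∞)) ^ 2 := by
    refine h1.trans ?_
    have h3 : (cubeWords.map fun l => eLpNorm (pdl l (a t)) 2 volume ^ 2).sum ≤
        ((cubeWords.map B).sum : ℝ≥0∞) ^ 2 := by
      have h4 : (cubeWords.map fun l => eLpNorm (pdl l (a t)) 2 volume ^ 2).sum ≤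
          (cubeWords.map fun l => (B l : ℝ≥0∞) ^ 2).sum :=
        List.sum_le_sum fun l _ => pow_le_pow_left' (hB l t ht) 2
      refine h4.trans ?_
      generalize cubeWords = w
      induction w with
      | nil => simp
      | cons l w ih =>
        simp only [List.map_cons, List.sum_cons, ENNReal.coe_add]
        refine (add_le_add_right ih _).trans ?_
        rw [add_sq]
        exact add_le_add_left le_self_add _
    calc _ ≤ 8 * ((cubeWords.map B).sum : ℝ≥0∞) ^ 2 := mul_le_mul_right h3 _
      _ ≤ 64 * ((cubeWords.map B).sum : ℝ≥0∞) ^ 2 := mul_le_mul_left (by norm_num) _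
      _ = _ := by ring
  have h5 : ‖a t x‖ₑ ≤ 8 * ((cubeWords.map B).sum : ℝ≥0∞) :=
    (ENNReal.pow_le_pow_left_iff (by norm_num)).1 h2
  have h6 : ‖a t x‖₊ ≤ 8 * (cubeWords.map B).sum := by exact_mod_cast h5
  rw [← Real.norm_eq_abs]
  exact_mod_cast h6

lemma mul_bound (ha : SobFam J a) (hb : SobFam J b) :
    ∃ B : ℝ≥0, ∀ t ∈ J, eLpNorm (fun x => a t x * b t x) 2 volume ≤ B := by
  obtain ⟨A, hA⟩ := ha.exists_abs_le
  obtain ⟨B, hB⟩ := hb.bound []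
  refine ⟨A * B, fun t ht => ?_⟩
  refine (eLpNorm_le_nnreal_smul_eLpNorm_of_ae_le_mul (g := b t) (c := A)
    (Filter.Eventually.of_forall fun x => ?_) 2).trans ?_
  · rw [← NNReal.coe_le_coe]
    simpa [abs_mul] using mul_le_mul_of_nonneg_right (hA t ht x) (abs_nonneg (b t x))
  · push_cast
    exact mul_le_mul_right (hB t ht) _

/-- The algebra property: the Leibniz rule reduces every derivative to products treated by
`mul_bound`, with one factor in `L^∞` and the other in `L²`. -/
lemma mul (ha : SobFam J a) (hb : SobFam J b) : SobFam J (fun t x => a t x * b t x) where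
  smooth t ht := (ha.smooth t ht).mul (hb.smooth t ht)
  bound l := by
    induction l generalizing a b with
    | nil => exact ha.mul_bound hb
    | cons i l ih =>
      obtain ⟨A, hA⟩ := ih (ha.pd i) hb
      obtain ⟨B, hB⟩ := ih ha (hb.pd i)
      refine ⟨A + B, fun t ht => ?_⟩
      have h1 := ha.smooth t ht
      have h2 := hb.smooth t ht
      have c1 := contDiff_pdl ((contDiff_pd h1 i).mul h2) l
      have c2 := contDiff_pdl (h1.mul (contDiff_pd h2 i)) l
      simp only [pdl]
      rw [pd_mul_fun h1 h2, pdl_add ((contDiff_pd h1 i).mul h2) (h1.mul (contDiff_pd h2 i))]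
      refine (eLpNorm_add_le c1.continuous.aestronglyMeasurable
        c2.continuous.aestronglyMeasurable (by norm_num)).trans ?_
      exact_mod_cast add_le_add (hA t ht) (hB t ht)

lemma lapH (ha : SobFam J a) : SobFam J (fun t => HBS.lapH (a t)) :=
  ((ha.pd 0).pd 0).add ((ha.pd 1).pd 1)

end SobFam

/-! ### Single Sobolev functions -/

section Sob
variable {f g : E3 → ℝ}

lemma Sob.contDiff (h : Sob f) : ContDiff ℝ ∞ f := h.smooth 0 trivial
lemma Sob.differentiable (h : Sob f) : Differentiable ℝ f := h.contDiff.differentiable (by simp)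
lemma Sob.differentiableAt (h : Sob f) (x : E3) : DifferentiableAt ℝ f x := h.differentiable x
lemma Sob.continuous (h : Sob f) : Continuous f := h.contDiff.continuous
lemma Sob.memLp (h : Sob f) : MemLp f 2 volume := SobFam.memLp h (mem_univ 0)
lemma Sob.pd (h : Sob f) (i : Fin 3) : Sob (HBS.pd i f) := SobFam.pd h i
lemma Sob.add (hf : Sob f) (hg : Sob g) : Sob fun x => f x + g x := SobFam.add hf hg
lemma Sob.sub (hf : Sob f) (hg : Sob g) : Sob fun x => f x - g x := SobFam.sub hf hg
lemma Sob.mul (hf : Sob f) (hg : Sob g) : Sob fun x => f x * g x := SobFam.mul hf hg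
lemma Sob.const_mul (hf : Sob f) (c : ℝ) : Sob fun x => c * f x := SobFam.const_mul hf c
lemma Sob.lapH (hf : Sob f) : Sob (HBS.lapH f) := SobFam.lapH hf
lemma Sob.integrable_mul (hf : Sob f) (hg : Sob g) : Integrable fun x => f x * g x :=
  hf.memLp.integrable_mul hg.memLp

lemma Sob.integrable_sq (hf : Sob f) : Integrable fun x => f x ^ 2 := hf.memLp.integrable_sq

lemma integral_mul_pd_of_integrable (i : Fin 3) (hf : Differentiable ℝ f)
    (hg : Differentiable ℝ g) (h1 : Integrable fun x => pd i f x * g x)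
    (h2 : Integrable fun x => f x * pd i g x) (h3 : Integrable fun x => f x * g x) :
    ∫ x, f x * pd i g x = - ∫ x, pd i f x * g x :=
  integral_mul_fderiv_eq_neg_fderiv_mul_of_integrable h1 h2 h3 (fun x _ => hf x) (fun x _ => hg x)

lemma Sob.integral_mul_pd (hf : Sob f) (hg : Sob g) (i : Fin 3) :
    ∫ x, f x * HBS.pd i g x = - ∫ x, HBS.pd i f x * g x :=
  integral_mul_pd_of_integrable i hf.differentiable hg.differentiable
    ((hf.pd i).integrable_mul hg) (hf.integrable_mul (hg.pd i)) (hf.integrable_mul hg)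

end Sob

/-! ### Square norms -/

/-- The square of the `L²` norm of a real function. -/
noncomputable def nsq (f : E3 → ℝ) : ℝ := ∫ x, f x ^ 2

lemma nsq_nonneg (f : E3 → ℝ) : 0 ≤ nsq f := integral_nonneg fun _ => sq_nonneg _

lemma ofReal_nsq {f : E3 → ℝ} (hf : MemLp f 2 volume) :
    ENNReal.ofReal (nsq f) = eLpNorm f 2 volume ^ 2 := by
  rw [← lintegral_sq_enorm, nsq, ofReal_integral_eq_lintegral_ofReal hf.integrable_sq
    (Filter.Eventually.of_forall fun _ => sq_nonneg _)]
  congr 1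
  funext x
  rw [Real.enorm_eq_ofReal_abs, ← ENNReal.ofReal_pow (abs_nonneg _), sq_abs]

lemma nsq_le_of_eLpNorm_le {f : E3 → ℝ} (hf : MemLp f 2 volume) {B : ℝ≥0}
    (h : eLpNorm f 2 volume ≤ B) : nsq f ≤ (B : ℝ) ^ 2 := by
  have h1 : ENNReal.ofReal (nsq f) ≤ ENNReal.ofReal ((B : ℝ) ^ 2) := by
    rw [ofReal_nsq hf, ENNReal.ofReal_pow B.coe_nonneg, ENNReal.ofReal_coe_nnreal]
    exact pow_le_pow_left' h 2
  exact (ENNReal.ofReal_le_ofReal_iff (by positivity)).1 h1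

lemma SobFam.exists_nsq_le {J : Set ℝ} {a : ℝ → E3 → ℝ} (h : SobFam J a) :
    ∃ B : ℝ, 0 ≤ B ∧ ∀ t ∈ J, nsq (a t) ≤ B := by
  obtain ⟨B, hB⟩ := h.bound []
  exact ⟨(B : ℝ) ^ 2, by positivity, fun t ht => nsq_le_of_eLpNorm_le (h.memLp ht) (hB t ht)⟩

lemma abs_integral_mul_le {f g : E3 → ℝ} (hf : MemLp f 2 volume) (hg : MemLp g 2 volume) :
    ∫ x, |f x| * |g x| ≤ Real.sqrt (nsq f) * Real.sqrt (nsq g) := by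
  have := integral_mul_norm_le_Lp_mul_Lq (f := f) (g := g) (μ := volume) Real.HolderConjugate.two_two
    (by simpa using hf) (by simpa using hg)
  simpa [Real.sqrt_eq_rpow, nsq] using this

lemma integral_mul_le_half {f g : E3 → ℝ} (hf : MemLp f 2 volume) (hg : MemLp g 2 volume) {c : ℝ}
    (hc : 0 < c) : 2 * |∫ x, f x * g x| ≤ c * nsq f + c⁻¹ * nsq g := by
  have h1 : |∫ x, f x * g x| ≤ ∫ x, |f x * g x| := abs_integral_le_integral_abs
  have h2 : ∫ x, |f x * g x| ≤ ∫ x, ((c / 2) * f x ^ 2 + (c⁻¹ / 2) * g x ^ 2) := by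
    refine integral_mono (hf.integrable_mul hg).abs
      ((hf.integrable_sq.const_mul _).add (hg.integrable_sq.const_mul _)) fun x => ?_
    rw [abs_mul]
    have h3 : 0 ≤ (c / 2) * (|f x| - c⁻¹ * |g x|) ^ 2 := by positivity
    have h4 : (c / 2) * (|f x| - c⁻¹ * |g x|) ^ 2 =
        (c / 2) * f x ^ 2 + (c⁻¹ / 2) * g x ^ 2 - |f x| * |g x| := by
      rw [sub_sq, mul_pow, sq_abs, sq_abs]; field_simp; ring
    simp only
    linarith
  rw [integral_add (hf.integrable_sq.const_mul _) (hg.integrable_sq.const_mul _),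
    integral_const_mul, integral_const_mul] at h2
  simp only [nsq]
  linarith

end HBS

namespace HBS

/-! ### Differentiation under the integral sign -/

lemma hasFDerivAt_of_differentiableAt {f : E3 → ℝ} {x : E3} (h : DifferentiableAt ℝ f x) :
    HasFDerivAt f (∑ i, pd i f x • (EuclideanSpace.proj i : E3 →L[ℝ] ℝ)) x := by
  have : fderiv ℝ f x = ∑ i, pd i f x • (EuclideanSpace.proj i : E3 →L[ℝ] ℝ) := by
    ext v
    rw [fderiv_apply_eq_sum]
    simp [mul_comm]
  rw [← this]
  exact h.hasFDerivAt

lemma contDiff_succ_of_pd {f : E3 → ℝ} {n : ℕ} (hf : Differentiable ℝ f)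
    (h : ∀ i, ContDiff ℝ n (pd i f)) : ContDiff ℝ (n + 1 : ℕ) f := by
  have e : fderiv ℝ f = fun x => ∑ i, pd i f x • (EuclideanSpace.proj i : E3 →L[ℝ] ℝ) :=
    funext fun x => (hasFDerivAt_of_differentiableAt (hf x)).fderiv
  have h1 : ContDiff ℝ n (fderiv ℝ f) := by
    rw [e]
    exact ContDiff.sum fun i _ => (h i).smul contDiff_const
  exact_mod_cast contDiff_succ_iff_fderiv.2 ⟨hf, by simp, h1⟩

lemma differentiable_integral {a : ℝ → E3 → ℝ} {s t : ℝ} (hst : s ≤ t)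
    (hd : ∀ τ ∈ Icc s t, Differentiable ℝ (a τ))
    (ha : ContinuousOn (fun q : ℝ × E3 => a q.1 q.2) (Icc s t ×ˢ univ))
    (hp : ∀ i, ContinuousOn (fun q : ℝ × E3 => pd i (a q.1) q.2) (Icc s t ×ˢ univ)) (x : E3) :
    HasFDerivAt (fun x => ∫ τ in s..t, a τ x)
      (∫ τ in s..t, ∑ i, pd i (a τ) x • (EuclideanSpace.proj i : E3 →L[ℝ] ℝ)) x := by
  have hslice : ∀ {F : Type} [NormedAddCommGroup F] {b : ℝ → E3 → F},
      ContinuousOn (fun q : ℝ × E3 => b q.1 q.2) (Icc s t ×ˢ univ) → ∀ y,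
      ContinuousOn (fun τ => b τ y) (Icc s t) := by
    intro F _ b hb y
    exact hb.comp (f := fun τ => (τ, y)) (by fun_prop) fun τ hτ => ⟨hτ, trivial⟩
  have hF : ContinuousOn (fun q : ℝ × E3 => ∑ i, pd i (a q.1) q.2 •
      (EuclideanSpace.proj i : E3 →L[ℝ] ℝ)) (Icc s t ×ˢ univ) :=
    continuousOn_finsetSum _ fun i _ => (hp i).smul continuousOn_const
  have hcpt : IsCompact (Icc s t ×ˢ Metric.closedBall x 1) :=
    isCompact_Icc.prod (isCompact_closedBall x 1)
  obtain ⟨K, hK⟩ := hcpt.exists_bound_of_continuousOn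
    (hF.mono (prod_mono_right (subset_univ _)))
  refine intervalIntegral.hasFDerivAt_integral_of_dominated_of_fderiv_le (𝕜 := ℝ)
    (F := fun y τ => a τ y)
    (F' := fun y τ => ∑ i, pd i (a τ) y • (EuclideanSpace.proj i : E3 →L[ℝ] ℝ))
    (bound := fun _ => K) (Metric.closedBall_mem_nhds x one_pos) ?_ ?_ ?_ ?_ ?_ ?_
  · refine Filter.Eventually.of_forall fun y => ?_
    rw [uIoc_of_le hst]
    exact ((hslice ha y).mono Ioc_subset_Icc_self).aestronglyMeasurable measurableSet_Ioc
  · exact ContinuousOn.intervalIntegrable_of_Icc hst (hslice ha x)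
  · rw [uIoc_of_le hst]
    exact ((hslice (b := fun τ y => ∑ i, pd i (a τ) y • (EuclideanSpace.proj i : E3 →L[ℝ] ℝ))
      hF x).mono Ioc_subset_Icc_self).aestronglyMeasurable measurableSet_Ioc
  · refine Filter.Eventually.of_forall fun τ hτ y hy => hK (τ, y) ⟨?_, hy⟩
    rw [uIoc_of_le hst] at hτ
    exact Ioc_subset_Icc_self hτ
  · simp
  · refine Filter.Eventually.of_forall fun τ hτ y _ => ?_
    rw [uIoc_of_le hst] at hτ
    exact hasFDerivAt_of_differentiableAt (hd τ (Ioc_subset_Icc_self hτ) y)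

lemma pd_integral {a : ℝ → E3 → ℝ} {s t : ℝ} (hst : s ≤ t)
    (hd : ∀ τ ∈ Icc s t, Differentiable ℝ (a τ))
    (ha : ContinuousOn (fun q : ℝ × E3 => a q.1 q.2) (Icc s t ×ˢ univ))
    (hp : ∀ i, ContinuousOn (fun q : ℝ × E3 => pd i (a q.1) q.2) (Icc s t ×ˢ univ))
    (i : Fin 3) (x : E3) :
    pd i (fun x => ∫ τ in s..t, a τ x) x = ∫ τ in s..t, pd i (a τ) x := by
  rw [pd_eq_of_hasFDerivAt (differentiable_integral hst hd ha hp x),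
    ContinuousLinearMap.intervalIntegral_apply]
  · congr 1
    funext τ
    simp [Fin.sum_univ_three]
    fin_cases i <;> simp
  · refine ContinuousOn.intervalIntegrable_of_Icc hst ?_
    refine continuousOn_finsetSum _ fun j _ => ?_
    have h1 : ContinuousOn (fun τ => pd j (a τ) x) (Icc s t) :=
      (hp j).comp (f := fun τ => (τ, x)) (by fun_prop) fun τ hτ => ⟨hτ, trivial⟩
    exact h1.fun_smul continuousOn_const

lemma pd_comp_clm {f : E3 → ℝ} (hf : Differentiable ℝ f) (L : E3 →L[ℝ] E3) (i : Fin 3) (x : E3) :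
    pd i (fun y => f (L y)) x = ∑ j, L (bv i) j * pd j f (L x) := by
  refine (pd_eq_of_hasFDerivAt ((hf (L x)).hasFDerivAt.comp x L.hasFDerivAt) i).trans ?_
  simp only [ContinuousLinearMap.comp_apply]
  rw [fderiv_apply_eq_sum]
  rfl

/-! ### Division by the first coordinate -/

/-- The dilation of the first coordinate. -/
noncomputable def dil (s : ℝ) : E3 →L[ℝ] E3 :=
  ContinuousLinearMap.id ℝ E3 +
    ((s - 1) • (EuclideanSpace.proj 0 : E3 →L[ℝ] ℝ)).smulRight (bv 0)

lemma dil_apply (s : ℝ) (x : E3) : dil s x = x + ((s - 1) * x 0) • bv 0 := by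
  simp [dil]

lemma dil_vec (s a b c : ℝ) : dil s !₂[a, b, c] = !₂[s * a, b, c] := by
  rw [dil_apply]
  ext k
  fin_cases k <;> simp
  ring

lemma continuous_dil : Continuous fun q : ℝ × E3 => dil q.1 q.2 := by
  simp only [dil_apply]
  fun_prop

/-- The weighted average of `f` over the segment from `x` to its projection on `{x₀ = 0}`. -/
noncomputable def avg (m : ℕ) (f : E3 → ℝ) (x : E3) : ℝ := ∫ s in (0 : ℝ)..1, s ^ m * f (dil s x)

lemma pd_comp_dil {f : E3 → ℝ} (hf : Differentiable ℝ f) (s : ℝ) (i : Fin 3) (x : E3) :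
    pd i (fun y => f (dil s y)) x = (if i = 0 then s else 1) * pd i f (dil s x) := by
  rw [pd_comp_clm hf, Fin.sum_univ_three]
  fin_cases i <;> simp [dil_apply]

lemma pd_pow_mul_comp_dil {f : E3 → ℝ} (hf : Differentiable ℝ f) (m : ℕ) (s : ℝ) (i : Fin 3)
    (x : E3) : pd i (fun y => s ^ m * f (dil s y)) x =
      s ^ (m + if i = 0 then 1 else 0) * pd i f (dil s x) := by
  have h : DifferentiableAt ℝ (fun y => f (dil s y)) x := (hf _).comp x (dil s).differentiableAt
  rw [pd_const_mul i _ h, pd_comp_dil hf]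
  split_ifs <;> ring

section
variable {f : E3 → ℝ}

lemma continuous_pow_mul_comp_dil (hf : ContDiff ℝ ∞ f) (m : ℕ) :
    Continuous fun q : ℝ × E3 => q.1 ^ m * f (dil q.1 q.2) :=
  (continuous_fst.pow m).mul (hf.continuous.comp continuous_dil)

/-- The chain rule for the dilation brings out a factor `s` exactly when the derivative is along
coordinate 0. This is why averages are defined with a weight `s ^ m`: the class is stable under
differentiation. -/
lemma pd_avg (hf : ContDiff ℝ ∞ f) (m : ℕ) (i : Fin 3) :
    pd i (avg m f) = avg (m + if i = 0 then 1 else 0) (pd i f) := by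
  have hd := hf.differentiable (by simp)
  funext x
  refine (pd_integral (a := fun s y => s ^ m * f (dil s y)) zero_le_one ?_ ?_ ?_ i x).trans ?_
  · exact fun s _ => (hd.comp (dil s).differentiable).const_mul _
  · exact (continuous_pow_mul_comp_dil hf m).continuousOn
  · intro j
    simp only [pd_pow_mul_comp_dil hd]
    exact (continuous_pow_mul_comp_dil (contDiff_pd hf j) _).continuousOn
  · simp only [pd_pow_mul_comp_dil hd]
    rfl

lemma differentiable_avg (hf : ContDiff ℝ ∞ f) (m : ℕ) : Differentiable ℝ (avg m f) := by
  have hd := hf.differentiable (by simp)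
  intro x
  refine (differentiable_integral (a := fun s y => s ^ m * f (dil s y))
    zero_le_one ?_ ?_ ?_ x).differentiableAt
  · exact fun s _ => (hd.comp (dil s).differentiable).const_mul _
  · exact (continuous_pow_mul_comp_dil hf m).continuousOn
  · intro j
    simp only [pd_pow_mul_comp_dil hd]
    exact (continuous_pow_mul_comp_dil (contDiff_pd hf j) _).continuousOn

lemma contDiff_avg (hf : ContDiff ℝ ∞ f) (m : ℕ) : ContDiff ℝ ∞ (avg m f) := by
  refine contDiff_infty.2 fun n => ?_
  induction n generalizing f m with
  | zero => exact_mod_cast contDiff_zero.2 (differentiable_avg hf m).continuous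
  | succ n ih =>
    refine contDiff_succ_of_pd (differentiable_avg hf m) fun i => ?_
    rw [pd_avg hf]
    exact ih (contDiff_pd hf i) _

lemma pdl_avg (hf : ContDiff ℝ ∞ f) (m : ℕ) (l : List (Fin 3)) : ∃ k, pdl l (avg m f) = avg k (pdl l f) := by
  induction l generalizing f m with
  | nil => exact ⟨m, rfl⟩
  | cons i l ih =>
    simp only [pdl]
    rw [pd_avg hf]
    exact ih (contDiff_pd hf i) _

end

lemma lintegral_comp_dil {g : E3 → ℝ≥0∞} (hg : Measurable g) {s : ℝ} (hs : 0 < s) :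
    ∫⁻ x, g (dil s x) = ENNReal.ofReal s⁻¹ * ∫⁻ x, g x := by
  have hg2 : Measurable fun x => g (dil s x) := hg.comp (dil s).continuous.measurable
  rw [lintegral_slice₃ hg, lintegral_slice₃ hg2, ← lintegral_const_mul' _ _ (by simp)]
  congr 1
  funext z
  simp only [dil_vec]
  have hm : Measurable fun a : ℝ => ∫⁻ b : ℝ, g !₂[a, b, z] := by
    refine Measurable.lintegral_prod_right' (f := fun p : ℝ × ℝ => g !₂[p.1, p.2, z]) ?_
    exact hg.comp (continuous_vec.comp
      (f := fun p : ℝ × ℝ => ((p.1, p.2, z) : ℝ × ℝ × ℝ)) (by fun_prop)).measurable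
  have h1 := Real.smul_map_volume_mul_left hs.ne'
  have h2 : ∀ G : ℝ → ℝ≥0∞, Measurable G →
      ∫⁻ a, G a = ENNReal.ofReal s * ∫⁻ a : ℝ, G (s * a) := by
    intro G hm
    conv_lhs => rw [← h1]
    rw [lintegral_smul_measure, lintegral_map hm (measurable_const_mul s), abs_of_pos hs]
    rfl
  rw [h2 _ hm, ← mul_assoc, ← ENNReal.ofReal_mul (by positivity), inv_mul_cancel₀ hs.ne']
  simp

/-- The constant in the `L²` bound for averages. -/
noncomputable def avgConst : ℝ≥0∞ := ∫⁻ s in Ioc (0 : ℝ) 1, ENNReal.ofReal (s ^ (-(1 / 2) : ℝ))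

lemma avgConst_lt_top : avgConst < ⊤ := by
  have h := (intervalIntegral.intervalIntegrable_rpow' (a := 0) (b := 1) (r := -(1 / 2))
    (by norm_num)).1
  refine lt_of_le_of_lt (lintegral_mono fun s => ?_) h.2
  rw [Real.enorm_eq_ofReal_abs]
  exact ENNReal.ofReal_le_ofReal (le_abs_self _)

lemma lintegral_mul_sq_le {α : Type*} [MeasurableSpace α] (μ : Measure α) {f g : α → ℝ≥0∞}
    (hf : AEMeasurable f μ) (hg : AEMeasurable g μ) :
    (∫⁻ x, f x * g x ∂μ) ^ 2 ≤ (∫⁻ x, f x ^ 2 ∂μ) * ∫⁻ x, g x ^ 2 ∂μ := by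
  have h := ENNReal.lintegral_mul_le_Lp_mul_Lq μ Real.HolderConjugate.two_two hf hg
  refine (pow_le_pow_left' h 2).trans (le_of_eq ?_)
  have e : ∀ z : ℝ≥0∞, (z ^ (1 / (2 : ℝ))) ^ 2 = z := fun z => by
    rw [← ENNReal.rpow_natCast, ← ENNReal.rpow_mul]; norm_num
  rw [mul_pow, e, e]
  simp

lemma ofReal_rpow_sq {s : ℝ} (hs : 0 < s) (r : ℝ) :
    ENNReal.ofReal (s ^ r) ^ 2 = ENNReal.ofReal (s ^ (r * 2)) := by
  rw [← ENNReal.ofReal_pow (by positivity), ← Real.rpow_natCast, ← Real.rpow_mul hs.le]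
  norm_num

/-- Cauchy-Schwarz with the splitting `1 = s^(-1/4) * s^(1/4)`. Dilation multiplies the squared `L²`
norm by `s⁻¹`, so the weight `s^(1/2)` leaves `s^(-1/2)`, still integrable at 0. -/
lemma sq_enorm_avg_le {f : E3 → ℝ} (hf : Continuous f) (m : ℕ) (x : E3) :
    ‖avg m f x‖ₑ ^ 2 ≤ avgConst *
      ∫⁻ s in Ioc (0 : ℝ) 1, ENNReal.ofReal (s ^ (1 / 2 : ℝ)) * ‖f (dil s x)‖ₑ ^ 2 := by
  have hc : Continuous fun s : ℝ => f (dil s x) :=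
    hf.comp (continuous_dil.comp (f := fun s : ℝ => (s, x)) (by fun_prop))
  have hm : Measurable fun s : ℝ => f (dil s x) := hc.measurable
  have h1 : ‖avg m f x‖ₑ ≤ ∫⁻ s in Ioc (0 : ℝ) 1,
      ENNReal.ofReal (s ^ (-(1 / 4) : ℝ)) * (ENNReal.ofReal (s ^ (1 / 4 : ℝ)) * ‖f (dil s x)‖ₑ) := by
    rw [avg, intervalIntegral.integral_of_le zero_le_one]
    refine (enorm_integral_le_lintegral_enorm _).trans
      (setLIntegral_mono' measurableSet_Ioc fun s hs => ?_)
    rw [← mul_assoc, ← ENNReal.ofReal_mul (by have := hs.1; positivity), ← Real.rpow_add hs.1]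
    simp only [neg_add_cancel, Real.rpow_zero, ENNReal.ofReal_one, one_mul, enorm_mul]
    refine mul_le_of_le_one_left (by simp) ?_
    rw [Real.enorm_eq_ofReal_abs, abs_of_nonneg (pow_nonneg hs.1.le m), ← ENNReal.ofReal_one]
    exact ENNReal.ofReal_le_ofReal (pow_le_one₀ hs.1.le hs.2)
  have m1 : Measurable fun s : ℝ => ENNReal.ofReal (s ^ (-(1 / 4) : ℝ)) := by fun_prop
  have m2 : Measurable fun s : ℝ => ENNReal.ofReal (s ^ (1 / 4 : ℝ)) * ‖f (dil s x)‖ₑ :=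
    (Measurable.ennreal_ofReal (by fun_prop)).mul hm.enorm
  refine (pow_le_pow_left' h1 2).trans ((lintegral_mul_sq_le (volume.restrict (Ioc (0 : ℝ) 1))
    m1.aemeasurable m2.aemeasurable).trans (le_of_eq ?_))
  congr 1
  · refine setLIntegral_congr_fun measurableSet_Ioc fun s hs => ?_
    simp only [ofReal_rpow_sq hs.1]
    norm_num
  · refine setLIntegral_congr_fun measurableSet_Ioc fun s hs => ?_
    simp only [mul_pow, ofReal_rpow_sq hs.1]
    norm_num

lemma eLpNorm_avg_le {f : E3 → ℝ} (hf : Continuous f) (m : ℕ) :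
    eLpNorm (avg m f) 2 volume ≤ avgConst * eLpNorm f 2 volume := by
  refine (ENNReal.pow_le_pow_left_iff (n := 2) (by norm_num)).1 ?_
  rw [← lintegral_sq_enorm, mul_pow]
  refine (lintegral_mono fun x => sq_enorm_avg_le hf m x).trans ?_
  have hm : Measurable fun p : E3 × ℝ =>
      ENNReal.ofReal (p.2 ^ (1 / 2 : ℝ)) * ‖f (dil p.2 p.1)‖ₑ ^ 2 := by
    have : Continuous fun p : E3 × ℝ => f (dil p.2 p.1) :=
      hf.comp (continuous_dil.comp (f := fun p : E3 × ℝ => (p.2, p.1)) (by fun_prop))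
    exact (Measurable.ennreal_ofReal (by fun_prop)).mul (this.measurable.enorm.pow_const 2)
  rw [lintegral_const_mul' _ _ avgConst_lt_top.ne, lintegral_lintegral_swap hm.aemeasurable]
  have h1 : ∫⁻ s in Ioc (0 : ℝ) 1, ∫⁻ x, ENNReal.ofReal (s ^ (1 / 2 : ℝ)) * ‖f (dil s x)‖ₑ ^ 2 =
      avgConst * eLpNorm f 2 volume ^ 2 := by
    rw [avgConst, ← lintegral_mul_const _ (by fun_prop)]
    refine setLIntegral_congr_fun measurableSet_Ioc fun s hs => ?_
    rw [lintegral_const_mul' _ _ (by simp), lintegral_comp_dil (g := fun x => ‖f x‖ₑ ^ 2)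
      ((hf.measurable.enorm).pow_const 2) hs.1, lintegral_sq_enorm, ← mul_assoc,
      ← ENNReal.ofReal_mul (Real.rpow_nonneg hs.1.le _), ← Real.rpow_neg_one, ← Real.rpow_add hs.1]
    norm_num
  rw [h1, ← mul_assoc, ← sq]

lemma SobFam.avg {J : Set ℝ} {a : ℝ → E3 → ℝ} (h : SobFam J a) (m : ℕ) :
    SobFam J (fun t => avg m (a t)) where
  smooth t ht := contDiff_avg (h.smooth t ht) m
  bound l := by
    obtain ⟨B, hB⟩ := h.bound l
    refine ⟨avgConst.toNNReal * B, fun t ht => ?_⟩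
    obtain ⟨k, hk⟩ := pdl_avg (h.smooth t ht) m l
    rw [hk]
    refine (eLpNorm_avg_le (contDiff_pdl (h.smooth t ht) l).continuous k).trans ?_
    push_cast
    rw [ENNReal.coe_toNNReal avgConst_lt_top.ne]
    exact mul_le_mul_right (hB t ht) _

/-- The quotient `f / x₀`, for a smooth function vanishing on the plane `{x₀ = 0}`. -/
noncomputable def quot (f : E3 → ℝ) : E3 → ℝ := avg 0 (pd 0 f)

lemma SobFam.quot {J : Set ℝ} {a : ℝ → E3 → ℝ} (h : SobFam J a) : SobFam J (fun t => quot (a t)) :=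
  (h.pd 0).avg 0

/-- Fundamental theorem of calculus along `s ↦ f (dil s x)`, which starts on the plane where `f`
vanishes and has derivative `x 0 * pd 0 f (dil s x)`. -/
lemma coord_mul_quot {f : E3 → ℝ} (hf : ContDiff ℝ ∞ f) (h0 : ∀ x : E3, x 0 = 0 → f x = 0)
    (x : E3) : x 0 * quot f x = f x := by
  have hd := hf.differentiable (by simp)
  have h1 : ∀ s : ℝ, HasDerivAt (fun s : ℝ => f (dil s x)) (x 0 * pd 0 f (dil s x)) s := by
    intro s
    have h2 : HasDerivAt (fun s : ℝ => dil s x) (x 0 • bv 0) s := by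
      simp only [dil_apply]
      have := ((((hasDerivAt_id s).sub_const 1).mul_const (x 0)).smul_const (bv 0)).const_add x
      simpa using this
    have h3 := (hd (dil s x)).hasFDerivAt.comp_hasDerivAt s h2
    rw [map_smul] at h3
    exact h3
  have hc : Continuous fun s : ℝ => x 0 * pd 0 f (dil s x) :=
    continuous_const.mul ((contDiff_pd hf 0).continuous.comp
      (continuous_dil.comp (f := fun s : ℝ => (s, x)) (by fun_prop)))
  have h4 := intervalIntegral.integral_eq_sub_of_hasDerivAt (a := 0) (b := 1) (fun s _ => h1 s)
    (hc.intervalIntegrable _ _)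
  have h5 : f (dil 0 x) = 0 := h0 _ (by simp [dil_apply])
  have h6 : dil 1 x = x := by simp [dil_apply]
  rw [h5, h6, intervalIntegral.integral_const_mul] at h4
  simpa [quot, avg] using h4

end HBS

namespace HBS

/-! ### Families depending smoothly on time -/

/-- Joint smoothness on `J × ℝ³`. -/
def JointSmooth (J : Set ℝ) (a : ℝ → E3 → ℝ) : Prop :=
  ContDiffOn ℝ ∞ (fun q : ℝ × E3 => a q.1 q.2) (J ×ˢ univ)

/-- The time derivative within `J`. -/
noncomputable def dtW (J : Set ℝ) (a : ℝ → E3 → ℝ) (t : ℝ) (x : E3) : ℝ :=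
  derivWithin (fun s => a s x) J t

namespace JointSmooth
variable {J : Set ℝ} {a b : ℝ → E3 → ℝ}

lemma smooth (h : JointSmooth J a) {t : ℝ} (ht : t ∈ J) : ContDiff ℝ ∞ (a t) := by
  rw [← contDiffOn_univ]
  exact ContDiffOn.comp (g := fun q : ℝ × E3 => a q.1 q.2) (f := fun x => (t, x)) h
    (by fun_prop) fun x _ => ⟨ht, trivial⟩

lemma continuousOn_time (h : JointSmooth J a) (x : E3) : ContinuousOn (fun t => a t x) J :=
  h.continuousOn.comp (f := fun t => (t, x)) (by fun_prop) fun _ ht => ⟨ht, trivial⟩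

lemma hasFDerivWithinAt (h : JointSmooth J a) {t : ℝ} (ht : t ∈ J) (x : E3) :
    HasFDerivWithinAt (fun q : ℝ × E3 => a q.1 q.2)
      (fderivWithin ℝ (fun q : ℝ × E3 => a q.1 q.2) (J ×ˢ univ) (t, x)) (J ×ˢ univ) (t, x) :=
  (h.differentiableOn (by simp) (t, x) ⟨ht, trivial⟩).hasFDerivWithinAt

lemma pd_eq (h : JointSmooth J a) {t : ℝ} (ht : t ∈ J) (i : Fin 3) (x : E3) : HBS.pd i (a t) x =
    fderivWithin ℝ (fun q : ℝ × E3 => a q.1 q.2) (J ×ˢ univ) (t, x) (0, bv i) := by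
  have h1 : HasFDerivWithinAt (fun y : E3 => (t, y)) (ContinuousLinearMap.inr ℝ ℝ E3) univ x :=
    (hasFDerivAt_prodMk_right t x).hasFDerivWithinAt
  have h2 := (h.hasFDerivWithinAt ht x).comp x h1 fun y _ => ⟨ht, trivial⟩
  rw [hasFDerivWithinAt_univ] at h2
  exact (pd_eq_of_hasFDerivAt h2 i).trans (by simp)

lemma pd (hJ : UniqueDiffOn ℝ J) (h : JointSmooth J a) (i : Fin 3) :
    JointSmooth J (fun t => HBS.pd i (a t)) := by
  have h1 := h.fderivWithin (m := ∞) (hJ.prod uniqueDiffOn_univ) (by simp)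
  exact (h1.clm_apply contDiffOn_const).congr fun q hq => h.pd_eq hq.1 i q.2

lemma hasDerivWithinAt (h : JointSmooth J a) {t : ℝ} (ht : t ∈ J) (x : E3) :
    HasDerivWithinAt (fun s => a s x) (dtW J a t x) J t := by
  have h1 : HasFDerivWithinAt (fun s : ℝ => (s, x)) (ContinuousLinearMap.inl ℝ ℝ E3) J t :=
    (hasFDerivAt_prodMk_left t x).hasFDerivWithinAt
  have h2 := (h.hasFDerivWithinAt ht x).comp t h1
    (show MapsTo (fun s : ℝ => (s, x)) J (J ×ˢ univ) from fun y hy => ⟨hy, trivial⟩)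
  exact h2.differentiableWithinAt.hasDerivWithinAt

lemma dt (hJ : UniqueDiffOn ℝ J) (h : JointSmooth J a) : JointSmooth J (dtW J a) := by
  have h1 := h.fderivWithin (m := ∞) (hJ.prod uniqueDiffOn_univ) (by simp)
  refine (h1.clm_apply (contDiffOn_const (c := ((1 : ℝ), (0 : E3))))).congr fun q hq => ?_
  have h1 : HasFDerivWithinAt (fun s : ℝ => (s, q.2)) (ContinuousLinearMap.inl ℝ ℝ E3) J q.1 :=
    (hasFDerivAt_prodMk_left q.1 q.2).hasFDerivWithinAt
  have h2 := (h.hasFDerivWithinAt hq.1 q.2).comp q.1 h1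
    (show MapsTo (fun s : ℝ => (s, q.2)) J (J ×ˢ univ) from fun y hy => ⟨hy, trivial⟩)
  have h3 := h2.hasDerivWithinAt.derivWithin (hJ q.1 hq.1)
  exact h3.trans (by simp)

lemma add (ha : JointSmooth J a) (hb : JointSmooth J b) :
    JointSmooth J (fun t x => a t x + b t x) := ContDiffOn.add ha hb

lemma sub (ha : JointSmooth J a) (hb : JointSmooth J b) :
    JointSmooth J (fun t x => a t x - b t x) := ContDiffOn.sub ha hb

lemma mul (ha : JointSmooth J a) (hb : JointSmooth J b) :
    JointSmooth J (fun t x => a t x * b t x) := ContDiffOn.mul ha hb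

lemma const_mul (ha : JointSmooth J a) (c : ℝ) :
    JointSmooth J (fun t x => c * a t x) := contDiffOn_const.mul ha

lemma zero : JointSmooth J (fun _ _ => 0) := contDiffOn_const

lemma lapH (hJ : UniqueDiffOn ℝ J) (ha : JointSmooth J a) :
    JointSmooth J (fun t => HBS.lapH (a t)) :=
  ((ha.pd hJ 0).pd hJ 0).add ((ha.pd hJ 1).pd hJ 1)

lemma mono {J' : Set ℝ} (ha : JointSmooth J a) (h : J' ⊆ J) : JointSmooth J' a :=
  ContDiffOn.mono ha (prod_mono_left h)

lemma congr (ha : JointSmooth J a) (h : ∀ t ∈ J, ∀ x, b t x = a t x) : JointSmooth J b :=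
  ContDiffOn.congr ha fun q hq => h q.1 hq.1 q.2

end JointSmooth

/-! ### Time derivatives of integrals over `ℝ³` -/

lemma aestronglyMeasurable_prod {J : Set ℝ} (hJ : MeasurableSet J) {a : ℝ → E3 → ℝ}
    (h : ContinuousOn (fun q : ℝ × E3 => a q.1 q.2) (J ×ˢ univ)) :
    AEStronglyMeasurable (fun q : ℝ × E3 => a q.1 q.2)
      ((volume.restrict J).prod (volume : Measure E3)) := by
  have h1 := h.aestronglyMeasurable (μ := (volume : Measure ℝ).prod (volume : Measure E3))
    (hJ.prod MeasurableSet.univ)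
  rwa [← Measure.prod_restrict, Measure.restrict_univ] at h1

/-- `a'` is the time derivative of the family `a` on `J`, at almost every point. -/
structure HasTimeDeriv (J : Set ℝ) (a a' : ℝ → E3 → ℝ) : Prop where
  deriv : ∀ᵐ x : E3, ∀ t ∈ J, HasDerivWithinAt (fun s => a s x) (a' t x) J t
  cont : ∀ᵐ x : E3, ContinuousOn (fun t => a' t x) J
  meas : AEStronglyMeasurable (fun q : ℝ × E3 => a q.1 q.2)
      ((volume.restrict J).prod (volume : Measure E3))
  meas' : AEStronglyMeasurable (fun q : ℝ × E3 => a' q.1 q.2)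
      ((volume.restrict J).prod (volume : Measure E3))

lemma JointSmooth.hasTimeDeriv {J : Set ℝ} {a a' : ℝ → E3 → ℝ} (hJ : UniqueDiffOn ℝ J)
    (hm : MeasurableSet J) (h : JointSmooth J a) (ha' : ∀ t ∈ J, ∀ x, dtW J a t x = a' t x) :
    HasTimeDeriv J a a' := by
  have h2 : JointSmooth J a' := (h.dt hJ).congr fun t ht x => (ha' t ht x).symm
  exact ⟨Filter.Eventually.of_forall fun x t ht => ha' t ht x ▸ h.hasDerivWithinAt ht x,
    Filter.Eventually.of_forall fun x => h2.continuousOn_time x,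
    aestronglyMeasurable_prod hm h.continuousOn, aestronglyMeasurable_prod hm h2.continuousOn⟩

namespace HasTimeDeriv
variable {J : Set ℝ} {a a' b b' : ℝ → E3 → ℝ}

lemma mul (ha : HasTimeDeriv J a a') (hb : HasTimeDeriv J b b') :
    HasTimeDeriv J (fun t x => a t x * b t x) (fun t x => a' t x * b t x + a t x * b' t x) where
  deriv := by
    filter_upwards [ha.deriv, hb.deriv] with x h1 h2 t ht
    exact (h1 t ht).fun_mul (h2 t ht)
  cont := by
    filter_upwards [ha.deriv, hb.deriv, ha.cont, hb.cont] with x h1 h2 h3 h4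
    exact (h3.mul fun t ht => (h2 t ht).continuousWithinAt).add
      (ContinuousOn.mul (fun t ht => (h1 t ht).continuousWithinAt) h4)
  meas := ha.meas.mul hb.meas
  meas' := (ha.meas'.mul hb.meas).add (ha.meas.mul hb.meas')

lemma mul_fixed (ha : HasTimeDeriv J a a') {k : E3 → ℝ} (hk : Measurable k) :
    HasTimeDeriv J (fun t x => a t x * k x) (fun t x => a' t x * k x) where
  deriv := by
    filter_upwards [ha.deriv] with x h1 t ht
    exact (h1 t ht).mul_const _
  cont := by
    filter_upwards [ha.cont] with x h1
    exact h1.mul continuousOn_const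
  meas := ha.meas.mul (hk.comp measurable_snd).aestronglyMeasurable
  meas' := ha.meas'.mul (hk.comp measurable_snd).aestronglyMeasurable

lemma mono {J' : Set ℝ} (ha : HasTimeDeriv J a a') (h : J' ⊆ J) : HasTimeDeriv J' a a' where
  deriv := ha.deriv.mono fun _ hx t ht => (hx t (h ht)).mono h
  cont := ha.cont.mono fun _ hx => hx.mono h
  meas := ha.meas.mono_measure (Measure.prod_mono (Measure.restrict_mono h le_rfl) le_rfl)
  meas' := ha.meas'.mono_measure (Measure.prod_mono (Measure.restrict_mono h le_rfl) le_rfl)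

/-- The fundamental theorem of calculus for the integral over `ℝ³` of a family. -/
lemma integral_sub {s t : ℝ} (hst : s ≤ t) (h : HasTimeDeriv (Icc s t) a a')
    (hs : Integrable (a s)) (ht : Integrable (a t)) {B : ℝ}
    (hb : ∀ τ ∈ Icc s t, Integrable (a' τ) ∧ ∫ x, |a' τ x| ≤ B) :
    IntervalIntegrable (fun τ => ∫ x, a' τ x) volume s t ∧
      (∫ x, a t x) - ∫ x, a s x = ∫ τ in s..t, ∫ x, a' τ x := by
  have hint : Integrable (fun q : ℝ × E3 => a' q.1 q.2)
      ((volume.restrict (Icc s t)).prod (volume : Measure E3)) := by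
    rw [integrable_prod_iff h.meas']
    refine ⟨(ae_restrict_iff' measurableSet_Icc).2 (Filter.Eventually.of_forall fun τ hτ =>
      (hb τ hτ).1), ?_⟩
    refine Integrable.of_bound h.meas'.norm.integral_prod_right' B ?_
    refine (ae_restrict_iff' measurableSet_Icc).2 (Filter.Eventually.of_forall fun τ hτ => ?_)
    rw [Real.norm_of_nonneg (integral_nonneg fun _ => norm_nonneg _)]
    exact (hb τ hτ).2
  constructor
  · rw [intervalIntegrable_iff_integrableOn_Icc_of_le hst]
    exact hint.integral_prod_left
  · rw [← MeasureTheory.integral_sub ht hs, intervalIntegral.integral_of_le hst,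
      ← integral_Icc_eq_integral_Ioc, integral_integral_swap hint]
    refine integral_congr_ae ?_
    filter_upwards [h.deriv, h.cont] with x h1 h2
    rw [integral_Icc_eq_integral_Ioc, ← intervalIntegral.integral_of_le hst]
    refine (intervalIntegral.integral_eq_sub_of_hasDeriv_right_of_le hst
      (fun τ hτ => (h1 τ hτ).continuousWithinAt) (fun τ hτ => ?_)
      (h2.intervalIntegrable_of_Icc hst)).symm
    exact (((h1 τ (Ioo_subset_Icc_self hτ)).hasDerivAt (Icc_mem_nhds hτ.1 hτ.2))).hasDerivWithinAt

lemma integral_mul_sub {s t : ℝ} (hst : s ≤ t) (h : HasTimeDeriv (Icc s t) a a')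
    {B : ℝ} (hb : ∀ τ ∈ Icc s t, MemLp (a' τ) 2 volume ∧ nsq (a' τ) ≤ B)
    (ha : ∀ τ ∈ Icc s t, MemLp (a τ) 2 volume) {k : E3 → ℝ} (hk : Measurable k)
    (hk2 : MemLp k 2 volume) :
    (∫ x, a t x * k x) - ∫ x, a s x * k x = ∫ τ in s..t, ∫ x, a' τ x * k x := by
  have h1 : ∀ τ ∈ Icc s t, Integrable (fun x => a' τ x * k x) ∧
      ∫ x, |a' τ x * k x| ≤ Real.sqrt B * Real.sqrt (nsq k) := fun τ hτ => by
    refine ⟨(hb τ hτ).1.integrable_mul hk2, ?_⟩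
    simp only [abs_mul]
    exact (abs_integral_mul_le (hb τ hτ).1 hk2).trans
      (mul_le_mul_of_nonneg_right (Real.sqrt_le_sqrt (hb τ hτ).2) (Real.sqrt_nonneg _))
  exact (integral_sub hst (h.mul_fixed hk) ((ha s (left_mem_Icc.2 hst)).integrable_mul hk2)
    ((ha t (right_mem_Icc.2 hst)).integrable_mul hk2) h1).2

/-- A family with time derivative bounded in `L²` is Lipschitz in `L²`. -/
lemma nsq_sub_le {s t : ℝ} (hst : s ≤ t) (h : HasTimeDeriv (Icc s t) a a')
    {B : ℝ} (hb : ∀ τ ∈ Icc s t, MemLp (a' τ) 2 volume ∧ nsq (a' τ) ≤ B)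
    (ha : ∀ τ ∈ Icc s t, MemLp (a τ) 2 volume) (hm : ∀ τ ∈ Icc s t, Measurable (a τ)) :
    nsq (fun x => a t x - a s x) ≤ B * (t - s) ^ 2 := by
  have hs := left_mem_Icc.2 hst
  have ht := right_mem_Icc.2 hst
  set k : E3 → ℝ := fun x => a t x - a s x with hk
  have hk2 : MemLp k 2 volume := (ha t ht).sub (ha s hs)
  -- The increment is its own test function. Its squared norm is then bounded by `√B (t - s)` times
  -- its norm, and one factor cancels.
  have h1 := h.integral_mul_sub hst hb ha (show Measurable k from (hm t ht).sub (hm s hs)) hk2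
  have h2 : nsq k = ∫ τ in s..t, ∫ x, a' τ x * k x := by
    have i1 : Integrable fun x => a t x * k x := (ha t ht).integrable_mul hk2
    have i2 : Integrable fun x => a s x * k x := (ha s hs).integrable_mul hk2
    rw [← h1, ← MeasureTheory.integral_sub i1 i2, nsq]
    congr 1
    funext x
    simp only [hk]; ring
  have h3 : |∫ τ in s..t, ∫ x, a' τ x * k x| ≤ Real.sqrt B * Real.sqrt (nsq k) * |t - s| := by
    rw [← Real.norm_eq_abs]
    refine intervalIntegral.norm_integral_le_of_norm_le_const fun τ hτ => ?_
    rw [uIoc_of_le hst] at hτ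
    have hτ' := Ioc_subset_Icc_self hτ
    refine (norm_integral_le_integral_norm _).trans ?_
    simp only [Real.norm_eq_abs, abs_mul]
    exact (abs_integral_mul_le (hb τ hτ').1 hk2).trans
      (mul_le_mul_of_nonneg_right (Real.sqrt_le_sqrt (hb τ hτ').2) (Real.sqrt_nonneg _))
  have hB : 0 ≤ B := (nsq_nonneg _).trans (hb s hs).2
  rw [← h2, abs_of_nonneg (nsq_nonneg _), abs_of_nonneg (sub_nonneg.2 hst)] at h3
  have h4 : Real.sqrt (nsq k) ^ 2 = nsq k := Real.sq_sqrt (nsq_nonneg _)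
  have h5 : Real.sqrt B ^ 2 = B := Real.sq_sqrt hB
  have h6 : Real.sqrt (nsq k) ≤ Real.sqrt B * (t - s) := by
    rcases (Real.sqrt_nonneg (nsq k)).eq_or_lt with h0 | h0
    · rw [← h0]; exact mul_nonneg (Real.sqrt_nonneg _) (sub_nonneg.2 hst)
    · refine le_of_mul_le_mul_right ?_ h0
      nlinarith
  calc nsq k = Real.sqrt (nsq k) ^ 2 := h4.symm
    _ ≤ (Real.sqrt B * (t - s)) ^ 2 := pow_le_pow_left₀ (Real.sqrt_nonneg _) h6 2
    _ = _ := by rw [mul_pow, h5]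

/-- The energy identity. -/
lemma nsq_sub_eq {s t : ℝ} (hst : s ≤ t) (h : HasTimeDeriv (Icc s t) a a')
    {A B : ℝ} (hb : ∀ τ ∈ Icc s t, MemLp (a' τ) 2 volume ∧ nsq (a' τ) ≤ B)
    (ha : ∀ τ ∈ Icc s t, MemLp (a τ) 2 volume ∧ nsq (a τ) ≤ A) :
    IntervalIntegrable (fun τ => 2 * ∫ x, a τ x * a' τ x) volume s t ∧
      nsq (a t) - nsq (a s) = ∫ τ in s..t, 2 * ∫ x, a τ x * a' τ x := by
  have e : ∀ τ, (∫ x, (a' τ x * a τ x + a τ x * a' τ x)) = 2 * ∫ x, a τ x * a' τ x := fun τ => by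
    rw [← integral_const_mul]
    congr 1
    funext x
    ring
  have h1 : ∀ τ ∈ Icc s t, Integrable (fun x => a' τ x * a τ x + a τ x * a' τ x) ∧
      ∫ x, |a' τ x * a τ x + a τ x * a' τ x| ≤ 2 * (Real.sqrt A * Real.sqrt B) := fun τ hτ => by
    have i1 := (hb τ hτ).1.integrable_mul (ha τ hτ).1
    have i2 := (ha τ hτ).1.integrable_mul (hb τ hτ).1
    refine ⟨i1.add i2, ?_⟩
    have e2 : ∀ x, |a' τ x * a τ x + a τ x * a' τ x| = 2 * (|a τ x| * |a' τ x|) := fun x => by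
      rw [← abs_mul, mul_comm (a' τ x), ← two_mul, abs_mul, abs_two]
    simp only [e2]
    rw [integral_const_mul]
    refine mul_le_mul_of_nonneg_left ((abs_integral_mul_le (ha τ hτ).1 (hb τ hτ).1).trans ?_)
      (by norm_num)
    exact mul_le_mul (Real.sqrt_le_sqrt (ha τ hτ).2) (Real.sqrt_le_sqrt (hb τ hτ).2)
      (Real.sqrt_nonneg _) (Real.sqrt_nonneg _)
  have hs := left_mem_Icc.2 hst
  have ht := right_mem_Icc.2 hst
  have h2 := (h.mul h).integral_sub hst ((ha s hs).1.integrable_mul (ha s hs).1)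
    ((ha t ht).1.integrable_mul (ha t ht).1) h1
  simp only [e] at h2
  refine ⟨h2.1, ?_⟩
  rw [← h2.2]
  simp only [nsq, sq]

end HasTimeDeriv

/-- Only `a` itself is Lipschitz in `L²`. An integration by parts writes the difference of the
squared norms of `pd i (a t)` and `pd i (a s)` as minus the integral of `a t - a s` against a sum of
second derivatives, which are bounded. -/
lemma nsq_lipschitz_pd {J : Set ℝ} {a : ℝ → E3 → ℝ} (h : SobFam J a) {L : ℝ}
    (hL : ∀ s ∈ J, ∀ t ∈ J, s ≤ t → nsq (fun x => a t x - a s x) ≤ L * (t - s) ^ 2) (i : Fin 3) :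
    ContinuousOn (fun t => nsq (pd i (a t))) J ∧ ContinuousOn (fun t => nsq (a t)) J := by
  have key : ∀ (b : ℝ → E3 → ℝ), SobFam J b → ∀ K : ℝ, (∀ s ∈ J, ∀ t ∈ J, s ≤ t →
      |nsq (b t) - nsq (b s)| ≤ K * (t - s)) → ContinuousOn (fun t => nsq (b t)) J := by
    intro b _ K hK
    have h1 : LipschitzOnWith (Real.toNNReal K) (fun t => nsq (b t)) J := by
      refine LipschitzOnWith.of_dist_le_mul fun s hs t ht => ?_
      wlog hst : s ≤ t generalizing s t
      · rw [dist_comm, dist_comm s]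
        exact this t ht s hs (le_of_not_ge hst)
      rw [dist_comm, dist_comm s, Real.dist_eq, Real.dist_eq, abs_of_nonneg (sub_nonneg.2 hst)]
      exact (hK s hs t ht hst).trans
        (mul_le_mul_of_nonneg_right (Real.le_coe_toNNReal K) (sub_nonneg.2 hst))
    exact h1.continuousOn
  obtain ⟨B1, hB1, h1⟩ := (h.exists_nsq_le)
  obtain ⟨B2, hB2, h2⟩ := ((h.pd i).pd i).exists_nsq_le
  have hsq : ∀ s ∈ J, ∀ t ∈ J, s ≤ t →
      Real.sqrt (nsq (fun x => a t x - a s x)) ≤ Real.sqrt L * (t - s) := by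
    intro s hs t ht hst
    refine (Real.sqrt_le_sqrt (hL s hs t ht hst)).trans (le_of_eq ?_)
    rw [Real.sqrt_mul' _ (sq_nonneg _), Real.sqrt_sq (sub_nonneg.2 hst)]
  have bd : ∀ f g w : E3 → ℝ, Sob f → Sob g → Sob w → ∀ K, nsq f ≤ K → nsq g ≤ K →
      ∀ m, Real.sqrt (nsq w) ≤ m → |∫ x, w x * (f x + g x)| ≤ 2 * Real.sqrt K * m := by
    intro f g w hf hg hw K hfK hgK m hm
    have i1 := hw.integrable_mul hf
    have i2 := hw.integrable_mul hg
    have i3 : Integrable fun x => |w x| * |f x| := by simpa [abs_mul] using i1.abs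
    have i4 : Integrable fun x => |w x| * |g x| := by simpa [abs_mul] using i2.abs
    have h5 : |∫ x, w x * (f x + g x)| ≤ ∫ x, (|w x| * |f x| + |w x| * |g x|) := by
      refine abs_integral_le_integral_abs.trans (integral_mono ?_ (i3.add i4) fun x => ?_)
      · exact (i1.add i2).abs.congr (Filter.Eventually.of_forall fun x => by simp [mul_add])
      · simp only [abs_mul, ← mul_add]
        exact mul_le_mul_of_nonneg_left (abs_add_le _ _) (abs_nonneg _)
    rw [integral_add i3 i4] at h5
    have h6 := abs_integral_mul_le hw.memLp hf.memLp
    have h7 := abs_integral_mul_le hw.memLp hg.memLp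
    have h8 := mul_le_mul hm (Real.sqrt_le_sqrt hfK) (Real.sqrt_nonneg _)
      ((Real.sqrt_nonneg _).trans hm)
    have h9 := mul_le_mul hm (Real.sqrt_le_sqrt hgK) (Real.sqrt_nonneg _)
      ((Real.sqrt_nonneg _).trans hm)
    linarith
  constructor
  · refine key _ (h.pd i) (2 * Real.sqrt B2 * Real.sqrt L) fun s hs t ht hst => ?_
    have hs1 := h.sob hs
    have ht1 := h.sob ht
    have hw := ht1.sub hs1
    have hv := (ht1.pd i).add (hs1.pd i)
    have e1 : nsq (pd i (a t)) - nsq (pd i (a s)) =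
        - ∫ x, (a t x - a s x) * (pd i (pd i (a t)) x + pd i (pd i (a s)) x) := by
      have e2 := hw.integral_mul_pd hv i
      have e3 : ∀ x, pd i (fun x => pd i (a t) x + pd i (a s) x) x =
          pd i (pd i (a t)) x + pd i (pd i (a s)) x := fun x =>
        pd_add i ((ht1.pd i).differentiableAt x) ((hs1.pd i).differentiableAt x)
      have e4 : ∀ x, pd i (fun x => a t x - a s x) x = pd i (a t) x - pd i (a s) x := fun x =>
        pd_sub i (ht1.differentiableAt x) (hs1.differentiableAt x)
      simp only [e3, e4] at e2
      rw [e2, neg_neg, nsq, nsq, ← integral_sub (ht1.pd i).integrable_sq (hs1.pd i).integrable_sq]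
      congr 1
      funext x
      ring
    rw [e1, abs_neg, mul_assoc]
    have := bd _ _ _ ((ht1.pd i).pd i) ((hs1.pd i).pd i) hw B2 (h2 t ht) (h2 s hs) _
      (hsq s hs t ht hst)
    linarith
  · refine key _ h (2 * Real.sqrt B1 * Real.sqrt L) fun s hs t ht hst => ?_
    have hs1 := h.sob hs
    have ht1 := h.sob ht
    have e1 : nsq (a t) - nsq (a s) = ∫ x, (a t x - a s x) * (a t x + a s x) := by
      rw [nsq, nsq, ← integral_sub ht1.integrable_sq hs1.integrable_sq]
      congr 1
      funext x
      ring
    rw [e1, mul_assoc]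
    have := bd _ _ _ ht1 hs1 (ht1.sub hs1) B1 (h1 t ht) (h1 s hs) _ (hsq s hs t ht hst)
    linarith

end HBS

namespace HBS

/-! ### Orthogonality of gradients and divergence-free fields -/

lemma integrable_mul_of_memLp {f g : E3 → ℝ} (hf : MemLp f 2 volume) (hg : MemLp g 2 volume) :
    Integrable fun x => f x * g x := hf.integrable_mul hg

/-- After approximation by compactly supported functions, a translation longer than the sum of the
radii makes the supports disjoint. -/
lemma exists_abs_integral_shift_mul_le {f g : E3 → ℝ} (hf : MemLp f 2 volume)
    (hg : MemLp g 2 volume) {ε : ℝ} (hε : 0 < ε) :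
    ∃ Λ : ℝ, ∀ c : ℝ, Λ ≤ c → |∫ x, f (x + c • bv 0) * g x| ≤ ε := by
  have approx : ∀ {f : E3 → ℝ}, MemLp f 2 volume → ∀ {ε : ℝ}, 0 < ε → ∃ f' : E3 → ℝ,
      HasCompactSupport f' ∧ MemLp f' 2 volume ∧ Real.sqrt (nsq (fun x => f x - f' x)) ≤ ε := by
    intro f hf ε hε
    obtain ⟨f', h1, h2, -, h3⟩ := hf.exists_hasCompactSupport_eLpNorm_sub_le (by norm_num)
      (ε := (Real.toNNReal ε : ℝ≥0∞)) (by simpa using hε)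
    refine ⟨f', h1, h3, ?_⟩
    have h4 := nsq_le_of_eLpNorm_le (hf.sub h3) h2
    rw [Real.coe_toNNReal _ hε.le] at h4
    exact (Real.sqrt_le_sqrt h4).trans (by rw [Real.sqrt_sq hε.le])
  -- The order matters: the precision for `g` depends on the norm of the approximation `f'`. The `1
  -- +` guards against a vanishing norm.
  obtain ⟨f', hf1, hf2, hf3⟩ := approx hf (ε := ε / 2 / (1 + Real.sqrt (nsq g)))
    (by have := Real.sqrt_nonneg (nsq g); positivity)
  obtain ⟨g', hg1, hg2, hg3⟩ := approx hg (ε := ε / 2 / (1 + Real.sqrt (nsq f')))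
    (by have := Real.sqrt_nonneg (nsq f'); positivity)
  obtain ⟨R, hR⟩ := hf1.isCompact.isBounded.subset_closedBall 0
  obtain ⟨R', hR'⟩ := hg1.isCompact.isBounded.subset_closedBall 0
  refine ⟨|R| + |R'| + 1, fun c hc => ?_⟩
  have shiftL : ∀ {h : E3 → ℝ}, MemLp h 2 volume → MemLp (fun x => h (x + c • bv 0)) 2 volume :=
    fun hh => hh.comp_measurePreserving (measurePreserving_add_right volume _)
  have shiftN : ∀ h : E3 → ℝ, nsq (fun x => h (x + c • bv 0)) = nsq h := fun h =>
    integral_add_right_eq_self (fun x => h x ^ 2) (c • bv 0)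
  have hzero : ∀ x, f' (x + c • bv 0) * g' x = 0 := by
    intro x
    by_contra hne
    have h1 := mem_closedBall_zero_iff.1 (hR (subset_tsupport _ (left_ne_zero_of_mul hne)))
    have h2 := mem_closedBall_zero_iff.1 (hR' (subset_tsupport _ (right_ne_zero_of_mul hne)))
    have h3 : ‖c • bv 0‖ ≤ ‖x + c • bv 0‖ + ‖x‖ := by
      have := norm_sub_le (x + c • bv 0) x
      rwa [add_sub_cancel_left] at this
    have h4 : ‖c • bv 0‖ = |c| := by simp [norm_smul]
    have := le_abs_self c
    have := le_abs_self R
    have := le_abs_self R'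
    linarith
  have i1 : Integrable fun x => |f (x + c • bv 0) - f' (x + c • bv 0)| * |g x| := by
    simpa [abs_mul] using ((shiftL (hf.sub hf2)).integrable_mul hg).abs
  have i2 : Integrable fun x => |f' (x + c • bv 0)| * |g x - g' x| := by
    simpa [abs_mul] using ((shiftL hf2).integrable_mul (hg.sub hg2)).abs
  have h1 : |∫ x, f (x + c • bv 0) * g x| ≤ ∫ x, (|f (x + c • bv 0) - f' (x + c • bv 0)| * |g x| +
      |f' (x + c • bv 0)| * |g x - g' x|) := by
    refine abs_integral_le_integral_abs.trans
      (integral_mono ((shiftL hf).integrable_mul hg).abs (i1.add i2) fun x => ?_)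
    simp only [← abs_mul]
    refine le_trans (le_of_eq ?_) (abs_add_le _ _)
    congr 1
    linear_combination hzero x
  rw [integral_add i1 i2] at h1
  have h2 := abs_integral_mul_le (shiftL (hf.sub hf2)) hg
  have h3 := abs_integral_mul_le (shiftL hf2) (hg.sub hg2)
  rw [shiftN] at h2 h3
  have b1 : Real.sqrt (nsq (fun x => f x - f' x)) * Real.sqrt (nsq g) ≤ ε / 2 := by
    have h0 := Real.sqrt_nonneg (nsq g)
    refine (mul_le_mul_of_nonneg_right hf3 h0).trans ?_
    rw [div_mul_eq_mul_div, div_le_iff₀ (by positivity)]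
    nlinarith
  have b2 : Real.sqrt (nsq f') * Real.sqrt (nsq (fun x => g x - g' x)) ≤ ε / 2 := by
    have h0 := Real.sqrt_nonneg (nsq f')
    refine (mul_le_mul_of_nonneg_left hg3 h0).trans ?_
    rw [mul_div_assoc', div_le_iff₀ (by positivity)]
    nlinarith
  have h2' : ∫ x, |f (x + c • bv 0) - f' (x + c • bv 0)| * |g x| ≤
      Real.sqrt (nsq (fun x => f x - f' x)) * Real.sqrt (nsq g) := h2
  have h3' : ∫ x, |f' (x + c • bv 0)| * |g x - g' x| ≤
      Real.sqrt (nsq f') * Real.sqrt (nsq (fun x => g x - g' x)) := h3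
  linarith

/-- Cauchy-Schwarz in time, then Tonelli. Lower integrals are used because square integrability of
the time integral is itself to be deduced. -/
lemma lintegral_sq_integral_le {b : ℝ → E3 → ℝ} {s t : ℝ} (hst : s ≤ t)
    (hb : ContinuousOn (fun q : ℝ × E3 => b q.1 q.2) (Icc s t ×ˢ univ)) {B : ℝ≥0}
    (hB : ∀ τ ∈ Icc s t, eLpNorm (b τ) 2 volume ≤ B) :
    ∫⁻ x, ‖∫ τ in s..t, b τ x‖ₑ ^ 2 ≤ (ENNReal.ofReal (t - s) * B) ^ 2 := by
  have hm := (aestronglyMeasurable_prod measurableSet_Icc hb).prod_swap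
  have hm2 : AEMeasurable (fun q : E3 × ℝ => ‖b q.2 q.1‖ₑ ^ 2)
      ((volume : Measure E3).prod (volume.restrict (Icc s t))) := hm.enorm.pow_const 2
  have h1 : ∀ x : E3, ‖∫ τ in s..t, b τ x‖ₑ ^ 2 ≤
      ENNReal.ofReal (t - s) * ∫⁻ τ in Icc s t, ‖b τ x‖ₑ ^ 2 := by
    intro x
    rw [intervalIntegral.integral_of_le hst, ← integral_Icc_eq_integral_Ioc]
    have hc : ContinuousOn (fun τ => b τ x) (Icc s t) :=
      hb.comp (f := fun τ => (τ, x)) (by fun_prop) fun τ hτ => ⟨hτ, trivial⟩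
    have h2 := lintegral_mul_sq_le (volume.restrict (Icc s t)) (f := fun _ => 1)
      (g := fun τ => ‖b τ x‖ₑ) aemeasurable_const (hc.aestronglyMeasurable measurableSet_Icc).enorm
    simp only [one_mul, one_pow, lintegral_const, Measure.restrict_apply MeasurableSet.univ,
      univ_inter, Real.volume_Icc] at h2
    exact (pow_le_pow_left' (enorm_integral_le_lintegral_enorm _) 2).trans h2
  refine (lintegral_mono h1).trans ?_
  rw [lintegral_const_mul' _ _ (by simp), lintegral_lintegral_swap hm2, mul_pow, sq, mul_assoc]
  refine mul_le_mul_right ?_ _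
  calc ∫⁻ τ in Icc s t, ∫⁻ x, ‖b τ x‖ₑ ^ 2 ≤ ∫⁻ _τ in Icc s t, (B : ℝ≥0∞) ^ 2 := by
        refine setLIntegral_mono' measurableSet_Icc fun τ hτ => ?_
        rw [lintegral_sq_enorm]
        exact pow_le_pow_left' (hB τ hτ) 2
    _ = _ := by
        rw [lintegral_const, Measure.restrict_apply MeasurableSet.univ, univ_inter, Real.volume_Icc]
        ring

lemma memLp_two_of_lintegral {f : E3 → ℝ} (hf : AEStronglyMeasurable f) {K : ℝ≥0∞} (hK : K ≠ ⊤)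
    (h : ∫⁻ x, ‖f x‖ₑ ^ 2 ≤ K) : MemLp f 2 volume := by
  refine ⟨hf, ?_⟩
  rw [lintegral_sq_enorm] at h
  by_contra hne
  rw [not_lt, top_le_iff] at hne
  rw [hne] at h
  exact hK (top_le_iff.1 (by simpa using h))

/-- The potential `Q` of `G` need not be square integrable. Its increment `Q (x + c e₀) - Q x` is,
being the integral of `G 0` along a segment of length `c`. Integrating this increment by parts
against the divergence-free `v` shows that `∫ G · v` does not change when `G` is translated by `c
e₀`. As `c` grows, the translated integral tends to zero. -/
lemma integral_curlFree_mul_divFree {G v : Fin 3 → E3 → ℝ} (hG : ∀ i, Differentiable ℝ (G i))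
    (hsymm : ∀ i j x, pd i (G j) x = pd j (G i) x) (hG2 : ∀ i, MemLp (G i) 2 volume)
    (hv : ∀ i, Sob (v i)) (hdiv : ∀ x, ∑ i, pd i (v i) x = 0) :
    ∑ i, ∫ x, G i x * v i x = 0 := by
  -- the potential
  obtain ⟨Q, hQ⟩ : ∃ Q : E3 → ℝ, ∀ x, HasFDerivAt Q
      (∑ i, G i x • (EuclideanSpace.proj i : E3 →L[ℝ] ℝ)) x := by
    have hF : ∀ x, HasFDerivAt (fun x => ∑ i, G i x • (EuclideanSpace.proj i : E3 →L[ℝ] ℝ))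
        (∑ i, (fderiv ℝ (G i) x).smulRight (EuclideanSpace.proj i : E3 →L[ℝ] ℝ)) x := fun x =>
      HasFDerivAt.fun_sum fun i _ =>
        (hG i x).hasFDerivAt.smul_const (EuclideanSpace.proj i : E3 →L[ℝ] ℝ)
    obtain ⟨Q, hQ⟩ := convex_univ.exists_forall_hasFDerivAt_of_fderiv_symmetric isOpen_univ
      (fun x _ => (hF x).differentiableAt.differentiableWithinAt) (fun a _ x y => by
        rw [(hF a).fderiv]
        have e : ∀ x y : E3, (∑ i, (fderiv ℝ (G i) a).smulRight
            (EuclideanSpace.proj i : E3 →L[ℝ] ℝ)) x y = ∑ i, fderiv ℝ (G i) a x * y i := by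
          intro x y
          simp
        rw [e, e]
        simp only [fderiv_apply_eq_sum, smul_eq_mul, Fin.sum_univ_three]
        rw [hsymm 0 1, hsymm 0 2, hsymm 1 2]
        ring)
    exact ⟨Q, fun x => hQ x trivial⟩
  have hQd : Differentiable ℝ Q := fun x => (hQ x).differentiableAt
  have hQp : ∀ i x, pd i Q x = G i x := by
    intro i x
    rw [pd_eq_of_hasFDerivAt (hQ x)]
    fin_cases i <;> simp [Fin.sum_univ_three]
  have key : ∀ c : ℝ, 0 ≤ c →
      ∑ i, ∫ x, G i (x + c • bv 0) * v i x = ∑ i, ∫ x, G i x * v i x := by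
    intro c hc
    set p : E3 → ℝ := fun x => Q (x + c • bv 0) - Q x with hp
    have hsd : Differentiable ℝ fun x => Q (x + c • bv 0) :=
      hQd.comp (differentiable_id.add_const _)
    have hpd : Differentiable ℝ p := hsd.sub hQd
    have hpp : ∀ i x, pd i p x = G i (x + c • bv 0) - G i x := by
      intro i x
      rw [hp, pd_sub i (hsd x) (hQd x), hQp]
      congr 1
      rw [pd, fderiv_comp_add_right]
      exact hQp i _
    have hp2 : MemLp p 2 volume := by
      obtain ⟨B, hB⟩ : ∃ B : ℝ≥0, (B : ℝ≥0∞) = eLpNorm (G 0) 2 volume :=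
        ⟨_, ENNReal.coe_toNNReal (hG2 0).2.ne⟩
      refine memLp_two_of_lintegral hpd.continuous.aestronglyMeasurable
        (K := (ENNReal.ofReal (c - 0) * B) ^ 2)
        (ENNReal.pow_ne_top (ENNReal.mul_ne_top (by simp) (by simp))) ?_
      have e : ∀ x, p x = ∫ τ in (0 : ℝ)..c, G 0 (x + τ • bv 0) := by
        intro x
        have hc : Continuous fun τ : ℝ => G 0 (x + τ • bv 0) :=
          (hG 0).continuous.comp (by fun_prop)
        rw [intervalIntegral.integral_eq_sub_of_hasDerivAt
          (fun τ _ => (hQp 0 (x + τ • bv 0)) ▸ hasDerivAt_line hQd 0 x τ)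
          (hc.intervalIntegrable _ _)]
        simp [hp]
      simp only [e]
      refine lintegral_sq_integral_le (b := fun τ x => G 0 (x + τ • bv 0)) hc
        ((hG 0).continuous.comp (by fun_prop)).continuousOn fun τ _ => ?_
      rw [hB]
      exact le_of_eq (eLpNorm_comp_measurePreserving (hG2 0).1
        (measurePreserving_add_right volume (τ • bv 0)))
    have hsh : ∀ i, MemLp (fun x => G i (x + c • bv 0)) 2 volume := fun i =>
      (hG2 i).comp_measurePreserving (measurePreserving_add_right volume _)
    have hpi : ∀ i, MemLp (pd i p) 2 volume := fun i => by
      have : pd i p = fun x => G i (x + c • bv 0) - G i x := funext (hpp i)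
      rw [this]
      exact (hsh i).sub (hG2 i)
    have ibp : ∀ i, ∫ x, p x * pd i (v i) x =
        - ((∫ x, G i (x + c • bv 0) * v i x) - ∫ x, G i x * v i x) := by
      intro i
      rw [integral_mul_pd_of_integrable i hpd (hv i).differentiable
        ((hpi i).integrable_mul (hv i).memLp) (hp2.integrable_mul ((hv i).pd i).memLp)
        (hp2.integrable_mul (hv i).memLp)]
      have i1 : Integrable fun x => G i (x + c • bv 0) * v i x := (hsh i).integrable_mul (hv i).memLp
      have i2 : Integrable fun x => G i x * v i x := (hG2 i).integrable_mul (hv i).memLp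
      rw [← integral_sub i1 i2]
      congr 2
      funext x
      rw [hpp]
      ring
    have h0 : ∑ i, ∫ x, p x * pd i (v i) x = 0 := by
      rw [← integral_finsetSum _ fun i _ => integrable_mul_of_memLp hp2 ((hv i).pd i).memLp]
      simp only [← Finset.mul_sum, hdiv, mul_zero, integral_zero]
    simp only [ibp, Finset.sum_neg_distrib, Finset.sum_sub_distrib] at h0
    linarith
  have hsmall : ∀ ε > 0, |∑ i, ∫ x, G i x * v i x| ≤ ε := by
    intro ε hε
    choose Λ hΛ using fun i => exists_abs_integral_shift_mul_le (hG2 i) (hv i).memLp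
      (ε := ε / 3) (by positivity)
    rw [← key (|Λ 0| + |Λ 1| + |Λ 2|) (by positivity), Fin.sum_univ_three]
    have h0 := hΛ 0 (|Λ 0| + |Λ 1| + |Λ 2|)
      (by linarith [le_abs_self (Λ 0), abs_nonneg (Λ 1), abs_nonneg (Λ 2)])
    have h1 := hΛ 1 (|Λ 0| + |Λ 1| + |Λ 2|)
      (by linarith [le_abs_self (Λ 1), abs_nonneg (Λ 0), abs_nonneg (Λ 2)])
    have h2 := hΛ 2 (|Λ 0| + |Λ 1| + |Λ 2|)
      (by linarith [le_abs_self (Λ 2), abs_nonneg (Λ 0), abs_nonneg (Λ 1)])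
    rw [abs_le] at *
    constructor <;> linarith [h0.1, h0.2, h1.1, h1.2, h2.1, h2.2]
  exact abs_eq_zero.1 (le_antisymm (le_of_forall_pos_le_add fun ε hε => by simpa using hsmall ε hε)
    (abs_nonneg _))

/-! ### Elimination of the pressure -/

/-- Difference quotients are bounded in `L²` and converge pointwise to the time derivative; Fatou's
lemma passes the bound to the limit. -/
lemma nsq_le_of_lipschitz {J : Set ℝ} (hJ : UniqueDiffOn ℝ J) {a : ℝ → E3 → ℝ}
    (ha : JointSmooth J a) (hs : SobFam J a) {C : ℝ} (hC0 : 0 ≤ C)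
    (hC : ∀ s ∈ J, ∀ t ∈ J, s ≤ t → nsq (fun x => a t x - a s x) ≤ C ^ 2 * (t - s) ^ 2)
    {t : ℝ} (ht : t ∈ J) : MemLp (dtW J a t) 2 volume ∧ nsq (dtW J a t) ≤ C ^ 2 := by
  -- Unique differentiability of `J` at `t` says that `t` is an accumulation point, so times
  -- different from `t` are available.
  have hne : (nhdsWithin t (J \ {t})).NeBot := by
    have h1 := uniqueDiffWithinAt_iff_accPt.1 (hJ t ht)
    rw [accPt_principal_iff_nhdsWithin] at h1
    exact h1
  obtain ⟨u, hu⟩ := Filter.exists_seq_tendsto (nhdsWithin t (J \ {t}))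
  have hu2 : ∀ᶠ n in Filter.atTop, u n ∈ J \ {t} := hu.eventually self_mem_nhdsWithin
  have hcd : Continuous (dtW J a t) := ((ha.dt hJ).smooth ht).continuous
  have hlim : ∀ x, Filter.Tendsto (fun n => (u n - t)⁻¹ • (a (u n) x - a t x)) Filter.atTop
      (nhds (dtW J a t x)) := fun x => by
    have h1 := hasDerivWithinAt_iff_tendsto_slope.1 (ha.hasDerivWithinAt ht x)
    exact h1.comp hu
  have hbd : eLpNorm (dtW J a t) 2 volume ≤ ENNReal.ofReal C := by
    -- discard the finitely many times outside `J`
    obtain ⟨N, hN⟩ := Filter.eventually_atTop.1 hu2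
    have hlim' : ∀ x, Filter.Tendsto (fun n => (u (n + N) - t)⁻¹ • (a (u (n + N)) x - a t x))
        Filter.atTop (nhds (dtW J a t x)) := fun x =>
      (hlim x).comp (Filter.tendsto_add_atTop_nat N)
    have hm : ∀ n, MemLp (fun x => a (u (n + N)) x - a t x) 2 volume := fun n =>
      (hs.memLp (hN (n + N) (by omega)).1).sub (hs.memLp ht)
    refine (Lp.eLpNorm_lim_le_liminf_eLpNorm
      (f := fun n x => (u (n + N) - t)⁻¹ • (a (u (n + N)) x - a t x))
      (fun n => ((hm n).const_smul (u (n + N) - t)⁻¹).1) _ (Filter.Eventually.of_forall hlim')).trans ?_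
    refine Filter.liminf_le_of_frequently_le' (Filter.Frequently.of_forall fun n => ?_)
    have hJn := hN (n + N) (by omega)
    have hne : u (n + N) - t ≠ 0 := sub_ne_zero.2 hJn.2
    have h1 : nsq (fun x => a (u (n + N)) x - a t x) ≤ C ^ 2 * (u (n + N) - t) ^ 2 := by
      rcases le_total t (u (n + N)) with h | h
      · exact hC t ht _ hJn.1 h
      · have := hC _ hJn.1 t ht h
        have e : nsq (fun x => a (u (n + N)) x - a t x) = nsq (fun x => a t x - a (u (n + N)) x) := by
          simp only [nsq]
          congr 1
          funext x
          ring
        rw [e]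
        nlinarith
    have h2 : eLpNorm (fun x => a (u (n + N)) x - a t x) 2 volume ≤
        ENNReal.ofReal (C * |u (n + N) - t|) := by
      refine (ENNReal.pow_le_pow_left_iff (n := 2) (by norm_num)).1 ?_
      rw [← ofReal_nsq (hm n), ← ENNReal.ofReal_pow (by positivity), mul_pow, sq_abs]
      exact ENNReal.ofReal_le_ofReal h1
    refine (eLpNorm_const_smul_le (c := (u (n + N) - t)⁻¹)).trans
      ((mul_le_mul_right h2 _).trans (le_of_eq ?_))
    rw [Real.enorm_eq_ofReal_abs, ← ENNReal.ofReal_mul (abs_nonneg _), abs_inv]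
    congr 1
    field_simp
  have hmem : MemLp (dtW J a t) 2 volume :=
    ⟨hcd.aestronglyMeasurable, hbd.trans_lt ENNReal.ofReal_lt_top⟩
  refine ⟨hmem, ?_⟩
  have := nsq_le_of_eLpNorm_le hmem (B := Real.toNNReal C) hbd
  rwa [Real.coe_toNNReal _ hC0] at this

/-- A divergence-free family `w` with `∂ₜw + ∇P = F` has time derivative in `L²`, and the pressure
does not contribute to its energy. -/
lemma exists_nsq_dt_le {T : ℝ} (hT : 0 < T) {w F : Fin 3 → ℝ → E3 → ℝ} {P : ℝ → E3 → ℝ}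
    (hw : ∀ i, SobFam (Icc 0 T) (w i)) (hwj : ∀ i, JointSmooth (Icc 0 T) (w i))
    (hF : ∀ i, SobFam (Icc 0 T) (F i)) (hFj : ∀ i, JointSmooth (Icc 0 T) (F i))
    (hP : ∀ t ∈ Icc 0 T, ContDiff ℝ ∞ (P t))
    (heq : ∀ t ∈ Icc 0 T, ∀ i x, dtW (Icc 0 T) (w i) t x + pd i (P t) x = F i t x)
    (hdiv : ∀ t ∈ Icc 0 T, ∀ x, ∑ i, pd i (w i t) x = 0) :
    (∃ C : ℝ, 0 ≤ C ∧
      (∀ i, ∀ s ∈ Icc 0 T, ∀ t ∈ Icc 0 T, s ≤ t →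
        nsq (fun x => w i t x - w i s x) ≤ C ^ 2 * (t - s) ^ 2) ∧
      ∀ i, ∀ t ∈ Icc 0 T, MemLp (dtW (Icc 0 T) (w i) t) 2 volume ∧
        nsq (dtW (Icc 0 T) (w i) t) ≤ C ^ 2) ∧
    ∀ t ∈ Icc 0 T, ∑ i, ∫ x, w i t x * dtW (Icc 0 T) (w i) t x = ∑ i, ∫ x, w i t x * F i t x := by
  have hJ : UniqueDiffOn ℝ (Icc 0 T) := uniqueDiffOn_Icc hT
  set J := Icc 0 T with hJdef
  -- `q` is the pressure gradient read off the equation. Unlike `P`, which carries no regularity in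
  -- time, it is jointly smooth.
  set q : Fin 3 → ℝ → E3 → ℝ := fun i t x => F i t x - dtW J (w i) t x with hq
  have hqP : ∀ t ∈ J, ∀ i, q i t = pd i (P t) := fun t ht i => funext fun x => by
    simp only [hq]; rw [← heq t ht i x]; ring
  have hqj : ∀ i, JointSmooth J (q i) := fun i => (hFj i).sub ((hwj i).dt hJ)
  choose B hB using fun i => (hF i).bound []
  -- At this stage `∂ₜw` is not known to be in `L²`, so neither is the pressure gradient. Its time
  -- integral `G = A - (w t - w s)` is. Orthogonality of `G` to the divergence-free `w t - w s`
  -- gives `‖w t - w s‖² = ∫ A · (w t - w s)`, hence a Lipschitz bound.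
  have hlip : ∀ s ∈ J, ∀ t ∈ J, s ≤ t → ∑ i, nsq (fun x => w i t x - w i s x) ≤
      (∑ i, (B i : ℝ) ^ 2) * (t - s) ^ 2 := by
    intro s hs t ht hst
    have hsub : Icc s t ⊆ J := Icc_subset_Icc hs.1 ht.2
    set A : Fin 3 → E3 → ℝ := fun i x => ∫ τ in s..t, F i τ x with hA
    set G : Fin 3 → E3 → ℝ := fun i x => ∫ τ in s..t, q i τ x with hGdef
    have cq : ∀ i, ContinuousOn (fun p : ℝ × E3 => q i p.1 p.2) (Icc s t ×ˢ univ) := fun i =>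
      (hqj i).continuousOn.mono (prod_mono_left hsub)
    have dq : ∀ i, ∀ τ ∈ Icc s t, Differentiable ℝ (q i τ) := fun i τ hτ =>
      ((hqj i).smooth (hsub hτ)).differentiable (by simp)
    have cpq : ∀ i j, ContinuousOn (fun p : ℝ × E3 => pd j (q i p.1) p.2) (Icc s t ×ˢ univ) :=
      fun i j => ((hqj i).pd hJ j).continuousOn.mono (prod_mono_left hsub)
    have hGd : ∀ i, Differentiable ℝ (G i) := fun i x =>
      (differentiable_integral hst (dq i) (cq i) (cpq i) x).differentiableAt
    have hGA : ∀ i x, G i x = A i x - (w i t x - w i s x) := by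
      intro i x
      have e1 : ∫ τ in s..t, dtW J (w i) τ x = w i t x - w i s x := by
        refine intervalIntegral.integral_eq_sub_of_hasDeriv_right_of_le hst
          (((hwj i).continuousOn_time x).mono hsub) (fun τ hτ => ?_)
          (((((hwj i).dt hJ).continuousOn_time x).mono hsub).intervalIntegrable_of_Icc hst)
        have h1 := ((hwj i).hasDerivWithinAt (hsub (Ioo_subset_Icc_self hτ)) x)
        exact (h1.mono hsub |>.hasDerivAt (Icc_mem_nhds hτ.1 hτ.2)).hasDerivWithinAt
      simp only [hGdef, hA, hq]
      rw [intervalIntegral.integral_sub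
        ((((hFj i).continuousOn_time x).mono hsub).intervalIntegrable_of_Icc hst)
        (((((hwj i).dt hJ).continuousOn_time x).mono hsub).intervalIntegrable_of_Icc hst), e1]
    have hAc : ∀ i, Continuous (A i) := fun i => by
      have : A i = fun x => G i x + (w i t x - w i s x) := funext fun x => by rw [hGA]; ring
      rw [this]
      exact (hGd i).continuous.add (((hw i).smooth t ht).continuous.sub
        ((hw i).smooth s hs).continuous)
    have hAb : ∀ i, ∫⁻ x, ‖A i x‖ₑ ^ 2 ≤ (ENNReal.ofReal (t - s) * B i) ^ 2 := fun i =>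
      lintegral_sq_integral_le hst ((hFj i).continuousOn.mono (prod_mono_left hsub))
        fun τ hτ => hB i τ (hsub hτ)
    have hA2 : ∀ i, MemLp (A i) 2 volume := fun i =>
      memLp_two_of_lintegral (hAc i).aestronglyMeasurable
        (ENNReal.pow_ne_top (ENNReal.mul_ne_top (by simp) (by simp))) (hAb i)
    have hAn : ∀ i, nsq (A i) ≤ (B i : ℝ) ^ 2 * (t - s) ^ 2 := fun i => by
      have h1 := hAb i
      rw [lintegral_sq_enorm, ← ofReal_nsq (hA2 i), ← ENNReal.ofReal_coe_nnreal,
        ← ENNReal.ofReal_mul (sub_nonneg.2 hst), ← ENNReal.ofReal_pow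
          (mul_nonneg (sub_nonneg.2 hst) (B i).coe_nonneg),
        ENNReal.ofReal_le_ofReal_iff (by positivity)] at h1
      linarith [h1, mul_pow (t - s) (B i : ℝ) 2]
    have hv : ∀ i, Sob fun x => w i t x - w i s x := fun i =>
      ((hw i).sob ht).sub ((hw i).sob hs)
    have horth : ∑ i, ∫ x, G i x * (w i t x - w i s x) = 0 := by
      refine integral_curlFree_mul_divFree (v := fun i x => w i t x - w i s x) hGd ?_ ?_ hv ?_
      · intro i j x
        rw [hGdef]
        simp only
        rw [pd_integral hst (dq j) (cq j) (cpq j), pd_integral hst (dq i) (cq i) (cpq i)]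
        refine intervalIntegral.integral_congr fun τ hτ => ?_
        rw [uIcc_of_le hst] at hτ
        simp only [hqP τ (hsub hτ)]
        exact pd_comm (hP τ (hsub hτ)) i j x
      · intro i
        have : G i = fun x => A i x - (w i t x - w i s x) := funext (hGA i)
        rw [this]
        exact (hA2 i).sub (hv i).memLp
      · intro x
        have e : ∀ i, pd i (fun x => w i t x - w i s x) x = pd i (w i t) x - pd i (w i s) x :=
          fun i => pd_sub i (((hw i).sob ht).differentiableAt x) (((hw i).sob hs).differentiableAt x)
        simp only [e, Finset.sum_sub_distrib, hdiv t ht x, hdiv s hs x, sub_zero]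
    have h1 : ∀ i, ∫ x, G i x * (w i t x - w i s x) =
        (∫ x, A i x * (w i t x - w i s x)) - nsq (fun x => w i t x - w i s x) := fun i => by
      rw [nsq, ← integral_sub (integrable_mul_of_memLp (hA2 i) (hv i).memLp) (hv i).integrable_sq]
      congr 1
      funext x
      rw [hGA]
      ring
    simp only [h1, Finset.sum_sub_distrib] at horth
    have h2 : ∀ i, 2 * |∫ x, A i x * (w i t x - w i s x)| ≤ 1 * nsq (A i) +
        1⁻¹ * nsq (fun x => w i t x - w i s x) := fun i =>
      integral_mul_le_half (hA2 i) (hv i).memLp one_pos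
    have h3 : ∀ i, 2 * (∫ x, A i x * (w i t x - w i s x)) ≤ (B i : ℝ) ^ 2 * (t - s) ^ 2 +
        nsq (fun x => w i t x - w i s x) := fun i => by
      have := h2 i
      have := le_abs_self (∫ x, A i x * (w i t x - w i s x))
      have := hAn i
      simp only [one_mul, inv_one] at *
      linarith
    have h4 := Finset.sum_le_sum fun i (_ : i ∈ Finset.univ) => h3 i
    rw [← Finset.mul_sum, Finset.sum_add_distrib, ← Finset.sum_mul] at h4
    linarith
  set C : ℝ := Real.sqrt (∑ i, (B i : ℝ) ^ 2) with hC
  have hC2 : C ^ 2 = ∑ i, (B i : ℝ) ^ 2 := Real.sq_sqrt (Finset.sum_nonneg fun i _ => sq_nonneg _)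
  have hC0 : 0 ≤ C := Real.sqrt_nonneg _
  have hlip' : ∀ i, ∀ s ∈ J, ∀ t ∈ J, s ≤ t →
      nsq (fun x => w i t x - w i s x) ≤ C ^ 2 * (t - s) ^ 2 := fun i s hs t ht hst => by
    rw [hC2]
    exact (Finset.single_le_sum (f := fun i => nsq (fun x => w i t x - w i s x))
      (fun j _ => nsq_nonneg _) (Finset.mem_univ i)).trans (hlip s hs t ht hst)
  have hdt : ∀ i, ∀ t ∈ J, MemLp (dtW J (w i) t) 2 volume ∧ nsq (dtW J (w i) t) ≤ C ^ 2 :=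
    fun i t ht => nsq_le_of_lipschitz hJ (hwj i) (hw i) hC0 (hlip' i) ht
  refine ⟨⟨C, hC0, hlip', hdt⟩, fun t ht => ?_⟩
  -- Now that `∂ₜw` is in `L²`, so is `q`, and the orthogonality applies at a fixed time.
  have horth : ∑ i, ∫ x, q i t x * w i t x = 0 := by
    refine integral_curlFree_mul_divFree (fun i => ((hqj i).smooth ht).differentiable (by simp)) ?_
      (fun i => ((hF i).memLp ht).sub (hdt i t ht).1) (fun i => (hw i).sob ht) (hdiv t ht)
    intro i j x
    rw [hqP t ht, hqP t ht]
    exact pd_comm (hP t ht) i j x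
  have h1 : ∀ i, ∫ x, q i t x * w i t x =
      (∫ x, w i t x * F i t x) - ∫ x, w i t x * dtW J (w i) t x := fun i => by
    have i1 : Integrable fun x => w i t x * F i t x := ((hw i).memLp ht).integrable_mul ((hF i).memLp ht)
    have i2 : Integrable fun x => w i t x * dtW J (w i) t x :=
      ((hw i).memLp ht).integrable_mul (hdt i t ht).1
    rw [← integral_sub i1 i2]
    congr 1
    funext x
    simp only [hq]
    ring
  simp only [h1, Finset.sum_sub_distrib] at horth
  linarith

end HBS

namespace HBS

/-! ### Grönwall's inequality in integral form -/

/-- With `z` the right-hand side of the hypothesis and `W` the primitive of `b`, the function `z *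
exp (-W)` is nonincreasing. -/
lemma le_mul_exp_of_le_integral_of_continuous {y b : ℝ → ℝ} (hy : Continuous y)
    (hb : Continuous b) {T A : ℝ} (hb0 : ∀ t ∈ Icc 0 T, 0 ≤ b t)
    (h : ∀ t ∈ Icc 0 T, y t ≤ A + ∫ τ in (0 : ℝ)..t, b τ * y τ) :
    ∀ t ∈ Icc 0 T, y t ≤ A * Real.exp (∫ τ in (0 : ℝ)..t, b τ) := by
  intro t ht
  set W : ℝ → ℝ := fun t => ∫ τ in (0 : ℝ)..t, b τ with hW
  set z : ℝ → ℝ := fun t => A + ∫ τ in (0 : ℝ)..t, b τ * y τ with hz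
  have hWd : ∀ t, HasDerivAt W (b t) t := fun t => (hb.integral_hasStrictDerivAt 0 t).hasDerivAt
  have hzd : ∀ t, HasDerivAt z (b t * y t) t := fun t =>
    (((hb.mul hy).integral_hasStrictDerivAt 0 t).hasDerivAt).const_add A
  have hgd : ∀ t, HasDerivAt (fun t => z t * Real.exp (-W t))
      (b t * y t * Real.exp (-W t) + z t * (Real.exp (-W t) * -b t)) t := fun t =>
    (hzd t).fun_mul (hWd t).fun_neg.exp
  have hanti : AntitoneOn (fun t => z t * Real.exp (-W t)) (Icc 0 T) := by
    refine antitoneOn_of_deriv_nonpos (convex_Icc 0 T)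
      (fun t _ => (hgd t).continuousAt.continuousWithinAt)
      (fun t _ => (hgd t).differentiableAt.differentiableWithinAt) fun t ht => ?_
    rw [interior_Icc] at ht
    have ht' := Ioo_subset_Icc_self ht
    rw [(hgd t).deriv]
    have h1 := mul_le_mul_of_nonneg_left (h t ht') (hb0 t ht')
    have h2 := Real.exp_pos (-W t)
    nlinarith
  have h1 := hanti (left_mem_Icc.2 (ht.1.trans ht.2)) ht ht.1
  simp only [hz, hW, intervalIntegral.integral_same, neg_zero, Real.exp_zero, add_zero, mul_one] at h1
  refine (h t ht).trans ?_
  have h2 := mul_le_mul_of_nonneg_right h1 (Real.exp_pos (W t)).le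
  rw [mul_assoc, ← Real.exp_add] at h2
  simpa [hW] using h2

lemma le_mul_exp_of_le_integral {y b : ℝ → ℝ} {T A : ℝ} (hy : ContinuousOn y (Icc 0 T))
    (hb : ContinuousOn b (Icc 0 T)) (hb0 : ∀ t ∈ Icc 0 T, 0 ≤ b t)
    (h : ∀ t ∈ Icc 0 T, y t ≤ A + ∫ τ in (0 : ℝ)..t, b τ * y τ) :
    ∀ t ∈ Icc 0 T, y t ≤ A * Real.exp (∫ τ in (0 : ℝ)..t, b τ) := by
  intro t ht
  have hT : 0 ≤ T := ht.1.trans ht.2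
  -- Clamping time to `[0, T]` extends the data continuously to the line without changing the
  -- integrals over `[0, t]`.
  set c : ℝ → ℝ := fun t => max 0 (min T t) with hc
  have hcc : Continuous c := by fun_prop
  have hcm : ∀ t, c t ∈ Icc 0 T := fun t => ⟨le_max_left _ _, max_le hT (min_le_left _ _)⟩
  have hce : ∀ t ∈ Icc 0 T, c t = t := fun t ht => by simp [hc, ht.1, ht.2]
  have e1 : ∀ t ∈ Icc 0 T, ∀ τ ∈ uIcc 0 t, c τ = τ := fun t ht τ hτ => by
    rw [uIcc_of_le ht.1] at hτ
    exact hce τ ⟨hτ.1, hτ.2.trans ht.2⟩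
  have h1 := le_mul_exp_of_le_integral_of_continuous (y := y ∘ c) (b := b ∘ c) (T := T) (A := A)
    (hy.comp_continuous hcc hcm) (hb.comp_continuous hcc hcm) (fun t _ => hb0 _ (hcm t))
    (fun t ht => by
      simp only [Function.comp_apply, hce t ht]
      refine (h t ht).trans (le_of_eq ?_)
      congr 1
      refine intervalIntegral.integral_congr fun τ hτ => ?_
      simp only [e1 t ht τ hτ]) t ht
  simp only [Function.comp_apply, hce t ht] at h1
  refine h1.trans (le_of_eq ?_)
  congr 2
  refine intervalIntegral.integral_congr fun τ hτ => ?_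
  simp only [e1 t ht τ hτ]

/-! ### Advection -/

/-- The advection `v · ∇a`. -/
noncomputable def adv (v : Fin 3 → E3 → ℝ) (a : E3 → ℝ) (x : E3) : ℝ := ∑ j, v j x * pd j a x

lemma SobFam.adv {J : Set ℝ} {v : Fin 3 → ℝ → E3 → ℝ} {a : ℝ → E3 → ℝ}
    (hv : ∀ i, SobFam J (v i)) (ha : SobFam J a) :
    SobFam J (fun t => HBS.adv (fun i => v i t) (a t)) :=
  SobFam.sum _ fun j _ => (hv j).mul (ha.pd j)

lemma JointSmooth.adv {J : Set ℝ} (hJ : UniqueDiffOn ℝ J) {v : Fin 3 → ℝ → E3 → ℝ}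
    {a : ℝ → E3 → ℝ} (hv : ∀ i, JointSmooth J (v i)) (ha : JointSmooth J a) :
    JointSmooth J (fun t => HBS.adv (fun i => v i t) (a t)) :=
  ContDiffOn.sum fun j _ => (hv j).mul (ha.pd hJ j)

lemma Sob.adv {v : Fin 3 → E3 → ℝ} {a : E3 → ℝ} (hv : ∀ i, Sob (v i)) (ha : Sob a) :
    Sob (HBS.adv v a) := SobFam.adv (v := fun i _ => v i) hv ha

/-- Advection by a divergence-free field is antisymmetric: integration by parts turns each term into
minus itself minus `∫ (∂_j v_j) a²`, and the latter sum to zero. -/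
lemma integral_mul_adv {v : Fin 3 → E3 → ℝ} {a : E3 → ℝ} (hv : ∀ i, Sob (v i))
    (hdiv : ∀ x, ∑ i, pd i (v i) x = 0) (ha : Sob a) : ∫ x, a x * adv v a x = 0 := by
  have h1 : ∀ j, ∫ x, (a x * v j x) * pd j a x =
      -(∫ x, pd j (v j) x * a x ^ 2) - (∫ x, (a x * v j x) * pd j a x) := by
    intro j
    have i1 : Integrable fun x => pd j (v j) x * a x ^ 2 := by
      simpa [sq] using ((hv j).pd j).integrable_mul (ha.mul ha)
    have i2 : Integrable fun x => (a x * v j x) * pd j a x := (ha.mul (hv j)).integrable_mul (ha.pd j)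
    rw [← neg_add', ← integral_add i1 i2, (ha.mul (hv j)).integral_mul_pd ha j]
    congr 2
    funext x
    rw [pd_mul j (ha.differentiableAt x) ((hv j).differentiableAt x)]
    ring
  have h2 : ∫ x, a x * adv v a x = ∑ j, ∫ x, (a x * v j x) * pd j a x := by
    rw [← integral_finsetSum _ fun j _ => (ha.mul (hv j)).integrable_mul (ha.pd j)]
    congr 1
    funext x
    simp only [adv, Finset.mul_sum, mul_assoc]
  have h3 : ∑ j, ∫ x, pd j (v j) x * a x ^ 2 = 0 := by
    rw [← integral_finsetSum _ fun j _ => by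
      simpa [sq] using ((hv j).pd j).integrable_mul (ha.mul ha)]
    simp [← Finset.sum_mul, hdiv]
  have h4 := Finset.sum_congr rfl fun j (_ : j ∈ Finset.univ) => h1 j
  rw [Finset.sum_sub_distrib, Finset.sum_neg_distrib, h3] at h4
  rw [h2]
  linarith

lemma integral_mul_lapH {a : E3 → ℝ} (ha : Sob a) :
    ∫ x, a x * lapH a x = - (nsq (pd 0 a) + nsq (pd 1 a)) := by
  have e : ∀ i, ∫ x, a x * pd i (pd i a) x = - nsq (pd i a) := fun i => by
    rw [ha.integral_mul_pd (ha.pd i) i, nsq]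
    simp only [sq]
  simp only [lapH, mul_add]
  rw [integral_add (ha.integrable_mul ((ha.pd 0).pd 0)) (ha.integrable_mul ((ha.pd 1).pd 1)), e, e]
  ring

/-! ### Solutions in components -/

/-- A smooth solution on the time interval `[0,T]`, in components. -/
structure CompSol (T : ℝ) (U : Fin 3 → ℝ → E3 → ℝ) (R P : ℝ → E3 → ℝ) : Prop where
  U_sob : ∀ i, SobFam (Icc 0 T) (U i)
  U_joint : ∀ i, JointSmooth (Icc 0 T) (U i)
  R_sob : SobFam (Icc 0 T) R
  R_joint : JointSmooth (Icc 0 T) R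
  P_smooth : ∀ t ∈ Icc 0 T, ContDiff ℝ ∞ (P t)
  momentum : ∀ t ∈ Icc 0 T, ∀ i x, dtW (Icc 0 T) (U i) t x + adv (fun j => U j t) (U i t) x -
    lapH (U i t) x + pd i (P t) x = if i = 2 then R t x else 0
  transport : ∀ t ∈ Icc 0 T, ∀ x, dtW (Icc 0 T) R t x + adv (fun j => U j t) (R t) x = 0
  incompressible : ∀ t ∈ Icc 0 T, ∀ x, ∑ i, pd i (U i t) x = 0

/-- The right-hand side of the momentum equation, without the pressure. -/
noncomputable def force (U : Fin 3 → ℝ → E3 → ℝ) (R : ℝ → E3 → ℝ) (i : Fin 3) (t : ℝ) (x : E3) : ℝ :=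
  -adv (fun j => U j t) (U i t) x + lapH (U i t) x + if i = 2 then R t x else 0

lemma dtW_sub {J : Set ℝ} (hJ : UniqueDiffOn ℝ J) {a b : ℝ → E3 → ℝ} (ha : JointSmooth J a)
    (hb : JointSmooth J b) {t : ℝ} (ht : t ∈ J) (x : E3) :
    dtW J (fun t x => a t x - b t x) t x = dtW J a t x - dtW J b t x :=
  ((ha.hasDerivWithinAt ht x).fun_sub (hb.hasDerivWithinAt ht x)).derivWithin (hJ t ht)

namespace CompSol
variable {T : ℝ} {U U' : Fin 3 → ℝ → E3 → ℝ} {R P R' P' : ℝ → E3 → ℝ}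

lemma force_sob (h : CompSol T U R P) (i : Fin 3) : SobFam (Icc 0 T) (force U R i) := by
  refine ((SobFam.adv h.U_sob (h.U_sob i)).neg.add (h.U_sob i).lapH).add ?_
  split_ifs
  · exact h.R_sob
  · exact SobFam.zero

lemma force_joint (hT : 0 < T) (h : CompSol T U R P) (i : Fin 3) :
    JointSmooth (Icc 0 T) (force U R i) := by
  have hJ := uniqueDiffOn_Icc hT
  have h1 : JointSmooth (Icc 0 T) fun t x => if i = 2 then R t x else 0 := by
    split_ifs
    · exact h.R_joint
    · exact JointSmooth.zero
  have h2 := (JointSmooth.adv hJ h.U_joint (h.U_joint i)).const_mul (-1)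
  refine ((h2.add ((h.U_joint i).lapH hJ)).add h1).congr fun t _ x => ?_
  simp [force]

lemma dt_add_pd (h : CompSol T U R P) {t : ℝ} (ht : t ∈ Icc 0 T) (i : Fin 3) (x : E3) :
    dtW (Icc 0 T) (U i) t x + pd i (P t) x = force U R i t x := by
  have := h.momentum t ht i x
  simp only [force]
  linarith

/-- Smooth solutions are determined by their initial data. -/
theorem unique (hT : 0 < T) (h : CompSol T U R P) (h' : CompSol T U' R' P')
    (hU : ∀ i, U i 0 = U' i 0) (hR : R 0 = R' 0) :
    ∀ t ∈ Icc 0 T, (∀ i, U i t = U' i t) ∧ R t = R' t := by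
  have hJ : UniqueDiffOn ℝ (Icc 0 T) := uniqueDiffOn_Icc hT
  set J := Icc 0 T with hJdef
  have h0J : (0 : ℝ) ∈ J := left_mem_Icc.2 hT.le
  set w : Fin 3 → ℝ → E3 → ℝ := fun i t x => U i t x - U' i t x with hw
  set η : ℝ → E3 → ℝ := fun t x => R t x - R' t x with hη
  have hws : ∀ i, SobFam J (w i) := fun i => (h.U_sob i).sub (h'.U_sob i)
  have hwj : ∀ i, JointSmooth J (w i) := fun i => (h.U_joint i).sub (h'.U_joint i)
  have hηs : SobFam J η := h.R_sob.sub h'.R_sob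
  have hηj : JointSmooth J η := h.R_joint.sub h'.R_joint
  have hpw : ∀ t ∈ J, ∀ i j x, pd j (w i t) x = pd j (U i t) x - pd j (U' i t) x :=
    fun t ht i j x => pd_sub j (((h.U_sob i).sob ht).differentiableAt x)
      (((h'.U_sob i).sob ht).differentiableAt x)
  have hpη : ∀ t ∈ J, ∀ j x, pd j (η t) x = pd j (R t) x - pd j (R' t) x :=
    fun t ht j x => pd_sub j ((h.R_sob.sob ht).differentiableAt x)
      ((h'.R_sob.sob ht).differentiableAt x)
  -- The difference of the velocities is divergence-free and solves the equation with the difference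
  -- of the forces and of the pressures, so the pressures drop out of its energy.
  obtain ⟨⟨C, hC0, hlip, hdt⟩, horth⟩ := exists_nsq_dt_le hT hws hwj
    (F := fun i t x => force U R i t x - force U' R' i t x)
    (P := fun t x => P t x - P' t x) (fun i => (h.force_sob i).sub (h'.force_sob i))
    (fun i => (h.force_joint hT i).sub (h'.force_joint hT i))
    (fun t ht => (h.P_smooth t ht).sub (h'.P_smooth t ht))
    (fun t ht i x => by
      rw [pd_sub i ((h.P_smooth t ht).differentiable (by simp) x)
        ((h'.P_smooth t ht).differentiable (by simp) x), dtW_sub hJ (h.U_joint i) (h'.U_joint i) ht,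
        ← h.dt_add_pd ht, ← h'.dt_add_pd ht]
      ring)
    (fun t ht x => by
      simp only [hpw t ht, Finset.sum_sub_distrib, h.incompressible t ht, h'.incompressible t ht,
        sub_zero])
  -- the density
  set η' : ℝ → E3 → ℝ := fun t x => -adv (fun j => U j t) (η t) x - adv (fun j => w j t) (R' t) x
    with hη'
  have hη's : SobFam J η' := (SobFam.adv h.U_sob hηs).neg.sub (SobFam.adv hws h'.R_sob)
  have hηd : HasTimeDeriv J η η' := hηj.hasTimeDeriv hJ measurableSet_Icc fun t ht x => by
    rw [hη, dtW_sub hJ h.R_joint h'.R_joint ht]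
    have e1 := h.transport t ht x
    have e2 := h'.transport t ht x
    simp only [hη', adv, Fin.sum_univ_three, hpη t ht, hw] at *
    linarith
  -- bounds for the second solution
  choose K hK using fun p : Fin 3 × Fin 3 => ((h'.U_sob p.1).pd p.2).exists_abs_le
  choose K' hK' using fun j : Fin 3 => (h'.R_sob.pd j).exists_abs_le
  obtain ⟨M, hM0, hM⟩ : ∃ M : ℝ, 0 ≤ M ∧ ∀ t ∈ J, ∀ j x, (∀ i, |pd j (U' i t) x| ≤ M) ∧
      |pd j (R' t) x| ≤ M := by
    refine ⟨(∑ p, K p : ℝ≥0) + (∑ j, K' j : ℝ≥0), by positivity, fun t ht j x => ⟨fun i => ?_, ?_⟩⟩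
    · refine (hK (i, j) t ht x).trans ?_
      have : K (i, j) ≤ ∑ p, K p := Finset.single_le_sum (fun p _ => zero_le) (Finset.mem_univ (i, j))
      have : (K (i, j) : ℝ) ≤ (∑ p, K p : ℝ≥0) := by exact_mod_cast this
      have : (0 : ℝ) ≤ (∑ j, K' j : ℝ≥0) := NNReal.coe_nonneg _
      linarith
    · refine (hK' j t ht x).trans ?_
      have : K' j ≤ ∑ j, K' j := Finset.single_le_sum (fun p _ => zero_le) (Finset.mem_univ j)
      have : (K' j : ℝ) ≤ (∑ j, K' j : ℝ≥0) := by exact_mod_cast this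
      have : (0 : ℝ) ≤ (∑ p, K p : ℝ≥0) := NNReal.coe_nonneg _
      linarith
  set S : ℝ → E3 → ℝ := fun t x => w 0 t x ^ 2 + w 1 t x ^ 2 + w 2 t x ^ 2 + η t x ^ 2 with hS
  set E : ℝ → ℝ := fun t => ∑ i, nsq (w i t) + nsq (η t) with hE
  have hSi : ∀ t ∈ J, Integrable (S t) := fun t ht =>
    (((((hws 0).sob ht).integrable_sq.add ((hws 1).sob ht).integrable_sq).add
      ((hws 2).sob ht).integrable_sq).add (hηs.sob ht).integrable_sq)
  have hSE : ∀ t ∈ J, ∫ x, S t x = E t := fun t ht => by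
    have i0 := ((hws 0).sob ht).integrable_sq
    have i1 := ((hws 1).sob ht).integrable_sq
    have i2 := ((hws 2).sob ht).integrable_sq
    have i3 := (hηs.sob ht).integrable_sq
    simp only [hS, hE, nsq, Fin.sum_univ_three]
    have i01 : Integrable fun x => w 0 t x ^ 2 + w 1 t x ^ 2 := i0.add i1
    have i012 : Integrable fun x => w 0 t x ^ 2 + w 1 t x ^ 2 + w 2 t x ^ 2 := i01.add i2
    rw [integral_add i012 i3, integral_add i01 i2, integral_add i0 i1]
  have young : ∀ a b d : ℝ, |d| ≤ M → -(a * (b * d)) ≤ M * ((a ^ 2 + b ^ 2) / 2) := by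
    intro a b d hd
    have h1 : |a * b| ≤ (a ^ 2 + b ^ 2) / 2 := by
      rw [abs_le]; constructor <;> nlinarith [sq_nonneg (a + b), sq_nonneg (a - b)]
    have h2 : |a * (b * d)| ≤ M * ((a ^ 2 + b ^ 2) / 2) := by
      rw [← mul_assoc, abs_mul, mul_comm M]
      exact mul_le_mul h1 hd (abs_nonneg _) (by positivity)
    exact (neg_le_abs _).trans h2
  -- the energy inequality
  have hUd : ∀ t ∈ J, ∀ i, ∫ x, w i t x * (force U R i t x - force U' R' i t x) ≤
      (3 * M + 1) * E t := by
    intro t ht i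
    have hwi := (hws i).sob ht
    have hU1 : ∀ j, Sob (U j t) := fun j => (h.U_sob j).sob ht
    -- Transport by `U` contributes nothing and viscosity has a sign. What remains is `-(w · ∇)
    -- U'_i` and the buoyancy: three products bounded by `M * S` and one bounded by `S`, whence `3 *
    -- M + 1`.
    set rest : E3 → ℝ := fun x => -adv (fun j => w j t) (U' i t) x + if i = 2 then η t x else 0
      with hrest
    have hrs : Sob rest := by
      have h1 : Sob fun x => if i = 2 then η t x else 0 := by
        split_ifs
        · exact hηs.sob ht
        · exact SobFam.zero
      have h2 := (Sob.adv (fun j => (hws j).sob ht) ((h'.U_sob i).sob ht)).const_mul (-1)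
      simpa [hrest] using h2.add h1
    have e1 : ∀ x, w i t x * (force U R i t x - force U' R' i t x) =
        -(w i t x * adv (fun j => U j t) (w i t) x) + w i t x * lapH (w i t) x + w i t x * rest x := by
      intro x
      have l1 : lapH (w i t) x = lapH (U i t) x - lapH (U' i t) x := by
        have : ∀ k, pd k (w i t) = fun x => pd k (U i t) x - pd k (U' i t) x := fun k =>
          funext fun x => hpw t ht i k x
        simp only [lapH, this]
        rw [pd_sub 0 ((((h.U_sob i).sob ht).pd 0).differentiableAt x)
          ((((h'.U_sob i).sob ht).pd 0).differentiableAt x),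
          pd_sub 1 ((((h.U_sob i).sob ht).pd 1).differentiableAt x)
          ((((h'.U_sob i).sob ht).pd 1).differentiableAt x)]
        ring
      rw [l1]
      simp only [hrest, force, adv, Fin.sum_univ_three, hpw t ht]
      split_ifs
      · simp only [hw, hη]; ring
      · simp only [hw]; ring
    simp only [e1]
    have i1 := hwi.integrable_mul (Sob.adv hU1 hwi)
    have i2 := hwi.integrable_mul hwi.lapH
    have i3 := hwi.integrable_mul hrs
    have i1n : Integrable fun x => -(w i t x * adv (fun j => U j t) (w i t) x) := i1.neg
    have i12 : Integrable fun x => -(w i t x * adv (fun j => U j t) (w i t) x) +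
      w i t x * lapH (w i t) x := i1n.add i2
    rw [integral_add i12 i3, integral_add i1n i2, integral_neg,
      integral_mul_adv hU1 (h.incompressible t ht) hwi, integral_mul_lapH hwi, ← hSE t ht,
      ← integral_const_mul]
    have h3 : ∫ x, w i t x * rest x ≤ ∫ x, (3 * M + 1) * S t x := by
      refine integral_mono i3 ((hSi t ht).const_mul _) fun x => ?_
      have y0 := young (w i t x) (w 0 t x) _ ((hM t ht 0 x).1 i)
      have y1 := young (w i t x) (w 1 t x) _ ((hM t ht 1 x).1 i)
      have y2 := young (w i t x) (w 2 t x) _ ((hM t ht 2 x).1 i)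
      have hSi : w i t x ^ 2 + η t x ^ 2 ≤ S t x := by
        simp only [hS]
        fin_cases i <;> simp only [Fin.zero_eta, Fin.mk_one, Fin.reduceFinMk] <;>
          nlinarith [sq_nonneg (w 0 t x), sq_nonneg (w 1 t x), sq_nonneg (w 2 t x)]
      have hS0 : w 0 t x ^ 2 + w 1 t x ^ 2 + w 2 t x ^ 2 ≤ S t x := by
        simp only [hS]; nlinarith [sq_nonneg (η t x)]
      have y3 : w i t x * (if i = 2 then η t x else 0) ≤ S t x := by
        split_ifs
        · nlinarith [sq_nonneg (w i t x - η t x), sq_nonneg (w i t x), sq_nonneg (η t x)]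
        · nlinarith [sq_nonneg (w i t x), sq_nonneg (η t x)]
      have e : w i t x * rest x = -(w i t x * (w 0 t x * pd 0 (U' i t) x)) -
          w i t x * (w 1 t x * pd 1 (U' i t) x) - w i t x * (w 2 t x * pd 2 (U' i t) x) +
          w i t x * (if i = 2 then η t x else 0) := by
        simp only [hrest, adv, Fin.sum_univ_three]; ring
      have hm1 := mul_le_mul_of_nonneg_left hSi hM0
      have hm2 := mul_le_mul_of_nonneg_left hS0 hM0
      have : 0 ≤ M * η t x ^ 2 := by positivity
      have : 0 ≤ M * w i t x ^ 2 := by positivity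
      simp only
      rw [e]
      linarith
    have := nsq_nonneg (pd 0 (w i t))
    have := nsq_nonneg (pd 1 (w i t))
    linarith
  have hRd : ∀ t ∈ J, ∫ x, η t x * η' t x ≤ (3 * M + 1) * E t := by
    intro t ht
    have hηt := hηs.sob ht
    have hU1 : ∀ j, Sob (U j t) := fun j => (h.U_sob j).sob ht
    have e1 : ∀ x, η t x * η' t x = -(η t x * adv (fun j => U j t) (η t) x) -
        η t x * adv (fun j => w j t) (R' t) x := fun x => by simp only [hη']; ring
    have i1 := hηt.integrable_mul (Sob.adv hU1 hηt)
    have i2 := hηt.integrable_mul (Sob.adv (fun j => (hws j).sob ht) (h'.R_sob.sob ht))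
    simp only [e1]
    have i1n : Integrable fun x => -(η t x * adv (fun j => U j t) (η t) x) := i1.neg
    rw [integral_sub i1n i2, integral_neg, integral_mul_adv hU1 (h.incompressible t ht) hηt,
      neg_zero, zero_sub, ← integral_neg, ← hSE t ht, ← integral_const_mul]
    refine integral_mono i2.neg ((hSi t ht).const_mul _) fun x => ?_
    have y0 := young (η t x) (w 0 t x) _ (hM t ht 0 x).2
    have y1 := young (η t x) (w 1 t x) _ (hM t ht 1 x).2
    have y2 := young (η t x) (w 2 t x) _ (hM t ht 2 x).2
    have hS0 : w 0 t x ^ 2 + w 1 t x ^ 2 + w 2 t x ^ 2 + η t x ^ 2 = S t x := rfl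
    have hSn : 0 ≤ S t x := by rw [← hS0]; positivity
    have hm : M * (w 0 t x ^ 2 + w 1 t x ^ 2 + w 2 t x ^ 2 + η t x ^ 2) = M * S t x := by rw [hS0]
    have e : -(η t x * adv (fun j => w j t) (R' t) x) = -(η t x * (w 0 t x * pd 0 (R' t) x)) -
          η t x * (w 1 t x * pd 1 (R' t) x) - η t x * (w 2 t x * pd 2 (R' t) x) := by
        simp only [adv, Fin.sum_univ_three]; ring
    simp only
    rw [e]
    have : 0 ≤ M * η t x ^ 2 := by positivity
    have : 0 ≤ M * w 0 t x ^ 2 := by positivity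
    have : 0 ≤ M * w 1 t x ^ 2 := by positivity
    have : 0 ≤ M * w 2 t x ^ 2 := by positivity
    linarith
  -- conclusion
  obtain ⟨Bη, -, hBη⟩ := hη's.exists_nsq_le
  obtain ⟨Aη, -, hAη⟩ := hηs.exists_nsq_le
  choose Aw _ hAw using fun i => (hws i).exists_nsq_le
  have hEc : ContinuousOn E J := by
    refine ContinuousOn.add (continuousOn_finsetSum _ fun i _ =>
      (nsq_lipschitz_pd (hws i) (hlip i) 0).2) (nsq_lipschitz_pd hηs (L := Bη) ?_ 0).2
    intro s hs t ht hst
    have hsub : Icc s t ⊆ J := Icc_subset_Icc hs.1 ht.2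
    exact (hηd.mono hsub).nsq_sub_le hst (fun τ hτ => ⟨hη's.memLp (hsub hτ), hBη τ (hsub hτ)⟩)
      (fun τ hτ => hηs.memLp (hsub hτ)) fun τ hτ => (hηs.smooth τ (hsub hτ)).continuous.measurable
  have hE0 : E 0 = 0 := by
    have e1 : ∀ i, w i 0 = fun _ => 0 := fun i => funext fun x => by simp [hw, hU i]
    have e2 : η 0 = fun _ => 0 := funext fun x => by simp [hη, hR]
    simp [hE, e1, e2, nsq]
  -- The factor 8 is 2, from differentiating a square, times the four unknowns: three velocity
  -- components and the density.
  have hgr : ∀ t ∈ J, E t ≤ 0 + ∫ τ in (0 : ℝ)..t, (8 * (3 * M + 1)) * E τ := by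
    intro t ht
    have hsub : Icc 0 t ⊆ J := Icc_subset_Icc le_rfl ht.2
    have h1 := fun i => (((hwj i).hasTimeDeriv hJ measurableSet_Icc
      (a' := dtW J (w i)) fun _ _ _ => rfl).mono hsub).nsq_sub_eq ht.1
      (fun τ hτ => hdt i τ (hsub hτ)) (fun τ hτ => ⟨(hws i).memLp (hsub hτ), hAw i τ (hsub hτ)⟩)
    have h2 := (hηd.mono hsub).nsq_sub_eq ht.1
      (fun τ hτ => ⟨hη's.memLp (hsub hτ), hBη τ (hsub hτ)⟩)
      (fun τ hτ => ⟨hηs.memLp (hsub hτ), hAη τ (hsub hτ)⟩)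
    have hs : IntervalIntegrable (fun τ => ∑ i, 2 * ∫ x, w i τ x * dtW J (w i) τ x) volume 0 t := by
      simpa only [Finset.sum_fn] using IntervalIntegrable.sum Finset.univ fun i _ => (h1 i).1
    have h3 : E t - E 0 = ∫ τ in (0 : ℝ)..t, ((∑ i, 2 * ∫ x, w i τ x * dtW J (w i) τ x) +
        2 * ∫ x, η τ x * η' τ x) := by
      rw [intervalIntegral.integral_add hs h2.1,
        intervalIntegral.integral_finsetSum fun i _ => (h1 i).1, ← h2.2,
        ← Finset.sum_congr rfl fun i _ => (h1 i).2]
      simp only [hE, Finset.sum_sub_distrib]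
      ring
    rw [hE0, sub_zero] at h3
    rw [h3, zero_add]
    refine intervalIntegral.integral_mono_on ht.1
      (hs.add h2.1)
      (((hEc.mono hsub).const_smul (8 * (3 * M + 1))).intervalIntegrable_of_Icc ht.1) fun τ hτ => ?_
    have hτ' := hsub hτ
    have e1 := horth τ hτ'
    have e2 := hRd τ hτ'
    have e3 := Finset.sum_le_sum fun i (_ : i ∈ Finset.univ) => hUd τ hτ' i
    rw [← e1] at e3
    rw [← Finset.mul_sum]
    simp only [Finset.sum_const, Finset.card_univ, Fintype.card_fin, nsmul_eq_mul] at e3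
    push_cast at e3
    linarith
  have hE1 := le_mul_exp_of_le_integral hEc (b := fun _ => 8 * (3 * M + 1)) continuousOn_const
    (fun _ _ => by positivity) hgr
  intro t ht
  have h1 := hE1 t ht
  rw [zero_mul] at h1
  have hz : ∀ {f : E3 → ℝ}, Sob f → nsq f ≤ 0 → f = fun _ => 0 := by
    intro f hf h0
    have h2 := (integral_eq_zero_iff_of_nonneg (fun x => sq_nonneg (f x)) hf.integrable_sq).1
      (le_antisymm h0 (nsq_nonneg f))
    have h3 : (fun x => f x ^ 2) = fun _ => 0 :=
      Continuous.ae_eq_iff_eq volume (hf.continuous.pow 2) continuous_const |>.1 h2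
    funext x
    have := congrFun h3 x
    exact pow_eq_zero_iff (two_ne_zero) |>.1 this
  constructor
  · intro i
    have h2 : nsq (w i t) ≤ 0 := by
      refine le_trans ?_ h1
      have := Finset.single_le_sum (f := fun i => nsq (w i t)) (fun j _ => nsq_nonneg _)
        (Finset.mem_univ i)
      have := nsq_nonneg (η t)
      simp only [hE]
      linarith
    funext x
    have := congrFun (hz ((hws i).sob ht) h2) x
    exact sub_eq_zero.1 this
  · have h2 : nsq (η t) ≤ 0 := by
      refine le_trans ?_ h1
      have := Finset.sum_nonneg fun i (_ : i ∈ Finset.univ) => nsq_nonneg (w i t)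
      simp only [hE]
      linarith
    funext x
    have := congrFun (hz (hηs.sob ht) h2) x
    exact sub_eq_zero.1 this

end CompSol

end HBS

namespace HBS

/-! ### Reflections through vertical planes -/

/-- The matrix of a reflection through a vertical plane containing the axis, if `c² + s² = 1`. -/
def reflMat (c s : ℝ) : Fin 3 → Fin 3 → ℝ := ![![c, s, 0], ![s, -c, 0], ![0, 0, 1]]

/-- The reflection with matrix `reflMat c s`. -/
noncomputable def refl (c s : ℝ) : E3 →L[ℝ] E3 :=
  (c • (EuclideanSpace.proj 0 : E3 →L[ℝ] ℝ) + s • EuclideanSpace.proj 1).smulRight (bv 0) +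
  (s • (EuclideanSpace.proj 0 : E3 →L[ℝ] ℝ) - c • EuclideanSpace.proj 1).smulRight (bv 1) +
  (EuclideanSpace.proj 2 : E3 →L[ℝ] ℝ).smulRight (bv 2)

section refl
variable (c s : ℝ)

@[simp] lemma refl_zero (x : E3) : refl c s x 0 = c * x 0 + s * x 1 := by simp [refl]
@[simp] lemma refl_one (x : E3) : refl c s x 1 = s * x 0 - c * x 1 := by simp [refl]
@[simp] lemma refl_two (x : E3) : refl c s x 2 = x 2 := by simp [refl]

lemma refl_bv (i j : Fin 3) : refl c s (bv i) j = reflMat c s j i := by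
  fin_cases i <;> fin_cases j <;> simp [reflMat]

lemma reflMat_symm (i j : Fin 3) : reflMat c s i j = reflMat c s j i := by
  fin_cases i <;> fin_cases j <;> simp [reflMat]

lemma pd_comp_refl {f : E3 → ℝ} (hf : Differentiable ℝ f) (i : Fin 3) (x : E3) :
    pd i (fun y => f (refl c s y)) x = ∑ j, reflMat c s i j * pd j f (refl c s x) := by
  rw [pd_comp_clm hf]
  simp only [refl_bv, reflMat_symm c s i]

end refl

section refl
variable {c s : ℝ}

lemma refl_refl (h : c ^ 2 + s ^ 2 = 1) (x : E3) : refl c s (refl c s x) = x := by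
  ext k
  fin_cases k
  · simp; linear_combination x 0 * h
  · simp; linear_combination x 1 * h
  · simp

lemma norm_refl (h : c ^ 2 + s ^ 2 = 1) (x : E3) : ‖refl c s x‖ = ‖x‖ := by
  simp only [EuclideanSpace.norm_eq, Fin.sum_univ_three, Real.norm_eq_abs, sq_abs, refl_zero,
    refl_one, refl_two]
  congr 1
  linear_combination (x 0 ^ 2 + x 1 ^ 2) * h

/-- The reflection as an isometric isomorphism. -/
noncomputable def reflIso (h : c ^ 2 + s ^ 2 = 1) : E3 ≃ₗᵢ[ℝ] E3 where
  toLinearEquiv := LinearEquiv.ofInvolutive (refl c s : E3 →ₗ[ℝ] E3) (refl_refl h)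
  norm_map' := norm_refl h

lemma measurePreserving_refl (h : c ^ 2 + s ^ 2 = 1) :
    MeasurePreserving (refl c s) (volume : Measure E3) volume := (reflIso h).measurePreserving

lemma integral_comp_refl (h : c ^ 2 + s ^ 2 = 1) (f : E3 → ℝ) :
    ∫ x, f (refl c s x) = ∫ x, f x :=
  (measurePreserving_refl h).integral_comp' (f := (reflIso h).toMeasurableEquiv) f

lemma nsq_comp_refl (h : c ^ 2 + s ^ 2 = 1) (f : E3 → ℝ) :
    nsq (fun x => f (refl c s x)) = nsq f := integral_comp_refl h fun x => f x ^ 2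

lemma rad_sq (x : E3) : rad x ^ 2 = x 0 ^ 2 + x 1 ^ 2 := Real.sq_sqrt (by positivity)

lemma rad_nonneg (x : E3) : 0 ≤ rad x := Real.sqrt_nonneg _

lemma rad_eq_rad_iff {x y : E3} : rad x = rad y ↔ x 0 ^ 2 + x 1 ^ 2 = y 0 ^ 2 + y 1 ^ 2 := by
  rw [← rad_sq, ← rad_sq, sq_eq_sq₀ (rad_nonneg _) (rad_nonneg _)]

lemma rad_refl (h : c ^ 2 + s ^ 2 = 1) (x : E3) : rad (refl c s x) = rad x := by
  rw [rad_eq_rad_iff]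
  simp
  linear_combination (x 0 ^ 2 + x 1 ^ 2) * h

lemma rad_eq_zero_iff {x : E3} : rad x = 0 ↔ x 0 = 0 ∧ x 1 = 0 := by
  rw [← sq_eq_zero_iff, rad_sq]
  constructor
  · intro h
    constructor <;> nlinarith [sq_nonneg (x 0), sq_nonneg (x 1)]
  · rintro ⟨h1, h2⟩
    simp [h1, h2]

/-- Reflections through vertical planes already act transitively on horizontal circles, so
invariance under them is full axisymmetry. -/
lemma exists_refl_eq {x y : E3} (h : rad x = rad y) (h2 : x 2 = y 2) :
    ∃ c s : ℝ, c ^ 2 + s ^ 2 = 1 ∧ refl c s x = y := by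
  have hr := rad_eq_rad_iff.1 h
  by_cases hx : rad x = 0
  · refine ⟨1, 0, by norm_num, ?_⟩
    have h1 := rad_eq_zero_iff.1 hx
    have h3 := rad_eq_zero_iff.1 (h ▸ hx)
    ext k
    fin_cases k <;> simp [h1, h3, h2]
  · have hx' : x 0 ^ 2 + x 1 ^ 2 ≠ 0 := by rw [← rad_sq]; exact pow_ne_zero 2 hx
    -- These are the cosine and sine of `α + β`, where `α` and `β` are the polar angles of `x` and
    -- `y`.
    refine ⟨(x 0 * y 0 - x 1 * y 1) / (x 0 ^ 2 + x 1 ^ 2),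
      (x 0 * y 1 + x 1 * y 0) / (x 0 ^ 2 + x 1 ^ 2), ?_, ?_⟩
    · field_simp
      linear_combination (-(x 0 ^ 2 + x 1 ^ 2)) * hr
    · ext k
      fin_cases k
      · simp
        field_simp
        ring
      · simp
        field_simp
        ring
      · simpa using h2

/-- Each derivative of the composite is a combination, with coefficients from `reflMat`, of composed
derivatives; the induction on the word is therefore over all families at once. -/
lemma pdl_comp_refl_bound (h : c ^ 2 + s ^ 2 = 1) {J : Set ℝ} (l : List (Fin 3))
    {a : ℝ → E3 → ℝ} (ha : SobFam J a) :
    ∃ B : ℝ≥0, ∀ t ∈ J, eLpNorm (pdl l (fun x => a t (refl c s x))) 2 volume ≤ B := by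
  induction l generalizing a with
  | nil =>
    obtain ⟨B, hB⟩ := ha.bound []
    refine ⟨B, fun t ht => ?_⟩
    have := eLpNorm_comp_measurePreserving (p := 2)
      ((ha.smooth t ht).continuous.aestronglyMeasurable) (measurePreserving_refl h)
    exact this.trans_le (hB t ht)
  | cons i l ih =>
    choose B hB using fun j => ih (ha.pd j)
    refine ⟨∑ j, ‖reflMat c s i j‖₊ * B j, fun t ht => ?_⟩
    have hc : ∀ j, ContDiff ℝ ∞ fun x => pd j (a t) (refl c s x) := fun j =>
      (contDiff_pd (ha.smooth t ht) j).comp (refl c s).contDiff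
    have hc' : ∀ j, ContDiff ℝ ∞ fun x => reflMat c s i j * pd j (a t) (refl c s x) := fun j =>
      contDiff_const.mul (hc j)
    have e : pdl (i :: l) (fun x => a t (refl c s x)) = fun x =>
        reflMat c s i 0 * pdl l (fun x => pd 0 (a t) (refl c s x)) x +
        reflMat c s i 1 * pdl l (fun x => pd 1 (a t) (refl c s x)) x +
        reflMat c s i 2 * pdl l (fun x => pd 2 (a t) (refl c s x)) x := by
      have : pd i (fun x => a t (refl c s x)) = fun x =>
          reflMat c s i 0 * pd 0 (a t) (refl c s x) + reflMat c s i 1 * pd 1 (a t) (refl c s x) +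
          reflMat c s i 2 * pd 2 (a t) (refl c s x) := by
        funext x
        rw [pd_comp_refl c s ((ha.smooth t ht).differentiable (by simp)), Fin.sum_univ_three]
      rw [pdl, this, pdl_add ((hc' 0).add (hc' 1)) (hc' 2), pdl_add (hc' 0) (hc' 1),
        pdl_const_mul _ (hc 0), pdl_const_mul _ (hc 1), pdl_const_mul _ (hc 2)]
    have hm : ∀ j, AEStronglyMeasurable
        (fun x => reflMat c s i j * pdl l (fun x => pd j (a t) (refl c s x)) x) volume := fun j =>
      ((contDiff_pdl (hc j) l).continuous.const_smul (reflMat c s i j)).aestronglyMeasurable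
    have hn : ∀ j, eLpNorm (fun x => reflMat c s i j * pdl l (fun x => pd j (a t) (refl c s x)) x)
        2 volume ≤ (‖reflMat c s i j‖₊ * B j : ℝ≥0) := fun j => by
      refine (eLpNorm_const_smul_le (c := reflMat c s i j)).trans ?_
      push_cast
      exact mul_le_mul_right (hB j t ht) _
    rw [e, Fin.sum_univ_three]
    push_cast
    refine (eLpNorm_add_le ((hm 0).add (hm 1)) (hm 2) (by norm_num)).trans (add_le_add
      ((eLpNorm_add_le (hm 0) (hm 1) (by norm_num)).trans (add_le_add ?_ ?_)) ?_)
    · exact_mod_cast hn 0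
    · exact_mod_cast hn 1
    · exact_mod_cast hn 2

lemma SobFam.comp_refl (h : c ^ 2 + s ^ 2 = 1) {J : Set ℝ} {a : ℝ → E3 → ℝ} (ha : SobFam J a) :
    SobFam J fun t x => a t (refl c s x) where
  smooth t ht := (ha.smooth t ht).comp (refl c s).contDiff
  bound l := pdl_comp_refl_bound h l ha

lemma JointSmooth.comp_refl {J : Set ℝ} {a : ℝ → E3 → ℝ} (ha : JointSmooth J a) :
    JointSmooth J fun t x => a t (refl c s x) := by
  refine ContDiffOn.comp (g := fun q : ℝ × E3 => a q.1 q.2) (f := fun q : ℝ × E3 => (q.1, refl c s q.2)) ha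
    ?_ fun q hq => ⟨hq.1, trivial⟩
  exact contDiffOn_fst.prodMk ((refl c s).contDiff.comp_contDiffOn contDiffOn_snd)

lemma adv_comp_refl (h : c ^ 2 + s ^ 2 = 1) {v : Fin 3 → E3 → ℝ} {a : E3 → ℝ}
    (ha : Differentiable ℝ a) (x : E3) :
    adv (fun i y => ∑ j, reflMat c s i j * v j (refl c s y)) (fun y => a (refl c s y)) x =
      adv v a (refl c s x) := by
  simp only [adv, pd_comp_refl c s ha, Fin.sum_univ_three]
  simp [reflMat]
  linear_combination (v 0 (refl c s x) * pd 0 a (refl c s x) +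
    v 1 (refl c s x) * pd 1 a (refl c s x)) * h

lemma lapH_comp_refl (h : c ^ 2 + s ^ 2 = 1) {a : E3 → ℝ} (ha : ContDiff ℝ ∞ a) (x : E3) :
    lapH (fun y => a (refl c s y)) x = lapH a (refl c s x) := by
  have hd := ha.differentiable (by simp)
  have hdd : ∀ i, Differentiable ℝ (pd i a) := fun i => (contDiff_pd ha i).differentiable (by simp)
  have hc : ∀ i, Differentiable ℝ fun y => pd i a (refl c s y) := fun i =>
    (hdd i).comp (refl c s).differentiable
  have e0 : pd 0 (fun y => a (refl c s y)) = fun y => c * pd 0 a (refl c s y) +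
      s * pd 1 a (refl c s y) := by
    funext y
    rw [pd_comp_refl c s hd, Fin.sum_univ_three]
    simp [reflMat]
  have e1 : pd 1 (fun y => a (refl c s y)) = fun y => s * pd 0 a (refl c s y) +
      (-c) * pd 1 a (refl c s y) := by
    funext y
    rw [pd_comp_refl c s hd, Fin.sum_univ_three]
    simp [reflMat]
  simp only [lapH]
  rw [e0, e1, pd_add 0 ((hc 0 x).const_mul _) ((hc 1 x).const_mul _),
    pd_add 1 ((hc 0 x).const_mul _) ((hc 1 x).const_mul _), pd_const_mul 0 _ (hc 0 x),
    pd_const_mul 0 _ (hc 1 x), pd_const_mul 1 _ (hc 0 x), pd_const_mul 1 _ (hc 1 x)]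
  simp only [pd_comp_refl c s (hdd _), Fin.sum_univ_three]
  simp [reflMat]
  linear_combination (pd 0 (pd 0 a) (refl c s x) + pd 1 (pd 1 a) (refl c s x)) * h

end refl

lemma dtW_sum_const_mul {J : Set ℝ} (hJ : UniqueDiffOn ℝ J) {a : Fin 3 → ℝ → E3 → ℝ}
    (ha : ∀ j, JointSmooth J (a j)) (m : Fin 3 → ℝ) {t : ℝ} (ht : t ∈ J) (x : E3) :
    dtW J (fun t x => ∑ j, m j * a j t x) t x = ∑ j, m j * dtW J (a j) t x :=
  (HasDerivWithinAt.fun_sum fun j _ =>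
    ((ha j).hasDerivWithinAt ht x).const_mul (m j)).derivWithin (hJ t ht)

namespace CompSol
variable {T : ℝ} {U : Fin 3 → ℝ → E3 → ℝ} {R P : ℝ → E3 → ℝ} {c s : ℝ}

/-- The reflection of a solution is a solution. -/
lemma comp_refl (hT : 0 < T) (h : CompSol T U R P) (hc : c ^ 2 + s ^ 2 = 1) :
    CompSol T (fun i t x => ∑ j, reflMat c s i j * U j t (refl c s x))
      (fun t x => R t (refl c s x)) (fun t x => P t (refl c s x)) := by
  have hJ := uniqueDiffOn_Icc hT
  have hUd : ∀ t ∈ Icc 0 T, ∀ j, Differentiable ℝ fun x => U j t (refl c s x) := fun t ht j =>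
    ((h.U_sob j).sob ht).differentiable.comp (refl c s).differentiable
  have hpd : ∀ t ∈ Icc 0 T, ∀ i k x, pd k (fun x => ∑ j, reflMat c s i j * U j t (refl c s x)) x =
      ∑ j, reflMat c s i j * pd k (fun x => U j t (refl c s x)) x := fun t ht i k x => by
    rw [pd_sum k Finset.univ _ fun j _ => (hUd t ht j x).const_mul _]
    exact Finset.sum_congr rfl fun j _ => pd_const_mul k _ (hUd t ht j x)
  refine ⟨fun i => SobFam.sum _ fun j _ => ((h.U_sob j).comp_refl hc).const_mul _,
    fun i => ContDiffOn.sum fun j _ => (h.U_joint j).comp_refl.const_mul _,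
    h.R_sob.comp_refl hc, h.R_joint.comp_refl,
    fun t ht => (h.P_smooth t ht).comp (refl c s).contDiff, fun t ht i x => ?_, fun t ht x => ?_,
    fun t ht x => ?_⟩
  · rw [dtW_sum_const_mul hJ (fun j => (h.U_joint j).comp_refl) _ ht]
    have e1 : adv (fun i y => ∑ j, reflMat c s i j * U j t (refl c s y))
        (fun x => ∑ j, reflMat c s i j * U j t (refl c s x)) x =
        ∑ j, reflMat c s i j * adv (fun j => U j t) (U j t) (refl c s x) := by
      simp only [← adv_comp_refl hc ((h.U_sob _).sob ht).differentiable]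
      simp only [adv, hpd t ht, Finset.mul_sum]
      rw [Finset.sum_comm]
      refine Finset.sum_congr rfl fun j _ => Finset.sum_congr rfl fun k _ => by ring
    have e2 : lapH (fun x => ∑ j, reflMat c s i j * U j t (refl c s x)) x =
        ∑ j, reflMat c s i j * lapH (U j t) (refl c s x) := by
      simp only [← lapH_comp_refl hc ((h.U_sob _).sob ht).contDiff]
      have hk : ∀ k, pd k (fun x => ∑ j, reflMat c s i j * U j t (refl c s x)) =
          fun x => ∑ j, reflMat c s i j * pd k (fun x => U j t (refl c s x)) x := fun k =>
        funext fun x => hpd t ht i k x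
      have hd : ∀ j k, DifferentiableAt ℝ (pd k (fun x => U j t (refl c s x))) x := fun j k =>
        (contDiff_pd (((h.U_sob j).sob ht).contDiff.comp (refl c s).contDiff) k).differentiable
          (by simp) x
      simp only [lapH, hk]
      rw [pd_sum 0 Finset.univ _ fun j _ => (hd j 0).const_mul _,
        pd_sum 1 Finset.univ _ fun j _ => (hd j 1).const_mul _, ← Finset.sum_add_distrib]
      refine Finset.sum_congr rfl fun j _ => ?_
      rw [pd_const_mul 0 _ (hd j 0), pd_const_mul 1 _ (hd j 1)]
      ring
    have e3 := pd_comp_refl c s ((h.P_smooth t ht).differentiable (by simp)) i x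
    rw [e1, e2, e3, ← Finset.sum_add_distrib, ← Finset.sum_sub_distrib, ← Finset.sum_add_distrib]
    have e4 : ∀ j, dtW (Icc 0 T) (fun t x => U j t (refl c s x)) t x =
        dtW (Icc 0 T) (U j) t (refl c s x) := fun j => rfl
    have e5 := fun j => h.momentum t ht j (refl c s x)
    calc _ = ∑ j, reflMat c s i j * (dtW (Icc 0 T) (U j) t (refl c s x) +
          adv (fun j => U j t) (U j t) (refl c s x) - lapH (U j t) (refl c s x) +
          pd j (P t) (refl c s x)) := Finset.sum_congr rfl fun j _ => by rw [e4]; ring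
      _ = _ := by
        simp only [e5]
        fin_cases i <;> simp [reflMat]
  · rw [adv_comp_refl hc (h.R_sob.sob ht).differentiable]
    exact h.transport t ht (refl c s x)
  · have e1 := h.incompressible t ht (refl c s x)
    simp only [hpd t ht, pd_comp_refl c s ((h.U_sob _).sob ht).differentiable]
    simp only [Fin.sum_univ_three] at e1 ⊢
    simp [reflMat]
    linear_combination e1 + (pd 0 (U 0 t) (refl c s x) + pd 1 (U 1 t) (refl c s x)) * hc

/-- Symmetric data produce symmetric solutions. -/
lemma symm (hT : 0 < T) (h : CompSol T U R P) (hc : c ^ 2 + s ^ 2 = 1)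
    (hU : ∀ i x, U i 0 x = ∑ j, reflMat c s i j * U j 0 (refl c s x))
    (hR : ∀ x, R 0 x = R 0 (refl c s x)) :
    ∀ t ∈ Icc 0 T, (∀ i x, U i t x = ∑ j, reflMat c s i j * U j t (refl c s x)) ∧
      ∀ x, R t x = R t (refl c s x) := by
  intro t ht
  obtain ⟨h1, h2⟩ := h.unique hT (h.comp_refl hT hc) (fun i => funext (hU i)) (funext hR) t ht
  exact ⟨fun i => congrFun (h1 i), congrFun h2⟩

end CompSol

end HBS

namespace HBS

/-! ### Smooth solutions in components -/

lemma sobFam_of_iteratedFDeriv {F : Type*} [NormedAddCommGroup F] [NormedSpace ℝ F] {J : Set ℝ}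
    {a : ℝ → E3 → F} (ha : ∀ t ∈ J, ContDiff ℝ ∞ (a t))
    (hb : ∀ k : ℕ, ∃ B : ℝ≥0, ∀ t ∈ J, eLpNorm (iteratedFDeriv ℝ k (a t)) 2 volume ≤ B)
    (L : F →L[ℝ] ℝ) (hL : ∀ v, ‖L v‖ ≤ ‖v‖) : SobFam J fun t x => L (a t x) where
  smooth t ht := L.contDiff.comp (ha t ht)
  bound l := by
    obtain ⟨B, hB⟩ := hb l.length
    refine ⟨B, fun t ht => ?_⟩
    obtain ⟨m, hm, he⟩ := pdl_eq_iteratedFDeriv l (a t) L (ha t ht)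
    refine (eLpNorm_mono fun x => ?_).trans (hB t ht)
    rw [he]
    refine (hL _).trans (((iteratedFDeriv ℝ l.length (a t) x).le_opNorm m).trans ?_)
    exact mul_le_of_le_one_right (norm_nonneg _)
      (Finset.prod_le_one (fun _ _ => norm_nonneg _) fun k _ => hm k)

lemma pd_apply {v : E3 → E3} {x : E3} (hv : DifferentiableAt ℝ v x) (i j : Fin 3) :
    pd j (fun y => v y i) x = pd j v x i := by
  have h := (EuclideanSpace.proj i : E3 →L[ℝ] ℝ).hasFDerivAt.comp x hv.hasFDerivAt
  exact (pd_eq_of_hasFDerivAt h j).trans (by simp [pd])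

lemma lapH_apply {v : E3 → E3} (hv : ContDiff ℝ ∞ v) (i : Fin 3) (x : E3) :
    lapH (fun y => v y i) x = lapH v x i := by
  have e : ∀ j, pd j (fun y => v y i) = fun y => pd j v y i := fun j =>
    funext fun y => pd_apply (hv.differentiable (by simp) y) i j
  have hd : ∀ j, DifferentiableAt ℝ (pd j v) x := fun j =>
    (contDiff_pd hv j).differentiable (by simp) x
  simp only [lapH, e]
  rw [pd_apply (hd 0), pd_apply (hd 1)]
  rfl

lemma gradient_apply (f : E3 → ℝ) (x : E3) (i : Fin 3) : gradient f x i = pd i f x := by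
  have h : inner ℝ (gradient f x) (bv i) = fderiv ℝ f x (bv i) := by
    rw [gradient, InnerProductSpace.toDual_symm_apply]
  rw [pd, ← h, EuclideanSpace.inner_single_right]
  simp

lemma Icc_subset_timeInterval {T : EReal} {T₁ : ℝ} (h : T₁ ∈ timeInterval T) :
    Icc 0 T₁ ⊆ timeInterval T := fun _ ht =>
  ⟨ht.1, lt_of_le_of_lt (EReal.coe_le_coe_iff.2 ht.2) h.2⟩

lemma IsSmoothSolution.compSol {T : EReal} {u₀ : E3 → E3} {ρ₀ : E3 → ℝ} {u : ℝ → E3 → E3}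
    {ρ P : ℝ → E3 → ℝ} (h : IsSmoothSolution T u₀ ρ₀ u ρ P) {T₁ : ℝ} (h0 : 0 < T₁)
    (h1 : T₁ ∈ timeInterval T) : CompSol T₁ (fun i t x => u t x i) ρ P := by
  have hsub := Icc_subset_timeInterval h1
  have hJ := uniqueDiffOn_Icc h0
  have hu : ∀ t ∈ timeInterval T, ContDiff ℝ ∞ (u t) := fun t ht => by
    rw [← contDiffOn_univ]
    exact ContDiffOn.comp (g := fun q : ℝ × E3 => u q.1 q.2) (f := fun x => (t, x)) h.u_smooth
      (by fun_prop) fun x _ => ⟨ht, trivial⟩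
  have hρj : JointSmooth (timeInterval T) ρ := h.ρ_smooth
  have hut : ∀ t ∈ timeInterval T, ∀ x, HasDerivWithinAt (fun s => u s x)
      (derivWithin (fun s => u s x) (timeInterval T) t) (timeInterval T) t := fun t ht x => by
    have h3 := (ContDiffOn.comp (g := fun q : ℝ × E3 => u q.1 q.2) (f := fun s : ℝ => (s, x))
      h.u_smooth (by fun_prop) (show MapsTo _ (timeInterval T) _ from fun s hs => ⟨hs, trivial⟩))
    exact (h3.differentiableOn (by simp) t ht).hasDerivWithinAt
  refine ⟨fun i => ?_, fun i => ?_, ?_, hρj.mono hsub, fun t ht => h.P_smooth t (hsub ht),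
    fun t ht i x => ?_, fun t ht x => ?_, fun t ht x => ?_⟩
  · exact sobFam_of_iteratedFDeriv (fun t ht => hu t (hsub ht)) (fun k => h.u_sobolev k T₁ h1)
      (EuclideanSpace.proj i) fun v => PiLp.norm_apply_le v i
  · exact (EuclideanSpace.proj i : E3 →L[ℝ] ℝ).contDiff.comp_contDiffOn
      (h.u_smooth.mono (prod_mono_left hsub))
  · exact sobFam_of_iteratedFDeriv (fun t ht => hρj.smooth (hsub ht))
      (fun k => h.ρ_sobolev k T₁ h1) (ContinuousLinearMap.id ℝ ℝ) fun v => le_rfl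
  -- The derivative within the whole time interval restricts to `[0, T₁]`, where unique
  -- differentiability identifies it with `dtW`; this covers the end points.
  · have e1 : dtW (Icc 0 T₁) (fun t x => u t x i) t x =
        derivWithin (fun s => u s x) (timeInterval T) t i :=
      ((EuclideanSpace.proj i : E3 →L[ℝ] ℝ).hasFDerivAt.comp_hasDerivWithinAt t
        ((hut t (hsub ht) x).mono hsub)).derivWithin (hJ t ht)
    have e2 := congrArg (fun v : E3 => v i) (h.momentum t (hsub ht) x)
    have e3 : (fderiv ℝ (u t) x (u t x)) i = adv (fun j x => u t x j) (fun x => u t x i) x := by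
      rw [fderiv_apply_eq_sum]
      simp only [adv, pd_apply ((hu t (hsub ht)).differentiable (by simp) x)]
      simp
    simp only [PiLp.add_apply, PiLp.sub_apply, e3, gradient_apply,
      ← lapH_apply (hu t (hsub ht))] at e2
    rw [e1, e2]
    fin_cases i <;> simp [e₃]
  · have e1 : dtW (Icc 0 T₁) ρ t x = derivWithin (fun s => ρ s x) (timeInterval T) t := by
      have h3 := (ContDiffOn.comp (g := fun q : ℝ × E3 => ρ q.1 q.2) (f := fun s : ℝ => (s, x))
        h.ρ_smooth (by fun_prop) (show MapsTo _ (timeInterval T) _ from fun s hs => ⟨hs, trivial⟩))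
      exact ((h3.differentiableOn (by simp) t (hsub ht)).hasDerivWithinAt.mono hsub).derivWithin
        (hJ t ht)
    have e2 := h.transport t (hsub ht) x
    rw [fderiv_apply_eq_sum] at e2
    rw [e1]
    exact e2
  · have e := h.incompressible t (hsub ht) x
    simp only [pd_apply ((hu t (hsub ht)).differentiable (by simp) x)]
    exact e

/-! ### Axisymmetric functions -/

/-- The function depends only on `r` and `z`. -/
def AxiS (h : E3 → ℝ) : Prop := ∀ x y : E3, rad x = rad y → x 2 = y 2 → h x = h y

lemma AxiS.comp_refl {h : E3 → ℝ} (hh : AxiS h) {c s : ℝ} (hc : c ^ 2 + s ^ 2 = 1) (x : E3) :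
    h (refl c s x) = h x := hh _ _ (rad_refl hc x) (refl_two c s x)

lemma axiS_of_comp_refl {h : E3 → ℝ}
    (hh : ∀ c s : ℝ, c ^ 2 + s ^ 2 = 1 → ∀ x, h (refl c s x) = h x) : AxiS h := by
  intro x y hxy h2
  obtain ⟨c, s, hc, rfl⟩ := exists_refl_eq hxy h2
  exact (hh c s hc x).symm

lemma dense_coord_zero_ne : Dense {x : E3 | x 0 ≠ 0} := by
  intro x
  by_cases hx : x 0 = 0
  · have h1 : Filter.Tendsto (fun n : ℕ => x + (1 / ((n : ℝ) + 1)) • bv 0) Filter.atTop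
        (nhds (x + (0 : ℝ) • bv 0)) :=
      (tendsto_one_div_add_atTop_nhds_zero_nat.smul_const _).const_add _
    rw [zero_smul, add_zero] at h1
    refine mem_closure_of_tendsto h1 (Filter.Eventually.of_forall fun n => ?_)
    simp [hx]
    positivity
  · exact subset_closure hx

/-- Identities obtained by dividing by `x₀` hold first off a plane and extend by density. -/
lemma eq_of_eq_of_coord_zero_ne {f g : E3 → ℝ} (hf : Continuous f) (hg : Continuous g)
    (h : ∀ x : E3, x 0 ≠ 0 → f x = g x) : f = g :=
  Continuous.ext_on dense_coord_zero_ne hf hg fun x hx => h x hx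

lemma ae_coord_zero_ne : ∀ᵐ x : E3, x 0 ≠ 0 := by
  have h : (volume : Measure E3) {x | x 0 = 0} = 0 := by
    have hm : MeasurableSet {x : E3 | x 0 = 0} :=
      (isClosed_singleton.preimage (contDiff_coord (n := 0) 0).continuous).measurableSet
    rw [← lintegral_indicator_one hm, lintegral_slice (measurable_one.indicator hm)]
    have : ∀ z : ℝ, ∫⁻ p : ℝ × ℝ, {x : E3 | x 0 = 0}.indicator 1 !₂[p.1, p.2, z] = 0 := fun z => by
      have e : (fun p : ℝ × ℝ => {x : E3 | x 0 = 0}.indicator (1 : E3 → ℝ≥0∞) !₂[p.1, p.2, z]) =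
          ({0} ×ˢ univ : Set (ℝ × ℝ)).indicator 1 := by
        funext p
        by_cases hp : p.1 = 0 <;> simp [indicator, mem_prod, hp]
      rw [e, lintegral_indicator_one ((measurableSet_singleton _).prod MeasurableSet.univ),
        Measure.volume_eq_prod, Measure.prod_prod]
      simp
    simp [this]
  exact measure_eq_zero_iff_ae_notMem.1 h

/-- A horizontal vector field equivariant under reflections is radial. -/
lemma radial_of_symm {a b : E3 → ℝ} (ha : ContDiff ℝ ∞ a) (hb : Continuous b)
    (hsym : ∀ c s : ℝ, c ^ 2 + s ^ 2 = 1 → ∀ x, a (refl c s x) = c * a x + s * b x ∧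
      b (refl c s x) = s * a x - c * b x) :
    (∀ x, a x = x 0 * quot a x) ∧ (∀ x, b x = x 1 * quot a x) ∧ AxiS (quot a) := by
  have hq : Continuous (quot a) := (contDiff_avg (contDiff_pd ha 0) 0).continuous
  -- The reflection that changes the sign of `x₀` fixes the plane `x₀ = 0` and reverses `a`.
  have ha0 : ∀ x : E3, x 0 = 0 → a x = 0 := fun x hx => by
    have h1 := (hsym (-1) 0 (by norm_num) x).1
    have h2 : refl (-1) 0 x = x := by
      ext k
      fin_cases k <;> simp [hx]
    rw [h2] at h1
    linarith
  have hqa : ∀ x, x 0 * quot a x = a x := coord_mul_quot ha ha0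
  have hqb : ∀ x, b x = x 1 * quot a x := by
    refine congrFun (eq_of_eq_of_coord_zero_ne hb
      ((contDiff_coord (n := 0) 1).continuous.mul hq) fun x hx => ?_)
    have hr : x 0 ^ 2 + x 1 ^ 2 ≠ 0 := by positivity
    -- Cosine and sine of twice the polar angle: the reflection through the vertical plane
    -- containing `x`. It fixes `x`, so the vector there lies in that plane, which excludes an
    -- angular component.
    set c := (x 0 ^ 2 - x 1 ^ 2) / (x 0 ^ 2 + x 1 ^ 2) with hc
    set s := 2 * x 0 * x 1 / (x 0 ^ 2 + x 1 ^ 2) with hs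
    have hcs : c ^ 2 + s ^ 2 = 1 := by rw [hc, hs]; field_simp; ring
    have h2 : refl c s x = x := by
      ext k
      fin_cases k
      · simp only [hc, hs, Fin.zero_eta, refl_zero]; field_simp; ring
      · simp only [hc, hs, Fin.mk_one, refl_one]; field_simp; ring
      · simp
    have h3 := (hsym c s hcs x).2
    rw [h2, ← hqa, hc, hs] at h3
    field_simp at h3
    have h4 : x 0 ^ 2 * (b x - x 1 * quot a x) = 0 := by nlinarith
    have := (mul_eq_zero.1 h4).resolve_left (by positivity)
    linarith
  refine ⟨fun x => (hqa x).symm, hqb, axiS_of_comp_refl fun c s hcs => ?_⟩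
  have key : ∀ y : E3, y 0 ≠ 0 → quot a y = quot a (refl c s y) := by
    intro y hy
    have h1 := (hsym c s hcs (refl c s y)).1
    rw [refl_refl hcs, ← hqa y, ← hqa (refl c s y), hqb (refl c s y)] at h1
    have h2 : y 0 = c * refl c s y 0 + s * refl c s y 1 := by
      simp; linear_combination -(y 0) * hcs
    have h3 : y 0 * quot a y = y 0 * quot a (refl c s y) := by
      linear_combination h1 - quot a (refl c s y) * h2
    exact mul_left_cancel₀ hy h3
  intro x
  exact (congrFun (eq_of_eq_of_coord_zero_ne hq (hq.comp (refl c s).continuous) key) x).symm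

/-- `∂_r h / r`, for an axisymmetric function `h`. -/
noncomputable def rq (h : E3 → ℝ) : E3 → ℝ := quot (pd 0 h)

lemma SobFam.rq {J : Set ℝ} {a : ℝ → E3 → ℝ} (h : SobFam J a) : SobFam J fun t => rq (a t) :=
  (h.pd 0).quot

lemma Sob.rq {f : E3 → ℝ} (h : Sob f) : Sob (rq f) := SobFam.rq h

lemma AxiS.pd_refl {h : E3 → ℝ} (hh : AxiS h) (hd : Differentiable ℝ h) {c s : ℝ}
    (hc : c ^ 2 + s ^ 2 = 1) (i : Fin 3) (x : E3) :
    pd i h x = ∑ j, reflMat c s i j * pd j h (refl c s x) := by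
  rw [← pd_comp_refl c s hd]
  congr 1
  funext y
  exact (hh.comp_refl hc y).symm

/-- The horizontal gradient of an invariant function is equivariant under reflections, hence radial.
-/
lemma AxiS.pd_eq {h : E3 → ℝ} (hh : AxiS h) (hd : ContDiff ℝ ∞ h) :
    (∀ x, pd 0 h x = x 0 * rq h x) ∧ (∀ x, pd 1 h x = x 1 * rq h x) ∧ AxiS (rq h) := by
  refine radial_of_symm (contDiff_pd hd 0) (contDiff_pd hd 1).continuous fun c s hc x => ?_
  have h1 := hh.pd_refl (hd.differentiable (by simp)) hc 0 (refl c s x)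
  have h2 := hh.pd_refl (hd.differentiable (by simp)) hc 1 (refl c s x)
  rw [refl_refl hc, Fin.sum_univ_three] at h1 h2
  constructor
  · rw [h1]; simp [reflMat]
  · rw [h2]; simp [reflMat]; ring

lemma AxiS.pd_two {h : E3 → ℝ} (hh : AxiS h) (hd : Differentiable ℝ h) : AxiS (pd 2 h) := by
  refine axiS_of_comp_refl fun c s hc x => ?_
  rw [hh.pd_refl hd hc 2 x, Fin.sum_univ_three]
  simp [reflMat]

lemma AxiS.sub {f g : E3 → ℝ} (hf : AxiS f) (hg : AxiS g) : AxiS fun x => f x - g x :=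
  fun x y h1 h2 => by simp only [hf x y h1 h2, hg x y h1 h2]

end HBS

namespace HBS

lemma integrable_mul_of_bounded {F k : E3 → ℝ} (hF : Integrable F)
    (hk : AEStronglyMeasurable k) {C : ℝ} (hC : ∀ x, |k x| ≤ C) :
    Integrable fun x => F x * k x := by
  refine (hF.norm.const_mul C).mono' (hF.1.mul hk) (Filter.Eventually.of_forall fun x => ?_)
  rw [norm_mul, mul_comm]
  exact mul_le_mul_of_nonneg_right (hC x) (norm_nonneg _)

/-! ### The singular radial operator -/

lemma quot_eq_of_eq_mul {a k : E3 → ℝ} (ha : ContDiff ℝ ∞ a) (hk : Continuous k)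
    (h : ∀ x : E3, a x = x 0 * k x) : quot a = k := by
  refine eq_of_eq_of_coord_zero_ne (contDiff_avg (contDiff_pd ha 0) 0).continuous hk fun x hx => ?_
  refine mul_left_cancel₀ hx ?_
  rw [← h, coord_mul_quot ha]
  intro y hy
  rw [h, hy, zero_mul]

lemma hasDerivAt_inv_add {y ε : ℝ} (h : y + ε ≠ 0) :
    HasDerivAt (fun y : ℝ => (y + ε)⁻¹) (-((y + ε) ^ 2)⁻¹) y := by
  have := ((hasDerivAt_id y).add_const ε).fun_inv h
  simpa [neg_div] using this

lemma differentiable_rsq : Differentiable ℝ fun y : E3 => y 0 ^ 2 + y 1 ^ 2 := by fun_prop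

lemma pd_rsq {i : Fin 3} (hi : i ≠ 2) (x : E3) :
    pd i (fun y : E3 => y 0 ^ 2 + y 1 ^ 2) x = 2 * x i := by
  have e : (fun y : E3 => y 0 ^ 2 + y 1 ^ 2) = fun y : E3 => y 0 * y 0 + y 1 * y 1 := by
    funext y; ring
  have h := differentiable_coord
  rw [e, pd_add i ((h 0 x).fun_mul (h 0 x)) ((h 1 x).fun_mul (h 1 x)), pd_coord_mul i 0 (h 0 x),
    pd_coord_mul i 1 (h 1 x), pd_coord, pd_coord]
  fin_cases i
  · simp; ring
  · simp; ring
  · exact absurd rfl hi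

lemma pd_rsq_two (x : E3) : pd 2 (fun y : E3 => y 0 ^ 2 + y 1 ^ 2) x = 0 := by
  have e : (fun y : E3 => y 0 ^ 2 + y 1 ^ 2) = fun y : E3 => y 0 * y 0 + y 1 * y 1 := by
    funext y; ring
  have h := differentiable_coord
  rw [e, pd_add 2 ((h 0 x).fun_mul (h 0 x)) ((h 1 x).fun_mul (h 1 x)), pd_coord_mul 2 0 (h 0 x),
    pd_coord_mul 2 1 (h 1 x), pd_coord, pd_coord]
  simp

/-- The derivative of `x_i / (r² + ε)`. -/
lemma pd_coord_div {i : Fin 3} (hi : i ≠ 2) {ε : ℝ} {x : E3} (hx : x 0 ^ 2 + x 1 ^ 2 + ε ≠ 0) :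
    DifferentiableAt ℝ (fun y : E3 => y i * (y 0 ^ 2 + y 1 ^ 2 + ε)⁻¹) x ∧
    pd i (fun y : E3 => y i * (y 0 ^ 2 + y 1 ^ 2 + ε)⁻¹) x =
      (x 0 ^ 2 + x 1 ^ 2 + ε)⁻¹ - 2 * x i ^ 2 * ((x 0 ^ 2 + x 1 ^ 2 + ε) ^ 2)⁻¹ := by
  have hd := hasDerivAt_inv_add hx
  have h1 : DifferentiableAt ℝ (fun y : E3 => (y 0 ^ 2 + y 1 ^ 2 + ε)⁻¹) x :=
    hd.differentiableAt.comp (f := fun y : E3 => y 0 ^ 2 + y 1 ^ 2) x (differentiable_rsq x)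
  refine ⟨(differentiable_coord i x).mul h1, ?_⟩
  rw [pd_coord_mul i i h1, pd_comp_real i hd (differentiable_rsq x), pd_rsq hi]
  simp
  ring

/-- In cylindrical coordinates the integral is formally `-π ∫ φ(0, z)² dz`. To avoid the axis, `x_h
/ r²` is replaced by `x_h / (r² + ε)`, whose horizontal divergence `2 ε / (r² + ε)²` is nonnegative;
integrate by parts against `φ²` and let `ε` tend to 0. -/
lemma integral_mul_rq_nonpos {φ : E3 → ℝ} (h : Sob φ) (ha : AxiS φ) :
    ∫ x, φ x * rq φ x ≤ 0 := by
  have hpd := ha.pd_eq h.contDiff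
  set N : ℝ → E3 → ℝ := fun ε x => x 0 ^ 2 + x 1 ^ 2 + ε with hN
  have hpos : ∀ {ε}, 0 < ε → ∀ x, 0 < N ε x := fun hε x => by simp only [hN]; positivity
  have hint : Integrable fun x => φ x * rq φ x := h.integrable_mul h.rq
  have key : ∀ ε > 0, ∫ x, φ x * rq φ x * ((x 0 ^ 2 + x 1 ^ 2) * (N ε x)⁻¹) ≤ 0 := by
    intro ε hε
    have hNc : Continuous fun x => (N ε x)⁻¹ := by
      refine Continuous.inv₀ ?_ fun x => (hpos hε x).ne'
      simp only [hN]
      fun_prop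
    have hm : ∀ i : Fin 3, i ≠ 2 → Continuous fun x : E3 => x i * (N ε x)⁻¹ := fun i _ =>
      (contDiff_coord (n := 0) i).continuous.mul hNc
    have hle : ∀ i : Fin 3, i ≠ 2 → ∀ x : E3, x i ^ 2 ≤ N ε x := by
      intro i hi x
      simp only [hN]
      fin_cases i
      · simp; nlinarith [sq_nonneg (x 1)]
      · simp; nlinarith [sq_nonneg (x 0)]
      · exact absurd rfl hi
    have hinv : ∀ x, (N ε x)⁻¹ ≤ ε⁻¹ := fun x =>
      inv_anti₀ hε (by simp only [hN]; nlinarith [sq_nonneg (x 0), sq_nonneg (x 1)])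
    have hb1 : ∀ i : Fin 3, i ≠ 2 → ∀ x : E3, |x i * (N ε x)⁻¹| ≤ 1 + ε⁻¹ := by
      intro i hi x
      rw [abs_mul, abs_of_pos (inv_pos.2 (hpos hε x))]
      have h1 : |x i| ≤ N ε x + 1 := by
        have := hle i hi x
        rw [← sq_abs] at this
        nlinarith [sq_nonneg (|x i| - 1)]
      calc |x i| * (N ε x)⁻¹ ≤ (N ε x + 1) * (N ε x)⁻¹ :=
            mul_le_mul_of_nonneg_right h1 (inv_pos.2 (hpos hε x)).le
        _ = 1 + (N ε x)⁻¹ := by rw [add_mul, mul_inv_cancel₀ (hpos hε x).ne', one_mul]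
        _ ≤ _ := by linarith [hinv x]
    have hdm := fun (i : Fin 3) (hi : i ≠ 2) (x : E3) => pd_coord_div hi (hpos hε x).ne'
    have hc2 : ∀ i : Fin 3, i ≠ 2 → Continuous fun x : E3 => pd i (fun y => y i * (N ε y)⁻¹) x := by
      intro i hi
      have : (fun x : E3 => pd i (fun y => y i * (N ε y)⁻¹) x) = fun x =>
          (N ε x)⁻¹ - 2 * x i ^ 2 * ((N ε x)⁻¹) ^ 2 := by
        funext x
        rw [inv_pow]
        exact (hdm i hi x).2
      rw [this]
      have := (contDiff_coord (n := 0) i).continuous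
      fun_prop
    have hb2 : ∀ i : Fin 3, i ≠ 2 → ∀ x : E3, |pd i (fun y => y i * (N ε y)⁻¹) x| ≤ 2 * ε⁻¹ := by
      intro i hi x
      have e := (hdm i hi x).2
      have h1 := hinv x
      have h2 := inv_pos.2 (hpos hε x)
      have h3 : x i ^ 2 * ((N ε x) ^ 2)⁻¹ ≤ (N ε x)⁻¹ := by
        calc x i ^ 2 * ((N ε x) ^ 2)⁻¹ ≤ N ε x * ((N ε x) ^ 2)⁻¹ :=
              mul_le_mul_of_nonneg_right (hle i hi x) (by have := hpos hε x; positivity)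
          _ = _ := by have := (hpos hε x).ne'; field_simp
      have h4 : 0 ≤ x i ^ 2 * ((N ε x) ^ 2)⁻¹ := by have := hpos hε x; positivity
      rw [show pd i (fun y => y i * (N ε y)⁻¹) x = (N ε x)⁻¹ - 2 * x i ^ 2 * ((N ε x) ^ 2)⁻¹ from e,
        abs_le]
      constructor <;> nlinarith
    have hibp : ∀ i : Fin 3, i ≠ 2 → ∫ x, (φ x * φ x) * pd i (fun y => y i * (N ε y)⁻¹) x =
        -∫ x, pd i (fun x => φ x * φ x) x * (x i * (N ε x)⁻¹) := by
      intro i hi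
      have hφ2 : Integrable fun x => φ x * φ x := h.integrable_mul h
      have hpφ : Integrable fun x => pd i (fun x => φ x * φ x) x := by
        have : (fun x => pd i (fun x => φ x * φ x) x) = fun x => 2 * (φ x * pd i φ x) := by
          funext x
          rw [pd_mul i (h.differentiableAt x) (h.differentiableAt x)]
          ring
        rw [this]
        exact (h.integrable_mul (h.pd i)).const_mul 2
      exact integral_mul_pd_of_integrable i (h.mul h).differentiable (fun x => (hdm i hi x).1)
        (integrable_mul_of_bounded hpφ (hm i hi).aestronglyMeasurable (hb1 i hi))
        (integrable_mul_of_bounded hφ2 (hc2 i hi).aestronglyMeasurable (hb2 i hi))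
        (integrable_mul_of_bounded hφ2 (hm i hi).aestronglyMeasurable (hb1 i hi))
    have hI : ∀ i : Fin 3, i ≠ 2 → Integrable
        fun x => (φ x * φ x) * pd i (fun y => y i * (N ε y)⁻¹) x := fun i hi =>
      integrable_mul_of_bounded (h.integrable_mul h) (hc2 i hi).aestronglyMeasurable (hb2 i hi)
    have hI2 : ∀ i : Fin 3, i ≠ 2 → Integrable
        fun x => pd i (fun x => φ x * φ x) x * (x i * (N ε x)⁻¹) := fun i hi => by
      refine integrable_mul_of_bounded ?_ (hm i hi).aestronglyMeasurable (hb1 i hi)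
      have : pd i (fun x => φ x * φ x) = fun x => 2 * (φ x * pd i φ x) := by
        funext x
        rw [pd_mul i (h.differentiableAt x) (h.differentiableAt x)]
        ring
      rw [this]
      exact (h.integrable_mul (h.pd i)).const_mul 2
    have h1 : 0 ≤ ∫ x, ((φ x * φ x) * pd 0 (fun y => y 0 * (N ε y)⁻¹) x +
        (φ x * φ x) * pd 1 (fun y => y 1 * (N ε y)⁻¹) x) := by
      refine integral_nonneg fun x => ?_
      simp only [Pi.zero_apply]
      rw [(hdm 0 (by decide) x).2, (hdm 1 (by decide) x).2, ← mul_add]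
      refine mul_nonneg (mul_self_nonneg _) ?_
      have := hpos hε x
      have e : x 0 ^ 2 + x 1 ^ 2 + ε = N ε x := rfl
      rw [e]
      have e2 : (N ε x)⁻¹ - 2 * x 0 ^ 2 * (N ε x ^ 2)⁻¹ +
          ((N ε x)⁻¹ - 2 * x 1 ^ 2 * (N ε x ^ 2)⁻¹) = 2 * ε * (N ε x ^ 2)⁻¹ := by
        have e3 : (N ε x)⁻¹ = N ε x * (N ε x ^ 2)⁻¹ := by field_simp
        rw [e3]
        simp only [hN]
        ring
      rw [e2]
      positivity
    rw [integral_add (hI 0 (by decide)) (hI 1 (by decide)), hibp 0 (by decide),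
      hibp 1 (by decide), ← neg_add, ← integral_add (hI2 0 (by decide)) (hI2 1 (by decide))] at h1
    have e : ∀ x, pd 0 (fun x => φ x * φ x) x * (x 0 * (N ε x)⁻¹) +
        pd 1 (fun x => φ x * φ x) x * (x 1 * (N ε x)⁻¹) =
        2 * (φ x * rq φ x * ((x 0 ^ 2 + x 1 ^ 2) * (N ε x)⁻¹)) := by
      intro x
      rw [pd_mul 0 (h.differentiableAt x) (h.differentiableAt x),
        pd_mul 1 (h.differentiableAt x) (h.differentiableAt x), hpd.1, hpd.2.1]
      ring
    simp only [e] at h1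
    rw [integral_const_mul] at h1
    linarith
  -- Dominated convergence: the factor `r² / (r² + ε)` is at most 1 and tends to 1 off the axis.
  have hlim : Filter.Tendsto (fun n : ℕ => ∫ x, φ x * rq φ x *
      ((x 0 ^ 2 + x 1 ^ 2) * (N (1 / ((n : ℝ) + 1)) x)⁻¹)) Filter.atTop
      (nhds (∫ x, φ x * rq φ x)) := by
    refine tendsto_integral_of_dominated_convergence (fun x => |φ x * rq φ x|) (fun n => ?_)
      hint.abs (fun n => Filter.Eventually.of_forall fun x => ?_) ?_
    · have hε : (0 : ℝ) < 1 / ((n : ℝ) + 1) := by positivity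
      refine (((h.continuous.mul h.rq.continuous)).mul (Continuous.mul (by fun_prop) (Continuous.inv₀
        ?_ fun x => (hpos hε x).ne'))).aestronglyMeasurable
      simp only [hN]
      fun_prop
    · have hε : (0 : ℝ) < 1 / ((n : ℝ) + 1) := by positivity
      have hp := hpos hε x
      rw [Real.norm_eq_abs, abs_mul]
      refine mul_le_of_le_one_right (abs_nonneg _) ?_
      rw [abs_of_nonneg (by positivity), ← div_eq_mul_inv, div_le_one hp]
      simp only [hN]
      linarith
    · filter_upwards [ae_coord_zero_ne] with x hx
      have hr : x 0 ^ 2 + x 1 ^ 2 + 0 ≠ 0 := by positivity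
      have h1 : Filter.Tendsto (fun n : ℕ => x 0 ^ 2 + x 1 ^ 2 + 1 / ((n : ℝ) + 1)) Filter.atTop
          (nhds (x 0 ^ 2 + x 1 ^ 2 + 0)) := tendsto_one_div_add_atTop_nhds_zero_nat.const_add _
      have h2 := ((h1.inv₀ hr).const_mul (x 0 ^ 2 + x 1 ^ 2)).const_mul (φ x * rq φ x)
      rw [add_zero, mul_inv_cancel₀ (by positivity), mul_one] at h2
      exact h2
  exact le_of_tendsto hlim (Filter.Eventually.of_forall fun n => key _ (by positivity))

end HBS

namespace HBS

/-! ### Axisymmetric velocities without swirl -/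

/-- A divergence-free Sobolev velocity which is axisymmetric without swirl. -/
structure AxiFlow (v : Fin 3 → E3 → ℝ) : Prop where
  sob : ∀ i, Sob (v i)
  div : ∀ x, ∑ i, pd i (v i) x = 0
  symm : ∀ c s : ℝ, c ^ 2 + s ^ 2 = 1 → ∀ i x, v i x = ∑ j, reflMat c s i j * v j (refl c s x)

/-- `v_r / r`. -/
noncomputable def vr (v : Fin 3 → E3 → ℝ) : E3 → ℝ := quot (v 0)

/-- `ω_θ / r`, extended smoothly to the axis. -/
noncomputable def Gam (v : Fin 3 → E3 → ℝ) (x : E3) : ℝ := pd 2 (vr v) x - rq (v 2) x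

lemma SobFam.vr {J : Set ℝ} {V : Fin 3 → ℝ → E3 → ℝ} (h : ∀ i, SobFam J (V i)) :
    SobFam J fun t => vr fun i => V i t := (h 0).quot

lemma SobFam.gam {J : Set ℝ} {V : Fin 3 → ℝ → E3 → ℝ} (h : ∀ i, SobFam J (V i)) :
    SobFam J fun t => Gam fun i => V i t := ((SobFam.vr h).pd 2).sub (h 2).rq

lemma rq_eq_of_pd {h k : E3 → ℝ} (hh : ContDiff ℝ ∞ h) (hk : Continuous k)
    (e : ∀ x, pd 0 h x = x 0 * k x) : rq h = k := quot_eq_of_eq_mul (contDiff_pd hh 0) hk e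

lemma AxiS.rq_pd_two {h : E3 → ℝ} (hh : AxiS h) (hs : Sob h) : rq (pd 2 h) = pd 2 (rq h) := by
  refine rq_eq_of_pd (hs.pd 2).contDiff (hs.rq.pd 2).continuous fun x => ?_
  rw [pd_comm hs.contDiff, show pd 0 h = fun x => x 0 * rq h x from
    funext (hh.pd_eq hs.contDiff).1, pd_coord_mul 2 0 (hs.rq.differentiableAt x)]
  simp

/-- The horizontal Laplacian of an axisymmetric function. -/
lemma AxiS.lapH_eq {h : E3 → ℝ} (hh : AxiS h) (hs : Sob h) (x : E3) :
    lapH h x = 2 * rq h x + (x 0 * pd 0 (rq h) x + x 1 * pd 1 (rq h) x) := by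
  have hpd := hh.pd_eq hs.contDiff
  simp only [lapH]
  rw [show pd 0 h = fun x => x 0 * rq h x from funext hpd.1,
    show pd 1 h = fun x => x 1 * rq h x from funext hpd.2.1,
    pd_coord_mul 0 0 (hs.rq.differentiableAt x), pd_coord_mul 1 1 (hs.rq.differentiableAt x)]
  simp
  ring

namespace AxiFlow
variable {v : Fin 3 → E3 → ℝ}

lemma vr_sob (h : AxiFlow v) : Sob (vr v) := SobFam.vr (V := fun i _ => v i) h.sob

lemma gam_sob (h : AxiFlow v) : Sob (Gam v) := SobFam.gam (V := fun i _ => v i) h.sob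

lemma radial (h : AxiFlow v) :
    (∀ x, v 0 x = x 0 * vr v x) ∧ (∀ x, v 1 x = x 1 * vr v x) ∧ AxiS (vr v) := by
  refine radial_of_symm (h.sob 0).contDiff (h.sob 1).continuous fun c s hc x => ?_
  have h1 := h.symm c s hc 0 (refl c s x)
  have h2 := h.symm c s hc 1 (refl c s x)
  rw [refl_refl hc, Fin.sum_univ_three] at h1 h2
  constructor
  · rw [h1]; simp [reflMat]
  · rw [h2]; simp [reflMat]; ring

lemma axiS_two (h : AxiFlow v) : AxiS (v 2) := axiS_of_comp_refl fun c s hc x => by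
  rw [h.symm c s hc 2 x, Fin.sum_univ_three]
  simp [reflMat]

lemma gam_axiS (h : AxiFlow v) : AxiS (Gam v) :=
  (h.radial.2.2.pd_two h.vr_sob.differentiable).sub (h.axiS_two.pd_eq (h.sob 2).contDiff).2.2

lemma v_zero (h : AxiFlow v) : v 0 = fun x => x 0 * vr v x := funext h.radial.1
lemma v_one (h : AxiFlow v) : v 1 = fun x => x 1 * vr v x := funext h.radial.2.1

lemma pd_zero (h : AxiFlow v) (i : Fin 3) (x : E3) :
    pd i (v 0) x = (if 0 = i then vr v x else 0) + x 0 * pd i (vr v) x := by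
  rw [h.v_zero, pd_coord_mul i 0 (h.vr_sob.differentiableAt x)]

lemma pd_one (h : AxiFlow v) (i : Fin 3) (x : E3) :
    pd i (v 1) x = (if 1 = i then vr v x else 0) + x 1 * pd i (vr v) x := by
  rw [h.v_one, pd_coord_mul i 1 (h.vr_sob.differentiableAt x)]

lemma pd_vr (h : AxiFlow v) (x : E3) : pd 0 (vr v) x = x 0 * rq (vr v) x ∧
    pd 1 (vr v) x = x 1 * rq (vr v) x :=
  ⟨(h.radial.2.2.pd_eq h.vr_sob.contDiff).1 x, (h.radial.2.2.pd_eq h.vr_sob.contDiff).2.1 x⟩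

lemma pd_two (h : AxiFlow v) (x : E3) : pd 0 (v 2) x = x 0 * rq (v 2) x ∧
    pd 1 (v 2) x = x 1 * rq (v 2) x :=
  ⟨(h.axiS_two.pd_eq (h.sob 2).contDiff).1 x, (h.axiS_two.pd_eq (h.sob 2).contDiff).2.1 x⟩

lemma pd_two_two (h : AxiFlow v) (x : E3) :
    pd 2 (v 2) x = -(2 * vr v x + (x 0 * pd 0 (vr v) x + x 1 * pd 1 (vr v) x)) := by
  have := h.div x
  rw [Fin.sum_univ_three, h.pd_zero, h.pd_one] at this
  simp at this
  linarith

lemma curl_one (h : AxiFlow v) (x : E3) : pd 2 (v 0) x - pd 0 (v 2) x = x 0 * Gam v x := by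
  rw [h.pd_zero, (h.pd_two x).1, Gam]
  simp
  ring

lemma curl_zero (h : AxiFlow v) (x : E3) : pd 1 (v 2) x - pd 2 (v 1) x = -(x 1 * Gam v x) := by
  rw [h.pd_one, (h.pd_two x).2, Gam]
  simp
  ring

lemma curl_two (h : AxiFlow v) (x : E3) : pd 0 (v 1) x - pd 1 (v 0) x = 0 := by
  rw [h.pd_one, h.pd_zero, (h.pd_vr x).1, (h.pd_vr x).2]
  simp
  ring

/-- Apply `∂_r / r` to incompressibility in the form `∂_z v_z = -(2 f + r ∂_r f)`, where `f = v_r /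
r`. This feeds the elliptic equation for `f`. -/
lemma rq_pd_two_two (h : AxiFlow v) :
    rq (pd 2 (v 2)) = fun x => -(2 * rq (vr v) x + lapH (vr v) x) := by
  have hf := h.vr_sob
  have ha := h.radial.2.2
  have hpd := ha.pd_eq hf.contDiff
  have hqq := hpd.2.2.pd_eq hf.rq.contDiff
  refine rq_eq_of_pd ((h.sob 2).pd 2).contDiff
    (((hf.rq.const_mul 2).add hf.lapH).continuous.neg) fun x => ?_
  have d0 := (hf.pd 0).differentiableAt x
  have d1 := (hf.pd 1).differentiableAt x
  have dd := hf.differentiableAt x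
  have c0 : DifferentiableAt ℝ (fun y : E3 => y 0 * pd 0 (vr v) y) x :=
    (differentiable_coord 0 x).mul d0
  have c1 : DifferentiableAt ℝ (fun y : E3 => y 1 * pd 1 (vr v) y) x :=
    (differentiable_coord 1 x).mul d1
  have c2 : DifferentiableAt ℝ (fun y : E3 => 2 * vr v y) x := dd.const_mul 2
  rw [show pd 2 (v 2) = fun x => -(2 * vr v x + (x 0 * pd 0 (vr v) x + x 1 * pd 1 (vr v) x)) from
    funext h.pd_two_two, pd_neg 0 (c2.fun_add (c0.fun_add c1)), pd_add 0 c2 (c0.fun_add c1),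
    pd_add 0 c0 c1, pd_const_mul 0 2 dd, pd_coord_mul 0 0 d0, pd_coord_mul 0 1 d1,
    ha.lapH_eq hf, show pd 0 (vr v) = fun x => x 0 * rq (vr v) x from funext hpd.1,
    show pd 1 (vr v) = fun x => x 1 * rq (vr v) x from funext hpd.2.1,
    pd_coord_mul 0 0 (hf.rq.differentiableAt x), pd_coord_mul 0 1 (hf.rq.differentiableAt x),
    hqq.1, hqq.2.1]
  simp
  ring

/-- The elliptic equation for `v_r / r`. -/
lemma pd_two_gam (h : AxiFlow v) (x : E3) :
    pd 2 (Gam v) x = pd 2 (pd 2 (vr v)) x + 2 * rq (vr v) x + lapH (vr v) x := by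
  have e : pd 2 (Gam v) x = pd 2 (pd 2 (vr v)) x - pd 2 (rq (v 2)) x :=
    pd_sub 2 ((h.vr_sob.pd 2).differentiableAt x) ((h.sob 2).rq.differentiableAt x)
  rw [e, ← h.axiS_two.rq_pd_two (h.sob 2), h.rq_pd_two_two]
  ring

/-- First elliptic estimate. -/
lemma nsq_pd_vr_le (h : AxiFlow v) :
    nsq (pd 0 (vr v)) + nsq (pd 1 (vr v)) + nsq (pd 2 (vr v)) ≤ nsq (Gam v) := by
  have hf := h.vr_sob
  -- The elliptic equation is tested against `vr v`; the singular term is discarded thanks to its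
  -- sign.
  have h1 : ∫ x, vr v x * pd 2 (Gam v) x = -∫ x, pd 2 (vr v) x * Gam v x :=
    hf.integral_mul_pd h.gam_sob 2
  have e : ∀ x, vr v x * pd 2 (Gam v) x = vr v x * pd 2 (pd 2 (vr v)) x +
      2 * (vr v x * rq (vr v) x) + vr v x * lapH (vr v) x := fun x => by
    rw [h.pd_two_gam]; ring
  have i1 := hf.integrable_mul ((hf.pd 2).pd 2)
  have i2 := (hf.integrable_mul hf.rq).const_mul 2
  have i3 := hf.integrable_mul hf.lapH
  have i12 : Integrable fun x => vr v x * pd 2 (pd 2 (vr v)) x + 2 * (vr v x * rq (vr v) x) :=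
    i1.add i2
  simp only [e] at h1
  rw [integral_add i12 i3, integral_add i1 i2, integral_const_mul, hf.integral_mul_pd (hf.pd 2) 2,
    integral_mul_lapH hf] at h1
  have h2 := integral_mul_rq_nonpos hf h.radial.2.2
  have h3 := integral_mul_le_half (hf.pd 2).memLp h.gam_sob.memLp one_pos
  have h4 : ∫ x, pd 2 (vr v) x * pd 2 (vr v) x = nsq (pd 2 (vr v)) := by
    simp only [nsq, sq]
  have h5 := abs_le.1 (le_refl |∫ x, pd 2 (vr v) x * Gam v x|)
  have := nsq_nonneg (pd 0 (vr v))
  have := nsq_nonneg (pd 1 (vr v))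
  linarith

/-- With `f = vr v` and `q = rq f`, the formula `Δ_h f = 2 q + r ∂_r q` gives `∇_h q · ∇_h f = q Δ_h
f - 2 q²`. Integration by parts then equates the integral with minus itself plus `2 ‖q‖²`. -/
lemma nsq_rq_vr_eq (h : AxiFlow v) :
    ∫ x, rq (vr v) x * lapH (vr v) x = nsq (rq (vr v)) := by
  have hf := h.vr_sob
  have ha := h.radial.2.2
  have i : ∀ k, Integrable fun x => rq (vr v) x * pd k (pd k (vr v)) x := fun k =>
    hf.rq.integrable_mul ((hf.pd k).pd k)
  have j : ∀ k, Integrable fun x => pd k (rq (vr v)) x * pd k (vr v) x := fun k =>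
    (hf.rq.pd k).integrable_mul (hf.pd k)
  have h1 : ∫ x, rq (vr v) x * lapH (vr v) x =
      -∫ x, (pd 0 (rq (vr v)) x * pd 0 (vr v) x + pd 1 (rq (vr v)) x * pd 1 (vr v) x) := by
    simp only [lapH, mul_add]
    rw [integral_add (i 0) (i 1), integral_add (j 0) (j 1), hf.rq.integral_mul_pd (hf.pd 0) 0,
      hf.rq.integral_mul_pd (hf.pd 1) 1]
    ring
  have e : ∀ x, pd 0 (rq (vr v)) x * pd 0 (vr v) x + pd 1 (rq (vr v)) x * pd 1 (vr v) x =
      rq (vr v) x * lapH (vr v) x - 2 * rq (vr v) x ^ 2 := fun x => by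
    rw [ha.lapH_eq hf, (h.pd_vr x).1, (h.pd_vr x).2]
    ring
  simp only [e] at h1
  rw [integral_sub (hf.rq.integrable_mul hf.lapH) (hf.rq.integrable_sq.const_mul 2),
    integral_const_mul] at h1
  simp only [nsq]
  linarith

/-- Second elliptic estimate. -/
lemma nsq_second_le (h : AxiFlow v) :
    nsq (pd 0 (pd 2 (vr v))) + nsq (pd 1 (pd 2 (vr v))) ≤ nsq (pd 0 (Gam v)) + nsq (pd 1 (Gam v)) ∧
    2 * nsq (lapH (vr v)) + 4 * nsq (rq (vr v)) ≤ nsq (pd 0 (Gam v)) + nsq (pd 1 (Gam v)) := by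
  have hf := h.vr_sob
  have hG := h.gam_sob
  -- integration by parts in two directions
  have swap : ∀ (k : Fin 3) {a : E3 → ℝ}, Sob a → ∫ x, pd 2 a x * pd k (pd k (vr v)) x =
      ∫ x, pd k a x * pd k (pd 2 (vr v)) x := by
    intro k a ha
    have e1 := ha.integral_mul_pd ((hf.pd k).pd k) 2
    have e2 := ha.integral_mul_pd ((hf.pd k).pd 2) k
    have e3 : ∀ x, pd 2 (pd k (pd k (vr v))) x = pd k (pd 2 (pd k (vr v))) x := fun x =>
      pd_comm (hf.pd k).contDiff 2 k x
    have e4 : ∀ x, pd 2 (pd k (vr v)) x = pd k (pd 2 (vr v)) x := fun x =>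
      pd_comm hf.contDiff 2 k x
    simp only [e3] at e1
    simp only [e4] at e1 e2
    linarith
  have hk : ∀ {a : E3 → ℝ}, Sob a → ∫ x, pd 2 a x * lapH (vr v) x =
      (∫ x, pd 0 a x * pd 0 (pd 2 (vr v)) x) + ∫ x, pd 1 a x * pd 1 (pd 2 (vr v)) x := by
    intro a ha
    simp only [lapH, mul_add]
    rw [integral_add ((ha.pd 2).integrable_mul ((hf.pd 0).pd 0))
      ((ha.pd 2).integrable_mul ((hf.pd 1).pd 1)), swap 0 ha, swap 1 ha]
  have e : ∀ x, pd 2 (Gam v) x * lapH (vr v) x = pd 2 (pd 2 (vr v)) x * lapH (vr v) x +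
      2 * (rq (vr v) x * lapH (vr v) x) + lapH (vr v) x ^ 2 := fun x => by
    rw [h.pd_two_gam]; ring
  have i1 := ((hf.pd 2).pd 2).integrable_mul hf.lapH
  have i2 := (hf.rq.integrable_mul hf.lapH).const_mul 2
  have i3 := hf.lapH.integrable_sq
  have i12 : Integrable fun x => pd 2 (pd 2 (vr v)) x * lapH (vr v) x +
      2 * (rq (vr v) x * lapH (vr v) x) := i1.add i2
  -- The elliptic equation is tested against `Δ_h (vr v)`. The three resulting squares have the same
  -- sign and equal the pairing of `∇_h Γ` with `∇_h ∂_z (vr v)`.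
  have h1 := hk hG
  simp only [e] at h1
  rw [integral_add i12 i3, integral_add i1 i2, integral_const_mul, h.nsq_rq_vr_eq,
    hk (hf.pd 2)] at h1
  have e0 : ∀ k, ∫ x, pd k (pd 2 (vr v)) x * pd k (pd 2 (vr v)) x = nsq (pd k (pd 2 (vr v))) :=
    fun k => by simp only [nsq, sq]
  have e5 : ∫ x, lapH (vr v) x ^ 2 = nsq (lapH (vr v)) := rfl
  rw [e0, e0, e5] at h1
  have y0 := integral_mul_le_half (hG.pd 0).memLp ((hf.pd 2).pd 0).memLp one_pos
  have y1 := integral_mul_le_half (hG.pd 1).memLp ((hf.pd 2).pd 1).memLp one_pos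
  have z0 := le_abs_self (∫ x, pd 0 (Gam v) x * pd 0 (pd 2 (vr v)) x)
  have z1 := le_abs_self (∫ x, pd 1 (Gam v) x * pd 1 (pd 2 (vr v)) x)
  have := nsq_nonneg (pd 0 (pd 2 (vr v)))
  have := nsq_nonneg (pd 1 (pd 2 (vr v)))
  have := nsq_nonneg (lapH (vr v))
  have := nsq_nonneg (rq (vr v))
  constructor <;> linarith

/-- `v_r / r` is controlled by the horizontal gradient of `v`. -/
lemma nsq_vr_le (h : AxiFlow v) : nsq (vr v) ≤
    nsq (pd 0 (v 0)) + nsq (pd 1 (v 0)) + nsq (pd 0 (v 1)) + nsq (pd 1 (v 1)) := by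
  have i : ∀ k l, Integrable fun x => pd k (v l) x ^ 2 := fun k l => ((h.sob l).pd k).integrable_sq
  have i2 : Integrable fun x => pd 0 (v 0) x ^ 2 + pd 1 (v 0) x ^ 2 := (i 0 0).add (i 1 0)
  have i3 : Integrable fun x => pd 0 (v 0) x ^ 2 + pd 1 (v 0) x ^ 2 + pd 0 (v 1) x ^ 2 :=
    i2.add (i 0 1)
  simp only [nsq]
  rw [← integral_add (i 0 0) (i 1 0), ← integral_add i2 (i 0 1), ← integral_add i3 (i 1 1)]
  refine integral_mono h.vr_sob.integrable_sq (i3.add (i 1 1)) fun x => ?_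
  simp only [h.pd_zero, h.pd_one, (h.pd_vr x).1, (h.pd_vr x).2]
  simp
  -- With `f = vr v` and `q = rq f`, the four squares add up to `f² + (f + r² q)²`.
  nlinarith [sq_nonneg (vr v x + (x 0 ^ 2 + x 1 ^ 2) * rq (vr v) x)]

/-- The gradient of `v` is controlled by the vorticity. -/
lemma sum_nsq_pd_eq (h : AxiFlow v) : ∑ i, ∑ j, nsq (pd i (v j)) =
    nsq (fun x => x 0 * Gam v x) + nsq (fun x => x 1 * Gam v x) := by
  have hs := h.sob
  -- `∫ ∂_i v_j ∂_j v_i` sums up to zero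
  have swap : ∀ i j, ∫ x, pd i (v j) x * pd j (v i) x = ∫ x, pd j (v j) x * pd i (v i) x := by
    intro i j
    have e1 := ((hs j).pd i).integral_mul_pd (hs i) j
    have e2 := ((hs j).pd j).integral_mul_pd (hs i) i
    have e3 : ∀ x, pd j (pd i (v j)) x = pd i (pd j (v j)) x := fun x =>
      pd_comm (hs j).contDiff j i x
    simp only [e3] at e1
    linarith
  have hz : ∑ i, ∑ j, ∫ x, pd i (v j) x * pd j (v i) x = 0 := by
    rw [Finset.sum_congr rfl fun i _ => Finset.sum_congr rfl fun j _ => swap i j]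
    have e1 : ∀ i, ∑ j, ∫ x, pd j (v j) x * pd i (v i) x = 0 := fun i => by
      rw [← integral_finsetSum _ fun j _ => ((hs j).pd j).integrable_mul ((hs i).pd i)]
      simp only [← Finset.sum_mul, h.div, zero_mul, integral_zero]
    simp [e1]
  have hc : ∀ i j, nsq (fun x => pd i (v j) x - pd j (v i) x) =
      nsq (pd i (v j)) + nsq (pd j (v i)) - 2 * ∫ x, pd i (v j) x * pd j (v i) x := by
    intro i j
    have i1 := ((hs j).pd i).integrable_sq
    have i2 := ((hs i).pd j).integrable_sq
    have i3 := (((hs j).pd i).integrable_mul ((hs i).pd j)).const_mul 2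
    have i12 : Integrable fun x => pd i (v j) x ^ 2 + pd j (v i) x ^ 2 := i1.add i2
    simp only [nsq]
    rw [← integral_const_mul, ← integral_add i1 i2, ← integral_sub i12 i3]
    congr 1
    funext x
    ring
  have c1 : nsq (fun x => x 0 * Gam v x) = nsq (fun x => pd 2 (v 0) x - pd 0 (v 2) x) := by
    simp only [h.curl_one]
  have c0 : nsq (fun x => x 1 * Gam v x) = nsq (fun x => pd 1 (v 2) x - pd 2 (v 1) x) := by
    simp only [h.curl_zero, nsq, neg_sq]
  have c2 : nsq (fun x => pd 0 (v 1) x - pd 1 (v 0) x) = 0 := by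
    simp [h.curl_two, nsq]
  rw [hc] at c0 c1 c2
  have d : ∀ i, ∫ x, pd i (v i) x * pd i (v i) x = nsq (pd i (v i)) := fun i => by
    simp only [nsq, sq]
  have sy : ∀ i j, ∫ x, pd i (v j) x * pd j (v i) x = ∫ x, pd j (v i) x * pd i (v j) x :=
    fun i j => by simp only [mul_comm]
  simp only [Fin.sum_univ_three, d] at hz ⊢
  have s1 := sy 1 0
  have s2 := sy 2 0
  have s3 := sy 2 1
  linarith

end AxiFlow

end HBS

namespace HBS

/-! ### Commutation of derivatives -/

/-- Symmetry of the second derivative of the jointly smooth function, up to the end points of the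
time interval. -/
lemma dtW_pd {T : ℝ} (hT : 0 < T) {a : ℝ → E3 → ℝ} (ha : JointSmooth (Icc 0 T) a) {t : ℝ}
    (ht : t ∈ Icc 0 T) (i : Fin 3) (x : E3) :
    dtW (Icc 0 T) (fun t => pd i (a t)) t x = pd i (dtW (Icc 0 T) a t) x := by
  have hJ := uniqueDiffOn_Icc hT
  set J := Icc 0 T with hJd
  have hS : UniqueDiffOn ℝ (J ×ˢ (univ : Set E3)) := hJ.prod uniqueDiffOn_univ
  set G : ℝ × E3 → ℝ := fun q => a q.1 q.2 with hG
  set D := fderivWithin ℝ G (J ×ˢ univ) with hD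
  have hDd : HasFDerivWithinAt D (fderivWithin ℝ D (J ×ˢ univ) (t, x)) (J ×ˢ univ) (t, x) :=
    ((ContDiffOn.fderivWithin (m := ∞) ha hS (by simp)).differentiableOn (by simp) (t, x)
      ⟨ht, trivial⟩).hasFDerivWithinAt
  set D2 := fderivWithin ℝ D (J ×ˢ univ) (t, x) with hD2
  -- At the end points, symmetry needs the point to be in the closure of the interior of `J ×ˢ
  -- univ`, which uses `0 < T`.
  have hsymm : IsSymmSndFDerivWithinAt ℝ G (J ×ˢ univ) (t, x) := by
    refine ContDiffWithinAt.isSymmSndFDerivWithinAt (n := ∞) (ha (t, x) ⟨ht, trivial⟩)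
      (by simpa using ENat.LEInfty.out) hS
      ?_ ⟨ht, trivial⟩
    rw [interior_prod_eq, interior_univ, closure_prod_eq, closure_univ, hJd, interior_Icc,
      closure_Ioo hT.ne]
    exact ⟨ht, trivial⟩
  have hinr : HasFDerivWithinAt (fun y : E3 => (t, y)) (ContinuousLinearMap.inr ℝ ℝ E3) univ x :=
    (hasFDerivAt_prodMk_right t x).hasFDerivWithinAt
  have hinl : ∀ s y, HasFDerivWithinAt (fun s : ℝ => (s, y)) (ContinuousLinearMap.inl ℝ ℝ E3) J s :=
    fun s y => (hasFDerivAt_prodMk_left s y).hasFDerivWithinAt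
  have hml : ∀ y, MapsTo (fun s : ℝ => (s, y)) J (J ×ˢ (univ : Set E3)) :=
    fun y s hs => ⟨hs, trivial⟩
  have e1 : dtW J a t = fun y => D (t, y) (1, 0) := by
    funext y
    have h1 := (ha.hasFDerivWithinAt ht y).comp t (hinl t y) (hml y)
    have h2 := h1.hasDerivWithinAt.derivWithin (hJ t ht)
    refine Eq.trans ?_ (h2.trans ?_)
    · rfl
    · simp [hD, hG]
  have e2 : ∀ s ∈ J, pd i (a s) x = D (s, x) (0, bv i) := fun s hs => ha.pd_eq hs i x
  have h1 : HasFDerivWithinAt (fun y : E3 => D (t, y)) (D2.comp (ContinuousLinearMap.inr ℝ ℝ E3))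
      univ x := hDd.comp x hinr fun y _ => ⟨ht, trivial⟩
  rw [hasFDerivWithinAt_univ] at h1
  have h2 := h1.clm_apply (hasFDerivAt_const ((1 : ℝ), (0 : E3)) x)
  have h3 : HasFDerivWithinAt (fun s : ℝ => D (s, x)) (D2.comp (ContinuousLinearMap.inl ℝ ℝ E3))
      J t := hDd.comp t (hinl t x) (hml x)
  have h4 := (h3.clm_apply (hasFDerivWithinAt_const ((0 : ℝ), bv i) t J)).hasDerivWithinAt
  rw [e1, pd_eq_of_hasFDerivAt h2]
  have h5 := (h4.congr (fun s hs => e2 s hs) (e2 t ht)).derivWithin (hJ t ht)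
  refine Eq.trans h5 ?_
  have := hsymm.eq (1, 0) (0, bv i)
  simpa using this

lemma pd_adv {v : Fin 3 → E3 → ℝ} {a : E3 → ℝ} (hv : ∀ i, ContDiff ℝ ∞ (v i))
    (ha : ContDiff ℝ ∞ a) (k : Fin 3) (x : E3) :
    pd k (adv v a) x = ∑ j, pd k (v j) x * pd j a x + adv v (pd k a) x := by
  have hd : ∀ j, DifferentiableAt ℝ (pd j a) x := fun j =>
    (contDiff_pd ha j).differentiable (by simp) x
  have hd' : ∀ j, DifferentiableAt ℝ (v j) x := fun j => (hv j).differentiable (by simp) x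
  have e : pd k (adv v a) x = ∑ j, pd k (fun x => v j x * pd j a x) x :=
    pd_sum k Finset.univ _ fun j _ => (hd' j).mul (hd j)
  rw [e, adv, ← Finset.sum_add_distrib]
  refine Finset.sum_congr rfl fun j _ => ?_
  rw [pd_mul k (hd' j) (hd j), pd_comm ha k j]

lemma pd_lapH {a : E3 → ℝ} (ha : ContDiff ℝ ∞ a) (k : Fin 3) (x : E3) :
    pd k (lapH a) x = lapH (pd k a) x := by
  have hd : ∀ j, ContDiff ℝ ∞ (pd j (pd j a)) := fun j => contDiff_pd (contDiff_pd ha j) j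
  have e : pd k (lapH a) x = pd k (pd 0 (pd 0 a)) x + pd k (pd 1 (pd 1 a)) x :=
    pd_add k ((hd 0).differentiable (by simp) x) ((hd 1).differentiable (by simp) x)
  have e2 : ∀ j, pd k (pd j a) = pd j (pd k a) := fun j => funext fun y => pd_comm ha k j y
  rw [e, lapH, pd_comm (contDiff_pd ha 0) k 0, pd_comm (contDiff_pd ha 1) k 1, e2, e2]

lemma adv_sub {v : Fin 3 → E3 → ℝ} {a b : E3 → ℝ} (ha : Differentiable ℝ a)
    (hb : Differentiable ℝ b) (x : E3) :
    adv v (fun x => a x - b x) x = adv v a x - adv v b x := by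
  simp only [adv, ← Finset.sum_sub_distrib]
  refine Finset.sum_congr rfl fun j _ => ?_
  rw [pd_sub j (ha x) (hb x)]
  ring

lemma lapH_sub {a b : E3 → ℝ} (ha : ContDiff ℝ ∞ a) (hb : ContDiff ℝ ∞ b) (x : E3) :
    lapH (fun x => a x - b x) x = lapH a x - lapH b x := by
  have e : ∀ k, pd k (fun x => a x - b x) = fun x => pd k a x - pd k b x := fun k =>
    funext fun x => pd_sub k (ha.differentiable (by simp) x) (hb.differentiable (by simp) x)
  have d : ∀ {f : E3 → ℝ}, ContDiff ℝ ∞ f → ∀ k, DifferentiableAt ℝ (pd k f) x := fun hf k =>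
    (contDiff_pd hf k).differentiable (by simp) x
  simp only [lapH, e]
  rw [pd_sub 0 (d ha 0) (d hb 0), pd_sub 1 (d ha 1) (d hb 1)]
  ring

lemma adv_coord_mul {v : Fin 3 → E3 → ℝ} {a : E3 → ℝ} (ha : Differentiable ℝ a) (x : E3) :
    adv v (fun x => x 0 * a x) x = x 0 * adv v a x + v 0 x * a x := by
  simp only [adv, pd_coord_mul _ 0 (ha x), Fin.sum_univ_three]
  simp
  ring

lemma lapH_coord_mul {a : E3 → ℝ} (ha : ContDiff ℝ ∞ a) (x : E3) :
    lapH (fun x => x 0 * a x) x = x 0 * lapH a x + 2 * pd 0 a x := by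
  have hd := ha.differentiable (by simp)
  have d : ∀ k, Differentiable ℝ (pd k a) := fun k => (contDiff_pd ha k).differentiable (by simp)
  have e0 : pd 0 (fun x : E3 => x 0 * a x) = fun x => a x + x 0 * pd 0 a x := by
    funext y; rw [pd_coord_mul 0 0 (hd y)]; simp
  have e1 : pd 1 (fun x : E3 => x 0 * a x) = fun x => x 0 * pd 1 a x := by
    funext y; rw [pd_coord_mul 1 0 (hd y)]; simp
  simp only [lapH, e0, e1]
  rw [pd_add 0 (hd x) ((differentiable_coord 0 x).fun_mul (d 0 x)), pd_coord_mul 0 0 (d 0 x),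
    pd_coord_mul 1 0 (d 1 x)]
  simp
  ring

/-- The quotient `Γ` comes with smoothness in space at each time only. Its regularity in time is
inherited from the jointly smooth `x₀ Γ` by division off the null set `x₀ = 0`, which is why
`HasTimeDeriv` is an almost everywhere notion. -/
lemma HasTimeDeriv.of_coord_mul {J : Set ℝ} (hJ : UniqueDiffOn ℝ J) (hm : MeasurableSet J)
    {w a a' : ℝ → E3 → ℝ} (hw : JointSmooth J w) (h : ∀ t ∈ J, ∀ x, w t x = x 0 * a t x)
    (h' : ∀ t ∈ J, ∀ x, dtW J w t x = x 0 * a' t x) : HasTimeDeriv J a a' := by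
  have meas : ∀ {w a : ℝ → E3 → ℝ}, JointSmooth J w → (∀ t ∈ J, ∀ x, w t x = x 0 * a t x) →
      AEStronglyMeasurable (fun q : ℝ × E3 => a q.1 q.2)
        ((volume.restrict J).prod (volume : Measure E3)) := by
    intro w a hw h
    have h1 := aestronglyMeasurable_prod hm hw.continuousOn
    have h2 : Measurable fun q : ℝ × E3 => (q.2 0)⁻¹ :=
      (((contDiff_coord (n := 0) 0).continuous.measurable).comp measurable_snd).inv
    refine (h2.aestronglyMeasurable.mul h1).congr ?_
    have h3 := Measure.quasiMeasurePreserving_fst (μ := volume.restrict J)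
      (ν := (volume : Measure E3)) |>.ae (ae_restrict_mem hm)
    have h4 := Measure.quasiMeasurePreserving_snd (μ := volume.restrict J)
      (ν := (volume : Measure E3)) |>.ae ae_coord_zero_ne
    filter_upwards [h3, h4] with q hq1 hq2
    simp only [Pi.mul_apply, h q.1 hq1]
    field_simp
  have hdt : JointSmooth J (dtW J w) := hw.dt hJ
  refine ⟨?_, ?_, meas hw h, meas hdt h'⟩
  · filter_upwards [ae_coord_zero_ne] with x hx t ht
    have h1 := (hw.hasDerivWithinAt ht x).const_mul (x 0)⁻¹
    rw [h' t ht, inv_mul_cancel_left₀ hx] at h1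
    refine h1.congr (fun s hs => ?_) ?_
    · rw [h s hs, inv_mul_cancel_left₀ hx]
    · rw [h t ht, inv_mul_cancel_left₀ hx]
  · filter_upwards [ae_coord_zero_ne] with x hx
    refine ((hdt.continuousOn_time x).const_smul (x 0)⁻¹).congr fun t ht => ?_
    rw [Pi.smul_apply, smul_eq_mul, h' t ht, inv_mul_cancel_left₀ hx]

/-! ### Axisymmetric solutions -/

/-- A solution on `[0,T]` which is axisymmetric without swirl. -/
structure AxiSol (T : ℝ) (U : Fin 3 → ℝ → E3 → ℝ) (R P : ℝ → E3 → ℝ) : Prop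
    extends CompSol T U R P where
  pos : 0 < T
  flow : ∀ t ∈ Icc 0 T, AxiFlow fun i => U i t
  axiR : ∀ t ∈ Icc 0 T, AxiS (R t)

lemma CompSol.axiSol {T : ℝ} {U : Fin 3 → ℝ → E3 → ℝ} {R P : ℝ → E3 → ℝ} (hT : 0 < T)
    (h : CompSol T U R P)
    (hU : ∀ c s : ℝ, c ^ 2 + s ^ 2 = 1 → ∀ i x, U i 0 x = ∑ j, reflMat c s i j * U j 0 (refl c s x))
    (hR : AxiS (R 0)) : AxiSol T U R P where
  toCompSol := h
  pos := hT
  flow t ht := ⟨fun i => (h.U_sob i).sob ht, h.incompressible t ht, fun c s hc =>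
    (h.symm hT hc (hU c s hc) (fun x => (hR.comp_refl hc x).symm) t ht).1⟩
  axiR t ht := axiS_of_comp_refl fun c s hc x =>
    ((h.symm hT hc (hU c s hc) (fun x => (hR.comp_refl hc x).symm) t ht).2 x).symm

namespace AxiSol
variable {T : ℝ} {U : Fin 3 → ℝ → E3 → ℝ} {R P : ℝ → E3 → ℝ} {t : ℝ}

/-- The vorticity component `x₀ ω_θ / r`. -/
noncomputable def _root_.HBS.vort (U : Fin 3 → ℝ → E3 → ℝ) (t : ℝ) (x : E3) : ℝ :=
  pd 2 (U 0 t) x - pd 0 (U 2 t) x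

lemma vort_sob (h : AxiSol T U R P) : SobFam (Icc 0 T) (vort U) :=
  ((h.U_sob 0).pd 2).sub ((h.U_sob 2).pd 0)

lemma vort_joint (h : AxiSol T U R P) : JointSmooth (Icc 0 T) (vort U) :=
  ((h.U_joint 0).pd (uniqueDiffOn_Icc h.pos) 2).sub ((h.U_joint 2).pd (uniqueDiffOn_Icc h.pos) 0)

lemma vort_eq (h : AxiSol T U R P) (ht : t ∈ Icc 0 T) (x : E3) :
    vort U t x = x 0 * Gam (fun i => U i t) x := (h.flow t ht).curl_one x

/-- One component of the curl of the momentum equation. The pressure disappears by symmetry of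
second derivatives, and absence of swirl reduces the stretching to multiplication by `v_r / r`. -/
lemma dt_vort (h : AxiSol T U R P) (ht : t ∈ Icc 0 T) (x : E3) :
    dtW (Icc 0 T) (vort U) t x = -adv (fun i => U i t) (vort U t) x +
      vr (fun i => U i t) x * vort U t x + lapH (vort U t) x - pd 0 (R t) x := by
  have hJ := uniqueDiffOn_Icc h.pos
  have hf := h.flow t ht
  have hs := fun i => (h.U_sob i).sob ht
  have hP := h.P_smooth t ht
  have hRs := h.R_sob.sob ht
  have e1 : dtW (Icc 0 T) (vort U) t x =
      dtW (Icc 0 T) (fun t => pd 2 (U 0 t)) t x - dtW (Icc 0 T) (fun t => pd 0 (U 2 t)) t x :=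
    dtW_sub hJ ((h.U_joint 0).pd hJ 2) ((h.U_joint 2).pd hJ 0) ht x
  have e2 : ∀ i, dtW (Icc 0 T) (U i) t = fun x => force U R i t x - pd i (P t) x := fun i =>
    funext fun x => by rw [← h.toCompSol.dt_add_pd ht]; ring
  have hF : ∀ i, DifferentiableAt ℝ (force U R i t) x := fun i =>
    ((h.force_sob i).sob ht).differentiableAt x
  have hdP : ∀ i, DifferentiableAt ℝ (pd i (P t)) x := fun i =>
    (contDiff_pd hP i).differentiable (by simp) x
  rw [e1, dtW_pd h.pos (h.U_joint 0) ht, dtW_pd h.pos (h.U_joint 2) ht, e2, e2,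
    pd_sub 2 (hF 0) (hdP 0), pd_sub 0 (hF 2) (hdP 2), pd_comm hP 2 0]
  have ha : ∀ i, DifferentiableAt ℝ (adv (fun j => U j t) (U i t)) x := fun i =>
    (Sob.adv hs (hs i)).differentiableAt x
  have hl : ∀ i, DifferentiableAt ℝ (lapH (U i t)) x := fun i => (hs i).lapH.differentiableAt x
  have f0 : force U R 0 t = fun x => -adv (fun j => U j t) (U 0 t) x + lapH (U 0 t) x := by
    funext y; simp [force]
  have f2 : force U R 2 t = fun x => -adv (fun j => U j t) (U 2 t) x + lapH (U 2 t) x + R t x := by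
    funext y; simp [force]
  have g0 : pd 2 (force U R 0 t) x = -(∑ j, pd 2 (U j t) x * pd j (U 0 t) x +
      adv (fun j => U j t) (pd 2 (U 0 t)) x) + lapH (pd 2 (U 0 t)) x := by
    rw [f0, pd_add 2 (ha 0).fun_neg (hl 0), pd_neg 2 (ha 0),
      pd_adv (fun i => (hs i).contDiff) (hs 0).contDiff, pd_lapH (hs 0).contDiff]
  have g2 : pd 0 (force U R 2 t) x = -(∑ j, pd 0 (U j t) x * pd j (U 2 t) x +
      adv (fun j => U j t) (pd 0 (U 2 t)) x) + lapH (pd 0 (U 2 t)) x + pd 0 (R t) x := by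
    rw [f2, pd_add 0 ((ha 2).fun_neg.fun_add (hl 2)) (hRs.differentiableAt x),
      pd_add 0 (ha 2).fun_neg (hl 2), pd_neg 0 (ha 2),
      pd_adv (fun i => (hs i).contDiff) (hs 2).contDiff, pd_lapH (hs 2).contDiff]
  have av : adv (fun i => U i t) (vort U t) x = adv (fun i => U i t) (pd 2 (U 0 t)) x -
      adv (fun i => U i t) (pd 0 (U 2 t)) x :=
    adv_sub ((hs 0).pd 2).differentiable ((hs 2).pd 0).differentiable x
  have lv : lapH (vort U t) x = lapH (pd 2 (U 0 t)) x - lapH (pd 0 (U 2 t)) x :=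
    lapH_sub ((hs 0).pd 2).contDiff ((hs 2).pd 0).contDiff x
  rw [g0, g2, av, lv]
  have br : ∑ j, pd 2 (U j t) x * pd j (U 0 t) x - ∑ j, pd 0 (U j t) x * pd j (U 2 t) x =
      -(vr (fun i => U i t) x * vort U t x) := by
    have z := hf.pd_zero
    have o := hf.pd_one
    have t1 := (hf.pd_two x).1
    have t2 := (hf.pd_two x).2
    have t3 := hf.pd_two_two x
    have p0 := (hf.pd_vr x).1
    have p1 := (hf.pd_vr x).2
    simp only [Fin.sum_univ_three, vort, z, o, t1, t2, t3, p0, p1]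
    simp
    ring
  linarith

/-- The right-hand side of the equation for `ω_θ / r`. -/
noncomputable def _root_.HBS.gamRhs (U : Fin 3 → ℝ → E3 → ℝ) (R : ℝ → E3 → ℝ) (t : ℝ) (x : E3) : ℝ :=
  -adv (fun i => U i t) (Gam fun i => U i t) x + lapH (Gam fun i => U i t) x +
    2 * rq (Gam fun i => U i t) x - rq (R t) x

lemma gamRhs_sob (h : AxiSol T U R P) : SobFam (Icc 0 T) (gamRhs U R) :=
  (((SobFam.adv h.U_sob (SobFam.gam h.U_sob)).neg.add (SobFam.gam h.U_sob).lapH).add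
    ((SobFam.gam h.U_sob).rq.const_mul 2)).sub h.R_sob.rq

/-- In the equation for `x₀ Γ`, the stretching term is exactly the advection of the factor `x₀`, so
it cancels. The Laplacian leaves `2 ∂₀ Γ = 2 x₀ rq Γ`, and everything is divisible by `x₀`. -/
lemma gam_hasTimeDeriv (h : AxiSol T U R P) :
    HasTimeDeriv (Icc 0 T) (fun t => Gam fun i => U i t) (gamRhs U R) := by
  refine HasTimeDeriv.of_coord_mul (uniqueDiffOn_Icc h.pos) measurableSet_Icc h.vort_joint
    (fun t ht => h.vort_eq ht) fun t ht x => ?_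
  have hf := h.flow t ht
  rw [h.dt_vort ht, show vort U t = fun x => x 0 * Gam (fun i => U i t) x from
    funext (h.vort_eq ht), adv_coord_mul hf.gam_sob.differentiable,
    lapH_coord_mul hf.gam_sob.contDiff, hf.radial.1, (hf.gam_axiS.pd_eq hf.gam_sob.contDiff).1,
    ((h.axiR t ht).pd_eq (h.R_sob.sob ht).contDiff).1, gamRhs]
  ring

end AxiSol

end HBS

/-! ### Energy of the velocity and mass of the density -/

namespace HBS

/-- Energy identity and continuity for a Sobolev family whose time derivative is one. -/
lemma HasTimeDeriv.energy {T : ℝ} {a a' : ℝ → E3 → ℝ} (h : HasTimeDeriv (Icc 0 T) a a')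
    (ha : SobFam (Icc 0 T) a) (ha' : SobFam (Icc 0 T) a') :
    (∀ i, ContinuousOn (fun t => nsq (pd i (a t))) (Icc 0 T)) ∧
    ContinuousOn (fun t => nsq (a t)) (Icc 0 T) ∧
    ∀ t ∈ Icc 0 T, IntervalIntegrable (fun τ => 2 * ∫ x, a τ x * a' τ x) volume 0 t ∧
      nsq (a t) - nsq (a 0) = ∫ τ in (0 : ℝ)..t, 2 * ∫ x, a τ x * a' τ x := by
  obtain ⟨B, -, hB⟩ := ha'.exists_nsq_le
  obtain ⟨A, -, hA⟩ := ha.exists_nsq_le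
  have hL : ∀ s ∈ Icc 0 T, ∀ t ∈ Icc 0 T, s ≤ t →
      nsq (fun x => a t x - a s x) ≤ B * (t - s) ^ 2 := by
    intro s hs t ht hst
    have hsub : Icc s t ⊆ Icc 0 T := Icc_subset_Icc hs.1 ht.2
    exact (h.mono hsub).nsq_sub_le hst (fun τ hτ => ⟨ha'.memLp (hsub hτ), hB τ (hsub hτ)⟩)
      (fun τ hτ => ha.memLp (hsub hτ)) fun τ hτ => (ha.smooth τ (hsub hτ)).continuous.measurable
  refine ⟨fun i => (nsq_lipschitz_pd ha hL i).1, (nsq_lipschitz_pd ha hL 0).2, fun t ht => ?_⟩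
  have hsub : Icc 0 t ⊆ Icc 0 T := Icc_subset_Icc le_rfl ht.2
  exact (h.mono hsub).nsq_sub_eq ht.1 (fun τ hτ => ⟨ha'.memLp (hsub hτ), hB τ (hsub hτ)⟩)
    (fun τ hτ => ⟨ha.memLp (hsub hτ), hA τ (hsub hτ)⟩)

namespace CompSol
variable {T : ℝ} {U : Fin 3 → ℝ → E3 → ℝ} {R P : ℝ → E3 → ℝ} {t : ℝ}

lemma rho_hasTimeDeriv (hT : 0 < T) (h : CompSol T U R P) :
    HasTimeDeriv (Icc 0 T) R fun t x => -adv (fun j => U j t) (R t) x :=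
  h.R_joint.hasTimeDeriv (uniqueDiffOn_Icc hT) measurableSet_Icc fun t ht x => by
    have := h.transport t ht x
    linarith

lemma nsq_rho (hT : 0 < T) (h : CompSol T U R P) (ht : t ∈ Icc 0 T) : nsq (R t) = nsq (R 0) := by
  have h1 := ((h.rho_hasTimeDeriv hT).energy h.R_sob (SobFam.adv h.U_sob h.R_sob).neg).2.2 t ht
  have h2 : ∫ τ in (0 : ℝ)..t, 2 * ∫ x, R τ x * -adv (fun j => U j τ) (R τ) x =
      ∫ τ in (0 : ℝ)..t, 0 := by
    refine intervalIntegral.integral_congr fun τ hτ => ?_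
    rw [uIcc_of_le ht.1] at hτ
    have hτ' : τ ∈ Icc 0 T := ⟨hτ.1, hτ.2.trans ht.2⟩
    simp only [mul_neg, integral_neg, integral_mul_adv (fun i => (h.U_sob i).sob hτ')
      (h.incompressible τ hτ') (h.R_sob.sob hτ'), neg_zero, mul_zero]
  rw [h2, intervalIntegral.integral_zero] at h1
  linarith [h1.2]

/-- `exists_nsq_dt_le` supplies the time derivative and removes the pressure; the buoyancy is split
by `2 |u₃ ρ| ≤ u₃² + ρ²`, and `‖ρ‖` is conserved. -/
lemma energy (hT : 0 < T) (h : CompSol T U R P) :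
    (∀ i j, ContinuousOn (fun t => nsq (pd j (U i t))) (Icc 0 T)) ∧
    (∀ i, ContinuousOn (fun t => nsq (U i t)) (Icc 0 T)) ∧
    ∀ t ∈ Icc 0 T, ∑ i, nsq (U i t) +
      2 * ∫ τ in (0 : ℝ)..t, ∑ i, (nsq (pd 0 (U i τ)) + nsq (pd 1 (U i τ))) ≤
      ∑ i, nsq (U i 0) + ∫ τ in (0 : ℝ)..t, (nsq (R 0) + ∑ i, nsq (U i τ)) := by
  have hJ := uniqueDiffOn_Icc hT
  obtain ⟨⟨C, hC0, hlip, hdt⟩, horth⟩ := exists_nsq_dt_le hT h.U_sob h.U_joint h.force_sob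
    (h.force_joint hT) h.P_smooth (fun t ht i x => h.dt_add_pd ht i x) h.incompressible
  have c1 : ∀ i j, ContinuousOn (fun t => nsq (pd j (U i t))) (Icc 0 T) := fun i j =>
    (nsq_lipschitz_pd (h.U_sob i) (hlip i) j).1
  have c2 : ∀ i, ContinuousOn (fun t => nsq (U i t)) (Icc 0 T) := fun i =>
    (nsq_lipschitz_pd (h.U_sob i) (hlip i) 0).2
  refine ⟨c1, c2, fun t ht => ?_⟩
  have hsub : Icc 0 t ⊆ Icc 0 T := Icc_subset_Icc le_rfl ht.2
  choose A _ hA using fun i => (h.U_sob i).exists_nsq_le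
  have h1 := fun i => (((h.U_joint i).hasTimeDeriv hJ measurableSet_Icc
      (a' := dtW (Icc 0 T) (U i)) fun _ _ _ => rfl).mono hsub).nsq_sub_eq ht.1
      (fun τ hτ => hdt i τ (hsub hτ)) (fun τ hτ => ⟨(h.U_sob i).memLp (hsub hτ), hA i τ (hsub hτ)⟩)
  have hs : IntervalIntegrable (fun τ => ∑ i, 2 * ∫ x, U i τ x * dtW (Icc 0 T) (U i) τ x)
      volume 0 t := by
    simpa only [Finset.sum_fn] using IntervalIntegrable.sum Finset.univ fun i _ => (h1 i).1
  have h2 : ∑ i, nsq (U i t) - ∑ i, nsq (U i 0) =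
      ∫ τ in (0 : ℝ)..t, ∑ i, 2 * ∫ x, U i τ x * dtW (Icc 0 T) (U i) τ x := by
    rw [intervalIntegral.integral_finsetSum fun i _ => (h1 i).1,
      ← Finset.sum_congr rfl fun i _ => (h1 i).2, Finset.sum_sub_distrib]
  have c3 : ContinuousOn (fun τ => ∑ i, (nsq (pd 0 (U i τ)) + nsq (pd 1 (U i τ)))) (Icc 0 t) :=
    (continuousOn_finsetSum _ fun i _ => (c1 i 0).add (c1 i 1)).mono hsub
  have c4 : ContinuousOn (fun τ => nsq (R 0) + ∑ i, nsq (U i τ)) (Icc 0 t) :=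
    continuousOn_const.add ((continuousOn_finsetSum _ fun i _ => c2 i).mono hsub)
  have i3 : IntervalIntegrable (fun τ => 2 * ∑ i, (nsq (pd 0 (U i τ)) + nsq (pd 1 (U i τ))))
      volume 0 t := (c3.const_smul (2 : ℝ)).intervalIntegrable_of_Icc ht.1
  have i4 := c4.intervalIntegrable_of_Icc (μ := volume) ht.1
  have h3 : ∫ τ in (0 : ℝ)..t, ∑ i, 2 * ∫ x, U i τ x * dtW (Icc 0 T) (U i) τ x ≤
      ∫ τ in (0 : ℝ)..t, ((nsq (R 0) + ∑ i, nsq (U i τ)) -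
        2 * ∑ i, (nsq (pd 0 (U i τ)) + nsq (pd 1 (U i τ)))) := by
    refine intervalIntegral.integral_mono_on ht.1 hs (i4.sub i3) fun τ hτ => ?_
    have hτ' := hsub hτ
    have hUs := fun i => (h.U_sob i).sob hτ'
    have hRs := h.R_sob.sob hτ'
    have e1 := horth τ hτ'
    have e2 : ∀ i, ∫ x, U i τ x * force U R i τ x =
        -(nsq (pd 0 (U i τ)) + nsq (pd 1 (U i τ))) +
          ∫ x, U i τ x * (if i = 2 then R τ x else 0) := by
      intro i
      have hk : Sob fun x => if i = 2 then R τ x else 0 := by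
        split_ifs
        · exact hRs
        · exact SobFam.zero
      have i1 : Integrable fun x => -(U i τ x * adv (fun j => U j τ) (U i τ) x) :=
        ((hUs i).integrable_mul (Sob.adv hUs (hUs i))).neg
      have i2 := (hUs i).integrable_mul (hUs i).lapH
      have i3 := (hUs i).integrable_mul hk
      have i12 : Integrable fun x => -(U i τ x * adv (fun j => U j τ) (U i τ) x) +
        U i τ x * lapH (U i τ) x := i1.add i2
      have e : ∀ x, U i τ x * force U R i τ x = -(U i τ x * adv (fun j => U j τ) (U i τ) x) +
          U i τ x * lapH (U i τ) x + U i τ x * (if i = 2 then R τ x else 0) := fun x => by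
        simp only [force]; ring
      simp only [e]
      rw [integral_add i12 i3, integral_add i1 i2, integral_neg,
        integral_mul_adv hUs (h.incompressible τ hτ') (hUs i), integral_mul_lapH (hUs i)]
      ring
    have e3 : ∑ i : Fin 3, ∫ x, U i τ x * (if i = 2 then R τ x else 0) = ∫ x, U 2 τ x * R τ x := by
      rw [Fin.sum_univ_three]
      simp
    have y := integral_mul_le_half (hUs 2).memLp hRs.memLp one_pos
    have y' := le_abs_self (∫ x, U 2 τ x * R τ x)
    rw [h.nsq_rho hT hτ'] at y
    have hm : nsq (U 2 τ) ≤ ∑ i, nsq (U i τ) :=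
      Finset.single_le_sum (f := fun i => nsq (U i τ)) (fun i _ => nsq_nonneg _) (Finset.mem_univ 2)
    simp only [e2, Finset.sum_add_distrib, Finset.sum_neg_distrib, e3] at e1
    rw [← Finset.mul_sum, e1]
    simp only [Finset.sum_add_distrib]
    linarith
  rw [intervalIntegral.integral_sub i4 i3, intervalIntegral.integral_const_mul] at h3
  linarith

end CompSol

/-! ### Densities supported away from the axis -/

/-- The density divided by the distance to the axis. -/
noncomputable def radInv (f : E3 → ℝ) (x : E3) : ℝ := (rad x)⁻¹ * f x

/-- Off the axis `x_h / r²` is divergence-free, so `∂_r R / r = div_h (x_h R / r²)`; the axis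
contributes nothing because `R` vanishes near it. Integration by parts puts the derivatives on `G`
and leaves a field of length `|R| / r`. The width `ε` only makes this legitimate and does not enter
the bound. -/
lemma two_abs_integral_mul_rq_le {G R : E3 → ℝ} (hG : Sob G) (hR : Sob R) (hRa : AxiS R) {ε : ℝ}
    (hε : 0 < ε) (hR0 : ∀ x, rad x < ε → R x = 0) :
    -(2 * ∫ x, G x * rq R x) ≤ nsq (pd 0 G) + nsq (pd 1 G) + nsq (radInv R) := by
  have hpd := hRa.pd_eq hR.contDiff
  have hradc : Continuous rad := by unfold rad; fun_prop
  -- The `+ 0` matches the form of `pd_coord_div`, used here with parameter 0.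
  set N : E3 → ℝ := fun x => x 0 ^ 2 + x 1 ^ 2 + 0 with hN
  have hNr : ∀ x, N x = rad x ^ 2 := fun x => by rw [rad_sq]; simp [hN]
  set Z : Fin 3 → E3 → ℝ := fun i x => x i * (N x)⁻¹ * R x with hZ
  -- behaviour near the axis
  have hnear : ∀ x, rad x < ε → R =ᶠ[nhds x] fun _ => 0 := fun x hx =>
    (hradc.continuousAt.eventually_lt continuousAt_const hx).mono fun y hy => hR0 y hy
  have hpR0 : ∀ i x, rad x < ε → pd i R x = 0 := fun i x hx => by
    rw [pd_congr_nhds (hnear x hx), pd_const]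
  have hfar : ∀ x, ¬ rad x < ε → N x ≠ 0 := fun x hx => by
    rw [hNr]
    have : 0 < rad x := hε.trans_le (not_lt.1 hx)
    positivity
  have hZd : ∀ i : Fin 3, i ≠ 2 → Differentiable ℝ (Z i) ∧ ∀ x, pd i (Z i) x =
      ((N x)⁻¹ - 2 * x i ^ 2 * ((N x) ^ 2)⁻¹) * R x + x i * (N x)⁻¹ * pd i R x := by
    intro i hi
    have key : ∀ x, DifferentiableAt ℝ (Z i) x ∧ pd i (Z i) x =
      ((N x)⁻¹ - 2 * x i ^ 2 * ((N x) ^ 2)⁻¹) * R x + x i * (N x)⁻¹ * pd i R x := by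
      intro x
      by_cases hx : rad x < ε
      · have hz : Z i =ᶠ[nhds x] fun _ => 0 := (hnear x hx).mono fun y hy => by simp [hZ, hy]
        refine ⟨(differentiableAt_const 0).congr_of_eventuallyEq hz, ?_⟩
        rw [pd_congr_nhds hz, pd_const, hR0 x hx, hpR0 i x hx]
        ring
      · have h1 := pd_coord_div hi (hfar x hx)
        refine ⟨h1.1.fun_mul (hR.differentiableAt x), ?_⟩
        rw [← h1.2]
        exact pd_mul i h1.1 (hR.differentiableAt x)
    exact ⟨fun x => (key x).1, fun x => (key x).2⟩
  have hle : ∀ i : Fin 3, i ≠ 2 → ∀ x : E3, x i ^ 2 ≤ N x := by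
    intro i hi x
    simp only [hN]
    fin_cases i
    · simp; nlinarith [sq_nonneg (x 1)]
    · simp; nlinarith [sq_nonneg (x 0)]
    · exact absurd rfl hi
  have hb0 : ∀ x, ¬ rad x < ε → (N x)⁻¹ ≤ (ε ^ 2)⁻¹ := fun x hx => by
    rw [hNr]
    exact inv_anti₀ (by positivity) (pow_le_pow_left₀ hε.le (not_lt.1 hx) 2)
  have hNn : ∀ x, 0 ≤ N x := fun x => by rw [hNr]; positivity
  have hb1 : ∀ i : Fin 3, i ≠ 2 → ∀ x, ¬ rad x < ε → |x i * (N x)⁻¹| ≤ ε⁻¹ := by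
    intro i hi x hx
    rw [abs_mul, abs_of_nonneg (inv_nonneg.2 (hNn x))]
    have hr : 0 < rad x := hε.trans_le (not_lt.1 hx)
    have h1 : |x i| ≤ rad x := by
      rw [← abs_of_pos hr, ← sq_le_sq, ← hNr]; exact hle i hi x
    calc |x i| * (N x)⁻¹ ≤ rad x * (N x)⁻¹ :=
          mul_le_mul_of_nonneg_right h1 (inv_nonneg.2 (hNn x))
      _ = (rad x)⁻¹ := by rw [hNr]; field_simp
      _ ≤ ε⁻¹ := inv_anti₀ hε (not_lt.1 hx)
  have hb2 : ∀ i : Fin 3, i ≠ 2 → ∀ x, ¬ rad x < ε →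
      |(N x)⁻¹ - 2 * x i ^ 2 * ((N x) ^ 2)⁻¹| ≤ 2 * (ε ^ 2)⁻¹ := by
    intro i hi x hx
    have h1 := hb0 x hx
    have h2 : 0 ≤ (N x)⁻¹ := inv_nonneg.2 (hNn x)
    have h3 : x i ^ 2 * ((N x) ^ 2)⁻¹ ≤ (N x)⁻¹ := by
      calc x i ^ 2 * ((N x) ^ 2)⁻¹ ≤ N x * ((N x) ^ 2)⁻¹ :=
            mul_le_mul_of_nonneg_right (hle i hi x) (by positivity)
        _ = _ := by have := hfar x hx; field_simp
    have h4 : 0 ≤ x i ^ 2 * ((N x) ^ 2)⁻¹ := by positivity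
    rw [abs_le]
    constructor <;> nlinarith
  have hNm : Measurable fun x => (N x)⁻¹ := by
    refine Measurable.inv ?_
    exact (by simp only [hN]; fun_prop : Continuous N).measurable
  have hcm : ∀ i : Fin 3, Measurable fun x : E3 => x i := fun i =>
    (contDiff_coord (n := 0) i).continuous.measurable
  have hZ2 : ∀ i : Fin 3, i ≠ 2 → MemLp (Z i) 2 volume := fun i hi => by
    refine (hR.memLp.norm.const_mul ε⁻¹).mono
      (((hcm i).mul hNm).mul hR.continuous.measurable).aestronglyMeasurable
      (Filter.Eventually.of_forall fun x => ?_)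
    rw [Real.norm_eq_abs, Real.norm_eq_abs, abs_mul (ε⁻¹), abs_of_pos (inv_pos.2 hε), abs_mul,
      Real.norm_eq_abs, abs_abs]
    by_cases hx : rad x < ε
    · simp [hR0 x hx]
    · exact mul_le_mul_of_nonneg_right (hb1 i hi x hx) (abs_nonneg _)
  have hpZ2 : ∀ i : Fin 3, i ≠ 2 → MemLp (pd i (Z i)) 2 volume := fun i hi => by
    rw [show pd i (Z i) = fun x => ((N x)⁻¹ - 2 * x i ^ 2 * ((N x) ^ 2)⁻¹) * R x +
      x i * (N x)⁻¹ * pd i R x from funext (hZd i hi).2]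
    have hm : Measurable fun x => (N x)⁻¹ - 2 * x i ^ 2 * ((N x) ^ 2)⁻¹ := by
      have : (fun x => (N x)⁻¹ - 2 * x i ^ 2 * ((N x) ^ 2)⁻¹) =
          fun x => (N x)⁻¹ - 2 * x i ^ 2 * ((N x)⁻¹) ^ 2 := by
        funext x; rw [inv_pow]
      rw [this]
      exact hNm.sub ((((hcm i).pow_const 2).const_mul 2).mul (hNm.pow_const 2))
    refine MemLp.add ?_ ?_
    · refine (hR.memLp.norm.const_mul (2 * (ε ^ 2)⁻¹)).mono
        (hm.mul hR.continuous.measurable).aestronglyMeasurable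
        (Filter.Eventually.of_forall fun x => ?_)
      rw [Real.norm_eq_abs, Real.norm_eq_abs, abs_mul (2 * (ε ^ 2)⁻¹),
        abs_of_pos (by positivity : 0 < 2 * (ε ^ 2)⁻¹), abs_mul, Real.norm_eq_abs, abs_abs]
      by_cases hx : rad x < ε
      · simp [hR0 x hx]
      · exact mul_le_mul_of_nonneg_right (hb2 i hi x hx) (abs_nonneg _)
    · refine ((hR.pd i).memLp.norm.const_mul ε⁻¹).mono
        (((hcm i).mul hNm).mul (hR.pd i).continuous.measurable).aestronglyMeasurable
        (Filter.Eventually.of_forall fun x => ?_)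
      rw [Real.norm_eq_abs, Real.norm_eq_abs, abs_mul (ε⁻¹), abs_of_pos (inv_pos.2 hε), abs_mul,
        Real.norm_eq_abs, abs_abs]
      by_cases hx : rad x < ε
      · simp [hpR0 i x hx]
      · exact mul_le_mul_of_nonneg_right (hb1 i hi x hx) (abs_nonneg _)
  have hibp : ∀ i : Fin 3, i ≠ 2 → ∫ x, G x * pd i (Z i) x = -∫ x, pd i G x * Z i x :=
    fun i hi => integral_mul_pd_of_integrable i hG.differentiable (hZd i hi).1
      (integrable_mul_of_memLp (hG.pd i).memLp (hZ2 i hi))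
      (integrable_mul_of_memLp hG.memLp (hpZ2 i hi)) (integrable_mul_of_memLp hG.memLp (hZ2 i hi))
  have e1 : ∫ x, G x * rq R x = (∫ x, G x * pd 0 (Z 0) x) + ∫ x, G x * pd 1 (Z 1) x := by
    rw [← integral_add (integrable_mul_of_memLp hG.memLp (hpZ2 0 (by decide)))
      (integrable_mul_of_memLp hG.memLp (hpZ2 1 (by decide)))]
    refine integral_congr_ae ?_
    filter_upwards [ae_coord_zero_ne] with x hx
    have hNx : N x ≠ 0 := by simp only [hN]; positivity
    have e3 : (N x)⁻¹ = N x * (N x ^ 2)⁻¹ := by field_simp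
    have e4 : N x * N x * (N x ^ 2)⁻¹ = 1 := by field_simp
    have e5 : N x = x 0 ^ 2 + x 1 ^ 2 := by simp [hN]
    rw [(hZd 0 (by decide)).2, (hZd 1 (by decide)).2, hpd.1, hpd.2.1, e3]
    generalize (N x ^ 2)⁻¹ = k at e4 ⊢
    rw [e5] at e4 ⊢
    linear_combination (-(G x * rq R x)) * e4
  rw [hibp 0 (by decide), hibp 1 (by decide)] at e1
  have y0 := integral_mul_le_half (hG.pd 0).memLp (hZ2 0 (by decide)) one_pos
  have y1 := integral_mul_le_half (hG.pd 1).memLp (hZ2 1 (by decide)) one_pos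
  have z0 := le_abs_self (∫ x, pd 0 G x * Z 0 x)
  have z1 := le_abs_self (∫ x, pd 1 G x * Z 1 x)
  have e6 : nsq (Z 0) + nsq (Z 1) = nsq (radInv R) := by
    simp only [nsq]
    rw [← integral_add (hZ2 0 (by decide)).integrable_sq (hZ2 1 (by decide)).integrable_sq]
    congr 1
    funext x
    simp only [hZ, radInv, mul_pow, inv_pow, hNr]
    by_cases hx : rad x = 0
    · simp [hx]
    · have e7 : rad x ^ 2 = x 0 ^ 2 + x 1 ^ 2 := rad_sq x
      have e8 : rad x ^ 2 * (rad x ^ 2)⁻¹ = 1 := by field_simp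
      have e9 : (rad x ^ 2)⁻¹ = (rad x ^ 2) * (((rad x ^ 2)) ^ 2)⁻¹ := by field_simp
      rw [e9]
      generalize ((rad x ^ 2) ^ 2)⁻¹ = k
      rw [e7]
      ring
  linarith

end HBS

/-! ### Integrated energy inequalities for `ω_θ / r` and for the vorticity -/

namespace HBS

/-- If the time derivative of the squared norm is at most `d - g`, integrate in time. -/
lemma nsq_add_integral_le {T : ℝ} {a a' : ℝ → E3 → ℝ} (h : HasTimeDeriv (Icc 0 T) a a')
    (ha : SobFam (Icc 0 T) a) (ha' : SobFam (Icc 0 T) a') {d g : ℝ → ℝ}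
    (hd : ContinuousOn d (Icc 0 T)) (hg : ContinuousOn g (Icc 0 T))
    (hle : ∀ t ∈ Icc 0 T, 2 * ∫ x, a t x * a' t x ≤ d t - g t) {t : ℝ} (ht : t ∈ Icc 0 T) :
    nsq (a t) + ∫ τ in (0 : ℝ)..t, g τ ≤ nsq (a 0) + ∫ τ in (0 : ℝ)..t, d τ := by
  obtain ⟨h1, h2⟩ := (h.energy ha ha').2.2 t ht
  have hsub : Icc 0 t ⊆ Icc 0 T := Icc_subset_Icc le_rfl ht.2
  have i1 := (hd.mono hsub).intervalIntegrable_of_Icc (μ := volume) ht.1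
  have i2 := (hg.mono hsub).intervalIntegrable_of_Icc (μ := volume) ht.1
  have h3 := intervalIntegral.integral_mono_on ht.1 h1 (i1.sub i2) fun τ hτ => hle τ (hsub hτ)
  rw [intervalIntegral.integral_sub i1 i2] at h3
  linarith

namespace AxiSol
variable {T : ℝ} {U : Fin 3 → ℝ → E3 → ℝ} {R P : ℝ → E3 → ℝ} {t : ℝ}

lemma gam_continuousOn (h : AxiSol T U R P) :
    (∀ i, ContinuousOn (fun t => nsq (pd i (Gam fun j => U j t))) (Icc 0 T)) ∧
      ContinuousOn (fun t => nsq (Gam fun j => U j t)) (Icc 0 T) :=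
  have h1 := h.gam_hasTimeDeriv.energy (SobFam.gam h.U_sob) h.gamRhs_sob
  ⟨h1.1, h1.2.1⟩

/-- Advection vanishes, the singular term has the good sign, and the Laplacian gives twice the
dissipation, half of which absorbs the density term. -/
lemma two_integral_gam_le (h : AxiSol T U R P) (ht : t ∈ Icc 0 T) {ε : ℝ} (hε : 0 < ε)
    (hR : ∀ x, rad x < ε → R t x = 0) :
    2 * ∫ x, Gam (fun j => U j t) x * gamRhs U R t x ≤ nsq (radInv (R t)) -
      (nsq (pd 0 (Gam fun j => U j t)) + nsq (pd 1 (Gam fun j => U j t))) := by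
  have hf := h.flow t ht
  have hRs := h.R_sob.sob ht
  have hG := hf.gam_sob
  set G := Gam fun j => U j t with hGd
  have i1 : Integrable fun x => -(G x * adv (fun j => U j t) G x) :=
    (hG.integrable_mul (Sob.adv hf.sob hG)).neg
  have i2 := hG.integrable_mul hG.lapH
  have i3 := (hG.integrable_mul hG.rq).const_mul 2
  have i4 := hG.integrable_mul hRs.rq
  have i12 : Integrable fun x => -(G x * adv (fun j => U j t) G x) + G x * lapH G x := i1.add i2
  have i123 : Integrable fun x => -(G x * adv (fun j => U j t) G x) + G x * lapH G x +
    2 * (G x * rq G x) := i12.add i3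
  have e : ∀ x, G x * gamRhs U R t x = -(G x * adv (fun j => U j t) G x) + G x * lapH G x +
      2 * (G x * rq G x) - G x * rq (R t) x := fun x => by
    simp only [gamRhs, ← hGd]; ring
  simp only [e]
  rw [integral_sub i123 i4, integral_add i12 i3, integral_add i1 i2, integral_neg,
    integral_mul_adv hf.sob hf.div hG, integral_mul_lapH hG, integral_const_mul]
  have h1 := integral_mul_rq_nonpos hG hf.gam_axiS
  have h2 := two_abs_integral_mul_rq_le hG hRs (h.axiR t ht) hε hR
  linarith

/-- Energy inequality for `ω_θ / r`. -/
lemma gam_energy (h : AxiSol T U R P) {d : ℝ → ℝ} (hd : ContinuousOn d (Icc 0 T))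
    (hR : ∀ t ∈ Icc 0 T, (∃ ε > 0, ∀ x, rad x < ε → R t x = 0) ∧ nsq (radInv (R t)) ≤ d t)
    (ht : t ∈ Icc 0 T) :
    nsq (Gam fun j => U j t) + ∫ τ in (0 : ℝ)..t,
        (nsq (pd 0 (Gam fun j => U j τ)) + nsq (pd 1 (Gam fun j => U j τ))) ≤
      nsq (Gam fun j => U j 0) + ∫ τ in (0 : ℝ)..t, d τ := by
  have hc := h.gam_continuousOn.1
  refine nsq_add_integral_le (a := fun t => Gam fun j => U j t) h.gam_hasTimeDeriv
    (SobFam.gam h.U_sob) h.gamRhs_sob hd ((hc 0).add (hc 1)) (fun τ hτ => ?_) ht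
  obtain ⟨⟨ε, hε, hz⟩, hle⟩ := hR τ hτ
  have := h.two_integral_gam_le hτ hε hz
  simp only [Pi.add_apply]
  linarith

/-- The right-hand side of the vorticity equation. -/
noncomputable def _root_.HBS.vortRhs (U : Fin 3 → ℝ → E3 → ℝ) (R : ℝ → E3 → ℝ) (t : ℝ) (x : E3) : ℝ :=
  -adv (fun i => U i t) (vort U t) x + vr (fun i => U i t) x * vort U t x + lapH (vort U t) x -
    pd 0 (R t) x

lemma vortRhs_sob (h : AxiSol T U R P) : SobFam (Icc 0 T) (vortRhs U R) :=
  (((SobFam.adv h.U_sob h.vort_sob).neg.add ((SobFam.vr h.U_sob).mul h.vort_sob)).add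
    h.vort_sob.lapH).sub (h.R_sob.pd 0)

lemma vort_hasTimeDeriv (h : AxiSol T U R P) : HasTimeDeriv (Icc 0 T) (vort U) (vortRhs U R) :=
  h.vort_joint.hasTimeDeriv (uniqueDiffOn_Icc h.pos) measurableSet_Icc fun _ ht x => h.dt_vort ht x

lemma vort_continuousOn (h : AxiSol T U R P) :
    (∀ i, ContinuousOn (fun t => nsq (pd i (vort U t))) (Icc 0 T)) ∧
      ContinuousOn (fun t => nsq (vort U t)) (Icc 0 T) :=
  have h1 := h.vort_hasTimeDeriv.energy h.vort_sob h.vortRhs_sob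
  ⟨h1.1, h1.2.1⟩

/-- Energy inequality for the vorticity. -/
lemma vort_energy (h : AxiSol T U R P) {b : ℝ → ℝ} (hb : ContinuousOn b (Icc 0 T))
    (hv : ∀ t ∈ Icc 0 T, ∀ x, |vr (fun i => U i t) x| ≤ b t) (ht : t ∈ Icc 0 T) :
    nsq (vort U t) + ∫ τ in (0 : ℝ)..t, (nsq (pd 0 (vort U τ)) + nsq (pd 1 (vort U τ))) ≤
      nsq (vort U 0) + ∫ τ in (0 : ℝ)..t, (nsq (R 0) + 2 * b τ * nsq (vort U τ)) := by
  have hc := h.vort_continuousOn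
  refine nsq_add_integral_le (d := fun τ => nsq (R 0) + 2 * b τ * nsq (vort U τ))
    h.vort_hasTimeDeriv h.vort_sob h.vortRhs_sob
    (continuousOn_const.add ((continuousOn_const.mul hb).mul hc.2)) ((hc.1 0).add (hc.1 1))
    (fun τ hτ => ?_) ht
  have hf := h.flow τ hτ
  have hw := h.vort_sob.sob hτ
  have hRs := h.R_sob.sob hτ
  set w := vort U τ with hwd
  have i1 : Integrable fun x => -(w x * adv (fun j => U j τ) w x) :=
    (hw.integrable_mul (Sob.adv hf.sob hw)).neg
  have i2 := hw.integrable_mul (hf.vr_sob.mul hw)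
  have i3 := hw.integrable_mul hw.lapH
  have i4 := hw.integrable_mul (hRs.pd 0)
  have i12 : Integrable fun x => -(w x * adv (fun j => U j τ) w x) +
    w x * (vr (fun i => U i τ) x * w x) := i1.add i2
  have i123 : Integrable fun x => -(w x * adv (fun j => U j τ) w x) +
    w x * (vr (fun i => U i τ) x * w x) + w x * lapH w x := i12.add i3
  have e : ∀ x, w x * vortRhs U R τ x = -(w x * adv (fun j => U j τ) w x) +
      w x * (vr (fun i => U i τ) x * w x) + w x * lapH w x - w x * pd 0 (R τ) x := fun x => by
    simp only [vortRhs, ← hwd]; ring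
  simp only [e]
  rw [integral_sub i123 i4, integral_add i12 i3, integral_add i1 i2, integral_neg,
    integral_mul_adv hf.sob hf.div hw, integral_mul_lapH hw, hw.integral_mul_pd hRs 0]
  have h1 : ∫ x, w x * (vr (fun i => U i τ) x * w x) ≤ b τ * nsq w := by
    rw [nsq, ← integral_const_mul]
    refine integral_mono i2 (hw.integrable_sq.const_mul _) fun x => ?_
    have := (abs_le.1 (hv τ hτ x)).2
    simp only
    nlinarith [sq_nonneg (w x)]
  -- The derivative of the density has been moved onto the vorticity, where part of the horizontal
  -- dissipation pays for it; only the conserved `‖ρ‖` remains.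
  have h2 := integral_mul_le_half (hw.pd 0).memLp hRs.memLp one_pos
  have h3 := le_abs_self (∫ x, pd 0 w x * R τ x)
  rw [h.nsq_rho h.pos hτ] at h2
  have := nsq_nonneg (pd 1 w)
  simp only [Pi.add_apply]
  linarith

end AxiSol

end HBS

namespace HBS

/-! ### Integration in cylindrical coordinates -/

/-- The half-plane point with coordinates `(r, z)`. -/
noncomputable abbrev hp (r z : ℝ) : E3 := !₂[r, 0, z]

lemma rad_hp {r : ℝ} (hr : 0 ≤ r) (z : ℝ) : rad (hp r z) = r := by
  simp [rad, Real.sqrt_sq hr]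

lemma lintegral_axisymmetric {F : E3 → ℝ≥0∞} (hF : Measurable F)
    (ha : ∀ x y : E3, rad x = rad y → x 2 = y 2 → F x = F y) :
    ∫⁻ x, F x = ENNReal.ofReal (2 * Real.pi) *
      ∫⁻ z : ℝ, ∫⁻ r in Ioi (0 : ℝ), ENNReal.ofReal r * F (hp r z) := by
  rw [lintegral_slice hF, ← lintegral_const_mul' _ _ ENNReal.ofReal_ne_top]
  congr 1
  funext z
  rw [← lintegral_comp_polarCoord_symm]
  have hm : Measurable fun r : ℝ => ENNReal.ofReal r * F (hp r z) := by
    refine ENNReal.measurable_ofReal.mul (hF.comp ?_)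
    exact (by fun_prop : Continuous fun r : ℝ => hp r z).measurable
  have e : ∫⁻ p in polarCoord.target, ENNReal.ofReal p.1 •
      F !₂[(polarCoord.symm p).1, (polarCoord.symm p).2, z] =
      ∫⁻ p in polarCoord.target, ENNReal.ofReal p.1 * F (hp p.1 z) := by
    refine setLIntegral_congr_fun polarCoord.open_target.measurableSet fun p hp' => ?_
    rw [smul_eq_mul]
    congr 1
    rw [polarCoord_target] at hp'
    have hr : 0 < p.1 := hp'.1
    refine ha _ _ ?_ (by simp)
    rw [rad_hp hr.le, rad, polarCoord_symm_apply]
    simp only [Matrix.cons_val_zero, Matrix.cons_val_one]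
    rw [show (p.1 * Real.cos p.2) ^ 2 + (p.1 * Real.sin p.2) ^ 2 = p.1 ^ 2 by
      rw [mul_pow, mul_pow, ← mul_add, Real.cos_sq_add_sin_sq, mul_one], Real.sqrt_sq hr.le]
  rw [e, polarCoord_target, Measure.volume_eq_prod, ← Measure.prod_restrict, lintegral_prod]
  · simp only [lintegral_const, Measure.restrict_apply MeasurableSet.univ, univ_inter,
      Real.volume_Ioo]
    rw [lintegral_mul_const _ hm, mul_comm]
    congr 2
    ring
  · exact (hm.comp measurable_fst).aemeasurable

lemma lintegral_strip_le {F : E3 → ℝ≥0∞} (hF : Measurable F)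
    (ha : ∀ x y : E3, rad x = rad y → x 2 = y 2 → F x = F y) (z : ℝ) :
    ∫⁻ s in Ioi (0 : ℝ), ENNReal.ofReal s * ∫⁻ y in Ioc z (z + 1), F (hp s y) ≤ ∫⁻ x, F x := by
  have hc : Continuous fun q : ℝ × ℝ => hp q.1 q.2 := by fun_prop
  have hm : Measurable fun q : ℝ × ℝ => ENNReal.ofReal q.1 * F (hp q.1 q.2) :=
    (ENNReal.measurable_ofReal.comp measurable_fst).mul (hF.comp hc.measurable)
  have h1 : ∫⁻ s in Ioi (0 : ℝ), ENNReal.ofReal s * ∫⁻ y in Ioc z (z + 1), F (hp s y) =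
      ∫⁻ y in Ioc z (z + 1), ∫⁻ s in Ioi (0 : ℝ), ENNReal.ofReal s * F (hp s y) := by
    rw [lintegral_lintegral_swap (f := fun y s => ENNReal.ofReal s * F (hp s y))
      (hm.comp measurable_swap).aemeasurable]
    congr 1
    funext s
    rw [lintegral_const_mul' _ _ ENNReal.ofReal_ne_top]
  rw [h1, lintegral_axisymmetric hF ha]
  have h2 : (1 : ℝ≥0∞) ≤ ENNReal.ofReal (2 * Real.pi) := by
    rw [ENNReal.one_le_ofReal]
    linarith [Real.pi_gt_three]
  calc _ ≤ ∫⁻ y : ℝ, ∫⁻ s in Ioi (0 : ℝ), ENNReal.ofReal s * F (hp s y) := setLIntegral_le_lintegral _ _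
    _ = 1 * ∫⁻ y : ℝ, ∫⁻ s in Ioi (0 : ℝ), ENNReal.ofReal s * F (hp s y) := (one_mul _).symm
    _ ≤ _ := by gcongr

lemma hp_eq_two (s y : ℝ) : hp s y = hp s 0 + y • bv 2 := by
  ext k; fin_cases k <;> simp

lemma hp_eq_zero (s y : ℝ) : hp s y = hp 0 y + s • bv 0 := by
  ext k; fin_cases k <;> simp

lemma hasDerivAt_hp_two {f : E3 → ℝ} (hf : Differentiable ℝ f) (s y : ℝ) :
    HasDerivAt (fun y => f (hp s y)) (pd 2 f (hp s y)) y := by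
  rw [show (fun y => f (hp s y)) = fun y => f (hp s 0 + y • bv 2) from
    funext fun y => by rw [hp_eq_two s y], hp_eq_two s y]
  exact hasDerivAt_line hf 2 (hp s 0) y

lemma hasDerivAt_hp_zero {f : E3 → ℝ} (hf : Differentiable ℝ f) (s y : ℝ) :
    HasDerivAt (fun s => f (hp s y)) (pd 0 f (hp s y)) s := by
  rw [show (fun s => f (hp s y)) = fun s => f (hp 0 y + s • bv 0) from
    funext fun s => by rw [hp_eq_zero s y], hp_eq_zero s y]
  exact hasDerivAt_line hf 0 (hp 0 y) s

/-- Weighted vertical trace inequality on the half-plane. -/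
lemma lintegral_trace_le {φ : E3 → ℝ} (hs : Sob φ) {k : ℝ → ℝ} (hk : Measurable k)
    (hk0 : ∀ r, 0 ≤ r → 0 ≤ k r) (ha : AxiS φ) (z : ℝ) :
    ∫⁻ s in Ioi (0 : ℝ), ENNReal.ofReal s * ENNReal.ofReal (k s * φ (hp s z) ^ 2) ≤
      ∫⁻ x, ENNReal.ofReal (k (rad x) * (φ x ^ 2 + 2 * |φ x * pd 2 φ x|)) := by
  have hrad : Continuous rad := by unfold rad; fun_prop
  have hm : Measurable fun x => ENNReal.ofReal (k (rad x) * (φ x ^ 2 + 2 * |φ x * pd 2 φ x|)) := by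
    have h1 : Continuous fun x => φ x ^ 2 + 2 * |φ x * pd 2 φ x| :=
      (hs.continuous.pow 2).add ((hs.continuous.mul (hs.pd 2).continuous).abs.const_smul (2 : ℝ))
    exact ENNReal.measurable_ofReal.comp ((hk.comp hrad.measurable).mul h1.measurable)
  have hax := ha.pd_two hs.differentiable
  refine le_trans ?_ (lintegral_strip_le hm (fun x y h1 h2 => by
    rw [h1, ha x y h1 h2, hax x y h1 h2]) z)
  refine setLIntegral_mono' measurableSet_Ioi fun s hs0 => ?_
  have hs0' : 0 ≤ s := le_of_lt hs0
  refine mul_le_mul_right ?_ _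
  have h1 := fun y => hasDerivAt_hp_two hs.differentiable s y
  have h2 : ∀ y, HasDerivAt (fun y => k s * φ (hp s y) ^ 2)
      (k s * (2 * (φ (hp s y) * pd 2 φ (hp s y)))) y := fun y => by
    have h3 := ((h1 y).fun_pow 2).const_mul (k s)
    refine h3.congr_deriv ?_
    rw [Nat.cast_ofNat, show 2 - 1 = 1 from rfl, pow_one]
    ring
  have hc : Continuous fun y : ℝ => hp s y := by fun_prop
  have h4 := ofReal_le_lintegral_add_abs_deriv z h2 (continuous_const.mul (continuous_const.mul
    ((hs.continuous.comp hc).mul ((hs.pd 2).continuous.comp hc))))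
    (fun y => mul_nonneg (hk0 s hs0') (sq_nonneg _))
  refine h4.trans (le_of_eq ?_)
  refine lintegral_congr fun y => ?_
  rw [rad_hp hs0', abs_mul, abs_of_nonneg (hk0 s hs0'), abs_mul, abs_two, ← mul_add]

/-- A pointwise bound for axisymmetric functions. -/
lemma sq_le_lintegral_axisymmetric {φ : E3 → ℝ} (hs : Sob φ) (ha : AxiS φ) (x : E3) :
    ENNReal.ofReal (φ x ^ 2) ≤
      2 * (∫⁻ x, ENNReal.ofReal (φ x ^ 2 + 2 * |φ x * pd 2 φ x|)) +
      4 * (∫⁻ x, ENNReal.ofReal (rad x * (rq φ x ^ 2 + 2 * |rq φ x * pd 2 (rq φ) x|))) := by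
  set r := rad x with hr
  set z := x 2 with hz
  have hr0 : 0 ≤ r := rad_nonneg x
  have hpd := ha.pd_eq hs.contDiff
  have hx : φ x = φ (hp r z) := ha _ _ (rad_hp hr0 z).symm (by simp [hz])
  have hcz : Continuous fun s : ℝ => hp s z := by fun_prop
  -- Traces on the horizontal plane through `x`: `A` of `φ²` with the measure `s ds`, and `B` of
  -- `(rq φ)²` with the measure `s² ds`.
  set A : ℝ≥0∞ := ∫⁻ s in Ioi (0 : ℝ), ENNReal.ofReal s * ENNReal.ofReal (1 * φ (hp s z) ^ 2)
  set B : ℝ≥0∞ := ∫⁻ s in Ioi (0 : ℝ), ENNReal.ofReal s * ENNReal.ofReal (s * rq φ (hp s z) ^ 2)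
    with hB
  have hA : A ≤ ∫⁻ x, ENNReal.ofReal (φ x ^ 2 + 2 * |φ x * pd 2 φ x|) := by
    have := lintegral_trace_le hs (k := fun _ => 1) measurable_const (fun _ _ => zero_le_one) ha z
    simp only [one_mul] at this
    simpa only [A, one_mul] using this
  have hB' : B ≤ ∫⁻ x, ENNReal.ofReal (rad x * (rq φ x ^ 2 + 2 * |rq φ x * pd 2 (rq φ) x|)) :=
    lintegral_trace_le hs.rq (k := fun r => r) measurable_id (fun _ h => h) hpd.2.2 z
  refine le_trans ?_ (add_le_add (mul_le_mul_right hA 2) (mul_le_mul_right hB' 4))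
  -- comparison with the value at distance `s`
  have hdiff : ∀ s ∈ Ioc (r + 1) (r + 2), ENNReal.ofReal (φ x ^ 2) ≤
      2 * ENNReal.ofReal (φ (hp s z) ^ 2) + 4 * B := by
    intro s hsr
    have hrs : r ≤ s := by linarith [hsr.1]
    have hcd : Continuous fun σ : ℝ => σ * rq φ (hp σ z) :=
      continuous_id.mul (hs.rq.continuous.comp hcz)
    have h1 : ∫ σ in r..s, σ * rq φ (hp σ z) = φ (hp s z) - φ (hp r z) := by
      refine intervalIntegral.integral_eq_sub_of_hasDerivAt (f := fun σ => φ (hp σ z))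
        (fun σ _ => ?_) (hcd.intervalIntegrable _ _)
      have := hasDerivAt_hp_zero hs.differentiable σ z
      rwa [hpd.1] at this
    -- Since `∂_r φ = σ rq φ`, Cauchy-Schwarz on an interval of length at most 2 produces exactly
    -- the integrand of `B`.
    have h2 : ‖φ (hp s z) - φ (hp r z)‖ₑ ^ 2 ≤ 2 * B := by
      rw [← h1, intervalIntegral.integral_of_le hrs]
      have h3 := enorm_integral_le_lintegral_enorm (μ := volume.restrict (Ioc r s))
        fun σ => σ * rq φ (hp σ z)
      have h4 := lintegral_mul_sq_le (volume.restrict (Ioc r s)) (f := fun _ => 1)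
        (g := fun σ => ‖σ * rq φ (hp σ z)‖ₑ) aemeasurable_const hcd.enorm.measurable.aemeasurable
      simp only [one_mul, one_pow, lintegral_one, Measure.restrict_apply MeasurableSet.univ,
        univ_inter, Real.volume_Ioc] at h4
      refine (pow_le_pow_left' h3 2).trans (h4.trans (mul_le_mul' ?_ ?_))
      · rw [show (2 : ℝ≥0∞) = ENNReal.ofReal 2 by simp]
        exact ENNReal.ofReal_le_ofReal (by linarith [hsr.2])
      · rw [hB]
        refine le_trans (lintegral_mono_set (fun σ hσ => lt_of_le_of_lt hr0 hσ.1 :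
          Ioc r s ⊆ Ioi 0)) ?_
        refine setLIntegral_mono' measurableSet_Ioi fun σ hσ => le_of_eq ?_
        have hσ0 : 0 ≤ σ := le_of_lt hσ
        rw [← ENNReal.ofReal_mul hσ0, Real.enorm_eq_ofReal_abs, ← ENNReal.ofReal_pow (abs_nonneg _),
          sq_abs]
        congr 1
        ring
    have h5 : φ x ^ 2 ≤ 2 * φ (hp s z) ^ 2 + 2 * (φ (hp s z) - φ (hp r z)) ^ 2 := by
      rw [hx]
      nlinarith [sq_nonneg (2 * φ (hp s z) - φ (hp r z))]
    have h6 : ENNReal.ofReal ((φ (hp s z) - φ (hp r z)) ^ 2) ≤ 2 * B := by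
      rw [Real.enorm_eq_ofReal_abs, ← ENNReal.ofReal_pow (abs_nonneg _), sq_abs] at h2
      exact h2
    calc ENNReal.ofReal (φ x ^ 2) ≤
          ENNReal.ofReal (2 * φ (hp s z) ^ 2 + 2 * (φ (hp s z) - φ (hp r z)) ^ 2) :=
            ENNReal.ofReal_le_ofReal h5
      _ = 2 * ENNReal.ofReal (φ (hp s z) ^ 2) +
          2 * ENNReal.ofReal ((φ (hp s z) - φ (hp r z)) ^ 2) := by
            rw [ENNReal.ofReal_add (by positivity) (by positivity), ENNReal.ofReal_mul (by norm_num),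
              ENNReal.ofReal_mul (by norm_num)]
            simp
      _ ≤ 2 * ENNReal.ofReal (φ (hp s z) ^ 2) + 2 * (2 * B) := by gcongr
      _ = _ := by rw [← mul_assoc]; norm_num
  -- The average is taken over `r + 1 < s ≤ r + 2`. There `s ≥ 1`, so `ds` is dominated by `s ds`,
  -- even when `x` lies on the axis.
  calc ENNReal.ofReal (φ x ^ 2) = ∫⁻ _s in Ioc (r + 1) (r + 2), ENNReal.ofReal (φ x ^ 2) := by
        rw [lintegral_const, Measure.restrict_apply MeasurableSet.univ, univ_inter, Real.volume_Ioc]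
        norm_num
    _ ≤ ∫⁻ s in Ioc (r + 1) (r + 2), (2 * ENNReal.ofReal (φ (hp s z) ^ 2) + 4 * B) :=
        setLIntegral_mono' measurableSet_Ioc hdiff
    _ = 2 * (∫⁻ s in Ioc (r + 1) (r + 2), ENNReal.ofReal (φ (hp s z) ^ 2)) + 4 * B := by
        rw [lintegral_add_right _ measurable_const, lintegral_const_mul' _ _ (by simp),
          lintegral_const, Measure.restrict_apply MeasurableSet.univ, univ_inter, Real.volume_Ioc]
        norm_num
    _ ≤ _ := by
        refine add_le_add (mul_le_mul_right ?_ 2) le_rfl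
        refine le_trans ?_ (lintegral_mono_set (fun s hs => by
          have := hs.1; simp only [mem_Ioi]; linarith : Ioc (r + 1) (r + 2) ⊆ Ioi 0))
        refine setLIntegral_mono' measurableSet_Ioc fun s hs => ?_
        rw [one_mul]
        refine le_mul_of_one_le_left' ?_
        rw [ENNReal.one_le_ofReal]
        linarith [hs.1]

end HBS

/-! ### Uniform bounds for `v_r / r` and `v_z` -/

namespace HBS

lemma sq_le_of_pointwise {φ H₁ H₂ : E3 → ℝ} (hs : Sob φ) (ha : AxiS φ) (h₁ : Integrable H₁)
    (h₂ : Integrable H₂) (hH₁ : ∀ x, φ x ^ 2 + 2 * |φ x * pd 2 φ x| ≤ H₁ x)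
    (hH₂ : ∀ x, rad x * (rq φ x ^ 2 + 2 * |rq φ x * pd 2 (rq φ) x|) ≤ H₂ x) (x : E3) :
    φ x ^ 2 ≤ 2 * (∫ x, H₁ x) + 4 * ∫ x, H₂ x := by
  have p1 : ∀ x, 0 ≤ H₁ x := fun x => le_trans (by positivity) (hH₁ x)
  have p2 : ∀ x, 0 ≤ H₂ x := fun x =>
    le_trans (mul_nonneg (rad_nonneg x) (by positivity)) (hH₂ x)
  have n1 : 0 ≤ ∫ x, H₁ x := integral_nonneg p1
  have n2 : 0 ≤ ∫ x, H₂ x := integral_nonneg p2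
  have h := sq_le_lintegral_axisymmetric hs ha x
  rw [← ENNReal.ofReal_le_ofReal_iff (by positivity)]
  refine h.trans ?_
  rw [ENNReal.ofReal_add (by positivity) (by positivity), ENNReal.ofReal_mul (by norm_num),
    ENNReal.ofReal_mul (by norm_num), ofReal_integral_eq_lintegral_ofReal h₁ (ae_of_all _ p1),
    ofReal_integral_eq_lintegral_ofReal h₂ (ae_of_all _ p2), ENNReal.ofReal_ofNat,
    ENNReal.ofReal_ofNat]
  exact add_le_add (mul_le_mul_right (lintegral_mono fun x => ENNReal.ofReal_le_ofReal (hH₁ x)) _)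
    (mul_le_mul_right (lintegral_mono fun x => ENNReal.ofReal_le_ofReal (hH₂ x)) _)

lemma nsq_add_le {f g : E3 → ℝ} (hf : MemLp f 2 volume) (hg : MemLp g 2 volume) :
    nsq (fun x => f x + g x) ≤ 2 * nsq f + 2 * nsq g := by
  simp only [nsq]
  rw [← integral_const_mul, ← integral_const_mul,
    ← integral_add (hf.integrable_sq.const_mul 2) (hg.integrable_sq.const_mul 2)]
  refine integral_mono (hf.add hg).integrable_sq
    ((hf.integrable_sq.const_mul 2).add (hg.integrable_sq.const_mul 2)) fun x => ?_
  simp only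
  nlinarith [sq_nonneg (f x - g x)]

/-- The squared norms which control the velocity pointwise. -/
noncomputable def ctrl (v : Fin 3 → E3 → ℝ) : ℝ :=
  nsq (Gam v) + (nsq (pd 0 (Gam v)) + nsq (pd 1 (Gam v))) + ∑ i, nsq (v i) +
    ∑ i, (nsq (pd 0 (v i)) + nsq (pd 1 (v i)))

lemma two_mul_abs_le (a b : ℝ) : 2 * |a * b| ≤ a ^ 2 + b ^ 2 := by
  rw [abs_mul, ← sq_abs a, ← sq_abs b]
  nlinarith [sq_nonneg (|a| - |b|)]

namespace AxiFlow
variable {v : Fin 3 → E3 → ℝ}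

/-- Viscosity acts only horizontally, so `∂_z Γ` must not appear. For `f = v_r / r` one has `r |∂_z
rq f| = |∇_h ∂_z f|`, which the second elliptic estimate controls by `∇_h Γ`. -/
lemma vr_sq_le (h : AxiFlow v) (x : E3) : vr v x ^ 2 ≤ 16 * ctrl v := by
  have hf := h.vr_sob
  have ha := h.radial.2.2
  have s0 := (hf.pd 0).integrable_sq
  have s1 := (hf.pd 1).integrable_sq
  have s2 := (hf.pd 2).integrable_sq
  have sq := hf.rq.integrable_sq
  have t0 := ((hf.pd 2).pd 0).integrable_sq
  have t1 := ((hf.pd 2).pd 1).integrable_sq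
  have i1 : Integrable fun x => 2 * vr v x ^ 2 + pd 2 (vr v) x ^ 2 :=
    (hf.integrable_sq.const_mul 2).add s2
  have j1 : Integrable fun x => 2 * rq (vr v) x ^ 2 + pd 0 (vr v) x ^ 2 := (sq.const_mul 2).add s0
  have j2 : Integrable fun x => 2 * rq (vr v) x ^ 2 + pd 0 (vr v) x ^ 2 + pd 1 (vr v) x ^ 2 :=
    j1.add s1
  have j3 : Integrable fun x => 2 * rq (vr v) x ^ 2 + pd 0 (vr v) x ^ 2 + pd 1 (vr v) x ^ 2 +
    pd 0 (pd 2 (vr v)) x ^ 2 := j2.add t0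
  have j4 : Integrable fun x => 2 * rq (vr v) x ^ 2 + pd 0 (vr v) x ^ 2 + pd 1 (vr v) x ^ 2 +
    pd 0 (pd 2 (vr v)) x ^ 2 + pd 1 (pd 2 (vr v)) x ^ 2 := j3.add t1
  have key := sq_le_of_pointwise hf ha i1 j4 (fun x => by
    have := two_mul_abs_le (vr v x) (pd 2 (vr v) x)
    linarith) (fun x => by
    have hpd2 := (ha.pd_two hf.differentiable).pd_eq (hf.pd 2).contDiff
    rw [hpd2.1, hpd2.2.1, (h.pd_vr x).1, (h.pd_vr x).2, ha.rq_pd_two hf]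
    have e1 := two_mul_abs_le (rq (vr v) x) (rad x * pd 2 (rq (vr v)) x)
    have e2 := two_mul_abs_le (rq (vr v) x) (rad x * rq (vr v) x)
    have e3 : |rq (vr v) x * (rad x * pd 2 (rq (vr v)) x)| =
        rad x * |rq (vr v) x * pd 2 (rq (vr v)) x| := by
      rw [← abs_of_nonneg (rad_nonneg x), ← abs_mul, abs_of_nonneg (rad_nonneg x)]
      congr 1
      ring
    have e4 : rq (vr v) x * (rad x * rq (vr v) x) = rad x * rq (vr v) x ^ 2 := by ring
    rw [e3] at e1
    rw [e4, abs_of_nonneg (mul_nonneg (rad_nonneg x) (sq_nonneg _))] at e2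
    rw [mul_pow, rad_sq] at e1 e2
    nlinarith [sq_nonneg (x 0 * rq (vr v) x), sq_nonneg (x 1 * rq (vr v) x),
      sq_nonneg (rq (vr v) x)]) x
  rw [integral_add (hf.integrable_sq.const_mul 2) s2, integral_add j3 t1, integral_add j2 t0,
    integral_add j1 s1, integral_add (sq.const_mul 2) s0, integral_const_mul,
    integral_const_mul] at key
  change vr v x ^ 2 ≤ 2 * (2 * nsq (vr v) + nsq (pd 2 (vr v))) + 4 * (2 * nsq (rq (vr v)) +
    nsq (pd 0 (vr v)) + nsq (pd 1 (vr v)) + nsq (pd 0 (pd 2 (vr v))) +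
    nsq (pd 1 (pd 2 (vr v)))) at key
  have k1 := h.nsq_vr_le
  have k2 := h.nsq_pd_vr_le
  have k3 := h.nsq_second_le
  have m1 := fun k => nsq_nonneg (pd k (vr v))
  have m2 := fun k l => nsq_nonneg (pd k (v l))
  have m3 := fun l => nsq_nonneg (v l)
  have m4 := nsq_nonneg (lapH (vr v))
  have m5 := nsq_nonneg (rq (vr v))
  have m6 := fun k => nsq_nonneg (pd k (Gam v))
  simp only [ctrl, Fin.sum_univ_three]
  linarith [m1 0, m1 1, m1 2, m2 0 0, m2 0 1, m2 0 2, m2 1 0, m2 1 1, m2 1 2, m3 0, m3 1, m3 2,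
    m6 0, m6 1]

/-- With `f = v_r / r`, one has `rq v_z = ∂_z f - Γ`, and incompressibility gives `∂_z rq v_z = -(2
rq f + Δ_h f)`. Both are covered by the elliptic estimates, without a vertical derivative of `Γ`. -/
lemma v_two_sq_le (h : AxiFlow v) (x : E3) : v 2 x ^ 2 ≤ 16 * ctrl v := by
  have hg := h.sob 2
  have hf := h.vr_sob
  have ha := h.axiS_two
  have s0 := (hg.pd 0).integrable_sq
  have s1 := (hg.pd 1).integrable_sq
  have s2 := (hg.pd 2).integrable_sq
  have sq := hg.rq.integrable_sq
  have t2 := (hg.rq.pd 2).integrable_sq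
  have i1 : Integrable fun x => 2 * v 2 x ^ 2 + pd 2 (v 2) x ^ 2 :=
    (hg.integrable_sq.const_mul 2).add s2
  have j1 : Integrable fun x => rq (v 2) x ^ 2 + 2 * pd 0 (v 2) x ^ 2 := sq.add (s0.const_mul 2)
  have j2 : Integrable fun x => rq (v 2) x ^ 2 + 2 * pd 0 (v 2) x ^ 2 + 2 * pd 1 (v 2) x ^ 2 :=
    j1.add (s1.const_mul 2)
  have j3 : Integrable fun x => rq (v 2) x ^ 2 + 2 * pd 0 (v 2) x ^ 2 + 2 * pd 1 (v 2) x ^ 2 +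
    pd 2 (rq (v 2)) x ^ 2 := j2.add t2
  have key := sq_le_of_pointwise hg ha i1 j3 (fun x => by
    have := two_mul_abs_le (v 2 x) (pd 2 (v 2) x)
    linarith) (fun x => by
    rw [(h.pd_two x).1, (h.pd_two x).2]
    have e1 := two_mul_abs_le (rad x * rq (v 2) x) (pd 2 (rq (v 2)) x)
    have e2 := two_mul_abs_le (rq (v 2) x) (rad x * rq (v 2) x)
    have e3 : |rad x * rq (v 2) x * pd 2 (rq (v 2)) x| =
        rad x * |rq (v 2) x * pd 2 (rq (v 2)) x| := by
      rw [mul_assoc, abs_mul, abs_of_nonneg (rad_nonneg x)]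
    have e4 : rq (v 2) x * (rad x * rq (v 2) x) = rad x * rq (v 2) x ^ 2 := by ring
    rw [e3] at e1
    rw [e4, abs_of_nonneg (mul_nonneg (rad_nonneg x) (sq_nonneg _))] at e2
    rw [mul_pow, rad_sq] at e1 e2
    nlinarith [sq_nonneg (x 0 * rq (v 2) x), sq_nonneg (x 1 * rq (v 2) x),
      sq_nonneg (rq (v 2) x)]) x
  rw [integral_add (hg.integrable_sq.const_mul 2) s2, integral_add j2 t2,
    integral_add j1 (s1.const_mul 2), integral_add sq (s0.const_mul 2), integral_const_mul,
    integral_const_mul, integral_const_mul] at key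
  change v 2 x ^ 2 ≤ 2 * (2 * nsq (v 2) + nsq (pd 2 (v 2))) + 4 * (nsq (rq (v 2)) +
    2 * nsq (pd 0 (v 2)) + 2 * nsq (pd 1 (v 2)) + nsq (pd 2 (rq (v 2)))) at key
  have k0 : nsq (pd 2 (v 2)) ≤ 2 * nsq (pd 0 (v 0)) + 2 * nsq (pd 1 (v 1)) := by
    have e : nsq (pd 2 (v 2)) = nsq fun x => pd 0 (v 0) x + pd 1 (v 1) x := by
      simp only [nsq]
      congr 1
      funext x
      have := h.div x
      rw [Fin.sum_univ_three] at this
      rw [show pd 2 (v 2) x = -(pd 0 (v 0) x + pd 1 (v 1) x) by linarith, neg_sq]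
    rw [e]
    exact nsq_add_le ((h.sob 0).pd 0).memLp ((h.sob 1).pd 1).memLp
  have k1 : nsq (rq (v 2)) ≤ 2 * nsq (pd 2 (vr v)) + 2 * nsq (Gam v) := by
    have e : nsq (rq (v 2)) = nsq fun x => pd 2 (vr v) x + (-1) * Gam v x := by
      congr 1
      funext x
      simp [Gam]
    have e2 : nsq (fun x => (-1) * Gam v x) = nsq (Gam v) := by simp [nsq]
    rw [e, ← e2]
    exact nsq_add_le (hf.pd 2).memLp (h.gam_sob.const_mul (-1)).memLp
  have k4 : nsq (pd 2 (rq (v 2))) ≤ 8 * nsq (rq (vr v)) + 2 * nsq (lapH (vr v)) := by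
    rw [← ha.rq_pd_two hg, h.rq_pd_two_two]
    have e : nsq (fun x => -(2 * rq (vr v) x + lapH (vr v) x)) =
        nsq fun x => 2 * rq (vr v) x + lapH (vr v) x := by simp only [nsq, neg_sq]
    have e2 : nsq (fun x => 2 * rq (vr v) x) = 4 * nsq (rq (vr v)) := by
      simp only [nsq, mul_pow]
      rw [integral_const_mul]
      norm_num
    have := nsq_add_le (hf.rq.const_mul 2).memLp hf.lapH.memLp
    rw [e]
    linarith
  have k2 := h.nsq_pd_vr_le
  have k3 := h.nsq_second_le
  have m1 := fun k => nsq_nonneg (pd k (vr v))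
  have m2 := fun k l => nsq_nonneg (pd k (v l))
  have m3 := fun l => nsq_nonneg (v l)
  have m4 := nsq_nonneg (lapH (vr v))
  have m5 := nsq_nonneg (rq (vr v))
  have m6 := fun k => nsq_nonneg (pd k (Gam v))
  simp only [ctrl, Fin.sum_univ_three]
  linarith [m1 0, m1 1, m1 2, m2 0 0, m2 0 1, m2 0 2, m2 1 0, m2 1 1, m2 1 2, m3 0, m3 1, m3 2,
    m6 0, m6 1]

end AxiFlow

end HBS

namespace HBS

/-! ### Transport of the support of the density -/

/-- The derivative is bounded because it vanishes outside `[0, 1]`, where the transition function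
sits at an extremum. -/
lemma transition_deriv : ∃ K : ℝ, 0 ≤ K ∧ ∀ y,
    HasDerivAt Real.smoothTransition (deriv Real.smoothTransition y) y ∧
    0 ≤ deriv Real.smoothTransition y ∧ deriv Real.smoothTransition y ≤ K ∧
    (y ≤ 0 → deriv Real.smoothTransition y = 0) := by
  have hc : Continuous (deriv Real.smoothTransition) :=
    (Real.smoothTransition.contDiff (n := 1)).continuous_deriv (by simp)
  have hz : ∀ y ≤ 0, deriv Real.smoothTransition y = 0 := fun y hy => by
    refine IsLocalMin.deriv_eq_zero (Filter.Eventually.of_forall fun z => ?_)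
    rw [Real.smoothTransition.zero_of_nonpos hy]
    exact Real.smoothTransition.nonneg z
  have ho : ∀ y, 1 ≤ y → deriv Real.smoothTransition y = 0 := fun y hy => by
    refine IsLocalMax.deriv_eq_zero (Filter.Eventually.of_forall fun z => ?_)
    rw [Real.smoothTransition.one_of_one_le hy]
    exact Real.smoothTransition.le_one z
  obtain ⟨K, hK⟩ := isCompact_Icc.exists_bound_of_continuousOn (s := Icc (0 : ℝ) 1) hc.continuousOn
  refine ⟨max K 0, le_max_right _ _, fun y => ⟨?_, ?_, ?_, hz y⟩⟩
  · exact ((Real.smoothTransition.contDiff (n := 1)).differentiable (by simp) y).hasDerivAt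
  · exact Real.smoothTransition.monotone.deriv_nonneg
  · by_cases h0 : y ≤ 0
    · rw [hz y h0]; exact le_max_right _ _
    · by_cases h1 : 1 ≤ y
      · rw [ho y h1]; exact le_max_right _ _
      · exact ((le_abs_self _).trans (hK y ⟨(not_le.1 h0).le, (not_le.1 h1).le⟩)).trans
          (le_max_left _ _)

namespace CompSol
variable {T : ℝ} {U : Fin 3 → ℝ → E3 → ℝ} {R P : ℝ → E3 → ℝ} {t : ℝ}

/-- A weight which decreases along the flow gives a nonincreasing weighted mass. -/
lemma integral_sq_mul_weight_le (hT : 0 < T) (h : CompSol T U R P) {w w' : ℝ → E3 → ℝ} {K : ℝ}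
    (hK : 0 ≤ K)
    (hw : ContinuousOn (fun q : ℝ × E3 => w q.1 q.2) (Icc 0 T ×ˢ univ))
    (hw' : ContinuousOn (fun q : ℝ × E3 => w' q.1 q.2) (Icc 0 T ×ˢ univ))
    (hd : ∀ t ∈ Icc 0 T, ∀ x, HasDerivWithinAt (fun s => w s x) (w' t x) (Icc 0 T) t)
    (hx : ∀ t ∈ Icc 0 T, Differentiable ℝ (w t))
    (hxc : ∀ t ∈ Icc 0 T, ∀ j, Continuous (pd j (w t)))
    (hb : ∀ t ∈ Icc 0 T, ∀ x, |w t x| ≤ K ∧ |w' t x| ≤ K ∧ ∀ j, |pd j (w t) x| ≤ K)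
    (hle : ∀ t ∈ Icc 0 T, ∀ x, w' t x + adv (fun j => U j t) (w t) x ≤ 0) (ht : t ∈ Icc 0 T) :
    ∫ x, R t x ^ 2 * w t x ≤ ∫ x, R 0 x ^ 2 * w 0 x := by
  have hsub : Icc 0 t ⊆ Icc 0 T := Icc_subset_Icc le_rfl ht.2
  have hwc : ∀ τ ∈ Icc 0 T, Continuous (w τ) := fun τ hτ => (hx τ hτ).continuous
  have hwc' : ∀ τ ∈ Icc 0 T, Continuous (w' τ) := fun τ hτ => by
    have := hw'.comp (f := fun x : E3 => (τ, x)) (s := univ) (by fun_prop) fun x _ => ⟨hτ, trivial⟩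
    exact continuousOn_univ.1 this
  have hwt : HasTimeDeriv (Icc 0 T) w w' := by
    refine ⟨ae_of_all _ fun x τ hτ => hd τ hτ x, ae_of_all _ fun x => ?_,
      aestronglyMeasurable_prod measurableSet_Icc hw, aestronglyMeasurable_prod measurableSet_Icc hw'⟩
    exact hw'.comp (f := fun s => (s, x)) (by fun_prop) fun τ hτ => ⟨hτ, trivial⟩
  have hRt := h.rho_hasTimeDeriv hT
  have hA : SobFam (Icc 0 T) (fun t => adv (fun j => U j t) (R t)) := SobFam.adv h.U_sob h.R_sob
  have htd := ((hRt.mul hRt).mul hwt).mono hsub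
  obtain ⟨BA, hBA0, hBA⟩ := hA.exists_nsq_le
  obtain ⟨BR, hBR0, hBR⟩ := h.R_sob.exists_nsq_le
  have hRR : ∀ τ ∈ Icc 0 T, Integrable fun x => R τ x * R τ x := fun τ hτ =>
    (h.R_sob.sob hτ).integrable_mul (h.R_sob.sob hτ)
  have hRA : ∀ τ ∈ Icc 0 T, Integrable fun x => -adv (fun j => U j τ) (R τ) x * R τ x +
      R τ x * -adv (fun j => U j τ) (R τ) x := fun τ hτ => by
    have h1 := ((h.R_sob.sob hτ).integrable_mul (hA.sob hτ)).const_mul (-2)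
    refine h1.congr (ae_of_all _ fun x => ?_)
    simp only
    ring
  have hi1 : ∀ τ ∈ Icc 0 T, Integrable fun x => (-adv (fun j => U j τ) (R τ) x * R τ x +
      R τ x * -adv (fun j => U j τ) (R τ) x) * w τ x := fun τ hτ =>
    integrable_mul_of_bounded (hRA τ hτ) (hwc τ hτ).aestronglyMeasurable fun x => (hb τ hτ x).1
  have hi2 : ∀ τ ∈ Icc 0 T, Integrable fun x => R τ x * R τ x * w' τ x := fun τ hτ =>
    integrable_mul_of_bounded (hRR τ hτ) (hwc' τ hτ).aestronglyMeasurable fun x => (hb τ hτ x).2.1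
  have hi0 : ∀ τ ∈ Icc 0 T, Integrable fun x => R τ x * R τ x * w τ x := fun τ hτ =>
    integrable_mul_of_bounded (hRR τ hτ) (hwc τ hτ).aestronglyMeasurable fun x => (hb τ hτ x).1
  have hbound : ∀ τ ∈ Icc 0 t, Integrable (fun x => (-adv (fun j => U j τ) (R τ) x * R τ x +
      R τ x * -adv (fun j => U j τ) (R τ) x) * w τ x + R τ x * R τ x * w' τ x) ∧
      ∫ x, |(-adv (fun j => U j τ) (R τ) x * R τ x +
      R τ x * -adv (fun j => U j τ) (R τ) x) * w τ x + R τ x * R τ x * w' τ x| ≤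
      K * (BA + 2 * BR) := by
    intro τ hτ
    have hτ' := hsub hτ
    have hi := (hi1 τ hτ').add (hi2 τ hτ')
    refine ⟨hi, ?_⟩
    have hAs := (hA.sob hτ').integrable_sq
    have hRs := ((h.R_sob.sob hτ').integrable_sq).const_mul 2
    calc _ ≤ ∫ x, K * (adv (fun j => U j τ) (R τ) x ^ 2 + 2 * R τ x ^ 2) := by
          refine integral_mono hi.abs ((hAs.add hRs).const_mul K) fun x => ?_
          obtain ⟨b1, b2, -⟩ := hb τ hτ' x
          set A := adv (fun j => U j τ) (R τ) x
          have e1 : |(-A * R τ x + R τ x * -A) * w τ x| ≤ (A ^ 2 + R τ x ^ 2) * K := by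
            rw [abs_mul]
            refine mul_le_mul ?_ b1 (abs_nonneg _) (by positivity)
            have := two_mul_abs_le A (R τ x)
            rw [show -A * R τ x + R τ x * -A = -(2 * (A * R τ x)) by ring, abs_neg, abs_mul, abs_two]
            exact this
          have e2 : |R τ x * R τ x * w' τ x| ≤ R τ x ^ 2 * K := by
            rw [abs_mul, ← sq, abs_of_nonneg (sq_nonneg _)]
            exact mul_le_mul_of_nonneg_left b2 (sq_nonneg _)
          refine (abs_add_le _ _).trans ?_
          simp only
          linarith
      _ = K * (nsq (adv (fun j => U j τ) (R τ)) + 2 * nsq (R τ)) := by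
          rw [integral_const_mul, integral_add hAs hRs, integral_const_mul]
          rfl
      _ ≤ _ := by
          have := hBA τ hτ'
          have := hBR τ hτ'
          refine mul_le_mul_of_nonneg_left ?_ hK
          linarith
  have hF := (htd.integral_sub ht.1 (hi0 0 (hsub (left_mem_Icc.2 ht.1))) (hi0 t ht) hbound).2
  have hneg : ∫ τ in (0 : ℝ)..t, ∫ x, ((-adv (fun j => U j τ) (R τ) x * R τ x +
      R τ x * -adv (fun j => U j τ) (R τ) x) * w τ x + R τ x * R τ x * w' τ x) ≤ 0 := by
    rw [← neg_nonneg, ← intervalIntegral.integral_neg]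
    refine intervalIntegral.integral_nonneg ht.1 fun τ hτ => ?_
    have hτ' := hsub hτ
    have hRs := h.R_sob.sob hτ'
    have hUs := fun j => (h.U_sob j).sob hτ'
    have hRU : ∀ j, Integrable fun x => R τ x * (R τ x * U j τ x) := fun j =>
      hRs.integrable_mul (hRs.mul (hUs j))
    have hpe : ∀ j x, pd j (fun x => R τ x * (R τ x * U j τ x)) x =
        pd j (R τ) x * (R τ x * U j τ x) + R τ x * pd j (fun x => R τ x * U j τ x) x := fun j x =>
      pd_mul j (hRs.differentiableAt x) ((hRs.mul (hUs j)).differentiableAt x)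
    have hpRU : ∀ j, Integrable fun x => pd j (fun x => R τ x * (R τ x * U j τ x)) x := fun j => by
      simp only [hpe]
      exact ((hRs.pd j).integrable_mul (hRs.mul (hUs j))).add
        (hRs.integrable_mul ((hRs.mul (hUs j)).pd j))
    have b1 : ∀ j, Integrable fun x => pd j (fun x => R τ x * (R τ x * U j τ x)) x * w τ x :=
      fun j => integrable_mul_of_bounded (hpRU j) (hwc τ hτ').aestronglyMeasurable
        fun x => (hb τ hτ' x).1
    have b2 : ∀ j, Integrable fun x => R τ x * (R τ x * U j τ x) * pd j (w τ) x := fun j =>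
      integrable_mul_of_bounded (hRU j) (hxc τ hτ' j).aestronglyMeasurable
        fun x => (hb τ hτ' x).2.2 j
    have hibp : ∀ j, ∫ x, R τ x * (R τ x * U j τ x) * pd j (w τ) x =
        -∫ x, pd j (fun x => R τ x * (R τ x * U j τ x)) x * w τ x := fun j =>
      integral_mul_pd_of_integrable j (hRs.mul (hRs.mul (hUs j))).differentiable (hx τ hτ') (b1 j)
        (b2 j) (integrable_mul_of_bounded (hRU j) (hwc τ hτ').aestronglyMeasurable
          fun x => (hb τ hτ' x).1)
    -- By incompressibility, integration by parts transfers the advection from the squared density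
    -- to the weight.
    have e1 : ∫ x, (-adv (fun j => U j τ) (R τ) x * R τ x +
        R τ x * -adv (fun j => U j τ) (R τ) x) * w τ x =
        ∫ x, R τ x * R τ x * adv (fun j => U j τ) (w τ) x := by
      have s1 : ∫ x, R τ x * R τ x * adv (fun j => U j τ) (w τ) x =
          ∑ j, ∫ x, R τ x * (R τ x * U j τ x) * pd j (w τ) x := by
        rw [← integral_finsetSum _ fun j _ => b2 j]
        congr 1
        funext x
        simp only [adv, Finset.mul_sum]
        exact Finset.sum_congr rfl fun j _ => by ring
      rw [s1]
      simp only [hibp]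
      rw [Finset.sum_neg_distrib, ← integral_finsetSum _ fun j _ => b1 j, ← integral_neg]
      congr 1
      funext x
      rw [← Finset.sum_mul]
      have hdv := h.incompressible τ hτ' x
      simp only [hpe, pd_mul _ (hRs.differentiableAt x) ((hUs _).differentiableAt x)]
      simp only [adv, Fin.sum_univ_three] at hdv ⊢
      linear_combination (R τ x * R τ x * w τ x) * hdv
    have i3 : Integrable fun x => R τ x * R τ x * adv (fun j => U j τ) (w τ) x := by
      have : (fun x => R τ x * R τ x * adv (fun j => U j τ) (w τ) x) =
          fun x => ∑ j, R τ x * (R τ x * U j τ x) * pd j (w τ) x := by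
        funext x
        simp only [adv, Finset.mul_sum]
        exact Finset.sum_congr rfl fun j _ => by ring
      rw [this]
      exact integrable_finsetSum _ fun j _ => b2 j
    rw [integral_add (hi1 τ hτ') (hi2 τ hτ'), e1, ← integral_add i3 (hi2 τ hτ'), neg_nonneg]
    refine integral_nonpos fun x => ?_
    have := hle τ hτ' x
    simp only [Pi.zero_apply]
    nlinarith [mul_nonneg (mul_self_nonneg (R τ x)) (neg_nonneg.2 this)]
  simp only [sq]
  linarith

/-- The density stays zero in a region which moves with the flow. -/
lemma density_eq_zero (hT : 0 < T) (h : CompSol T U R P) {σ σ' : ℝ → E3 → ℝ} {K : ℝ} (hK : 0 ≤ K)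
    (hσ : ContinuousOn (fun q : ℝ × E3 => σ q.1 q.2) (Icc 0 T ×ˢ univ))
    (hσ' : ContinuousOn (fun q : ℝ × E3 => σ' q.1 q.2) (Icc 0 T ×ˢ univ))
    (hd : ∀ t ∈ Icc 0 T, ∀ x, HasDerivWithinAt (fun s => σ s x) (σ' t x) (Icc 0 T) t)
    (hx : ∀ t ∈ Icc 0 T, Differentiable ℝ (σ t))
    (hxc : ∀ t ∈ Icc 0 T, ∀ j, Continuous (pd j (σ t)))
    (hb : ∀ t ∈ Icc 0 T, ∀ x, 0 < σ t x → |σ' t x| ≤ K ∧ ∀ j, |pd j (σ t) x| ≤ K)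
    (hle : ∀ t ∈ Icc 0 T, ∀ x, 0 < σ t x → σ' t x + adv (fun j => U j t) (σ t) x ≤ 0)
    (h0 : ∀ᵐ x, 0 < σ 0 x → R 0 x = 0) :
    ∀ t ∈ Icc 0 T, ∀ x, 0 < σ t x → R t x = 0 := by
  obtain ⟨L, hL0, hL⟩ := transition_deriv
  have hθc : Continuous (deriv Real.smoothTransition) :=
    (Real.smoothTransition.contDiff (n := 1)).continuous_deriv (by simp)
  -- A bounded nondecreasing function of `σ`, flat on `σ ≤ 0`: the conditions on `σ` are then needed
  -- only where `σ` is positive. The resulting weighted mass starts at zero and cannot increase.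
  set w : ℝ → E3 → ℝ := fun t x => Real.smoothTransition (σ t x) with hw
  set w' : ℝ → E3 → ℝ := fun t x => deriv Real.smoothTransition (σ t x) * σ' t x with hw'
  have hpd : ∀ t ∈ Icc 0 T, ∀ j x, pd j (w t) x =
      deriv Real.smoothTransition (σ t x) * pd j (σ t) x := fun t ht j x =>
    pd_comp_real j (hL _).1 (hx t ht x)
  have hsmall : ∀ {y a : ℝ}, (0 < y → |a| ≤ K) → |deriv Real.smoothTransition y * a| ≤ 1 + L * K := by
    intro y a ha
    by_cases hy : 0 < y
    · rw [abs_mul, abs_of_nonneg (hL y).2.1]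
      have := mul_le_mul (hL y).2.2.1 (ha hy) (abs_nonneg _) hL0
      linarith
    · rw [(hL y).2.2.2 (not_lt.1 hy), zero_mul, abs_zero]
      positivity
  have hmain := fun t ht => h.integral_sq_mul_weight_le hT (w := w) (w' := w') (K := 1 + L * K)
    (by positivity) (Real.smoothTransition.continuous.comp_continuousOn hσ)
    ((hθc.comp_continuousOn hσ).mul hσ')
    (fun t ht x => (hL _).1.comp_hasDerivWithinAt t (hd t ht x))
    (fun t ht x => (hL _).1.differentiableAt.comp x (hx t ht x))
    (fun t ht j => by
      rw [show pd j (w t) = fun x => deriv Real.smoothTransition (σ t x) * pd j (σ t) x from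
        funext (hpd t ht j)]
      exact (hθc.comp (hx t ht).continuous).mul (hxc t ht j))
    (fun t ht x => ⟨by
      rw [abs_of_nonneg (Real.smoothTransition.nonneg _)]
      refine (Real.smoothTransition.le_one _).trans ?_
      have : 0 ≤ L * K := by positivity
      linarith, hsmall fun hy => (hb t ht x hy).1, fun j => by
      rw [hpd t ht]
      exact hsmall fun hy => (hb t ht x hy).2 j⟩)
    (fun t ht x => by
      have e : w' t x + adv (fun j => U j t) (w t) x = deriv Real.smoothTransition (σ t x) *
          (σ' t x + adv (fun j => U j t) (σ t) x) := by
        simp only [adv, hpd t ht, hw', mul_add, Finset.mul_sum]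
        congr 1
        exact Finset.sum_congr rfl fun j _ => by ring
      rw [e]
      by_cases hy : 0 < σ t x
      · exact mul_nonpos_of_nonneg_of_nonpos (hL _).2.1 (hle t ht x hy)
      · rw [(hL _).2.2.2 (not_lt.1 hy), zero_mul]) (t := t) ht
  intro t ht x hxt
  have hz : ∫ x, R 0 x ^ 2 * w 0 x = 0 := by
    refine integral_eq_zero_of_ae ?_
    filter_upwards [h0] with x hx0
    by_cases hy : 0 < σ 0 x
    · rw [hx0 hy]; simp
    · simp [hw, Real.smoothTransition.zero_of_nonpos (not_lt.1 hy)]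
  have h1 := hmain t ht
  rw [hz] at h1
  have hRs := h.R_sob.sob ht
  have hn : ∀ x, 0 ≤ R t x ^ 2 * w t x := fun x =>
    mul_nonneg (sq_nonneg _) (Real.smoothTransition.nonneg _)
  have hwc : Continuous (w t) := Real.smoothTransition.continuous.comp (hx t ht).continuous
  have hi : Integrable fun x => R t x ^ 2 * w t x :=
    integrable_mul_of_bounded hRs.integrable_sq hwc.aestronglyMeasurable (C := 1) fun x => by
      rw [abs_of_nonneg (Real.smoothTransition.nonneg _)]
      exact Real.smoothTransition.le_one _
  have h2 := (integral_eq_zero_iff_of_nonneg hn hi).1 (le_antisymm h1 (integral_nonneg hn))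
  have h3 := (Continuous.ae_eq_iff_eq volume ((hRs.continuous.pow 2).mul hwc)
    continuous_const).1 h2
  have h4 := congrFun h3 x
  have h5 := Real.smoothTransition.pos_of_pos hxt
  have h6 := (mul_eq_zero.1 h4).resolve_right h5.ne'
  exact pow_eq_zero_iff two_ne_zero |>.1 h6

end CompSol

end HBS

namespace HBS

/-! ### Size and support of the density -/

lemma hasDerivWithinAt_primitive {T : ℝ} (hT : 0 ≤ T) {b : ℝ → ℝ} (hb : ContinuousOn b (Icc 0 T))
    {t : ℝ} (ht : t ∈ Icc 0 T) :
    HasDerivWithinAt (fun t => ∫ τ in (0 : ℝ)..t, b τ) (b t) (Icc 0 T) t := by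
  have hc : Continuous (IccExtend hT ((Icc 0 T).domRestrict b)) :=
    (continuousOn_iff_continuous_domRestrict.1 hb).Icc_extend'
  have he : ∀ τ ∈ Icc 0 T, IccExtend hT ((Icc 0 T).domRestrict b) τ = b τ := fun τ hτ => by
    rw [IccExtend_of_mem hT _ hτ]; rfl
  have h := (hc.integral_hasStrictDerivAt 0 t).hasDerivAt.hasDerivWithinAt (s := Icc 0 T)
  rw [he t ht] at h
  have hi : ∀ s ∈ Icc 0 T, ∫ τ in (0 : ℝ)..s, b τ =
      ∫ τ in (0 : ℝ)..s, IccExtend hT ((Icc 0 T).domRestrict b) τ := fun s hs => by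
    refine intervalIntegral.integral_congr fun τ hτ => ?_
    rw [uIcc_of_le hs.1] at hτ
    exact (he τ ⟨hτ.1, hτ.2.trans hs.2⟩).symm
  exact h.congr hi (hi t ht)

lemma continuousOn_primitive {T : ℝ} (hT : 0 ≤ T) {b : ℝ → ℝ} (hb : ContinuousOn b (Icc 0 T)) :
    ContinuousOn (fun t => ∫ τ in (0 : ℝ)..t, b τ) (Icc 0 T) :=
  fun _ ht => (hasDerivWithinAt_primitive hT hb ht).continuousWithinAt

lemma primitive_nonneg {T : ℝ} {b : ℝ → ℝ} (hb : ∀ t ∈ Icc 0 T, 0 ≤ b t) {t : ℝ}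
    (ht : t ∈ Icc 0 T) : 0 ≤ ∫ τ in (0 : ℝ)..t, b τ :=
  intervalIntegral.integral_nonneg ht.1 fun τ hτ => hb τ ⟨hτ.1, hτ.2.trans ht.2⟩

lemma ContinuousOn.comp_fst_Icc {T : ℝ} {g : ℝ → ℝ} (hg : ContinuousOn g (Icc 0 T)) :
    ContinuousOn (fun q : ℝ × E3 => g q.1) (Icc 0 T ×ˢ univ) :=
  hg.comp continuousOn_fst fun _ hq => hq.1

lemma pd_const_sub {f : E3 → ℝ} (c : ℝ) (j : Fin 3) (x : E3) (hf : DifferentiableAt ℝ f x) :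
    pd j (fun y => c - f y) x = -pd j f x := by
  rw [pd_sub j (differentiableAt_const c) hf, pd_const, zero_sub]

lemma pd_sub_const {f : E3 → ℝ} (c : ℝ) (j : Fin 3) (x : E3) (hf : DifferentiableAt ℝ f x) :
    pd j (fun y => f y - c) x = pd j f x := by
  rw [pd_sub j hf (differentiableAt_const c), pd_const, sub_zero]

namespace CompSol
variable {T : ℝ} {U : Fin 3 → ℝ → E3 → ℝ} {R P : ℝ → E3 → ℝ}

/-- The function `s R - M` is itself transported. Applied to it, `density_eq_zero` makes `R` vanish
where `s R > M ≥ 0`, which is absurd. -/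
lemma mul_density_le (hT : 0 < T) (h : CompSol T U R P) {M : ℝ} (hM : 0 ≤ M) (s : ℝ)
    (h0 : ∀ᵐ x, s * R 0 x ≤ M) : ∀ t ∈ Icc 0 T, ∀ x, s * R t x ≤ M := by
  have hJ := uniqueDiffOn_Icc hT
  have hA : SobFam (Icc 0 T) (fun t => adv (fun j => U j t) (R t)) := SobFam.adv h.U_sob h.R_sob
  obtain ⟨B, hB⟩ := hA.exists_abs_le
  choose B' hB' using fun j => (h.R_sob.pd j).exists_abs_le
  have hdt : ∀ t ∈ Icc 0 T, ∀ x, dtW (Icc 0 T) R t x = -adv (fun j => U j t) (R t) x :=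
    fun t ht x => by
      have := h.transport t ht x
      linarith
  have hRd : ∀ t ∈ Icc 0 T, Differentiable ℝ (R t) := fun t ht => (h.R_sob.sob ht).differentiable
  have hpd : ∀ t ∈ Icc 0 T, ∀ j, pd j (fun x => s * R t x - M) = fun x => s * pd j (R t) x :=
    fun t ht j => funext fun x => by
      rw [pd_sub_const M j x ((hRd t ht x).const_mul s), pd_const_mul j s (hRd t ht x)]
  have key := h.density_eq_zero hT (σ := fun t x => s * R t x - M)
    (σ' := fun t x => s * dtW (Icc 0 T) R t x) (K := |s| * (B + ∑ j, (B' j : ℝ))) (by positivity)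
    ((h.R_joint.continuousOn.const_smul s).sub continuousOn_const)
    ((h.R_joint.dt hJ).continuousOn.const_smul s)
    (fun t ht x => ((h.R_joint.hasDerivWithinAt ht x).const_mul s).sub_const M)
    (fun t ht => ((hRd t ht).const_mul s).sub_const M)
    (fun t ht j => by
      rw [hpd t ht]
      exact continuous_const.mul ((h.R_sob.sob ht).pd j).continuous)
    (fun t ht x _ => by
      have hs : ∀ j, (B' j : ℝ) ≤ ∑ j, (B' j : ℝ) := fun j =>
        Finset.single_le_sum (f := fun j => (B' j : ℝ)) (fun _ _ => NNReal.coe_nonneg _)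
          (Finset.mem_univ j)
      refine ⟨?_, fun j => ?_⟩
      · rw [abs_mul, hdt t ht, abs_neg]
        refine mul_le_mul_of_nonneg_left ((hB t ht x).trans ?_) (abs_nonneg _)
        linarith [hs 0, (B' 0).coe_nonneg]
      · rw [hpd t ht, abs_mul]
        refine mul_le_mul_of_nonneg_left ((hB' j t ht x).trans ?_) (abs_nonneg _)
        linarith [hs j, B.coe_nonneg])
    (fun t ht x _ => by
      have e : adv (fun j => U j t) (fun x => s * R t x - M) x =
          s * adv (fun j => U j t) (R t) x := by
        simp only [adv, hpd t ht, Finset.mul_sum]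
        exact Finset.sum_congr rfl fun j _ => by ring
      rw [e, hdt t ht]
      linarith)
    (by
      filter_upwards [h0] with x hx hx'
      linarith)
  intro t ht x
  by_contra hlt
  have := key t ht x (by linarith)
  rw [this, mul_zero] at hlt
  exact hlt hM

lemma abs_density_le (hT : 0 < T) (h : CompSol T U R P) {M : ℝ} (hM : 0 ≤ M)
    (h0 : ∀ᵐ x, |R 0 x| ≤ M) : ∀ t ∈ Icc 0 T, ∀ x, |R t x| ≤ M := fun t ht x => by
  have h1 := h.mul_density_le hT hM 1 (h0.mono fun x hx => by linarith [le_abs_self (R 0 x)]) t ht x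
  have h2 := h.mul_density_le hT hM (-1) (h0.mono fun x hx => by linarith [neg_le_abs (R 0 x)]) t
    ht x
  exact abs_le.2 ⟨by linarith, by linarith⟩

variable {b : ℝ → ℝ}

/-- Propagation of the vertical extent of the support. -/
lemma density_eq_zero_of_height (hT : 0 < T) (h : CompSol T U R P)
    (hb : ContinuousOn b (Icc 0 T)) (hU : ∀ t ∈ Icc 0 T, ∀ x, |U 2 t x| ≤ b t) {s z M : ℝ}
    (hs : |s| = 1) (h0 : ∀ x, M < s * (x 2 - z) → R 0 x = 0) :
    ∀ t ∈ Icc 0 T, ∀ x, M + ∫ τ in (0 : ℝ)..t, b τ < s * (x 2 - z) → R t x = 0 := by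
  obtain ⟨B, hB⟩ := isCompact_Icc.exists_bound_of_continuousOn hb
  have hd : ∀ x, DifferentiableAt ℝ (fun x : E3 => s * (x 2 - z)) x := fun x =>
    ((differentiable_coord 2 x).sub_const z).const_mul s
  have hpd : ∀ t j, pd j (fun x : E3 => s * (x 2 - z) - (M + ∫ τ in (0 : ℝ)..t, b τ)) =
      fun x => s * if (2 : Fin 3) = j then 1 else 0 := fun t j => funext fun x => by
    rw [pd_sub_const _ j x (hd x), pd_const_mul j s ((differentiable_coord 2 x).sub_const z),
      pd_sub_const z j x (differentiable_coord 2 x), pd_coord]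
  have hBn : 0 ≤ B := (norm_nonneg _).trans (hB 0 (left_mem_Icc.2 hT.le))
  -- Along the flow `s (x₂ - z)` grows at rate `s u₂ ≤ b`, so this `σ` cannot increase. The two
  -- signs of `s` treat the top and the bottom of the support.
  have key := h.density_eq_zero hT
    (σ := fun t x => s * (x 2 - z) - (M + ∫ τ in (0 : ℝ)..t, b τ))
    (σ' := fun t x => -b t) (K := B + 1) (by linarith)
    (by
      refine ContinuousOn.sub ?_ (ContinuousOn.comp_fst_Icc
        (g := fun t => M + ∫ τ in (0 : ℝ)..t, b τ)
        (continuousOn_const.add (continuousOn_primitive hT.le hb)))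
      exact (continuous_const.mul (((differentiable_coord 2).continuous.comp continuous_snd).sub
        continuous_const)).continuousOn)
    (ContinuousOn.comp_fst_Icc (g := fun t => -b t) hb.neg)
    (fun t ht x => ((hasDerivWithinAt_primitive hT.le hb ht).const_add M).const_sub _)
    (fun t ht x => (hd x).sub_const _)
    (fun t ht j => by
      rw [hpd t]
      exact continuous_const)
    (fun t ht x _ => by
      refine ⟨?_, fun j => ?_⟩
      · rw [abs_neg]
        have := hB t ht
        rw [Real.norm_eq_abs] at this
        linarith
      · rw [hpd t, abs_mul, hs]
        split_ifs <;> simp <;> linarith)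
    (fun t ht x _ => by
      have e : adv (fun j => U j t) (fun x : E3 => s * (x 2 - z) - (M + ∫ τ in (0 : ℝ)..t, b τ)) x =
          U 2 t x * s := by
        simp only [adv, hpd t, Fin.sum_univ_three]
        simp
      rw [e]
      have h1 := hU t ht x
      have h2 := le_abs_self (U 2 t x * s)
      rw [abs_mul, hs, mul_one] at h2
      linarith)
    (ae_of_all _ fun x hx => h0 x (by simpa using hx))
  intro t ht x hx
  exact key t ht x (by linarith)

end CompSol

namespace AxiSol
variable {T : ℝ} {U : Fin 3 → ℝ → E3 → ℝ} {R P : ℝ → E3 → ℝ} {b : ℝ → ℝ}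

/-- Propagation of the distance of the support to the axis. -/
lemma density_eq_zero_of_rad_lt (h : AxiSol T U R P) (hb : ContinuousOn b (Icc 0 T))
    (hU : ∀ t ∈ Icc 0 T, ∀ x, |vr (fun i => U i t) x| ≤ b t) {δ : ℝ} (hδ : 0 < δ)
    (h0 : ∀ x, rad x < δ → R 0 x = 0) :
    ∀ t ∈ Icc 0 T, ∀ x, rad x < δ * Real.exp (-∫ τ in (0 : ℝ)..t, b τ) → R t x = 0 := by
  have hT := h.pos
  obtain ⟨B, hB⟩ := isCompact_Icc.exists_bound_of_continuousOn hb
  have hBn : 0 ≤ B := (norm_nonneg _).trans (hB 0 (left_mem_Icc.2 hT.le))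
  have hb0 : ∀ t ∈ Icc 0 T, 0 ≤ b t := fun t ht => (abs_nonneg _).trans (hU t ht 0)
  set W : ℝ → ℝ := fun t => ∫ τ in (0 : ℝ)..t, b τ with hW
  have hW0 : ∀ t ∈ Icc 0 T, 0 ≤ W t := fun t ht => primitive_nonneg hb0 ht
  -- Using `r²` rather than `r` keeps the region function smooth on the axis. Along the flow `r²`
  -- has derivative `2 r² (v_r / r) ≥ -2 b r²`, so `a - r²` cannot increase where it is positive.
  set a : ℝ → ℝ := fun t => δ ^ 2 * Real.exp (-2 * W t) with ha
  have ha' : ∀ t ∈ Icc 0 T, HasDerivWithinAt a (δ ^ 2 * (Real.exp (-2 * W t) * (-2 * b t)))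
      (Icc 0 T) t := fun t ht =>
    (((hasDerivWithinAt_primitive hT.le hb ht).const_mul (-2)).exp).const_mul (δ ^ 2)
  have hac : ContinuousOn a (Icc 0 T) := fun t ht => (ha' t ht).continuousWithinAt
  have hale : ∀ t ∈ Icc 0 T, a t ≤ δ ^ 2 := fun t ht => by
    refine mul_le_of_le_one_right (sq_nonneg _) (Real.exp_le_one_iff.2 ?_)
    linarith [hW0 t ht]
  have ha0 : ∀ t, 0 < a t := fun t => by positivity
  have hpd : ∀ t x, (∀ j, pd j (fun x : E3 => a t - (x 0 ^ 2 + x 1 ^ 2)) x =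
      -pd j (fun x : E3 => x 0 ^ 2 + x 1 ^ 2) x) := fun t x j =>
    pd_const_sub _ j x (differentiable_rsq x)
  have hpd0 : ∀ t, pd 0 (fun x : E3 => a t - (x 0 ^ 2 + x 1 ^ 2)) = fun x => -(2 * x 0) := fun t =>
    funext fun x => by rw [hpd, pd_rsq (by decide)]
  have hpd1 : ∀ t, pd 1 (fun x : E3 => a t - (x 0 ^ 2 + x 1 ^ 2)) = fun x => -(2 * x 1) := fun t =>
    funext fun x => by rw [hpd, pd_rsq (by decide)]
  have hpd2 : ∀ t, pd 2 (fun x : E3 => a t - (x 0 ^ 2 + x 1 ^ 2)) = fun x => 0 := fun t =>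
    funext fun x => by rw [hpd, pd_rsq_two, neg_zero]
  have key := h.density_eq_zero hT (σ := fun t x => a t - (x 0 ^ 2 + x 1 ^ 2))
    (σ' := fun t x => a t * (-2 * b t)) (K := 2 * δ + δ ^ 2 * (2 * B)) (by positivity)
    ((ContinuousOn.comp_fst_Icc hac).sub
      (differentiable_rsq.continuous.comp continuous_snd).continuousOn)
    (ContinuousOn.comp_fst_Icc (g := fun t => a t * (-2 * b t)) (hac.mul (continuousOn_const.mul hb)))
    (fun t ht x => by
      have := (ha' t ht).sub_const (x 0 ^ 2 + x 1 ^ 2)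
      rwa [← mul_assoc] at this)
    (fun t ht => differentiable_rsq.const_sub _)
    (fun t ht j => by
      fin_cases j
      · exact (hpd0 t) ▸ by fun_prop
      · exact (hpd1 t) ▸ by fun_prop
      · exact (hpd2 t) ▸ by fun_prop)
    (fun t ht x hx => by
      have hbt := hB t ht
      rw [Real.norm_eq_abs] at hbt
      have hx' : x 0 ^ 2 + x 1 ^ 2 < δ ^ 2 := by linarith [hale t ht]
      have hc : ∀ y : ℝ, y ^ 2 ≤ δ ^ 2 → |-(2 * y)| ≤ 2 * δ := fun y hy => by
        rw [abs_neg, abs_mul, abs_two]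
        linarith [abs_le_of_sq_le_sq hy hδ.le, abs_le.2 (abs_le_of_sq_le_sq' hy hδ.le)]
      have hB2 : 0 ≤ δ ^ 2 * (2 * B) := by positivity
      refine ⟨?_, fun j => ?_⟩
      · rw [abs_mul, abs_of_pos (ha0 t), abs_mul, abs_neg, abs_two]
        have : a t * (2 * |b t|) ≤ δ ^ 2 * (2 * B) :=
          mul_le_mul (hale t ht) (by linarith) (by positivity) (by positivity)
        linarith
      · have h2 : ∀ k : Fin 3, k = 0 ∨ k = 1 → |-(2 * x k)| ≤ 2 * δ := by
          rintro k (rfl | rfl)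
          · exact hc _ (by nlinarith [sq_nonneg (x 1)])
          · exact hc _ (by nlinarith [sq_nonneg (x 0)])
        fin_cases j
        · show |pd 0 _ x| ≤ _
          rw [hpd0]
          linarith [h2 0 (Or.inl rfl)]
        · show |pd 1 _ x| ≤ _
          rw [hpd1]
          linarith [h2 1 (Or.inr rfl)]
        · show |pd 2 _ x| ≤ _
          rw [hpd2, abs_zero]
          positivity)
    (fun t ht x hx => by
      have hf := h.flow t ht
      have e0 : U 0 t x = x 0 * vr (fun i => U i t) x := congrFun hf.v_zero x
      have e1 : U 1 t x = x 1 * vr (fun i => U i t) x := congrFun hf.v_one x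
      simp only [adv, Fin.sum_univ_three, hpd0, hpd1, hpd2, e0, e1]
      have h1 := hU t ht x
      set f := vr (fun i => U i t) x
      have h2 : -(x 0 ^ 2 + x 1 ^ 2) * f ≤ (x 0 ^ 2 + x 1 ^ 2) * b t := by
        have := mul_le_mul_of_nonneg_left ((neg_le_abs f).trans h1)
          (show 0 ≤ x 0 ^ 2 + x 1 ^ 2 by positivity)
        linarith
      have h3 := mul_nonneg hx.le (hb0 t ht)
      nlinarith)
    (ae_of_all _ fun x hx => h0 x (by
      have hx' : x 0 ^ 2 + x 1 ^ 2 < δ ^ 2 := by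
        linarith [hale 0 (left_mem_Icc.2 hT.le)]
      rw [← rad_sq] at hx'
      exact lt_of_pow_lt_pow_left₀ 2 hδ.le hx'))
  intro t ht x hx
  refine key t ht x ?_
  have h1 := pow_lt_pow_left₀ hx (rad_nonneg x) two_ne_zero
  rw [rad_sq, mul_pow, ← Real.exp_nat_mul] at h1
  have e : ((2 : ℕ) : ℝ) * -(∫ τ in (0 : ℝ)..t, b τ) = -2 * W t := by
    push_cast; ring
  rw [e] at h1
  linarith

end AxiSol

end HBS

namespace HBS

/-! ### The weighted norm of the density -/

lemma continuous_rad : Continuous rad := by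
  unfold rad; fun_prop

lemma lintegral_div_le {ε L c : ℝ} (hε : 0 < ε) (hl : -Real.log ε ≤ L) (hc : 0 ≤ c) :
    ∫⁻ r in Icc ε 1, ENNReal.ofReal (c * r⁻¹) ≤ ENNReal.ofReal (c * L) := by
  by_cases h1 : ε ≤ 1
  · have hi : IntegrableOn (fun r : ℝ => c * r⁻¹) (Icc ε 1) := by
      refine ContinuousOn.integrableOn_Icc (continuousOn_const.mul ?_)
      exact continuousOn_inv₀.mono fun r hr => (hε.trans_le hr.1).ne'
    have hn : 0 ≤ᵐ[volume.restrict (Icc ε 1)] fun r : ℝ => c * r⁻¹ := by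
      filter_upwards [ae_restrict_mem measurableSet_Icc] with r hr
      exact mul_nonneg hc (inv_nonneg.2 (hε.le.trans hr.1))
    rw [← ofReal_integral_eq_lintegral_ofReal hi hn, integral_Icc_eq_integral_Ioc,
      ← intervalIntegral.integral_of_le h1, intervalIntegral.integral_const_mul,
      integral_inv_of_pos hε one_pos, one_div, Real.log_inv]
    exact ENNReal.ofReal_le_ofReal (mul_le_mul_of_nonneg_left hl hc)
  · rw [Icc_eq_empty h1]
    simp

/-- Beyond distance 1 the weight is at most 1. Inside, integrating `1 / r²` in cylindrical
coordinates leaves `∫ dr / r` over `[ε, 1]` times the height `2 H`. The distance to the axis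
therefore enters only through its logarithm. -/
lemma nsq_radInv_le {f : E3 → ℝ} (hc : Continuous f) (hf : MemLp f 2 volume) {M ε H L z : ℝ}
    (hε : 0 < ε) (hL : 0 ≤ L) (hl : -Real.log ε ≤ L) (hH : 0 ≤ H) (hM : ∀ x, |f x| ≤ M)
    (h1 : ∀ x, rad x < ε → f x = 0) (h2 : ∀ x, H < |x 2 - z| → f x = 0) :
    nsq (radInv f) ≤ nsq f + 2 * Real.pi * (M ^ 2 * L * (2 * H)) := by
  set S : Set E3 := {x | ε ≤ rad x ∧ rad x ≤ 1 ∧ |x 2 - z| ≤ H} with hS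
  have hSm : MeasurableSet S := by
    have c2 : Continuous fun x : E3 => |x 2 - z| := by fun_prop
    exact (measurableSet_le measurable_const continuous_rad.measurable).inter
      ((measurableSet_le continuous_rad.measurable measurable_const).inter
        (measurableSet_le c2.measurable measurable_const))
  set G : E3 → ℝ≥0∞ := S.indicator fun x => ENNReal.ofReal (M ^ 2 * (rad x)⁻¹ ^ 2) with hG
  have hGm : Measurable G := Measurable.indicator (by
    exact (((continuous_rad.measurable.inv).pow_const 2).const_mul _).ennreal_ofReal) hSm
  have hsq : ∀ x, f x ^ 2 ≤ M ^ 2 := fun x => sq_le_sq' (by linarith [abs_le.1 (hM x)])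
    (abs_le.1 (hM x)).2
  have hle : ∀ x, ENNReal.ofReal (radInv f x ^ 2) ≤ ENNReal.ofReal (f x ^ 2) + G x := fun x => by
    by_cases hx : f x = 0
    · simp [radInv, hx]
    have e1 : ε ≤ rad x := not_lt.1 fun h => hx (h1 x h)
    have e2 : |x 2 - z| ≤ H := not_lt.1 fun h => hx (h2 x h)
    have hr : 0 < rad x := hε.trans_le e1
    rw [radInv, mul_pow]
    by_cases e3 : rad x ≤ 1
    · rw [hG, indicator_of_mem (show x ∈ S from ⟨e1, e3, e2⟩)]
      refine (ENNReal.ofReal_le_ofReal ?_).trans le_add_self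
      rw [mul_comm]
      exact mul_le_mul_of_nonneg_right (hsq x) (by positivity)
    · refine (ENNReal.ofReal_le_ofReal ?_).trans le_self_add
      refine mul_le_of_le_one_left (sq_nonneg _) (pow_le_one₀ (by positivity) ?_)
      exact inv_le_one_of_one_le₀ (not_le.1 e3).le
  have hGi : ∫⁻ x, G x ≤ ENNReal.ofReal (2 * Real.pi * (M ^ 2 * L * (2 * H))) := by
    have hinv : ∀ x y : E3, rad x = rad y → x 2 = y 2 → G x = G y := fun x y e e' => by
      have hm : x ∈ S ↔ y ∈ S := by simp only [hS, mem_ofPred_eq, e, e']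
      by_cases hy : y ∈ S
      · simp only [hG, indicator_of_mem hy, indicator_of_mem (hm.2 hy), e]
      · simp only [hG, indicator_of_notMem hy, indicator_of_notMem (mt hm.1 hy)]
    rw [lintegral_axisymmetric hGm hinv, ENNReal.ofReal_mul (p := 2 * Real.pi) (by positivity)]
    refine mul_le_mul_right ?_ _
    have hin : ∀ y : ℝ, ∫⁻ r in Ioi (0 : ℝ), ENNReal.ofReal r * G (hp r y) ≤
        (Icc (z - H) (z + H)).indicator (fun _ => ENNReal.ofReal (M ^ 2 * L)) y := fun y => by
      by_cases hy : y ∈ Icc (z - H) (z + H)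
      · rw [indicator_of_mem hy]
        refine le_trans ?_ (lintegral_div_le hε hl (sq_nonneg M))
        rw [← lintegral_indicator measurableSet_Ioi, ← lintegral_indicator measurableSet_Icc]
        refine lintegral_mono fun r => ?_
        by_cases hr : r ∈ Ioi (0 : ℝ)
        · have hr' : (0 : ℝ) < r := hr
          rw [indicator_of_mem hr, hG]
          by_cases hm : hp r y ∈ S
          · have hm' := hm
            simp only [hS, mem_ofPred_eq, rad_hp hr'.le] at hm'
            rw [indicator_of_mem hm, indicator_of_mem (show r ∈ Icc ε 1 from ⟨hm'.1, hm'.2.1⟩),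
              rad_hp hr'.le, ← ENNReal.ofReal_mul hr'.le]
            refine ENNReal.ofReal_le_ofReal (le_of_eq ?_)
            field_simp
          · rw [indicator_of_notMem hm, mul_zero]
            exact zero_le
        · rw [indicator_of_notMem hr]
          exact zero_le
      · rw [indicator_of_notMem hy]
        refine le_of_eq ?_
        rw [setLIntegral_congr_fun (g := fun _ => 0) measurableSet_Ioi fun r hr => ?_, lintegral_zero]
        have : hp r y ∉ S := fun hm => hy (by
          have h3 := abs_le.1 hm.2.2
          simp only at h3
          simp at h3
          exact ⟨by linarith [h3.1], by linarith [h3.2]⟩)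
        simp only [hG, indicator_of_notMem this, mul_zero]
    refine (lintegral_mono hin).trans ?_
    rw [lintegral_indicator measurableSet_Icc, setLIntegral_const, Real.volume_Icc,
      ← ENNReal.ofReal_mul (by positivity)]
    refine ENNReal.ofReal_le_ofReal (le_of_eq ?_)
    ring
  have hm : AEStronglyMeasurable (fun x => radInv f x ^ 2) volume := by
    have : Measurable (radInv f) := continuous_rad.measurable.inv.mul hc.measurable
    exact (this.pow_const 2).aestronglyMeasurable
  have hn := nsq_nonneg f
  rw [nsq, integral_eq_lintegral_of_nonneg_ae (ae_of_all _ fun x => sq_nonneg _) hm]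
  refine ENNReal.toReal_le_of_le_ofReal (by positivity) ?_
  refine (lintegral_mono hle).trans ?_
  rw [lintegral_add_right _ hGm, ENNReal.ofReal_add hn (by positivity)]
  refine add_le_add (le_of_eq ?_) hGi
  rw [nsq, ofReal_integral_eq_lintegral_ofReal hf.integrable_sq (ae_of_all _ fun x => sq_nonneg _)]

end HBS

namespace HBS

/-! ### Closing the estimates -/

/-- Cauchy-Schwarz, from the integral of `(t b - W)²`. -/
lemma sq_integral_le {b : ℝ → ℝ} {t : ℝ} (ht : 0 ≤ t) (hb : ContinuousOn b (Icc 0 t)) :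
    (∫ τ in (0 : ℝ)..t, b τ) ^ 2 ≤ t * ∫ τ in (0 : ℝ)..t, b τ ^ 2 := by
  set W := ∫ τ in (0 : ℝ)..t, b τ with hW
  rcases ht.eq_or_lt with rfl | ht'
  · simp [hW]
  have i1 : IntervalIntegrable (fun τ => t ^ 2 * b τ ^ 2) volume 0 t :=
    (continuousOn_const.mul (hb.pow 2)).intervalIntegrable_of_Icc ht
  have i2 : IntervalIntegrable (fun τ => 2 * t * W * b τ) volume 0 t :=
    (continuousOn_const.mul hb).intervalIntegrable_of_Icc ht
  have i12 : IntervalIntegrable (fun τ => t ^ 2 * b τ ^ 2 - 2 * t * W * b τ) volume 0 t := i1.sub i2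
  have h : 0 ≤ ∫ τ in (0 : ℝ)..t, (t ^ 2 * b τ ^ 2 - 2 * t * W * b τ + W ^ 2) :=
    intervalIntegral.integral_nonneg ht fun τ _ => by nlinarith [sq_nonneg (t * b τ - W)]
  rw [intervalIntegral.integral_add i12 (by simp), intervalIntegral.integral_sub i1 i2,
    intervalIntegral.integral_const_mul, intervalIntegral.integral_const_mul,
    intervalIntegral.integral_const, ← hW, smul_eq_mul, sub_zero] at h
  have h2 : 0 ≤ t * (t * (∫ τ in (0 : ℝ)..t, b τ ^ 2) - W ^ 2) := by nlinarith
  linarith [nonneg_of_mul_nonneg_right h2 ht']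

/-- The bounds on the initial data which enter the estimates. -/
structure InitBound (M δ : ℝ) (U : Fin 3 → ℝ → E3 → ℝ) (R : ℝ → E3 → ℝ) : Prop where
  energy : ∑ i, nsq (U i 0) ≤ M ^ 2
  gam : nsq (Gam fun j => U j 0) ≤ M ^ 2
  vort : nsq (HBS.vort U 0) ≤ 4 * M ^ 2
  rho : nsq (R 0) ≤ M ^ 2
  rho_le : ∀ᵐ x, |R 0 x| ≤ M
  rad : ∀ x, HBS.rad x < δ → R 0 x = 0
  height : ∃ z, ∀ x, M < |x 2 - z| → R 0 x = 0

/-- The constant in the bound of the weighted density. -/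
noncomputable def densC (M δ : ℝ) : ℝ :=
  M ^ 2 + 8 * Real.pi * M ^ 2 * (1 + M + |Real.log δ|) ^ 2

/-- Bound of the energy. -/
noncomputable def energyB (M s : ℝ) : ℝ := M ^ 2 * s ^ 2 * Real.exp s

/-- Bound of `ω_θ / r`. -/
noncomputable def gamB (M δ s : ℝ) : ℝ :=
  (M ^ 2 + densC M δ * s + 16 * densC M δ * s ^ 3 * energyB M s) *
    Real.exp (16 * densC M δ * s ^ 3)

/-- Bound of the time integral of the velocity. -/
noncomputable def speedB (M δ s : ℝ) : ℝ := 4 * s * (1 + gamB M δ s + energyB M s)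

/-- Bound of the vorticity. -/
noncomputable def vortB (M δ s : ℝ) : ℝ :=
  (4 * M ^ 2 + s * M ^ 2) * Real.exp (2 * speedB M δ s)

lemma densC_nonneg (M δ : ℝ) : 0 ≤ densC M δ := by
  unfold densC; positivity

/-- A bound for the speed. -/
noncomputable def speed (U : Fin 3 → ℝ → E3 → ℝ) (t : ℝ) : ℝ := 4 * √(ctrl fun i => U i t)

lemma ctrl_nonneg (v : Fin 3 → E3 → ℝ) : 0 ≤ ctrl v := by
  have := nsq_nonneg
  unfold ctrl
  have h1 : 0 ≤ ∑ i, nsq (v i) := Finset.sum_nonneg fun i _ => this _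
  have h2 : 0 ≤ ∑ i, (nsq (pd 0 (v i)) + nsq (pd 1 (v i))) :=
    Finset.sum_nonneg fun i _ => add_nonneg (this _) (this _)
  linarith [this (Gam v), this (pd 0 (Gam v)), this (pd 1 (Gam v))]

lemma speed_sq (U : Fin 3 → ℝ → E3 → ℝ) (t : ℝ) : speed U t ^ 2 = 16 * ctrl fun i => U i t := by
  rw [speed, mul_pow, Real.sq_sqrt (ctrl_nonneg _)]
  norm_num

lemma speed_nonneg (U : Fin 3 → ℝ → E3 → ℝ) (t : ℝ) : 0 ≤ speed U t := by
  unfold speed; positivity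

namespace AxiSol
variable {T M δ : ℝ} {U : Fin 3 → ℝ → E3 → ℝ} {R P : ℝ → E3 → ℝ} {t : ℝ}

lemma speed_continuousOn (h : AxiSol T U R P) : ContinuousOn (speed U) (Icc 0 T) := by
  obtain ⟨h1, h2⟩ := h.gam_continuousOn
  obtain ⟨h3, h4, -⟩ := h.toCompSol.energy h.pos
  refine continuousOn_const.mul (ContinuousOn.sqrt ?_)
  unfold ctrl
  exact ((h2.add ((h1 0).add (h1 1))).add (continuousOn_finsetSum _ fun i _ => h4 i)).add
    (continuousOn_finsetSum _ fun i _ => (h3 i 0).add (h3 i 1))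

lemma vr_le_speed (h : AxiSol T U R P) (ht : t ∈ Icc 0 T) (x : E3) :
    |vr (fun i => U i t) x| ≤ speed U t := by
  refine abs_le_of_sq_le_sq ?_ (speed_nonneg U t)
  rw [speed_sq]
  exact (h.flow t ht).vr_sq_le x

lemma two_le_speed (h : AxiSol T U R P) (ht : t ∈ Icc 0 T) (x : E3) :
    |U 2 t x| ≤ speed U t := by
  refine abs_le_of_sq_le_sq ?_ (speed_nonneg U t)
  rw [speed_sq]
  exact (h.flow t ht).v_two_sq_le x

lemma energy_le (h : AxiSol T U R P) (hI : InitBound M δ U R) (ht : t ∈ Icc 0 T) :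
    ∑ i, nsq (U i t) + ∫ τ in (0 : ℝ)..t, ∑ i, (nsq (pd 0 (U i τ)) + nsq (pd 1 (U i τ))) ≤
      energyB M (1 + T) := by
  obtain ⟨c1, c2, h3⟩ := h.toCompSol.energy h.pos
  have hT := h.pos
  have cE : ContinuousOn (fun t => ∑ i, nsq (U i t)) (Icc 0 T) :=
    continuousOn_finsetSum _ fun i _ => c2 i
  have nE : ∀ t, 0 ≤ ∑ i, nsq (U i t) := fun t => Finset.sum_nonneg fun i _ => nsq_nonneg _
  have nH : ∀ t, 0 ≤ ∑ i, (nsq (pd 0 (U i t)) + nsq (pd 1 (U i t))) := fun t =>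
    Finset.sum_nonneg fun i _ => add_nonneg (nsq_nonneg _) (nsq_nonneg _)
  have key : ∀ t ∈ Icc 0 T, ∑ i, nsq (U i t) +
      2 * ∫ τ in (0 : ℝ)..t, ∑ i, (nsq (pd 0 (U i τ)) + nsq (pd 1 (U i τ))) ≤
      M ^ 2 * (1 + T) + ∫ τ in (0 : ℝ)..t, 1 * ∑ i, nsq (U i τ) := fun t ht => by
    have h4 := h3 t ht
    have i2 : IntervalIntegrable (fun τ => ∑ i, nsq (U i τ)) volume 0 t :=
      (cE.mono (Icc_subset_Icc le_rfl ht.2)).intervalIntegrable_of_Icc ht.1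
    rw [intervalIntegral.integral_add (by simp) i2, intervalIntegral.integral_const, smul_eq_mul,
      sub_zero] at h4
    have h5 : t * nsq (R 0) ≤ T * M ^ 2 := mul_le_mul ht.2 hI.rho (nsq_nonneg _) hT.le
    have := hI.energy
    simp only [one_mul]
    linarith
  have hnn : ∀ t ∈ Icc 0 T,
      0 ≤ ∫ τ in (0 : ℝ)..t, ∑ i, (nsq (pd 0 (U i τ)) + nsq (pd 1 (U i τ))) := fun t ht =>
    primitive_nonneg (T := T) (fun τ _ => nH τ) ht
  have hg := le_mul_exp_of_le_integral (y := fun t => ∑ i, nsq (U i t)) (b := fun _ => 1)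
    (A := M ^ 2 * (1 + T)) cE
    continuousOn_const (fun _ _ => zero_le_one)
    (fun t ht => by linarith [key t ht, hnn t ht])
  have hE : ∀ t ∈ Icc 0 T, ∑ i, nsq (U i t) ≤ M ^ 2 * (1 + T) * Real.exp T := fun t ht => by
    refine (hg t ht).trans ?_
    rw [intervalIntegral.integral_const, smul_eq_mul, mul_one, sub_zero]
    gcongr
    exact ht.2
  have hint : ∫ τ in (0 : ℝ)..t, 1 * ∑ i, nsq (U i τ) ≤ T * (M ^ 2 * (1 + T) * Real.exp T) := by
    have i2 : IntervalIntegrable (fun τ => 1 * ∑ i, nsq (U i τ)) volume 0 t :=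
      (((continuousOn_const (c := (1 : ℝ))).mul cE).mono
        (Icc_subset_Icc le_rfl ht.2)).intervalIntegrable_of_Icc ht.1
    refine (intervalIntegral.integral_mono_on ht.1 i2 (by simp)
      fun τ hτ => (one_mul _).le.trans (hE τ ⟨hτ.1, hτ.2.trans ht.2⟩)).trans ?_
    rw [intervalIntegral.integral_const, smul_eq_mul, sub_zero]
    exact mul_le_mul_of_nonneg_right ht.2 (by positivity)
  have h6 := key t ht
  have h7 := hnn t ht
  have h8 : (1 : ℝ) ≤ Real.exp T := Real.one_le_exp hT.le
  have h9 : Real.exp T ≤ Real.exp (1 + T) := Real.exp_le_exp.2 (by linarith)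
  have h10 : M ^ 2 * (1 + T) ≤ M ^ 2 * (1 + T) * Real.exp T :=
    le_mul_of_one_le_right (by positivity) h8
  have h11 : M ^ 2 * (1 + T) ^ 2 * Real.exp T ≤ M ^ 2 * (1 + T) ^ 2 * Real.exp (1 + T) := by gcongr
  rw [energyB]
  nlinarith

/-- The support stays at distance at least `δ exp (-W)` from the axis, so the logarithm costs one
factor `W`; its vertical spreading costs another. The growth is quadratic in `W`, which is what
Cauchy-Schwarz in time can absorb. -/
lemma radInv_le (h : AxiSol T U R P) (hM : 0 ≤ M) (hδ : 0 < δ) (hI : InitBound M δ U R)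
    (ht : t ∈ Icc 0 T) :
    (∃ ε > 0, ∀ x, rad x < ε → R t x = 0) ∧
      nsq (radInv (R t)) ≤ densC M δ * (1 + (∫ τ in (0 : ℝ)..t, speed U τ) ^ 2) := by
  have hb := h.speed_continuousOn
  set W := ∫ τ in (0 : ℝ)..t, speed U τ with hW
  have hW0 : 0 ≤ W := primitive_nonneg (T := T) (fun τ _ => speed_nonneg U τ) ht
  have h1 := h.density_eq_zero_of_rad_lt hb (fun t ht => h.vr_le_speed ht) hδ hI.rad t ht
  obtain ⟨z, hz⟩ := hI.height
  have h2 : ∀ x, M + W < |x 2 - z| → R t x = 0 := fun x hx => by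
    rcases lt_abs.1 hx with hx | hx
    · exact h.toCompSol.density_eq_zero_of_height h.pos hb (fun t ht => h.two_le_speed ht) (s := 1)
        (by simp) (fun x hx => hz x (by
          rw [one_mul] at hx
          exact lt_abs.2 (Or.inl hx))) t ht x (by rwa [one_mul])
    · exact h.toCompSol.density_eq_zero_of_height h.pos hb (fun t ht => h.two_le_speed ht)
        (s := -1) (by simp) (fun x hx => hz x (by
          rw [neg_one_mul] at hx
          exact lt_abs.2 (Or.inr hx))) t ht x (by rwa [neg_one_mul])
  have h3 := h.toCompSol.abs_density_le h.pos hM hI.rho_le t ht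
  have hε : 0 < δ * Real.exp (-W) := by positivity
  refine ⟨⟨_, hε, h1⟩, ?_⟩
  have hl : -Real.log (δ * Real.exp (-W)) ≤ |Real.log δ| + W := by
    rw [Real.log_mul hδ.ne' (Real.exp_pos _).ne', Real.log_exp]
    linarith [neg_le_abs (Real.log δ)]
  have hR := h.R_sob.sob ht
  have h4 := nsq_radInv_le hR.continuous hR.memLp hε (by positivity) hl (by positivity) h3 h1 h2
  rw [h.toCompSol.nsq_rho h.pos ht] at h4
  have h5 : (|Real.log δ| + W) * (M + W) ≤
      (1 + M + |Real.log δ|) ^ 2 * (2 * (1 + W ^ 2)) := by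
    set q := 1 + M + |Real.log δ| with hq
    have hl0 := abs_nonneg (Real.log δ)
    have a1 : |Real.log δ| + W ≤ q * (1 + W) := by nlinarith
    have a2 : M + W ≤ q * (1 + W) := by nlinarith
    have a3 : (1 + W) ^ 2 ≤ 2 * (1 + W ^ 2) := by nlinarith [sq_nonneg (1 - W)]
    calc _ ≤ (q * (1 + W)) * (q * (1 + W)) := mul_le_mul a1 a2 (by positivity) (by positivity)
      _ = q ^ 2 * (1 + W) ^ 2 := by ring
      _ ≤ _ := mul_le_mul_of_nonneg_left a3 (sq_nonneg _)
  have h6 := mul_le_mul_of_nonneg_left h5 (show 0 ≤ 4 * Real.pi * M ^ 2 by positivity)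
  have h7 : 0 ≤ M ^ 2 * W ^ 2 := by positivity
  have := hI.rho
  rw [densC]
  linarith

/-- The time integral of the speed is controlled by the dissipation. -/
lemma sq_integral_speed_le (h : AxiSol T U R P) (hI : InitBound M δ U R) (ht : t ∈ Icc 0 T) :
    (∫ τ in (0 : ℝ)..t, speed U τ) ^ 2 ≤ 16 * T * ((∫ τ in (0 : ℝ)..t, nsq (Gam fun j => U j τ)) +
      (∫ τ in (0 : ℝ)..t, (nsq (pd 0 (Gam fun j => U j τ)) + nsq (pd 1 (Gam fun j => U j τ)))) +
      (1 + T) * energyB M (1 + T)) := by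
  have hT := h.pos
  have hsub : Icc 0 t ⊆ Icc 0 T := Icc_subset_Icc le_rfl ht.2
  obtain ⟨g1, g2⟩ := h.gam_continuousOn
  obtain ⟨c1, c2, -⟩ := h.toCompSol.energy hT
  have cE : ContinuousOn (fun t => ∑ i, nsq (U i t)) (Icc 0 T) :=
    continuousOn_finsetSum _ fun i _ => c2 i
  have cH : ContinuousOn (fun t => ∑ i, (nsq (pd 0 (U i t)) + nsq (pd 1 (U i t)))) (Icc 0 T) :=
    continuousOn_finsetSum _ fun i _ => (c1 i 0).add (c1 i 1)
  have hii : ∀ {g : ℝ → ℝ}, ContinuousOn g (Icc 0 T) → IntervalIntegrable g volume 0 t :=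
    fun hg => (hg.mono hsub).intervalIntegrable_of_Icc ht.1
  have hE : ∀ τ ∈ Icc 0 t, ∑ i, nsq (U i τ) ≤ energyB M (1 + T) := fun τ hτ => by
    have := h.energy_le hI (hsub hτ)
    have := primitive_nonneg (T := T) (b := fun τ => ∑ i, (nsq (pd 0 (U i τ)) + nsq (pd 1 (U i τ))))
      (fun τ _ => Finset.sum_nonneg fun i _ => add_nonneg (nsq_nonneg _) (nsq_nonneg _)) (hsub hτ)
    linarith
  have hEi : ∫ τ in (0 : ℝ)..t, ∑ i, nsq (U i τ) ≤ T * energyB M (1 + T) := by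
    refine (intervalIntegral.integral_mono_on ht.1 (hii cE) (by simp) hE).trans ?_
    rw [intervalIntegral.integral_const, smul_eq_mul, sub_zero]
    refine mul_le_mul_of_nonneg_right ht.2 ?_
    unfold energyB
    positivity
  have hHi : ∫ τ in (0 : ℝ)..t, ∑ i, (nsq (pd 0 (U i τ)) + nsq (pd 1 (U i τ))) ≤
      energyB M (1 + T) := by
    have := h.energy_le hI ht
    have : 0 ≤ ∑ i, nsq (U i t) := Finset.sum_nonneg fun i _ => nsq_nonneg _
    linarith
  have hcs := sq_integral_le ht.1 (h.speed_continuousOn.mono hsub)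
  have e : ∫ τ in (0 : ℝ)..t, speed U τ ^ 2 =
      16 * ((∫ τ in (0 : ℝ)..t, nsq (Gam fun j => U j τ)) +
      (∫ τ in (0 : ℝ)..t, (nsq (pd 0 (Gam fun j => U j τ)) + nsq (pd 1 (Gam fun j => U j τ)))) +
      (∫ τ in (0 : ℝ)..t, ∑ i, nsq (U i τ)) +
      ∫ τ in (0 : ℝ)..t, ∑ i, (nsq (pd 0 (U i τ)) + nsq (pd 1 (U i τ)))) := by
    simp only [speed_sq, ctrl]
    have a2 : IntervalIntegrable (fun τ => nsq (pd 0 (Gam fun j => U j τ)) +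
        nsq (pd 1 (Gam fun j => U j τ))) volume 0 t := hii ((g1 0).add (g1 1))
    have a3 : IntervalIntegrable (fun τ => nsq (Gam fun j => U j τ) +
        (nsq (pd 0 (Gam fun j => U j τ)) + nsq (pd 1 (Gam fun j => U j τ)))) volume 0 t :=
      (hii g2).add a2
    have a4 : IntervalIntegrable (fun τ => nsq (Gam fun j => U j τ) +
        (nsq (pd 0 (Gam fun j => U j τ)) + nsq (pd 1 (Gam fun j => U j τ))) +
        ∑ i, nsq (U i τ)) volume 0 t := a3.add (hii cE)
    rw [intervalIntegral.integral_const_mul,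
      intervalIntegral.integral_add a4 (hii cH),
      intervalIntegral.integral_add a3 (hii cE),
      intervalIntegral.integral_add (hii g2) a2]
  rw [e] at hcs
  have n1 : 0 ≤ ∫ τ in (0 : ℝ)..t, nsq (Gam fun j => U j τ) :=
    primitive_nonneg (T := T) (fun τ _ => nsq_nonneg _) ht
  have n2 : 0 ≤ ∫ τ in (0 : ℝ)..t,
      (nsq (pd 0 (Gam fun j => U j τ)) + nsq (pd 1 (Gam fun j => U j τ))) :=
    primitive_nonneg (T := T) (fun τ _ => add_nonneg (nsq_nonneg _) (nsq_nonneg _)) ht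
  have n3 : 0 ≤ ∫ τ in (0 : ℝ)..t, ∑ i, nsq (U i τ) :=
    primitive_nonneg (T := T) (fun τ _ => Finset.sum_nonneg fun i _ => nsq_nonneg _) ht
  have n4 : 0 ≤ ∫ τ in (0 : ℝ)..t, ∑ i, (nsq (pd 0 (U i τ)) + nsq (pd 1 (U i τ))) :=
    primitive_nonneg (T := T)
      (fun τ _ => Finset.sum_nonneg fun i _ => add_nonneg (nsq_nonneg _) (nsq_nonneg _)) ht
  refine hcs.trans ?_
  rw [show ∀ a : ℝ, t * (16 * a) = 16 * t * a from fun a => by ring]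
  have h16 : 16 * t ≤ 16 * T := by linarith [ht.2]
  refine mul_le_mul h16 (by linarith) (by positivity) (by linarith)

/-- The right-hand side of the energy inequality involves `W²`, which is bounded by `16 T` times the
time integral of `‖Γ‖²`, plus the dissipation, plus a known energy term. The inequality is thus
linear in `X`, and Grönwall's inequality gives one exponential of order `(1 + T)³`. -/
lemma gam_le (h : AxiSol T U R P) (hM : 0 ≤ M) (hδ : 0 < δ) (hI : InitBound M δ U R)
    (ht : t ∈ Icc 0 T) :
    nsq (Gam fun j => U j t) + ∫ τ in (0 : ℝ)..t,
      (nsq (pd 0 (Gam fun j => U j τ)) + nsq (pd 1 (Gam fun j => U j τ))) ≤ gamB M δ (1 + T) := by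
  have hT := h.pos
  obtain ⟨g1, g2⟩ := h.gam_continuousOn
  have cG := (g1 0).add (g1 1)
  have hA := densC_nonneg M δ
  set A := densC M δ with hAd
  set B := energyB M (1 + T) with hB
  have hB0 : 0 ≤ B := by
    rw [hB, energyB]
    positivity
  -- The dissipation is kept inside the unknown because it bounds the speed.
  set X : ℝ → ℝ := fun t => nsq (Gam fun j => U j t) + ∫ τ in (0 : ℝ)..t,
      (nsq (pd 0 (Gam fun j => U j τ)) + nsq (pd 1 (Gam fun j => U j τ))) with hX
  have cX : ContinuousOn X (Icc 0 T) := g2.add (continuousOn_primitive hT.le cG)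
  have cW := continuousOn_primitive hT.le h.speed_continuousOn
  have hd : ContinuousOn (fun t => A * (1 + (∫ τ in (0 : ℝ)..t, speed U τ) ^ 2)) (Icc 0 T) :=
    continuousOn_const.mul (continuousOn_const.add (cW.pow 2))
  have nG : ∀ τ ∈ Icc 0 T, 0 ≤ ∫ τ in (0 : ℝ)..τ,
      (nsq (pd 0 (Gam fun j => U j τ)) + nsq (pd 1 (Gam fun j => U j τ))) := fun τ hτ =>
    primitive_nonneg (T := T) (fun τ _ => add_nonneg (nsq_nonneg _) (nsq_nonneg _)) hτ
  have key : ∀ t ∈ Icc 0 T, X t ≤ (M ^ 2 + A * T + 16 * A * T ^ 2 * (1 + T) * B) +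
      ∫ τ in (0 : ℝ)..t, (16 * A * T * (1 + T)) * X τ := fun t ht => by
    have hsub : Icc 0 t ⊆ Icc 0 T := Icc_subset_Icc le_rfl ht.2
    have hii : ∀ {g : ℝ → ℝ}, ContinuousOn g (Icc 0 T) → IntervalIntegrable g volume 0 t :=
      fun hg => (hg.mono hsub).intervalIntegrable_of_Icc ht.1
    have h1 := h.gam_energy hd (fun τ hτ => h.radInv_le hM hδ hI hτ) ht
    set N := ∫ τ in (0 : ℝ)..t, nsq (Gam fun j => U j τ) with hN
    have hNX : N ≤ ∫ τ in (0 : ℝ)..t, X τ :=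
      intervalIntegral.integral_mono_on ht.1 (hii g2) (hii cX) fun τ hτ => by
        have := nG τ (hsub hτ)
        simp only [hX]
        linarith
    have hN0 : 0 ≤ N := primitive_nonneg (T := T) (fun τ _ => nsq_nonneg _) ht
    have hX0 : 0 ≤ ∫ τ in (0 : ℝ)..t, X τ := hN0.trans hNX
    -- The integral of `‖Γ‖²` is enlarged to its value `N` at the final time, while the dissipation
    -- up to `τ` is part of `X τ`.
    have hpt : ∀ τ ∈ Icc 0 t, A * (1 + (∫ τ in (0 : ℝ)..τ, speed U τ) ^ 2) ≤
        A * (1 + 16 * T * (N + (1 + T) * B)) + 16 * A * T * X τ := fun τ hτ => by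
      have h2 := h.sq_integral_speed_le hI (hsub hτ)
      have h3 : ∫ τ in (0 : ℝ)..τ, nsq (Gam fun j => U j τ) ≤ N := by
        refine intervalIntegral.integral_mono_interval le_rfl hτ.1 hτ.2
          (ae_of_all _ fun _ => nsq_nonneg _) (hii g2)
      have h4 : (∫ τ in (0 : ℝ)..τ, speed U τ) ^ 2 ≤
          16 * T * (N + (1 + T) * B) + 16 * T * X τ := by
        refine h2.trans ?_
        rw [← mul_add]
        refine mul_le_mul_of_nonneg_left ?_ (by positivity)
        simp only [hX]
        linarith [nsq_nonneg (Gam fun j => U j τ)]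
      have h5 := mul_le_mul_of_nonneg_left h4 hA
      linarith
    have hi : IntervalIntegrable (fun τ => 16 * A * T * X τ) volume 0 t :=
      hii (continuousOn_const.mul cX)
    have h6 := intervalIntegral.integral_mono_on ht.1 (hii hd)
      ((intervalIntegrable_const (c := A * (1 + 16 * T * (N + (1 + T) * B)))).add hi) hpt
    rw [intervalIntegral.integral_add (by simp) hi, intervalIntegral.integral_const,
      intervalIntegral.integral_const_mul (16 * A * T), smul_eq_mul, sub_zero] at h6
    have h7 : t * (A * (1 + 16 * T * (N + (1 + T) * B))) ≤
        T * (A * (1 + 16 * T * ((∫ τ in (0 : ℝ)..t, X τ) + (1 + T) * B))) := by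
      refine mul_le_mul ht.2 ?_ (by positivity) hT.le
      gcongr
    rw [intervalIntegral.integral_const_mul]
    have := hI.gam
    refine h1.trans ?_
    linarith
  have h8 := le_mul_exp_of_le_integral cX (b := fun _ => 16 * A * T * (1 + T)) continuousOn_const
    (fun _ _ => by positivity) key t ht
  refine h8.trans ?_
  rw [intervalIntegral.integral_const, smul_eq_mul, sub_zero, gamB]
  have e1 : T ^ 2 * (1 + T) ≤ (1 + T) ^ 3 := by
    nlinarith [sq_nonneg T]
  have e2 : t * (16 * A * T * (1 + T)) ≤ 16 * A * (1 + T) ^ 3 := by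
    have := mul_le_mul_of_nonneg_right ht.2 (show 0 ≤ 16 * A * T * (1 + T) by positivity)
    have := mul_le_mul_of_nonneg_left e1 (show 0 ≤ 16 * A by positivity)
    linarith
  have e3 : 16 * A * T ^ 2 * (1 + T) * B ≤ 16 * A * (1 + T) ^ 3 * B := by
    have := mul_le_mul_of_nonneg_left e1 (show 0 ≤ 16 * A * B by positivity)
    linarith
  have e4 : A * T ≤ A * (1 + T) := by linarith
  refine mul_le_mul (by linarith) (Real.exp_le_exp.2 e2) (by positivity) (by positivity)

lemma integral_speed_le (h : AxiSol T U R P) (hM : 0 ≤ M) (hδ : 0 < δ) (hI : InitBound M δ U R)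
    (ht : t ∈ Icc 0 T) : ∫ τ in (0 : ℝ)..t, speed U τ ≤ speedB M δ (1 + T) := by
  have hT := h.pos
  have h1 := h.sq_integral_speed_le hI ht
  have hsub : Icc 0 t ⊆ Icc 0 T := Icc_subset_Icc le_rfl ht.2
  have hG : ∀ τ ∈ Icc 0 T, nsq (Gam fun j => U j τ) ≤ gamB M δ (1 + T) := fun τ hτ => by
    have h2 := h.gam_le hM hδ hI hτ
    have := primitive_nonneg (T := T)
      (b := fun τ => nsq (pd 0 (Gam fun j => U j τ)) + nsq (pd 1 (Gam fun j => U j τ)))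
      (fun τ _ => add_nonneg (nsq_nonneg _) (nsq_nonneg _)) hτ
    linarith
  have h3 : ∫ τ in (0 : ℝ)..t, nsq (Gam fun j => U j τ) ≤ T * gamB M δ (1 + T) := by
    refine (intervalIntegral.integral_mono_on ht.1
      ((h.gam_continuousOn.2.mono hsub).intervalIntegrable_of_Icc ht.1) (by simp)
      fun τ hτ => hG τ (hsub hτ)).trans ?_
    rw [intervalIntegral.integral_const, smul_eq_mul, sub_zero]
    exact mul_le_mul_of_nonneg_right ht.2 ((nsq_nonneg _).trans (hG t ht))
  have h4 := h.gam_le hM hδ hI ht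
  have h5 := nsq_nonneg (Gam fun j => U j t)
  have hX0 : 0 ≤ gamB M δ (1 + T) := (nsq_nonneg _).trans (hG t ht)
  have hB0 : 0 ≤ energyB M (1 + T) := by
    rw [energyB]
    positivity
  rw [speedB]
  set X := gamB M δ (1 + T)
  set B := energyB M (1 + T)
  refine le_of_sq_le_sq ?_ (by positivity)
  have h6 := mul_le_mul_of_nonneg_left (show
    (∫ τ in (0 : ℝ)..t, nsq (Gam fun j => U j τ)) +
      (∫ τ in (0 : ℝ)..t, (nsq (pd 0 (Gam fun j => U j τ)) + nsq (pd 1 (Gam fun j => U j τ)))) +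
      (1 + T) * B ≤ (1 + T) * (X + B) by linarith)
    (show 0 ≤ 16 * T by positivity)
  -- Avoids a square root, so that `speedB` is polynomial in the earlier bounds.
  have h7 : X + B ≤ (1 + X + B) ^ 2 := by nlinarith
  calc _ ≤ _ := h1
    _ ≤ _ := h6
    _ ≤ 16 * (1 + T) ^ 2 * (X + B) := by
      have : 0 ≤ (1 + T) * (X + B) := by positivity
      linarith
    _ ≤ 16 * (1 + T) ^ 2 * (1 + X + B) ^ 2 := mul_le_mul_of_nonneg_left h7 (by positivity)
    _ = _ := by ring

/-- Grönwall's inequality with rate `2 * speed U`, whose time integral is bounded by `speedB`. As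
`speedB` is already exponential, this is where the second exponential arises. -/
lemma vort_le (h : AxiSol T U R P) (hM : 0 ≤ M) (hδ : 0 < δ) (hI : InitBound M δ U R)
    (ht : t ∈ Icc 0 T) :
    nsq (vort U t) + ∫ τ in (0 : ℝ)..t, (nsq (pd 0 (vort U τ)) + nsq (pd 1 (vort U τ))) ≤
      vortB M δ (1 + T) := by
  have hT := h.pos
  obtain ⟨c1, c2⟩ := h.vort_continuousOn
  have cb := h.speed_continuousOn
  set Y : ℝ → ℝ := fun t => nsq (vort U t) +
    ∫ τ in (0 : ℝ)..t, (nsq (pd 0 (vort U τ)) + nsq (pd 1 (vort U τ))) with hY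
  have cY : ContinuousOn Y (Icc 0 T) :=
    c2.add (continuousOn_primitive hT.le ((c1 0).add (c1 1)))
  have key : ∀ t ∈ Icc 0 T, Y t ≤ (4 * M ^ 2 + (1 + T) * M ^ 2) +
      ∫ τ in (0 : ℝ)..t, (2 * speed U τ) * Y τ := fun t ht => by
    have hsub : Icc 0 t ⊆ Icc 0 T := Icc_subset_Icc le_rfl ht.2
    have hii : ∀ {g : ℝ → ℝ}, ContinuousOn g (Icc 0 T) → IntervalIntegrable g volume 0 t :=
      fun hg => (hg.mono hsub).intervalIntegrable_of_Icc ht.1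
    have h1 := h.vort_energy cb (fun τ hτ => h.vr_le_speed hτ) ht
    have cw : ContinuousOn (fun τ => 2 * speed U τ * nsq (vort U τ)) (Icc 0 T) :=
      ((continuousOn_const (c := (2 : ℝ))).mul cb).mul c2
    rw [intervalIntegral.integral_add (by simp) (hii cw), intervalIntegral.integral_const,
      smul_eq_mul, sub_zero] at h1
    have h2 : t * nsq (R 0) ≤ (1 + T) * M ^ 2 :=
      mul_le_mul (by linarith [ht.2]) hI.rho (nsq_nonneg _) (by linarith)
    have h3 : ∫ τ in (0 : ℝ)..t, 2 * speed U τ * nsq (vort U τ) ≤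
        ∫ τ in (0 : ℝ)..t, (2 * speed U τ) * Y τ :=
      intervalIntegral.integral_mono_on ht.1 (hii cw)
        (hii ((continuousOn_const.mul cb).mul cY)) fun τ hτ => by
          refine mul_le_mul_of_nonneg_left ?_ (mul_nonneg zero_le_two (speed_nonneg U τ))
          have := primitive_nonneg (T := T)
            (b := fun τ => nsq (pd 0 (vort U τ)) + nsq (pd 1 (vort U τ)))
            (fun τ _ => add_nonneg (nsq_nonneg _) (nsq_nonneg _)) (hsub hτ)
          simp only [hY]
          linarith
    have := hI.vort
    simp only [hY] at h3 ⊢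
    linarith
  have h8 := le_mul_exp_of_le_integral cY (b := fun τ => 2 * speed U τ)
    (continuousOn_const.mul cb) (fun τ _ => mul_nonneg zero_le_two (speed_nonneg U τ)) key t ht
  refine h8.trans ?_
  rw [vortB, intervalIntegral.integral_const_mul]
  refine mul_le_mul_of_nonneg_left (Real.exp_le_exp.2 ?_) (by positivity)
  linarith [h.integral_speed_le hM hδ hI ht]

end AxiSol

end HBS

namespace HBS

/-! ### The growth of the bounds -/

/-- At most exponential growth in `s ^ 3`. -/
def ExpCubic (f : ℝ → ℝ) : Prop := ∃ A : ℝ, ∀ s, 1 ≤ s → 0 ≤ f s ∧ f s ≤ Real.exp (A * s ^ 3)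

lemma le_exp_self (x : ℝ) : x ≤ Real.exp x := by linarith [Real.add_one_le_exp x]

namespace ExpCubic
variable {f g : ℝ → ℝ}

lemma const {c : ℝ} (hc : 0 ≤ c) : ExpCubic fun _ => c :=
  ⟨c, fun _ hs => ⟨hc, (le_mul_of_one_le_right hc (one_le_pow₀ hs)).trans (le_exp_self _)⟩⟩

lemma exp_cubic (c : ℝ) : ExpCubic fun s => Real.exp (c * s ^ 3) :=
  ⟨c, fun _ _ => ⟨(Real.exp_pos _).le, le_rfl⟩⟩

lemma exp_id : ExpCubic fun s => Real.exp s :=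
  ⟨1, fun s hs => ⟨(Real.exp_pos _).le, Real.exp_le_exp.2 (by
    rw [one_mul]
    exact le_self_pow₀ hs (by norm_num))⟩⟩

lemma mul (hf : ExpCubic f) (hg : ExpCubic g) : ExpCubic fun s => f s * g s := by
  obtain ⟨A, hA⟩ := hf
  obtain ⟨B, hB⟩ := hg
  refine ⟨A + B, fun s hs => ⟨mul_nonneg (hA s hs).1 (hB s hs).1, ?_⟩⟩
  rw [add_mul, Real.exp_add]
  exact mul_le_mul (hA s hs).2 (hB s hs).2 (hB s hs).1 (Real.exp_pos _).le

lemma add (hf : ExpCubic f) (hg : ExpCubic g) : ExpCubic fun s => f s + g s := by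
  obtain ⟨A, hA⟩ := hf
  obtain ⟨B, hB⟩ := hg
  refine ⟨1 + max A B, fun s hs => ⟨add_nonneg (hA s hs).1 (hB s hs).1, ?_⟩⟩
  have hs3 : 1 ≤ s ^ 3 := one_le_pow₀ hs
  have h1 : Real.exp (A * s ^ 3) ≤ Real.exp (max A B * s ^ 3) :=
    Real.exp_le_exp.2 (mul_le_mul_of_nonneg_right (le_max_left _ _) (by positivity))
  have h2 : Real.exp (B * s ^ 3) ≤ Real.exp (max A B * s ^ 3) :=
    Real.exp_le_exp.2 (mul_le_mul_of_nonneg_right (le_max_right _ _) (by positivity))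
  have h3 : 2 ≤ Real.exp (1 * s ^ 3) := by linarith [Real.add_one_le_exp (1 * s ^ 3)]
  rw [add_mul, Real.exp_add]
  have := mul_le_mul_of_nonneg_right h3 (Real.exp_pos (max A B * s ^ 3)).le
  linarith [(hA s hs).2, (hB s hs).2]

lemma id : ExpCubic fun s => s := by
  obtain ⟨A, hA⟩ := exp_id
  exact ⟨A, fun s hs => ⟨by linarith, (le_exp_self s).trans (hA s hs).2⟩⟩

lemma pow (hf : ExpCubic f) (n : ℕ) : ExpCubic fun s => f s ^ n := by
  induction n with
  | zero => simpa using const zero_le_one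
  | succ n ih => simpa only [pow_succ] using ih.mul hf

end ExpCubic

lemma energyB_expCubic (M : ℝ) : ExpCubic (energyB M) :=
  ((ExpCubic.const (sq_nonneg M)).mul (ExpCubic.id.pow 2)).mul ExpCubic.exp_id

lemma gamB_expCubic (M δ : ℝ) : ExpCubic (gamB M δ) := by
  have hA := densC_nonneg M δ
  have hA' : 0 ≤ 16 * densC M δ := by positivity
  exact (((ExpCubic.const (sq_nonneg M)).add ((ExpCubic.const hA).mul ExpCubic.id)).add
    (((ExpCubic.const hA').mul (ExpCubic.id.pow 3)).mul (energyB_expCubic M))).mul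
    (ExpCubic.exp_cubic _)

lemma speedB_expCubic (M δ : ℝ) : ExpCubic (speedB M δ) :=
  ((ExpCubic.const (by norm_num : (0 : ℝ) ≤ 4)).mul ExpCubic.id).mul
    (((ExpCubic.const zero_le_one).add (gamB_expCubic M δ)).add (energyB_expCubic M))

/-- Only `vortB` is doubly exponential. The prefactor and the singly exponential terms are moved
into the exponent by `x ≤ exp x`, and a sum of two terms by `2 exp g ≤ exp (1 + g)`. -/
lemma exists_total_le (M δ : ℝ) : ∃ A : ℝ, 0 ≤ A ∧ ∀ s, 1 ≤ s →
    2 * vortB M δ s + gamB M δ s + energyB M s ≤ Real.exp (Real.exp (A * s ^ 3)) := by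
  have hpoly : ExpCubic fun s => 2 * (4 * M ^ 2 + s * M ^ 2) :=
    (ExpCubic.const zero_le_two).mul ((ExpCubic.const (by positivity)).add
      (ExpCubic.id.mul (ExpCubic.const (sq_nonneg M))))
  obtain ⟨A, hA⟩ := (ExpCubic.const zero_le_one).add
    ((hpoly.add ((ExpCubic.const zero_le_two).mul (speedB_expCubic M δ))).add
      ((gamB_expCubic M δ).add (energyB_expCubic M)))
  obtain ⟨_, hG⟩ := gamB_expCubic M δ
  obtain ⟨_, hE⟩ := energyB_expCubic M
  obtain ⟨_, hS⟩ := speedB_expCubic M δ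
  obtain ⟨_, hP⟩ := hpoly
  refine ⟨max A 0, le_max_right _ _, fun s hs => ?_⟩
  have h1 := (hA s hs).2
  have hG0 := (hG s hs).1
  have hE0 := (hE s hs).1
  have hS0 := (hS s hs).1
  have hP0 := (hP s hs).1
  set p := 2 * (4 * M ^ 2 + s * M ^ 2) with hp
  set q := gamB M δ s + energyB M s with hq
  have h2 : 2 * vortB M δ s ≤ Real.exp (p + 2 * speedB M δ s) := by
    rw [vortB, ← mul_assoc, ← hp, Real.exp_add]
    exact mul_le_mul_of_nonneg_right (le_exp_self p) (Real.exp_pos _).le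
  have h3 := le_exp_self q
  set g := p + 2 * speedB M δ s + q with hg
  have h4 : Real.exp (p + 2 * speedB M δ s) ≤ Real.exp g := Real.exp_le_exp.2 (by linarith)
  have h5 : Real.exp q ≤ Real.exp g := Real.exp_le_exp.2 (by linarith)
  have h6 : 2 * Real.exp g ≤ Real.exp (1 + g) := by
    rw [Real.exp_add 1 g]
    exact mul_le_mul_of_nonneg_right (by linarith [Real.add_one_le_exp (1 : ℝ)]) (Real.exp_pos _).le
  have h7 : Real.exp (A * s ^ 3) ≤ Real.exp (max A 0 * s ^ 3) :=
    Real.exp_le_exp.2 (mul_le_mul_of_nonneg_right (le_max_left _ _) (by positivity))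
  have h8 : Real.exp (1 + g) ≤ Real.exp (Real.exp (max A 0 * s ^ 3)) :=
    Real.exp_le_exp.2 (h1.trans h7)
  linarith

/-- For `T > 1`, `(1 + T)³ ≤ 8 T³ ≤ 8 T¹⁷`, so the cubic growth is stronger than required. For `T ≤
1` the bound is a number absorbed by `C`; this case also serves `t = 0`, where the interval `[0, T]`
must still have positive length. -/
lemma exists_const (M δ : ℝ) : ∃ C : ℝ, 0 < C ∧ ∀ T t, 0 ≤ T → (T = t ∨ T ≤ 1) → 0 ≤ t →
    2 * vortB M δ (1 + T) + gamB M δ (1 + T) + energyB M (1 + T) ≤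
      C * Real.exp (Real.exp (C * t ^ 17)) := by
  obtain ⟨A, hA0, hA⟩ := exists_total_le M δ
  have hC1 : 1 ≤ Real.exp (Real.exp (8 * A)) := Real.one_le_exp (Real.exp_pos _).le
  -- The first summand handles short times as a prefactor, the second is the rate for `T > 1`.
  set C := Real.exp (Real.exp (8 * A)) + 8 * A with hC
  have hC1' : 1 ≤ C := by linarith
  refine ⟨C, by linarith, fun T t hT hTt ht => (hA (1 + T) (by linarith)).trans ?_⟩
  by_cases h1 : T ≤ 1
  · have h3 : (1 + T) ^ 3 ≤ 8 :=
      (pow_le_pow_left₀ (by linarith) (by linarith : 1 + T ≤ 2) 3).trans (by norm_num)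
    have h4 : Real.exp (Real.exp (A * (1 + T) ^ 3)) ≤ C := by
      have : Real.exp (Real.exp (A * (1 + T) ^ 3)) ≤ Real.exp (Real.exp (8 * A)) :=
        Real.exp_le_exp.2 (Real.exp_le_exp.2 (by nlinarith))
      linarith
    exact h4.trans (le_mul_of_one_le_right (by linarith) (Real.one_le_exp (Real.exp_pos _).le))
  · obtain rfl : T = t := hTt.resolve_right h1
    have h1' : 1 ≤ T := (not_le.1 h1).le
    have h3 : (1 + T) ^ 3 ≤ 8 * T ^ 17 := by
      calc (1 + T) ^ 3 ≤ (2 * T) ^ 3 := pow_le_pow_left₀ (by linarith) (by linarith) 3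
        _ = 8 * T ^ 3 := by ring
        _ ≤ 8 * T ^ 17 := by
          have := pow_le_pow_right₀ h1' (show 3 ≤ 17 by norm_num)
          linarith
    have h4 : A * (1 + T) ^ 3 ≤ C * T ^ 17 := by
      have h5 : 8 * A ≤ C := by linarith
      calc _ ≤ A * (8 * T ^ 17) := mul_le_mul_of_nonneg_left h3 hA0
        _ = 8 * A * T ^ 17 := by ring
        _ ≤ _ := mul_le_mul_of_nonneg_right h5 (by positivity)
    refine (Real.exp_le_exp.2 (Real.exp_le_exp.2 h4)).trans ?_
    exact le_mul_of_one_le_left (Real.exp_pos _).le hC1'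

end HBS

namespace HBS

/-! ### The initial data -/

lemma l2sq_eq_ofReal_sum {v : E3 → E3} (hv : ∀ i, MemLp (fun x => v x i) 2 volume) :
    l2sq v = ENNReal.ofReal (∑ i, nsq fun x => v x i) := by
  have h1 : ∀ x, ‖v x‖ₑ ^ 2 = ENNReal.ofReal (∑ i, v x i ^ 2) := fun x => by
    rw [← EuclideanSpace.real_norm_sq_eq, ← ofReal_norm,
      ENNReal.ofReal_pow (norm_nonneg _)]
  have h2 : l2sq v = ∫⁻ x, ‖v x‖ₑ ^ 2 := by
    rw [l2sq, eLpNorm_eq_lintegral_rpow_enorm_toReal two_ne_zero ENNReal.ofNat_ne_top]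
    rw [← ENNReal.rpow_natCast, ← ENNReal.rpow_mul]
    simp
  rw [h2]
  simp only [h1]
  rw [← ofReal_integral_eq_lintegral_ofReal
    (integrable_finsetSum _ fun i _ => (hv i).integrable_sq)
    (ae_of_all _ fun x => Finset.sum_nonneg fun i _ => sq_nonneg _),
    integral_finsetSum _ fun i _ => (hv i).integrable_sq]
  rfl

/-- Initial bounds refer to weak derivatives; a smooth solution makes `u₀` smooth, and testing
identifies them with the classical ones. -/
lemma ae_eq_weakPartial {u D : E3 → E3} (hu : ContDiff ℝ ∞ u) {i : Fin 3}
    (h : IsWeakPartial i u D) : D =ᵐ[volume] pd i u := by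
  obtain ⟨-, h1, h2⟩ := h
  have hc : Continuous (pd i u) := (contDiff_pd hu i).continuous
  refine ae_eq_of_integral_contDiff_smul_eq h1 hc.locallyIntegrable fun φ hφ hs => ?_
  have hd := hφ.differentiable (by simp)
  have hcφ : Continuous (pd i φ) := (contDiff_pd hφ i).continuous
  have hsφ : HasCompactSupport (pd i φ) := hs.fderiv_apply ℝ _
  have h3 := integral_smul_fderiv_eq_neg_fderiv_smul_of_integrable (μ := volume)
    (v := EuclideanSpace.single i (1 : ℝ)) (f := φ) (g := u)
    ((hcφ.smul hu.continuous).integrable_of_hasCompactSupport (hsφ.smul_right))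
    ((hφ.continuous.smul hc).integrable_of_hasCompactSupport (hs.smul_right))
    ((hφ.continuous.smul hu.continuous).integrable_of_hasCompactSupport (hs.smul_right))
    (fun x _ => hd x) (fun x _ => hu.differentiable (by simp) x)
  have h4 := h2 φ hφ hs
  simp only [pd] at h3 h4 ⊢
  rw [h3, h4, neg_neg]

lemma IsAxisymScalar.axiS {f : E3 → ℝ} (h : IsAxisymScalar f) : AxiS f := by
  obtain ⟨g, hg⟩ := h
  intro x y h1 h2
  rw [hg, hg, h1, h2]

lemma IsAxisymVector.comp_refl {v : E3 → E3} (h : IsAxisymVector v) {c s : ℝ}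
    (hc : c ^ 2 + s ^ 2 = 1) (i : Fin 3) (x : E3) :
    v x i = ∑ j, reflMat c s i j * v (refl c s x) j := by
  obtain ⟨a, b, h⟩ := h
  rw [h x, h (refl c s x), rad_refl hc, refl_two, Fin.sum_univ_three]
  fin_cases i
  · simp [er, e₃, reflMat, rad_refl hc]
    linear_combination (-(a (rad x) (x 2) * (x 0 / rad x))) * hc
  · simp [er, e₃, reflMat, rad_refl hc]
    linear_combination (-(a (rad x) (x 2) * (x 1 / rad x))) * hc
  · simp [er, e₃, reflMat]

lemma dist_projZ (x : E3) : dist x (projZ x) = rad x := by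
  rw [EuclideanSpace.dist_eq, rad]
  simp [projZ, Fin.sum_univ_three, Real.dist_eq, sq_abs]

lemma curl_eq {v : E3 → E3} (hv : Differentiable ℝ v) (h : AxiFlow fun i x => v x i) (x : E3) :
    curl v x = !₂[-(x 1 * Gam (fun i x => v x i) x), x 0 * Gam (fun i x => v x i) x, 0] := by
  have h0 := h.curl_zero x
  have h1 := h.curl_one x
  have h2 := h.curl_two x
  simp only [pd_apply (hv x)] at h0 h1 h2
  rw [curl, curlOf, h0, h1, h2]

/-- Without swirl the vorticity is purely angular, so its length is `r |Γ|`. -/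
lemma nsq_gam_le {M : ℝ≥0} {v : E3 → E3} {D : Fin 3 → E3 → E3} (hv : ContDiff ℝ ∞ v)
    (h : AxiFlow fun i x => v x i) (hD : ∀ i, IsWeakPartial i v (D i))
    (hM : eLpNorm (fun x => (rad x)⁻¹ • curlOf D x) 2 volume ≤ M) :
    nsq (Gam fun i x => v x i) ≤ (M : ℝ) ^ 2 := by
  refine nsq_le_of_eLpNorm_le h.gam_sob.memLp (le_trans (le_of_eq ?_) hM)
  refine eLpNorm_congr_norm_ae ?_
  filter_upwards [ae_all_iff.2 fun i => ae_eq_weakPartial hv (hD i), ae_coord_zero_ne] with x hx hx0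
  have e : curlOf D x = curl v x := by simp only [curl, curlOf, hx]
  have hr : rad x ≠ 0 := fun hr => hx0 (rad_eq_zero_iff.1 hr).1
  rw [e, curl_eq (hv.differentiable (by simp)) h, norm_smul, EuclideanSpace.norm_eq]
  simp only [Fin.sum_univ_three]
  simp only [norm_inv, Real.norm_eq_abs, sq_abs, abs_of_nonneg (rad_nonneg x)]
  set G := Gam (fun i x => v x i) x
  rw [show (√((!₂[-(x 1 * G), x 0 * G, 0] : E3) 0 ^ 2 + (!₂[-(x 1 * G), x 0 * G, 0] : E3) 1 ^ 2 +
    (!₂[-(x 1 * G), x 0 * G, 0] : E3) 2 ^ 2)) = rad x * |G| from ?_]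
  · field_simp
  · rw [← Real.sqrt_sq_eq_abs, rad, ← Real.sqrt_mul (by positivity)]
    congr 1
    simp
    ring

/-- The initial bounds of a smooth solution. -/
lemma IsSmoothSolution.initBound {M : ℝ≥0} {δ : ℝ} {u₀ : E3 → E3} {D : Fin 3 → E3 → E3}
    {ρ₀ : E3 → ℝ} (hA : IsAdmissibleData u₀ D ρ₀) (hB : DataBound M δ u₀ D ρ₀) {T : EReal}
    {u : ℝ → E3 → E3} {ρ P : ℝ → E3 → ℝ} (h : IsSmoothSolution T u₀ ρ₀ u ρ P) {T₁ : ℝ}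
    (h0 : 0 < T₁) (h1 : T₁ ∈ timeInterval T) :
    AxiSol T₁ (fun i t x => u t x i) ρ P ∧ InitBound M δ (fun i t x => u t x i) ρ := by
  have hC := h.compSol h0 h1
  have hz : (0 : ℝ) ∈ Icc 0 T₁ := left_mem_Icc.2 h0.le
  have hS : AxiSol T₁ (fun i t x => u t x i) ρ P := hC.axiSol h0
    (fun c s hc i x => by
      simp only [h.u_init]
      exact hA.u_axisym.comp_refl hc i x)
    (by
      rw [h.ρ_init]
      exact hA.ρ_axisym.axiS)
  have hu : ContDiff ℝ ∞ u₀ := by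
    rw [← h.u_init, contDiff_euclidean]
    exact fun i => ((hC.U_sob i).sob hz).contDiff
  have hU : ∀ i, Sob fun x => u 0 x i := fun i => (hC.U_sob i).sob hz
  have hpd : ∀ j, (fun x => pd j u₀ x) = pd j (u 0) := fun j => by rw [h.u_init]
  have hUj : ∀ i j, (fun x => pd j (u 0) x i) = pd j fun x => u 0 x i := fun i j =>
    funext fun x => by
      rw [pd_apply]
      rw [h.u_init]
      exact hu.differentiable (by simp) x
  have hh1 := hB.u_h1
  have hM2 : ((M : ℝ≥0∞)) ^ 2 = ENNReal.ofReal ((M : ℝ) ^ 2) := by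
    rw [ENNReal.ofReal_pow M.coe_nonneg, ENNReal.ofReal_coe_nnreal]
  have hE : ∑ i, nsq (fun x => u 0 x i) ≤ (M : ℝ) ^ 2 := by
    have e := l2sq_eq_ofReal_sum (v := u 0) fun i => (hU i).memLp
    rw [h.u_init] at e
    have h2 : l2sq u₀ ≤ (M : ℝ≥0∞) ^ 2 := le_self_add.trans hh1
    rw [e, hM2, ENNReal.ofReal_le_ofReal_iff (by positivity)] at h2
    rwa [h.u_init]
  have hDn : ∀ i j, nsq (pd j fun x => u 0 x i) ≤ (M : ℝ) ^ 2 := fun i j => by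
    have e := l2sq_eq_ofReal_sum (v := pd j (u 0)) fun i => by
      rw [hUj i j]
      exact ((hU i).pd j).memLp
    have e2 : l2sq (D j) = l2sq (pd j (u 0)) := by
      rw [l2sq, l2sq, eLpNorm_congr_ae (ae_eq_weakPartial hu (hA.u_weak j)), h.u_init]
    have h2 : l2sq (D j) ≤ (M : ℝ≥0∞) ^ 2 := by
      refine le_trans ?_ (le_add_self.trans hh1)
      exact Finset.single_le_sum (f := fun i => l2sq (D i)) (fun _ _ => zero_le)
        (Finset.mem_univ j)
    rw [e2, e, hM2, ENNReal.ofReal_le_ofReal_iff (by positivity)] at h2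
    simp only [hUj] at h2
    exact (Finset.single_le_sum (f := fun i => nsq (pd j fun x => u 0 x i))
      (fun _ _ => nsq_nonneg _) (Finset.mem_univ i)).trans h2
  refine ⟨hS, hE, ?_, ?_, ?_, ?_, ?_, ?_⟩
  · have := nsq_gam_le (v := u 0) (by rw [h.u_init]; exact hu) (hS.flow 0 hz)
      (by rw [h.u_init]; exact hA.u_weak) hB.vorticity
    exact this
  -- The factor 4 comes from `(a - b)² ≤ 2 a² + 2 b²` with both derivatives bounded by `M` in `L²`.
  · have h3 := nsq_add_le ((hU 0).pd 2).memLp ((hU 2).pd 0).memLp.neg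
    have e : (fun x => pd 2 (fun x => u 0 x 0) x + (-pd 0 (fun x => u 0 x 2)) x) =
        vort (fun i t x => u t x i) 0 := by
      funext x
      rw [vort, sub_eq_add_neg, Pi.neg_apply]
    rw [e] at h3
    have e2 : nsq (-pd 0 (fun x => u 0 x 2)) = nsq (pd 0 fun x => u 0 x 2) := by
      simp only [nsq, Pi.neg_apply, neg_sq]
    rw [e2] at h3
    linarith [hDn 0 2, hDn 2 0]
  · refine nsq_le_of_eLpNorm_le (hC.R_sob.memLp hz) ?_
    rw [h.ρ_init]
    exact hB.ρ_two
  · have h3 := hB.ρ_top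
    rw [eLpNorm_exponent_top] at h3
    rw [h.ρ_init]
    filter_upwards [ae_le_eLpNormEssSup (f := ρ₀) (μ := volume)] with x hx
    have h4 := hx.trans h3
    rwa [enorm_le_coe, ← NNReal.coe_le_coe, coe_nnnorm] at h4
  · intro x hx
    rw [h.ρ_init]
    refine image_eq_zero_of_notMem_tsupport fun hm => ?_
    -- The distance to the axis is tested at the orthogonal projection, where it equals `rad x`.
    have h3 := hB.ρ_dist x hm (projZ x) ⟨by simp [projZ], by simp [projZ]⟩
    rw [dist_projZ] at h3
    exact absurd h3 (not_le.2 hx)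
  · rw [h.ρ_init]
    -- The reference height is that of any point of the support; the diameter then bounds all
    -- vertical distances to it.
    rcases (tsupport ρ₀).eq_empty_or_nonempty with he | ⟨y, hy⟩
    · exact ⟨0, fun x _ => image_eq_zero_of_notMem_tsupport (by simp [he])⟩
    · refine ⟨y 2, fun x hx => image_eq_zero_of_notMem_tsupport fun hm => ?_⟩
      have h3 := (Metric.dist_le_diam_of_mem hA.ρ_compact.isBounded (mem_image_of_mem projZ hm)
        (mem_image_of_mem projZ hy)).trans hB.ρ_diam
      rw [dist_eq_norm] at h3
      have h4 := (PiLp.norm_apply_le (projZ x - projZ y) 2).trans h3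
      simp only [projZ, Real.norm_eq_abs] at h4
      simp at h4
      exact absurd h4 (not_le.2 hx)

end HBS

namespace HBS

/-! ### The vorticity in cylindrical coordinates -/

lemma l2sq_eq_lintegral (f : E3 → ℝ) : l2sq f = ∫⁻ x, ENNReal.ofReal (f x ^ 2) := by
  rw [l2sq, ← lintegral_sq_enorm]
  congr 1
  funext x
  rw [← ofReal_norm, ← ENNReal.ofReal_pow (norm_nonneg _), Real.norm_eq_abs, sq_abs]

lemma l2sq_eq_nsq {f : E3 → ℝ} (hf : MemLp f 2 volume) : l2sq f = ENNReal.ofReal (nsq f) :=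
  (ofReal_nsq hf).symm

lemma ae_rad_ne : ∀ᵐ x : E3, rad x ≠ 0 := by
  filter_upwards [ae_coord_zero_ne] with x hx hr
  exact hx (rad_eq_zero_iff.1 hr).1

lemma pd_rad {i : Fin 3} (hi : i ≠ 2) {x : E3} (hx : rad x ≠ 0) :
    DifferentiableAt ℝ rad x ∧ pd i rad x = x i / rad x := by
  have hp : x 0 ^ 2 + x 1 ^ 2 ≠ 0 := fun h => hx (by rw [rad, h, Real.sqrt_zero])
  have hd := Real.hasDerivAt_sqrt hp
  have h1 : DifferentiableAt ℝ (fun y : E3 => √(y 0 ^ 2 + y 1 ^ 2)) x :=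
    hd.differentiableAt.comp (f := fun y : E3 => y 0 ^ 2 + y 1 ^ 2) x (differentiable_rsq x)
  refine ⟨h1, ?_⟩
  have h2 := pd_comp_real i hd (differentiable_rsq x)
  rw [pd_rsq hi] at h2
  refine h2.trans ?_
  rw [rad]
  field_simp

namespace AxiFlow
variable {u : E3 → E3}

lemma omega_eq (hu : Differentiable ℝ u) (h : AxiFlow fun i x => u x i) (x : E3) :
    ωθ u x = rad x * Gam (fun i x => u x i) x := by
  rw [ωθ, curl_eq hu h]
  set G := Gam (fun i x => u x i) x
  have e : inner ℝ (!₂[-(x 1 * G), x 0 * G, 0] : E3) (eθ x) = (x 0 ^ 2 + x 1 ^ 2) / rad x * G := by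
    simp [eθ, PiLp.inner_apply, Fin.sum_univ_three]
    ring
  rw [e, ← rad_sq]
  by_cases hr : rad x = 0
  · simp [hr]
  · field_simp

lemma omegar_eq (hu : Differentiable ℝ u) (h : AxiFlow fun i x => u x i) {x : E3}
    (hx : rad x ≠ 0) : ωθr u x = Gam (fun i x => u x i) x := by
  rw [ωθr, h.omega_eq hu]
  field_simp

lemma l2sq_omegar (hu : Differentiable ℝ u) (h : AxiFlow fun i x => u x i) :
    l2sq (ωθr u) = ENNReal.ofReal (nsq (Gam fun i x => u x i)) := by
  rw [← l2sq_eq_nsq h.gam_sob.memLp, l2sq, l2sq, eLpNorm_congr_ae]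
  filter_upwards [ae_rad_ne] with x hx
  exact h.omegar_eq hu hx

lemma gradHsq_omegar (hu : Differentiable ℝ u) (h : AxiFlow fun i x => u x i) :
    gradHsq (ωθr u) = ENNReal.ofReal
      (nsq (pd 0 (Gam fun i x => u x i)) + nsq (pd 1 (Gam fun i x => u x i))) := by
  have e : ∀ j, l2sq (pd j (ωθr u)) = ENNReal.ofReal (nsq (pd j (Gam fun i x => u x i))) :=
    fun j => by
      rw [← l2sq_eq_nsq (h.gam_sob.pd j).memLp, l2sq, l2sq, eLpNorm_congr_ae]
      filter_upwards [ae_rad_ne] with x hx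
      have he : ωθr u =ᶠ[nhds x] Gam fun i x => u x i := by
        filter_upwards [(isOpen_ne_fun continuous_rad continuous_const).mem_nhds hx] with y hy
        exact h.omegar_eq hu hy
      rw [pd, pd, he.fderiv_eq]
  rw [gradHsq, e, e, ENNReal.ofReal_add (nsq_nonneg _) (nsq_nonneg _)]

/-- The reflection `refl 0 1` exchanges `x₀` and `x₁`, so the two horizontal vorticity components
have equal norms and a single one needs to be estimated. -/
lemma nsq_one_eq {v : Fin 3 → E3 → ℝ} (h : AxiFlow v) :
    nsq (fun x => x 1 * Gam v x) = nsq (fun x => x 0 * Gam v x) ∧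
    nsq (pd 0 fun x => x 1 * Gam v x) = nsq (pd 1 fun x => x 0 * Gam v x) ∧
    nsq (pd 1 fun x => x 1 * Gam v x) = nsq (pd 0 fun x => x 0 * Gam v x) := by
  have hc : (0 : ℝ) ^ 2 + 1 ^ 2 = 1 := by norm_num
  have e : (fun x : E3 => x 1 * Gam v x) =
      fun x => (fun y : E3 => y 0 * Gam v y) (refl 0 1 x) := by
    funext x
    simp [h.gam_axiS.comp_refl hc x]
  have hd : Differentiable ℝ fun x : E3 => x 0 * Gam v x :=
    (differentiable_coord 0).fun_mul h.gam_sob.differentiable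
  refine ⟨?_, ?_, ?_⟩
  · exact (congrArg nsq e).trans
      (nsq_comp_refl hc fun y => y 0 * Gam v y)
  · rw [e, ← nsq_comp_refl hc (pd 1 _)]
    congr 1
    funext x
    rw [pd_comp_refl 0 1 hd, Fin.sum_univ_three]
    simp [reflMat]
  · rw [e, ← nsq_comp_refl hc (pd 0 _)]
    congr 1
    funext x
    rw [pd_comp_refl 0 1 hd, Fin.sum_univ_three]
    simp [reflMat]

/-- `ω_θ² = (x₀ Γ)² + (x₁ Γ)²`, two terms with the same integral. -/
lemma l2sq_omega (hu : Differentiable ℝ u) (h : AxiFlow fun i x => u x i)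
    (h0 : Sob fun x => x 0 * Gam (fun i x => u x i) x)
    (h1 : Sob fun x => x 1 * Gam (fun i x => u x i) x) :
    l2sq (ωθ u) = ENNReal.ofReal (2 * nsq fun x => x 0 * Gam (fun i x => u x i) x) := by
  rw [two_mul]
  nth_rw 2 [← h.nsq_one_eq.1]
  rw [ENNReal.ofReal_add (nsq_nonneg _) (nsq_nonneg _), ← l2sq_eq_nsq h0.memLp,
    ← l2sq_eq_nsq h1.memLp]
  simp only [l2sq_eq_lintegral]
  have hm : Measurable fun x : E3 => ENNReal.ofReal ((x 0 * Gam (fun i x => u x i) x) ^ 2) :=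
    (h0.continuous.pow 2).measurable.ennreal_ofReal
  rw [← lintegral_add_left hm]
  congr 1
  funext x
  rw [← ENNReal.ofReal_add (sq_nonneg _) (sq_nonneg _), h.omega_eq hu, mul_pow, rad_sq]
  congr 1
  ring

/-- The horizontal gradient of the vector `ω_θ e_θ` satisfies `|∇_h (ω_θ e_θ)|² = |∇_h ω_θ|² + (ω_θ
/ r)²`, so the dissipation of the Cartesian components yields both terms at once. -/
lemma gradHsq_omega (hu : Differentiable ℝ u) (h : AxiFlow fun i x => u x i)
    (h0 : Sob fun x => x 0 * Gam (fun i x => u x i) x)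
    (h1 : Sob fun x => x 1 * Gam (fun i x => u x i) x) :
    gradHsq (ωθ u) + l2sq (ωθr u) = ENNReal.ofReal (2 *
      (nsq (pd 0 fun x => x 0 * Gam (fun i x => u x i) x) +
        nsq (pd 1 fun x => x 0 * Gam (fun i x => u x i) x))) := by
  set G := Gam fun i x => u x i with hG
  have hGs : Sob G := h.gam_sob
  have hpd : ∀ i : Fin 3, i ≠ 2 → l2sq (pd i (ωθ u)) =
      ∫⁻ x, ENNReal.ofReal ((x i / rad x * G x + rad x * pd i G x) ^ 2) := fun i hi => by
    rw [l2sq_eq_lintegral]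
    refine lintegral_congr_ae ?_
    filter_upwards [ae_rad_ne] with x hx
    obtain ⟨d1, d2⟩ := pd_rad hi hx
    have e : ωθ u = fun x => rad x * G x := funext fun x => h.omega_eq hu x
    rw [e, pd_mul i d1 (hGs.differentiableAt x), d2]
  have hm : ∀ i, Measurable fun x : E3 =>
      ENNReal.ofReal ((x i / rad x * G x + rad x * pd i G x) ^ 2) := fun i => by
    have m1 := (differentiable_coord i).continuous.measurable
    have m2 := continuous_rad.measurable
    have m3 := hGs.continuous.measurable
    have m4 := (hGs.pd i).continuous.measurable
    exact ((((m1.div m2).mul m3).add (m2.mul m4)).pow_const 2).ennreal_ofReal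
  have hmp : ∀ {f : E3 → ℝ}, Sob f → Measurable fun x => ENNReal.ofReal (f x ^ 2) := fun hf =>
    (hf.continuous.pow 2).measurable.ennreal_ofReal
  obtain ⟨-, e1, e2⟩ := h.nsq_one_eq
  rw [show 2 * (nsq (pd 0 fun x => x 0 * G x) + nsq (pd 1 fun x => x 0 * G x)) =
    nsq (pd 0 fun x => x 0 * G x) + nsq (pd 1 fun x => x 0 * G x) +
    nsq (pd 0 fun x => x 1 * G x) + nsq (pd 1 fun x => x 1 * G x) by rw [e1, e2]; ring]
  have n := nsq_nonneg
  rw [ENNReal.ofReal_add (add_nonneg (add_nonneg (n _) (n _)) (n _)) (n _),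
    ENNReal.ofReal_add (add_nonneg (n _) (n _)) (n _), ENNReal.ofReal_add (n _) (n _),
    ← l2sq_eq_nsq (h0.pd 0).memLp, ← l2sq_eq_nsq (h0.pd 1).memLp, ← l2sq_eq_nsq (h1.pd 0).memLp,
    ← l2sq_eq_nsq (h1.pd 1).memLp, gradHsq, hpd 0 (by decide), hpd 1 (by decide),
    h.l2sq_omegar hu, ← l2sq_eq_nsq hGs.memLp]
  simp only [l2sq_eq_lintegral]
  rw [← lintegral_add_left (hm 0), ← lintegral_add_right _ (hmp hGs),
    ← lintegral_add_right _ (hmp (h0.pd 1)), ← lintegral_add_right _ (hmp (h1.pd 0)),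
    ← lintegral_add_right _ (hmp (h1.pd 1))]
  refine lintegral_congr_ae ?_
  filter_upwards [ae_rad_ne] with x hx
  have hd := hGs.differentiableAt x
  simp only [pd_coord_mul _ _ hd]
  rw [← ENNReal.ofReal_add (by positivity) (by positivity),
    ← ENNReal.ofReal_add (by positivity) (by positivity),
    ← ENNReal.ofReal_add (by positivity) (by positivity),
    ← ENNReal.ofReal_add (by positivity) (by positivity),
    ← ENNReal.ofReal_add (by positivity) (by positivity)]
  congr 1
  have hr := rad_sq x
  simp
  have e3 : (x 0 / rad x) ^ 2 + (x 1 / rad x) ^ 2 = 1 := by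
    rw [div_pow, div_pow, ← add_div, ← hr]
    field_simp
  have e4 : ∀ i : Fin 3, x i / rad x * rad x = x i := fun i => div_mul_cancel₀ _ hx
  set a := x 0 / rad x
  set b := x 1 / rad x
  have e5 := e4 0
  have e6 := e4 1
  change a * rad x = x 0 at e5
  change b * rad x = x 1 at e6
  linear_combination G x ^ 2 * e3 + 2 * G x * pd 0 G x * e5 + 2 * G x * pd 1 G x * e6 +
    (pd 0 G x ^ 2 + pd 1 G x ^ 2) * hr

end AxiFlow

lemma lintegral_Icc_ofReal {t : ℝ} (ht : 0 ≤ t) {g : ℝ → ℝ} (hg : ContinuousOn g (Icc 0 t))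
    (h0 : ∀ τ, 0 ≤ g τ) :
    ∫⁻ τ in Icc 0 t, ENNReal.ofReal (g τ) = ENNReal.ofReal (∫ τ in (0 : ℝ)..t, g τ) := by
  rw [intervalIntegral.integral_of_le ht, ← integral_Icc_eq_integral_Ioc,
    ofReal_integral_eq_lintegral_ofReal hg.integrableOn_Icc (ae_of_all _ h0)]

lemma AxiSol.coord_gam_sob {T : ℝ} {U : Fin 3 → ℝ → E3 → ℝ} {R P : ℝ → E3 → ℝ}
    (h : AxiSol T U R P) {t : ℝ} (ht : t ∈ Icc 0 T) :
    (Sob fun x => x 0 * Gam (fun i => U i t) x) ∧ Sob fun x => x 1 * Gam (fun i => U i t) x := by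
  have hf := h.flow t ht
  have h0 := ((hf.sob 0).pd 2).sub ((hf.sob 2).pd 0)
  have h1 := ((hf.sob 1).pd 2).sub ((hf.sob 2).pd 1)
  constructor
  · refine h0.congr fun _ _ => ?_
    funext x
    exact (hf.curl_one x).symm
  · refine h1.congr fun _ _ => ?_
    funext x
    linarith [hf.curl_zero x]

/-- The estimates, for a solution on `[0,T₁]`. -/
lemma IsSmoothSolution.norms_le {M : ℝ≥0} {δ : ℝ} (hδ : 0 < δ) {u₀ : E3 → E3}
    {D : Fin 3 → E3 → E3} {ρ₀ : E3 → ℝ} (hA : IsAdmissibleData u₀ D ρ₀)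
    (hB : DataBound M δ u₀ D ρ₀) {T : EReal} {u : ℝ → E3 → E3} {ρ P : ℝ → E3 → ℝ}
    (h : IsSmoothSolution T u₀ ρ₀ u ρ P) {T₁ : ℝ} (h0 : 0 < T₁) (h1 : T₁ ∈ timeInterval T)
    {t : ℝ} (ht : t ∈ Icc 0 T₁) :
    l2sq (ωθ (u t)) + (∫⁻ τ in Icc 0 t, (gradHsq (ωθ (u τ)) + l2sq (ωθr (u τ)))) +
        l2sq (ωθr (u t)) + (∫⁻ τ in Icc 0 t, gradHsq (ωθr (u τ))) ≤
      ENNReal.ofReal (2 * vortB M δ (1 + T₁) + gamB M δ (1 + T₁)) ∧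
    h1sq (u t) (fun i => pd i (u t)) ≤
      ENNReal.ofReal (2 * vortB M δ (1 + T₁) + energyB M (1 + T₁)) := by
  obtain ⟨hS, hI⟩ := h.initBound hA hB h0 h1
  have hsub : Icc 0 t ⊆ Icc 0 T₁ := Icc_subset_Icc le_rfl ht.2
  have hud : ∀ τ ∈ Icc 0 T₁, Differentiable ℝ (u τ) := fun τ hτ => by
    rw [differentiable_euclidean]
    exact fun i => ((hS.U_sob i).sob hτ).differentiable
  set U : Fin 3 → ℝ → E3 → ℝ := fun i t x => u t x i with hU
  have hv : ∀ τ ∈ Icc 0 T₁, (fun x => x 0 * Gam (fun i => U i τ) x) = vort U τ := fun τ hτ =>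
    funext fun x => (hS.vort_eq hτ x).symm
  have e1 : ∀ τ ∈ Icc 0 T₁, l2sq (ωθ (u τ)) = ENNReal.ofReal (2 * nsq (vort U τ)) := fun τ hτ => by
    rw [← hv τ hτ]
    exact (hS.flow τ hτ).l2sq_omega (hud τ hτ) (hS.coord_gam_sob hτ).1 (hS.coord_gam_sob hτ).2
  have e2 : ∀ τ ∈ Icc 0 T₁, gradHsq (ωθ (u τ)) + l2sq (ωθr (u τ)) =
      ENNReal.ofReal (2 * (nsq (pd 0 (vort U τ)) + nsq (pd 1 (vort U τ)))) := fun τ hτ => by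
    rw [← hv τ hτ]
    exact (hS.flow τ hτ).gradHsq_omega (hud τ hτ) (hS.coord_gam_sob hτ).1 (hS.coord_gam_sob hτ).2
  have e3 : ∀ τ ∈ Icc 0 T₁, l2sq (ωθr (u τ)) = ENNReal.ofReal (nsq (Gam fun i => U i τ)) :=
    fun τ hτ => (hS.flow τ hτ).l2sq_omegar (hud τ hτ)
  have e4 : ∀ τ ∈ Icc 0 T₁, gradHsq (ωθr (u τ)) = ENNReal.ofReal
      (nsq (pd 0 (Gam fun i => U i τ)) + nsq (pd 1 (Gam fun i => U i τ))) :=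
    fun τ hτ => (hS.flow τ hτ).gradHsq_omegar (hud τ hτ)
  have n := nsq_nonneg
  obtain ⟨c1, -⟩ := hS.vort_continuousOn
  obtain ⟨g1, -⟩ := hS.gam_continuousOn
  have y1 := hS.vort_le M.coe_nonneg hδ hI ht
  have y2 := hS.gam_le M.coe_nonneg hδ hI ht
  have y3 := hS.energy_le hI ht
  have p1 := primitive_nonneg (T := T₁)
    (b := fun τ => nsq (pd 0 (vort U τ)) + nsq (pd 1 (vort U τ)))
    (fun τ _ => add_nonneg (n _) (n _)) ht
  have p2 := primitive_nonneg (T := T₁)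
    (b := fun τ => nsq (pd 0 (Gam fun i => U i τ)) + nsq (pd 1 (Gam fun i => U i τ)))
    (fun τ _ => add_nonneg (n _) (n _)) ht
  have p3 := primitive_nonneg (T := T₁)
    (b := fun τ => ∑ i, (nsq (pd 0 (U i τ)) + nsq (pd 1 (U i τ))))
    (fun τ _ => Finset.sum_nonneg fun i _ => add_nonneg (n _) (n _)) ht
  have cv : ContinuousOn (fun τ => 2 * (nsq (pd 0 (vort U τ)) + nsq (pd 1 (vort U τ))))
      (Icc 0 T₁) := continuousOn_const.mul ((c1 0).add (c1 1))
  have cg : ContinuousOn (fun τ => nsq (pd 0 (Gam fun i => U i τ)) +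
      nsq (pd 1 (Gam fun i => U i τ))) (Icc 0 T₁) := (g1 0).add (g1 1)
  constructor
  · rw [setLIntegral_congr_fun measurableSet_Icc fun τ hτ => e2 τ (hsub hτ),
      setLIntegral_congr_fun measurableSet_Icc fun τ hτ => e4 τ (hsub hτ), e1 t ht, e3 t ht,
      lintegral_Icc_ofReal ht.1
        (cv.mono hsub)
        (fun τ => mul_nonneg zero_le_two (add_nonneg (n _) (n _))),
      lintegral_Icc_ofReal ht.1 (cg.mono hsub)
        (fun τ => add_nonneg (n _) (n _)), intervalIntegral.integral_const_mul]
    have n1 := n (vort U t)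
    have n2 := n (Gam fun i => U i t)
    rw [← ENNReal.ofReal_add (by positivity) (by positivity),
      ← ENNReal.ofReal_add (by positivity) (by positivity),
      ← ENNReal.ofReal_add (by positivity) (by positivity)]
    refine ENNReal.ofReal_le_ofReal ?_
    linarith
  · have hf := hS.flow t ht
    have f1 : l2sq (u t) = ENNReal.ofReal (∑ i, nsq (U i t)) :=
      l2sq_eq_ofReal_sum fun i => (hf.sob i).memLp
    have f2 : ∀ j, l2sq (pd j (u t)) = ENNReal.ofReal (∑ i, nsq (pd j (U i t))) := fun j => by
      have e : ∀ i, (fun x => pd j (u t) x i) = pd j (U i t) := fun i =>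
        funext fun x => (pd_apply (hud t ht x) i j).symm
      rw [l2sq_eq_ofReal_sum fun i => by
        rw [e]
        exact ((hf.sob i).pd j).memLp]
      simp only [e]
    -- The full gradient, vertical derivatives included, has the norm of the vorticity.
    have f3 := hf.sum_nsq_pd_eq
    rw [hf.nsq_one_eq.1, hv t ht] at f3
    rw [h1sq, f1]
    simp only [f2]
    rw [← ENNReal.ofReal_sum_of_nonneg fun i _ => Finset.sum_nonneg fun j _ => n _, f3,
      ← ENNReal.ofReal_add (Finset.sum_nonneg fun i _ => n _) (add_nonneg (n _) (n _))]
    refine ENNReal.ofReal_le_ofReal ?_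
    linarith

end HBS

/-! ### Conclusion -/

theorem mainTheorem5 (M : ℝ≥0) (δ : ℝ) (hδ : 0 < δ) :
    ∃ C : ℝ, 0 < C ∧
      ∀ (u₀ : HBS.E3 → HBS.E3) (D : Fin 3 → HBS.E3 → HBS.E3) (ρ₀ : HBS.E3 → ℝ),
        HBS.IsAdmissibleData u₀ D ρ₀ → HBS.DataBound M δ u₀ D ρ₀ →
      ∀ (T : EReal) (u : ℝ → HBS.E3 → HBS.E3) (ρ P : ℝ → HBS.E3 → ℝ),
        HBS.IsSmoothSolution T u₀ ρ₀ u ρ P →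
      ∀ t ∈ HBS.timeInterval T,
        HBS.l2sq (HBS.ωθ (u t))
            + (∫⁻ τ in Icc 0 t, (HBS.gradHsq (HBS.ωθ (u τ)) + HBS.l2sq (HBS.ωθr (u τ))))
            + HBS.l2sq (HBS.ωθr (u t))
            + (∫⁻ τ in Icc 0 t, HBS.gradHsq (HBS.ωθr (u τ)))
          ≤ ENNReal.ofReal (C * Real.exp (Real.exp (C * t ^ 17)))
        ∧ HBS.h1sq (u t) (fun i => HBS.pd i (u t))
          ≤ ENNReal.ofReal (C * Real.exp (Real.exp (C * t ^ 17))) := by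
  obtain ⟨C, hC, hbound⟩ := HBS.exists_const M δ
  refine ⟨C, hC, fun u₀ D ρ₀ hA hB T u ρ P h t ht => ?_⟩
  -- The estimates need a nondegenerate interval `[0, T₁]`. For `t > 0` take `T₁ = t`; for `t = 0`
  -- take any positive admissible time not exceeding 1.
  obtain ⟨T₁, h0, h1, htT, hT⟩ : ∃ T₁ : ℝ, 0 < T₁ ∧ T₁ ∈ HBS.timeInterval T ∧ t ≤ T₁ ∧
      (T₁ = t ∨ T₁ ≤ 1) := by
    rcases ht.1.eq_or_lt with rfl | hpos
    · obtain ⟨q, hq0, hqT⟩ := EReal.lt_iff_exists_real_btwn.1 ht.2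
      have hq : 0 < q := EReal.coe_lt_coe_iff.1 hq0
      have hm : 0 < min q 1 := lt_min hq one_pos
      exact ⟨min q 1, hm, ⟨hm.le, (EReal.coe_le_coe_iff.2 (min_le_left q 1)).trans_lt hqT⟩, hm.le,
        Or.inr (min_le_right _ _)⟩
    · exact ⟨t, hpos, ht, le_rfl, Or.inl rfl⟩
  obtain ⟨h2, h3⟩ := h.norms_le hδ hA hB h0 h1 ⟨ht.1, htT⟩
  have h4 := hbound T₁ t h0.le hT ht.1
  obtain ⟨_, hG⟩ := HBS.gamB_expCubic M δ
  obtain ⟨_, hE⟩ := HBS.energyB_expCubic M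
  have hG0 := (hG (1 + T₁) (by linarith)).1
  have hE0 := (hE (1 + T₁) (by linarith)).1
  exact ⟨h2.trans (ENNReal.ofReal_le_ofReal (by linarith)),
    h3.trans (ENNReal.ofReal_le_ofReal (by linarith))⟩
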